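/- A one-way state generator (OWSG) is a triple $(\mathsf{KeyGen},\mathsf{StateGen},\mathsf{Ver})$ of (uniform) quantum polynomial-time (QPT) algorithms, all of which receive the security parameter $1^\lambda$, such that $\mathsf{KeyGen}(1^\lambda)$ outputs a classical key $k\in\{0,1\}^{\kappa(\lambda)}$; $\mathsf{StateGen}(k)$ outputs an $m(\lambda)$-qubit, possibly mixed, state $\phi_k$; $\mathsf{Ver}(k',\phi_k)$ takes a bit string $k'$ and an $m(\lambda)$-qubit state and outputs $\top$ or $\bot$; and the following hold. Correctness: there is a negligible function $\varepsilon$ such that for all $\lambda$ $$\Pr[\top\gets\mathsf{Ver}(k,\phi_k):k\gets\mathsf{KeyGen}(1^\lambda),\ \phi_k\gets\mathsf{StateGen}(k)]\ \ge\ 1-\varepsilon(\lambda).$$ Security: for every QPT adversary $\mathcal A$ and every polynomial $t$ there is a negligible function $\varepsilon$ such that for all $\lambda$ $$\mathrm{Succ}_{\mathcal A,t}(\lambda):=\Pr[\top\gets\mathsf{Ver}(k',\phi_k):k\gets\mathsf{KeyGen}(1^\lambda),\ \phi_k\gets\mathsf{StateGen}(k),\ k'\gets\mathcal A(\phi_k^{\otimes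 t(\lambda)})]\ \le\ \varepsilon(\lambda).$$ A weak OWSG is a triple of the same kind with the same correctness condition, in which security is replaced by weak security: there is a polynomial $p$, with positive values, such that for every QPT adversary $\mathcal A$ and every polynomial $t$ one has $\mathrm{Succ}_{\mathcal A,t}(\lambda)\le 1-\frac1{p(\lambda)}$ for all sufficiently large $\lambda$ (where "sufficiently large" may depend on $\mathcal A$ and $t$, but $p$ may not). Theorem. One-way state generators exist if and only if weak one-way state generators exist. -/

import Mathlib

open Filter

noncomputable section

namespace QCrypto

/-! ### The machine model: classical programs controlling a quantum memory

A machine has countably many classical stacks of bits and countably many stacks of qubits (a program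
mentions only finitely many of them).  A program is a finite text in the structured language below.
It reads classical bits and measurement outcomes only, and it acts on qubits by the universal gate
set `H`, `T`, `CNOT`, by allocation of fresh qubits in state `|0⟩`, and by measurement in the
computational basis.  Every elementary instruction and every test costs one step, and touches only
the tops of at most two stacks, so that polynomial time here is quantum polynomial time. -/

/-- Programs. -/
inductive Prog : Type
  /-- do nothing -/
  | skip : Prog
  /-- push the bit `b` on the classical stack `r` -/
  | push (r : ℕ) (b : Bool) : Prog
  /-- remove the top bit of the classical stack `r` -/
  | pop (r : ℕ) : Prog
  /-- push a fresh qubit in state `|0⟩` on the quantum stack `s` -/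
  | alloc (s : ℕ) : Prog
  /-- discard (trace out) the top qubit of the quantum stack `s` -/
  | discard (s : ℕ) : Prog
  /-- move the top qubit of the quantum stack `s` to the top of the quantum stack `s'` -/
  | move (s s' : ℕ) : Prog
  /-- Hadamard gate on the top qubit of the quantum stack `s` -/
  | had (s : ℕ) : Prog
  /-- `T = diag(1, e^{iπ/4})` gate on the top qubit of the quantum stack `s` -/
  | tgate (s : ℕ) : Prog
  /-- controlled not; the control is the top qubit of `s`, the target is the top qubit of `s'` -/
  | cnot (s s' : ℕ) : Prog
  /-- remove the top qubit of the quantum stack `s`, measure it in the computational basis, and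
  push the outcome on the classical stack `r` -/
  | meas (s r : ℕ) : Prog
  /-- sequential composition -/
  | seq (P Q : Prog) : Prog
  /-- run `P` if the top bit of the classical stack `r` is `1`, and `Q` if it is `0` or missing -/
  | ite (r : ℕ) (P Q : Prog) : Prog
  /-- repeat `P` as long as the classical stack `r` is not empty -/
  | whileBits (r : ℕ) (P : Prog) : Prog
  /-- repeat `P` as long as the quantum stack `s` is not empty (the number of qubits in a stack
  is classical information) -/
  | whileQubits (s : ℕ) (P : Prog) : Prog

/-- Density operators on `n` qubits, as matrices in the computational basis `{0,1}ⁿ`. -/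
abbrev QState (n : ℕ) : Type := Matrix (Fin n → Bool) (Fin n → Bool) ℂ

/-- Operators on the memory.  The qubits of a machine are numbered by natural numbers, and a
computational basis state is given by the finite set of the qubits that are `1`. -/
abbrev MemOp : Type := Matrix (Finset ℕ) (Finset ℕ) ℂ

/-- The Hadamard gate on qubit `i`, acting on vectors. -/
def hadVec (i : ℕ) (ψ : Finset ℕ → ℂ) : Finset ℕ → ℂ := fun S =>
  (ψ (S.erase i) + (if i ∈ S then -1 else 1) * ψ (insert i S)) / (Real.sqrt 2 : ℂ)

/-- The `T` gate on qubit `i`, acting on vectors. -/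
def tVec (i : ℕ) (ψ : Finset ℕ → ℂ) : Finset ℕ → ℂ := fun S =>
  if i ∈ S then Complex.exp (Complex.I * Real.pi / 4) * ψ S else ψ S

/-- The controlled not gate with control `i` and target `j ≠ i`, acting on vectors. -/
def cnotVec (i j : ℕ) (ψ : Finset ℕ → ℂ) : Finset ℕ → ℂ := fun S =>
  if i ∈ S then ψ (symmDiff S {j}) else ψ S

/-- The projection onto the outcome `b` of a measurement of qubit `i`, acting on vectors. -/
def projVec (i : ℕ) (b : Bool) (ψ : Finset ℕ → ℂ) : Finset ℕ → ℂ := fun S =>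
  if decide (i ∈ S) = b then ψ S else 0

/-- `ρ ↦ K ρ K†` for a linear operator `K` on vectors. -/
def conjBy (K : (Finset ℕ → ℂ) → (Finset ℕ → ℂ)) (ρ : MemOp) : MemOp := fun S S' =>
  star (K (fun R' => star (K (fun R => ρ R R') S)) S')

/-- A configuration of a machine on one computation path. -/
structure Config where
  /-- the programs that remain to be run, in this order; the machine has halted if there is none -/
  todo : List Prog
  /-- the contents of the classical stacks, top first -/
  bits : ℕ → List Bool
  /-- the numbers of the qubits in the quantum stacks, top first -/
  qubits : ℕ → List ℕ
  /-- the number of qubits that have been used so far; qubit `next` is fresh -/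
  next : ℕ
  /-- the unnormalized density operator of the memory on this path; its trace is the
  probability of the path -/
  state : MemOp

/-- The effect of the first item `P` of the list of remaining programs, where `c` is the
configuration from which this item has been removed already.  The result lists the possible
successors: two for a measurement, one otherwise.  Instructions on empty stacks do nothing. -/
def exec (c : Config) : Prog → List Config
  | .skip => [c]
  | .push r b => [{ c with bits := Function.update c.bits r (b :: c.bits r) }]
  | .pop r => [{ c with bits := Function.update c.bits r (c.bits r).tail }]
  | .alloc s =>
      [{ c with
          qubits := Function.update c.qubits s (c.next :: c.qubits s)
          next := c.next + 1 }]
  | .discard s => [{ c with qubits := Function.update c.qubits s (c.qubits s).tail }]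
  | .move s s' =>
      match c.qubits s with
      | [] => [c]
      | i :: l =>
          let q := Function.update c.qubits s l
          [{ c with qubits := Function.update q s' (i :: q s') }]
  | .had s =>
      match c.qubits s with
      | [] => [c]
      | i :: _ => [{ c with state := conjBy (hadVec i) c.state }]
  | .tgate s =>
      match c.qubits s with
      | [] => [c]
      | i :: _ => [{ c with state := conjBy (tVec i) c.state }]
  | .cnot s s' =>
      match c.qubits s, c.qubits s' with
      | i :: _, j :: _ =>
          if i = j then [c] else [{ c with state := conjBy (cnotVec i j) c.state }]
      | _, _ => [c]
  | .meas s r =>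
      match c.qubits s with
      | [] => [c]
      | i :: l =>
          [false, true].map fun b =>
            { c with
              bits := Function.update c.bits r (b :: c.bits r)
              qubits := Function.update c.qubits s l
              state := conjBy (projVec i b) c.state }
  | .seq P Q => [{ c with todo := P :: Q :: c.todo }]
  | .ite r P Q =>
      match c.bits r with
      | true :: _ => [{ c with todo := P :: c.todo }]
      | _ => [{ c with todo := Q :: c.todo }]
  | .whileBits r P =>
      match c.bits r with
      | [] => [c]
      | _ :: _ => [{ c with todo := P :: Prog.whileBits r P :: c.todo }]
  | .whileQubits s P =>
      match c.qubits s with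
      | [] => [c]
      | _ :: _ => [{ c with todo := P :: Prog.whileQubits s P :: c.todo }]

/-- One step of a machine; a halted configuration stays as it is. -/
def step (c : Config) : List Config :=
  match c.todo with
  | [] => [c]
  | P :: K => exec { c with todo := K } P

/-- All computation paths of `n` steps. -/
def run : ℕ → Config → List Config
  | 0, c => [c]
  | n + 1, c => (step c).flatMap (run n)

/-- The probability of a computation path, the trace of its unnormalized density operator. -/
def Config.weight (c : Config) : ℝ :=
  (∑ S ∈ (Finset.range c.next).powerset, c.state S S).re

/-- The density operator on the qubits `0, …, N - 1` as an operator on the memory, all the other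
qubits being `|0⟩`. -/
def embed (N : ℕ) (ρ : QState N) : MemOp := fun S S' =>
  if S ⊆ Finset.range N ∧ S' ⊆ Finset.range N then
    ρ (fun i => decide ((i : ℕ) ∈ S)) (fun i => decide ((i : ℕ) ∈ S'))
  else 0

/-- The initial configuration of the program `P` with security parameter `n`, classical input `x`
and quantum input `ρ` on `N` qubits: the classical stack `0` holds `1ⁿ`, the classical stack `1`
holds `x`, the quantum stack `0` holds the `N` input qubits, and all other stacks are empty. -/
def initial (P : Prog) (n : ℕ) (x : List Bool) (N : ℕ) (ρ : QState N) : Config where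
  todo := [P]
  bits r := if r = 0 then List.replicate n true else if r = 1 then x else []
  qubits s := if s = 0 then List.range N else []
  next := N
  state := embed N ρ

/-- The set of those of the qubits listed in `l` that are `1` in the basis state `u`, where the
entry `i` of `l` is in the state `u i`. -/
def basisSet {m : ℕ} (l : List ℕ) (u : Fin m → Bool) : Finset ℕ :=
  (Finset.univ.filter fun i => u i = true).image fun i : Fin m => l.getD (i : ℕ) 0

/-- The (unnormalized) state of the qubits in the quantum stack `0`, as a state of `m` qubits, all
the other qubits being traced out.  It is `0` if the number of these qubits is not `m`. -/
def Config.outQubits (c : Config) (m : ℕ) : QState m := fun u v =>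
  if (c.qubits 0).length = m then
    ∑ E ∈ (Finset.range c.next \ (c.qubits 0).toFinset).powerset,
      c.state (basisSet (c.qubits 0) u ∪ E) (basisSet (c.qubits 0) v ∪ E)
  else 0

/-- The classical output, the content of the classical stack `1`. -/
def Config.out (c : Config) : List Bool := c.bits 1

/-- A (uniform) quantum polynomial-time algorithm: a program that halts on all inputs and all
computation paths within a number of steps that is polynomial in the security parameter and the
lengths of the classical and of the quantum input. -/
structure QPTAlg where
  prog : Prog
  time : Polynomial ℕ
  halts : ∀ (n : ℕ) (x : List Bool) (N : ℕ) (ρ : QState N),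
    ∀ c ∈ run (time.eval (n + x.length + N)) (initial prog n x N ρ), c.todo = []

namespace QPTAlg

/-- The final configurations of all the computation paths. -/
def final (A : QPTAlg) (n : ℕ) (x : List Bool) (N : ℕ) (ρ : QState N) : List Config :=
  run (A.time.eval (n + x.length + N)) (initial A.prog n x N ρ)

/-- The expectation of a function of the classical output. -/
def expect (A : QPTAlg) (n : ℕ) (x : List Bool) (N : ℕ) (ρ : QState N)
    (f : List Bool → ℝ) : ℝ :=
  ((A.final n x N ρ).map fun c => c.weight * f c.out).sum

/-- The quantum output on `m` qubits: a density operator, in general mixed. -/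
def outState (A : QPTAlg) (n : ℕ) (x : List Bool) (N : ℕ) (ρ : QState N) (m : ℕ) : QState m :=
  ((A.final n x N ρ).map fun c => c.outQubits m).sum

/-- The probability that the output bit, the top bit of the classical output, is `1`. -/
def acceptProb (A : QPTAlg) (n : ℕ) (x : List Bool) (N : ℕ) (ρ : QState N) : ℝ :=
  A.expect n x N ρ fun y => if y.head? = some true then 1 else 0

end QPTAlg

/-- The empty quantum input. -/
def noQubits : QState 0 := fun _ _ => 1

/-- The tensor power `ρ^{⊗ t}`. -/
def tensorPow {m : ℕ} (t : ℕ) (ρ : QState m) : QState (t * m) := fun u v =>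
  ∏ j : Fin t, ρ (fun i => u (finProdFinEquiv (j, i))) (fun i => v (finProdFinEquiv (j, i)))

/-! ### One-way state generators -/

/-- The syntax of a one-way state generator.  All algorithms get the security parameter in unary.
* `keyGen` outputs a key in `{0,1}^κ`, where `κ = keyLen n`;
* `stateGen` gets a key in `{0,1}^κ` and outputs `m` qubits, where `m = stateLen n`;
* `ver` gets a bit string and `m` qubits, and accepts or rejects. -/
structure StateGenerator where
  keyLen : ℕ → ℕ
  stateLen : ℕ → ℕ
  keyGen : QPTAlg
  stateGen : QPTAlg
  ver : QPTAlg
  keyGen_length : ∀ n, ∀ c ∈ keyGen.final n [] 0 noQubits, c.out.length = keyLen n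
  stateGen_length : ∀ n (k : List Bool), k.length = keyLen n →
    ∀ c ∈ stateGen.final n k 0 noQubits, (c.qubits 0).length = stateLen n

namespace StateGenerator

variable (G : StateGenerator)

/-- The state `φ_k` that `stateGen` outputs on input `k`. -/
def phi (n : ℕ) (k : List Bool) : QState (G.stateLen n) :=
  G.stateGen.outState n k 0 noQubits (G.stateLen n)

/-- `Pr[⊤ ← Ver(k', φ_k)]`. -/
def verProb (n : ℕ) (k' k : List Bool) : ℝ :=
  G.ver.acceptProb n k' (G.stateLen n) (G.phi n k)

/-- `Pr[⊤ ← Ver(k, φ_k) : k ← KeyGen(1ⁿ), φ_k ← StateGen(k)]`. -/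
def correctProb (n : ℕ) : ℝ :=
  G.keyGen.expect n [] 0 noQubits fun k => G.verProb n k k

/-- `Pr[⊤ ← Ver(k', φ_k) : k ← KeyGen(1ⁿ), φ_k ← StateGen(k), k' ← A(φ_k^{⊗ t})]`. -/
def successProb (A : QPTAlg) (t n : ℕ) : ℝ :=
  G.keyGen.expect n [] 0 noQubits fun k =>
    A.expect n [] (t * G.stateLen n) (tensorPow t (G.phi n k)) fun k' => G.verProb n k' k

end StateGenerator

/-- Negligible functions of the security parameter: smaller than any inverse polynomial. -/
def Negligible (ε : ℕ → ℝ) : Prop :=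
  Asymptotics.SuperpolynomialDecay atTop (fun n : ℕ => (n : ℝ)) ε

/-- Correctness: an honestly generated pair passes except with negligible probability. -/
def StateGenerator.Correct (G : StateGenerator) : Prop :=
  ∃ ε, Negligible ε ∧ ∀ n, 1 - ε n ≤ G.correctProb n

/-- Security: each QPT adversary with polynomially many copies has negligible success. -/
def StateGenerator.Secure (G : StateGenerator) : Prop :=
  ∀ (A : QPTAlg) (t : Polynomial ℕ),
    ∃ ε, Negligible ε ∧ ∀ n, G.successProb A (t.eval n) n ≤ ε n

/-- Weak security: the success of each QPT adversary with polynomially many copies is at most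
`1 - 1/p` for all large security parameters, where the polynomial `p` depends neither on the
adversary nor on the number of copies. -/
def StateGenerator.WeaklySecure (G : StateGenerator) : Prop :=
  ∃ p : Polynomial ℕ, (∀ n, 0 < p.eval n) ∧
    ∀ (A : QPTAlg) (t : Polynomial ℕ),
      ∀ᶠ n in atTop, G.successProb A (t.eval n) n ≤ 1 - 1 / ((p.eval n : ℕ) : ℝ)

/-- One-way state generators. -/
def IsOWSG (G : StateGenerator) : Prop := G.Correct ∧ G.Secure

/-- Weak one-way state generators. -/
def IsWeakOWSG (G : StateGenerator) : Prop := G.Correct ∧ G.WeaklySecure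

end QCrypto

end

/-! One direction is immediate, since a negligible success probability is eventually at most 1/2.
For the other, let `G` be a weak generator with bound `1 - 1/P`. The strong generator is the direct
product of `N = 128 P² n + 1` instances of `G`: independent keys, the tensor product of the states,
acceptance if every component accepts. Its correctness follows from Bernoulli's inequality, and its
security from hardness amplification.

Let `A` attack the product with `t` copies, and let `v(c, k)` be the probability that `Ver` accepts
`c` on the state of `k`. Put `g = 64 P`. For a position `i` and a key `k`, let `E(i, k)` be the
probability, over the other keys and the run of `A`, that the whole answer is accepted and that its
component `i` has `v ≥ 1 - 1/g`. Call `k` bad at `i` if `E(i, k) < 1/u`. An accepted answer that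
contains a component with `v ≥ 1 - 1/g` at a position where the key is bad costs at most `1/u` for
each position. Otherwise every position with a bad key contributes a factor below `1 - 1/g`. As the
keys are independent, the success of `A` is at most `∏ᵢ (1 - Pr[bad at i]/g) + N/u`. It remains to
see that a key is bad at any given position with probability at least `1/(2P)`.

For this, `A` is turned into an adversary against `G`. For each position in turn, and `R` times for
each, it draws the other keys itself, puts copies of the unknown state at this position, runs `A`,
and tests the component of the answer on further copies; a candidate that passes replaces the
current one. `Ver` is probabilistic, so that `v` can only be estimated: among `gX` tests, fewer than
`2X` failures occur with probability at least `1/2` if `v ≥ 1 - 1/g`, and at most `1/X` if `v < 1 -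
8/g` (`pass_good`, `pass_bad`). If `k` is not bad at some position, the final candidate is accepted
with probability at least `1 - 1/(2P)` (`pos_le`). Weak security then bounds the probability of such
keys by `1 - 1/(2P)`. This is `amplification`, a statement on finite probability spaces.

The other half of the proof shows that these procedures are programs of the machine model with
exactly these probabilities. A density operator is a linear combination of dyads `|u⟩⟨v|`, and a
program sends a dyad to a finite combination of dyads. So quantum programs become classical
nondeterministic programs with complex weights, which compose and call each other like ordinary
programs; `Config.val_run` is the transfer to the machine. Positivity is needed only when weights
are read as probabilities (`isEx_expect`). The programs are provided by `exists_repeat` and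
`exists_adversary`, and their expectations are computed in `verSteps_ex` and `positions_ex`. -/

noncomputable section

namespace QCrypto

/-! ### Complex-weighted finite lists -/

/-- Finite formal linear combinations with complex coefficients. -/
def W (α : Type*) : Type _ := List (ℂ × α)

namespace W

variable {α β γ : Type*}

/-- The combination consisting of `a` with weight `1`. -/
def pure (a : α) : W α := [(1, a)]

/-- The combination consisting of `a` with weight `w`. -/
def single (w : ℂ) (a : α) : W α := [(w, a)]

/-- Sequential composition. -/
def bind (L : W α) (f : α → W β) : W β :=
  List.flatMap (fun p => List.map (fun t => (p.1 * t.1, t.2)) (f p.2)) L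

/-- The weighted sum of a function. -/
def ex (L : W α) (F : α → ℂ) : ℂ := (List.map (fun p => p.1 * F p.2) L).sum

/-- Membership, whatever the weight. -/
def Mem (a : α) (L : W α) : Prop := ∃ w, List.Mem (w, a) L

@[simp] theorem ex_pure (a : α) (F : α → ℂ) : (pure a).ex F = F a := by
  simp [ex, pure]

@[simp] theorem ex_single (w : ℂ) (a : α) (F : α → ℂ) : (single w a).ex F = w * F a := by
  simp [ex, single]

@[simp] theorem mem_pure {a b : α} : Mem b (pure a) ↔ b = a := by
  constructor
  · rintro ⟨w, h⟩
    have h' : (w, b) ∈ [((1 : ℂ), a)] := h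
    simp at h'
    exact h'.2
  · rintro rfl
    exact ⟨1, List.mem_singleton.2 rfl⟩

@[simp] theorem mem_single {w : ℂ} {a b : α} : Mem b (single w a) ↔ b = a := by
  constructor
  · rintro ⟨v, h⟩
    have h' : (v, b) ∈ [(w, a)] := h
    simp at h'
    exact h'.2
  · rintro rfl
    exact ⟨w, List.mem_singleton.2 rfl⟩

/-- The empty combination. -/
def nil : W α := []

/-- Add a term. -/
def cons (p : ℂ × α) (L : W α) : W α := List.cons p L

@[elab_as_elim] theorem induct {p : W α → Prop} (L : W α) (nil : p nil)
    (cons : ∀ (x : ℂ × α) (L : W α), p L → p (cons x L)) : p L := by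
  have h : ∀ L : List (ℂ × α), p L := by
    intro L
    induction L with
    | nil => exact nil
    | cons x L ih => exact cons x L ih
  exact h L

theorem ex_nil (F : α → ℂ) : (nil : W α).ex F = 0 := rfl

theorem ex_cons (p : ℂ × α) (L : W α) (F : α → ℂ) : (cons p L).ex F = p.1 * F p.2 + L.ex F :=
  List.sum_cons

theorem ex_append (L M : W α) (F : α → ℂ) :
    ex (List.append L M : W α) F = ex (L : W α) F + ex (M : W α) F := by
  induction L using induct with
  | nil => rw [ex_nil, zero_add]; rfl
  | cons p L ih =>
    refine (ex_cons p (List.append L M : W α) F).trans ?_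
    rw [ex_cons, add_assoc]
    exact congrArg _ ih

theorem ex_scale (w : ℂ) (L : W α) (F : α → ℂ) :
    ex (List.map (fun t : ℂ × α => (w * t.1, t.2)) L : W α) F = w * ex L F := by
  induction L using induct with
  | nil => rw [ex_nil, mul_zero]; rfl
  | cons p L ih =>
    refine (ex_cons (w * p.1, p.2) (List.map (fun t : ℂ × α => (w * t.1, t.2)) L : W α) F).trans ?_
    rw [ex_cons, mul_add, mul_assoc]
    exact congrArg _ ih

@[simp] theorem ex_bind (L : W α) (f : α → W β) (F : β → ℂ) :
    (L.bind f).ex F = L.ex fun a => (f a).ex F := by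
  induction L using induct with
  | nil => rfl
  | cons p L ih =>
    refine (ex_append (List.map (fun t : ℂ × β => (p.1 * t.1, t.2)) (f p.2) : W β) (L.bind f) F).trans ?_
    rw [ex_cons, ih]
    exact congrArg (· + _) (ex_scale _ _ _)

@[simp] theorem mem_bind {L : W α} {f : α → W β} {b : β} :
    Mem b (L.bind f) ↔ ∃ a, Mem a L ∧ Mem b (f a) := by
  constructor
  · rintro ⟨w, h⟩
    obtain ⟨p, hp, h2⟩ := List.mem_flatMap.1 (show (w, b) ∈ List.flatMap _ _ from h)
    obtain ⟨t, ht, h3⟩ := List.mem_map.1 h2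
    refine ⟨p.2, ⟨p.1, hp⟩, ⟨t.1, ?_⟩⟩
    have : t = (t.1, b) := by
      have := congrArg Prod.snd h3
      simp at this
      rw [← this]
    rw [← this]
    exact ht
  · rintro ⟨a, ⟨w, h⟩, ⟨v, h'⟩⟩
    refine ⟨w * v, ?_⟩
    show (w * v, b) ∈ List.flatMap _ _
    exact List.mem_flatMap.2 ⟨(w, a), h, List.mem_map.2 ⟨(v, b), h', rfl⟩⟩

/-- The image under a function. -/
def map (f : α → β) (L : W α) : W β := List.map (fun p : ℂ × α => (p.1, f p.2)) L

@[simp] theorem ex_map (f : α → β) (L : W α) (F : β → ℂ) :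
    (L.map f).ex F = L.ex fun a => F (f a) := by
  induction L using induct with
  | nil => rfl
  | cons p L ih => exact congrArg (p.1 * F (f p.2) + ·) ih

@[simp] theorem mem_map {f : α → β} {L : W α} {b : β} :
    Mem b (L.map f) ↔ ∃ a, Mem a L ∧ b = f a := by
  constructor
  · rintro ⟨w, h⟩
    obtain ⟨p, hp, h2⟩ := List.mem_map.1 (show (w, b) ∈ List.map _ _ from h)
    exact ⟨p.2, ⟨p.1, hp⟩, (congrArg Prod.snd h2).symm⟩
  · rintro ⟨a, ⟨w, h⟩, rfl⟩
    refine ⟨w, ?_⟩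
    show _ ∈ List.map _ _
    exact List.mem_map.2 ⟨(w, a), h, rfl⟩

theorem map_single (f : α → β) (w : ℂ) (a : α) : (single w a).map f = single w (f a) := rfl

theorem map_bind (L : W α) (f : α → W β) (g : β → γ) :
    (L.bind f).map g = L.bind fun a => (f a).map g := by
  refine Eq.trans List.map_flatMap ?_
  refine congrArg (fun h => List.flatMap h L) (funext fun p => ?_)
  exact List.map_map.trans (List.map_map (l := (f p.2 : List (ℂ × β)))
    (g := fun t : ℂ × γ => (p.1 * t.1, t.2)) (f := fun t : ℂ × β => (t.1, g t.2))).symm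

theorem bind_map (L : W α) (f : α → β) (g : β → W γ) :
    (L.map f).bind g = L.bind fun a => g (f a) := by
  exact List.flatMap_map _ _ _

theorem map_map (L : W α) (f : α → β) (g : β → γ) :
    (L.map f).map g = L.map fun a => g (f a) := by
  exact List.map_map

theorem ex_congr {L : W α} {F G : α → ℂ} (h : ∀ a, Mem a L → F a = G a) : L.ex F = L.ex G := by
  unfold ex
  congr 1
  apply List.map_congr_left
  rintro ⟨w, a⟩ hp
  have := h a ⟨w, hp⟩
  simp [this]

theorem ex_add (L : W α) (F G : α → ℂ) : L.ex (fun a => F a + G a) = L.ex F + L.ex G := by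
  induction L using induct with
  | nil => simp [ex_nil]
  | cons p L ih =>
    simp only [ex_cons, ih]
    ring

theorem ex_mul_left (L : W α) (z : ℂ) (F : α → ℂ) : L.ex (fun a => z * F a) = z * L.ex F := by
  induction L using induct with
  | nil => simp [ex_nil]
  | cons p L ih =>
    simp only [ex_cons, ih]
    ring

theorem ex_mul_right (L : W α) (z : ℂ) (F : α → ℂ) : L.ex (fun a => F a * z) = L.ex F * z := by
  simp_rw [mul_comm _ z, ex_mul_left]

theorem ex_zero (L : W α) : L.ex (fun _ => 0) = 0 := by
  simpa using ex_mul_left L 0 fun _ => 0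

theorem ex_sum {ι : Type*} (s : Finset ι) (L : W α) (F : ι → α → ℂ) :
    L.ex (fun a => ∑ i ∈ s, F i a) = ∑ i ∈ s, L.ex (F i) := by
  classical
  induction s using Finset.induction_on with
  | empty => simp [ex_zero]
  | insert i s hi ih =>
    simp only [Finset.sum_insert hi]
    rw [ex_add, ih]

/-- The Fubini rule. It plays the part of commutation for operations on different qubits:
independent samples may be drawn in any order. -/
theorem ex_comm (L : W α) (M : W β) (F : α → β → ℂ) :
    L.ex (fun a => M.ex fun b => F a b) = M.ex fun b => L.ex fun a => F a b := by
  induction L using induct with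
  | nil => simp [ex_nil, ex_zero]
  | cons p L ih => simp only [ex_cons, ih, ex_add, ex_mul_left]

end W

/-! ### The dyad machine

A state of several qubits is a linear combination of dyads `|u⟩⟨v|`.  A dyad of a stack of qubits is
a list of pairs of bits.  On dyads, a quantum program acts as a nondeterministic classical program
with complex weights. -/

/-- Dyads of computational basis states of a stack of qubits. -/
abbrev QL : Type := List (Bool × Bool)

/-- The memory of the dyad machine. -/
@[ext] structure Cfg where
  /-- the classical stacks -/
  bits : ℕ → List Bool
  /-- the dyads of the quantum stacks -/
  q : ℕ → QL

namespace Cfg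

/-- Replace the content of a classical stack. -/
def setB (c : Cfg) (r : ℕ) (l : List Bool) : Cfg := { c with bits := Function.update c.bits r l }

/-- Replace the content of a quantum stack. -/
def setQ (c : Cfg) (s : ℕ) (l : QL) : Cfg := { c with q := Function.update c.q s l }

theorem setB_bits (c : Cfg) (r r' : ℕ) (l : List Bool) :
    (c.setB r l).bits r' = if r' = r then l else c.bits r' := by
  simp [setB, Function.update_apply]

@[simp] theorem setB_q (c : Cfg) (r : ℕ) (l : List Bool) : (c.setB r l).q = c.q := rfl

@[simp] theorem setQ_bits (c : Cfg) (s : ℕ) (l : QL) : (c.setQ s l).bits = c.bits := rfl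

theorem setQ_q (c : Cfg) (s s' : ℕ) (l : QL) :
    (c.setQ s l).q s' = if s' = s then l else c.q s' := by
  simp [setQ, Function.update_apply]

end Cfg

/-- Entries of the Hadamard gate. -/
def hadC (x y : Bool) : ℂ := (if x && y then -1 else 1) / (Real.sqrt 2 : ℂ)

/-- Entries of the `T` gate. -/
def tC (x y : Bool) : ℂ :=
  if x = y then (if x then Complex.exp (Complex.I * Real.pi / 4) else 1) else 0

/-- All pairs of bits. -/
def bitPairs : List (Bool × Bool) := [(false, false), (false, true), (true, false), (true, true)]

/-- A one-qubit gate with entries `k` on the top of a quantum stack. -/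
def gateW (k : Bool → Bool → ℂ) (c : Cfg) (s : ℕ) : W (List Prog × Cfg) :=
  match c.q s with
  | [] => W.pure ([], c)
  | p :: l => bitPairs.map fun y => (k p.1 y.1 * star (k p.2 y.2), ([], c.setQ s (y :: l)))

/-- One instruction of the dyad machine.  The result lists the weights of the successors, the programs
to be run before the remaining ones, and the new memory. -/
def wexec (c : Cfg) : Prog → W (List Prog × Cfg)
  | .skip => W.pure ([], c)
  | .push r b => W.pure ([], c.setB r (b :: c.bits r))
  | .pop r => W.pure ([], c.setB r (c.bits r).tail)
  | .alloc s => W.pure ([], c.setQ s ((false, false) :: c.q s))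
  | .discard s =>
      match c.q s with
      | [] => W.pure ([], c)
      | p :: l => W.single (if p.1 = p.2 then 1 else 0) ([], c.setQ s l)
  | .move s s' =>
      match c.q s with
      | [] => W.pure ([], c)
      | p :: l => W.pure ([], (c.setQ s l).setQ s' (p :: (c.setQ s l).q s'))
  | .had s => gateW hadC c s
  | .tgate s => gateW tC c s
  | .cnot s s' =>
      match c.q s, c.q s' with
      | p :: _, r :: l =>
          if s = s' then W.pure ([], c)
          else W.pure ([], c.setQ s' ((xor r.1 p.1, xor r.2 p.2) :: l))
      | _, _ => W.pure ([], c)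
  | .meas s r =>
      match c.q s with
      | [] => W.pure ([], c)
      | p :: l => [false, true].map fun b =>
          (if p.1 = b ∧ p.2 = b then 1 else 0, ([], (c.setB r (b :: c.bits r)).setQ s l))
  | .seq P Q => W.pure ([P, Q], c)
  | .ite r P Q =>
      match c.bits r with
      | true :: _ => W.pure ([P], c)
      | _ => W.pure ([Q], c)
  | .whileBits r P =>
      match c.bits r with
      | [] => W.pure ([], c)
      | _ :: _ => W.pure ([P, Prog.whileBits r P], c)
  | .whileQubits s P =>
      match c.q s with
      | [] => W.pure ([], c)
      | _ :: _ => W.pure ([P, Prog.whileQubits s P], c)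

/-- One step of the dyad machine. -/
def wstep (K : List Prog) (c : Cfg) : W (List Prog × Cfg) :=
  match K with
  | [] => W.pure ([], c)
  | P :: K => (wexec c P).map fun t => (t.1 ++ K, t.2)

/-- `n` steps of the dyad machine. -/
def wrun : ℕ → List Prog → Cfg → W (List Prog × Cfg)
  | 0, K, c => W.pure (K, c)
  | n + 1, K, c => (wstep K c).bind fun t => wrun n t.1 t.2

/-- From the memory `c`, the programs `K` halt within `n` steps on all paths, and the final
memories are, with their weights, those listed in `L`. -/
def Spec (K : List Prog) (c : Cfg) (n : ℕ) (L : W Cfg) : Prop :=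
  (∀ t, W.Mem t (wrun n K c) → t.1 = [] ∧ W.Mem t.2 L) ∧
    ∀ F : Cfg → ℂ, (wrun n K c).ex (fun t => F t.2) = L.ex F

theorem mem_wrun_nil {n : ℕ} {c : Cfg} {t : List Prog × Cfg} :
    W.Mem t (wrun n [] c) ↔ t = ([], c) := by
  induction n with
  | zero => simp [wrun]
  | succ n ih => simp [wrun, wstep, ih]

theorem ex_wrun_nil {n : ℕ} {c : Cfg} (F : List Prog × Cfg → ℂ) :
    (wrun n [] c).ex F = F ([], c) := by
  induction n with
  | zero => simp [wrun]
  | succ n ih => simp [wrun, wstep, ih]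

/-- Running times are upper bounds, so a path of `J` may halt early and leave part of its budget `n`
to `K`. The induction on `n` follows the steps of `J`; when `J` is used up, the surplus has to be
harmless for `K`. -/
theorem wrun_append {n m : ℕ} {J K : List Prog} {c : Cfg} {f : Cfg → W Cfg}
    (h : ∀ t, W.Mem t (wrun n J c) → t.1 = [] ∧ Spec K t.2 m (f t.2)) :
    (∀ t, W.Mem t (wrun (n + m) (J ++ K) c) →
      t.1 = [] ∧ ∃ t', W.Mem t' (wrun n J c) ∧ W.Mem t.2 (f t'.2)) ∧
    ∀ F : Cfg → ℂ, (wrun (n + m) (J ++ K) c).ex (fun t => F t.2)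
      = (wrun n J c).ex fun t => (f t.2).ex F := by
  induction n generalizing J c with
  | zero =>
    have h0 := h (J, c) (by simp [wrun])
    obtain ⟨rfl, h1⟩ := h0
    simp only [wrun, Nat.zero_add, List.nil_append]
    refine ⟨fun t ht => ⟨(h1.1 t ht).1, ([], c), by simp, (h1.1 t ht).2⟩, fun F => ?_⟩
    rw [h1.2 F]
    simp
  | succ n ih =>
    cases J with
    | nil =>
      have h1 : Spec K c m (f c) := (h ([], c) (by rw [mem_wrun_nil])).2
      have key : ∀ k, (∀ t, W.Mem t (wrun (k + m) K c) → t.1 = [] ∧ W.Mem t.2 (f c)) ∧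
          ∀ F : Cfg → ℂ, (wrun (k + m) K c).ex (fun t => F t.2) = (f c).ex F := by
        intro k
        -- Additional steps change nothing once all the paths have halted.
        have gen : ∀ k m K c, (∀ t, W.Mem t (wrun m K c) → t.1 = []) →
            (∀ t, W.Mem t (wrun (k + m) K c) → W.Mem t (wrun m K c)) ∧
            ∀ F : List Prog × Cfg → ℂ, (wrun (k + m) K c).ex F = (wrun m K c).ex F := by
          intro k m
          induction m with
          | zero =>
            intro K c hK
            have : K = [] := hK (K, c) (by simp [wrun])
            subst this
            constructor
            · intro t ht
              rw [mem_wrun_nil] at ht ⊢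
              exact ht
            · intro F
              rw [ex_wrun_nil, ex_wrun_nil]
          | succ m ihm =>
            intro K c hK
            have hK' : ∀ t, W.Mem t (wstep K c) →
                ∀ t', W.Mem t' (wrun m t.1 t.2) → t'.1 = [] := by
              intro t ht t' ht'
              exact hK t' (by simp only [wrun, W.mem_bind]; exact ⟨t, ht, ht'⟩)
            constructor
            · intro t ht
              rw [← Nat.add_assoc] at ht
              simp only [wrun, W.mem_bind] at ht ⊢
              obtain ⟨a, ha, hb⟩ := ht
              exact ⟨a, ha, (ihm _ _ (hK' a ha)).1 t hb⟩
            · intro F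
              rw [← Nat.add_assoc]
              simp only [wrun, W.ex_bind]
              exact W.ex_congr fun a ha => (ihm _ _ (hK' a ha)).2 F
        have g := gen k m K c fun t ht => (h1.1 t ht).1
        exact ⟨fun t ht => h1.1 t (g.1 t ht), fun F => by rw [g.2, h1.2]⟩
      refine ⟨fun t ht => ?_, fun F => ?_⟩
      · have := (key (n + 1)).1 t ht
        exact ⟨this.1, ([], c), by rw [mem_wrun_nil], this.2⟩
      · rw [ex_wrun_nil]
        exact (key (n + 1)).2 F
    | cons P J =>
      have e : n + 1 + m = (n + m) + 1 := by ring
      rw [e]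
      have h' : ∀ t, W.Mem t (wexec c P) → ∀ t', W.Mem t' (wrun n (t.1 ++ J) t.2) →
          t'.1 = [] ∧ Spec K t'.2 m (f t'.2) := by
        intro t ht t' ht'
        refine h t' ?_
        simp only [wrun, wstep, W.mem_bind, W.mem_map]
        exact ⟨_, ⟨t, ht, rfl⟩, ht'⟩
      constructor
      · intro t ht
        simp only [wrun, wstep, W.mem_bind, W.mem_map, List.cons_append] at ht ⊢
        obtain ⟨_, ⟨a, ha, rfl⟩, hb⟩ := ht
        simp only [← List.append_assoc] at hb
        obtain ⟨h1, t', h2, h3⟩ := (ih (h' a ha)).1 t hb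
        exact ⟨h1, t', ⟨_, ⟨a, ha, rfl⟩, h2⟩, h3⟩
      · intro F
        simp only [wrun, wstep, W.ex_bind, W.ex_map, List.cons_append]
        refine W.ex_congr fun a ha => ?_
        simp only [← List.append_assoc]
        exact (ih (h' a ha)).2 F

namespace Spec

theorem append {J K : List Prog} {c : Cfg} {n m : ℕ} {L : W Cfg} {f : Cfg → W Cfg}
    (h1 : Spec J c n L) (h2 : ∀ c', W.Mem c' L → Spec K c' m (f c')) :
    Spec (J ++ K) c (n + m) (L.bind f) := by
  have h := wrun_append (J := J) (K := K) (n := n) (m := m) (c := c) (f := f) fun t ht =>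
    ⟨(h1.1 t ht).1, h2 _ (h1.1 t ht).2⟩
  refine ⟨fun t ht => ?_, fun F => ?_⟩
  · obtain ⟨h3, t', h4, h5⟩ := h.1 t ht
    exact ⟨h3, W.mem_bind.2 ⟨_, (h1.1 _ h4).2, h5⟩⟩
  · rw [h.2 F, W.ex_bind, ← h1.2 fun a => (f a).ex F]

theorem nil (c : Cfg) (n : ℕ) : Spec [] c n (W.pure c) := by
  refine ⟨fun t ht => ?_, fun F => ?_⟩
  · rw [mem_wrun_nil] at ht
    simp [ht]
  · simp [ex_wrun_nil]

/-- A specification fixes the final combination only through the memories that occur and through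
expectations, so lists with regrouped terms are interchangeable. Memories of weight zero still count
as occurring, since halting is demanded on all paths. -/
theorem conv {K : List Prog} {c : Cfg} {n : ℕ} {L M : W Cfg} (h : Spec K c n L)
    (hs : ∀ a, W.Mem a L → W.Mem a M) (he : ∀ F, L.ex F = M.ex F) : Spec K c n M :=
  ⟨fun t ht => ⟨(h.1 t ht).1, hs _ (h.1 t ht).2⟩, fun F => (h.2 F).trans (he F)⟩

theorem mono {K : List Prog} {c : Cfg} {n m : ℕ} {L : W Cfg} (h : Spec K c n L) (hm : n ≤ m) :
    Spec K c m L := by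
  obtain ⟨k, rfl⟩ := Nat.exists_eq_add_of_le hm
  have := h.append (K := []) (m := k) (f := W.pure) fun c' _ => nil c' k
  rw [List.append_nil] at this
  refine this.conv (fun a ha => ?_) fun F => ?_
  · simpa using ha
  · simp

/-- The first step of a program. -/
theorem first {P : Prog} {K : List Prog} {c : Cfg} {n : ℕ} {L : W (List Prog × Cfg)}
    {f : List Prog × Cfg → W Cfg} (hw : wexec c P = L)
    (h : ∀ t, W.Mem t L → Spec (t.1 ++ K) t.2 n (f t)) : Spec (P :: K) c (n + 1) (L.bind f) := by
  subst hw
  refine ⟨fun t ht => ?_, fun F => ?_⟩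
  · simp only [wrun, wstep, W.mem_bind, W.mem_map] at ht ⊢
    obtain ⟨_, ⟨a, ha, rfl⟩, hb⟩ := ht
    have := (h a ha).1 t hb
    exact ⟨this.1, a, ha, this.2⟩
  · simp only [wrun, wstep, W.ex_bind, W.ex_map]
    exact W.ex_congr fun a ha => (h a ha).2 F

theorem first_pure {P : Prog} {J K : List Prog} {c c' : Cfg} {n : ℕ} {L : W Cfg}
    (hw : wexec c P = W.pure (J, c')) (h : Spec (J ++ K) c' n L) : Spec (P :: K) c (n + 1) L := by
  refine (first (f := fun _ => L) hw fun t ht => ?_).conv (fun a ha => ?_) fun F => ?_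
  · rw [W.mem_pure] at ht
    subst ht
    exact h
  · simpa using ha
  · simp

theorem seq {P Q : Prog} {c : Cfg} {n m : ℕ} {L : W Cfg} {f : Cfg → W Cfg}
    (h1 : Spec [P] c n L) (h2 : ∀ c', W.Mem c' L → Spec [Q] c' m (f c')) :
    Spec [P.seq Q] c (n + m + 1) (L.bind f) :=
  first_pure (J := [P, Q]) rfl (by simpa using h1.append h2)

end Spec

/-- From the memory `c`, the program `P` halts within `n` steps with memory `c'`. -/
def Det (P : Prog) (c : Cfg) (n : ℕ) (c' : Cfg) : Prop := Spec [P] c n (W.pure c')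

namespace Det

theorem mono {P : Prog} {c c' : Cfg} {n m : ℕ} (h : Det P c n c') (hm : n ≤ m) : Det P c m c' :=
  Spec.mono h hm

theorem spec_seq {P Q : Prog} {c c' : Cfg} {n m : ℕ} {L : W Cfg} (h1 : Det P c n c')
    (h2 : Spec [Q] c' m L) : Spec [P.seq Q] c (n + m + 1) L := by
  refine (Spec.seq (f := fun _ => L) h1 fun a ha => ?_).conv (fun a ha => ?_) fun F => ?_
  · rw [W.mem_pure] at ha
    subst ha
    exact h2
  · simpa using ha
  · simp

theorem seq {P Q : Prog} {c c' c'' : Cfg} {n m : ℕ} (h1 : Det P c n c')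
    (h2 : Det Q c' m c'') : Det (P.seq Q) c (n + m + 1) c'' :=
  spec_seq h1 h2

theorem skip (c : Cfg) : Det .skip c 1 c := Spec.first_pure (J := []) rfl (Spec.nil _ _)

theorem push (c : Cfg) (r : ℕ) (b : Bool) : Det (.push r b) c 1 (c.setB r (b :: c.bits r)) :=
  Spec.first_pure (J := []) rfl (Spec.nil _ _)

theorem pop (c : Cfg) (r : ℕ) : Det (.pop r) c 1 (c.setB r (c.bits r).tail) :=
  Spec.first_pure (J := []) rfl (Spec.nil _ _)

end Det

namespace Spec

theorem ite_true {r : ℕ} {P Q : Prog} {c : Cfg} {n : ℕ} {L : W Cfg}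
    (hr : (c.bits r).headD false = true) (h : Spec [P] c n L) : Spec [.ite r P Q] c (n + 1) L := by
  refine first_pure (J := [P]) (c' := c) ?_ h
  rcases hb : c.bits r with _ | ⟨_ | _, l⟩ <;> simp_all [wexec]

theorem ite_false {r : ℕ} {P Q : Prog} {c : Cfg} {n : ℕ} {L : W Cfg}
    (hr : (c.bits r).headD false = false) (h : Spec [Q] c n L) : Spec [.ite r P Q] c (n + 1) L := by
  refine first_pure (J := [Q]) (c' := c) ?_ h
  rcases hb : c.bits r with _ | ⟨_ | _, l⟩ <;> simp_all [wexec]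

theorem whileBits_nil {r : ℕ} {P : Prog} {c : Cfg} (hr : c.bits r = []) :
    Det (.whileBits r P) c 1 c :=
  first_pure (J := []) (by simp [wexec, hr]) (nil _ _)

theorem whileQubits_nil {s : ℕ} {P : Prog} {c : Cfg} (hr : c.q s = []) :
    Det (.whileQubits s P) c 1 c :=
  first_pure (J := []) (by simp [wexec, hr]) (nil _ _)

theorem whileBits_cons {r : ℕ} {P : Prog} {c : Cfg} {n m : ℕ} {L : W Cfg} {f : Cfg → W Cfg}
    (hr : c.bits r ≠ []) (h1 : Spec [P] c n L)
    (h2 : ∀ c', W.Mem c' L → Spec [.whileBits r P] c' m (f c')) :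
    Spec [.whileBits r P] c (n + m + 1) (L.bind f) := by
  refine first_pure (J := [P, .whileBits r P]) (c' := c) ?_ (by simpa using h1.append h2)
  rcases hb : c.bits r with _ | ⟨b, l⟩
  · exact absurd hb hr
  · simp [wexec, hb]

theorem whileQubits_cons {s : ℕ} {P : Prog} {c : Cfg} {n m : ℕ} {L : W Cfg} {f : Cfg → W Cfg}
    (hr : c.q s ≠ []) (h1 : Spec [P] c n L)
    (h2 : ∀ c', W.Mem c' L → Spec [.whileQubits s P] c' m (f c')) :
    Spec [.whileQubits s P] c (n + m + 1) (L.bind f) := by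
  refine first_pure (J := [P, .whileQubits s P]) (c' := c) ?_ (by simpa using h1.append h2)
  rcases hb : c.q s with _ | ⟨b, l⟩
  · exact absurd hb hr
  · simp [wexec, hb]

theorem whileBits_cons_det {r : ℕ} {P : Prog} {c c' : Cfg} {n m : ℕ} {L : W Cfg}
    (hr : c.bits r ≠ []) (h1 : Det P c n c') (h2 : Spec [.whileBits r P] c' m L) :
    Spec [.whileBits r P] c (n + m + 1) L := by
  refine first_pure (J := [P, .whileBits r P]) (c' := c) ?_ ?_
  · rcases hb : c.bits r with _ | ⟨b, l⟩
    · exact absurd hb hr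
    · simp [wexec, hb]
  · refine (Spec.append (J := [P]) (f := fun _ => L) h1 fun a ha => ?_).conv (fun a ha => ?_)
      fun F => ?_
    · rw [W.mem_pure] at ha
      subst ha
      exact h2
    · simpa using ha
    · simp

end Spec

/-! ### Machines and dyad machines have the same control flow -/

/-- A memory of a machine and a memory of the dyad machine have the same classical contents. -/
def Sim (c : Config) (d : Cfg) : Prop :=
  c.bits = d.bits ∧ ∀ s, (c.qubits s).length = (d.q s).length

theorem mem_gateW {k : Bool → Bool → ℂ} {c : Cfg} {s : ℕ} {t : List Prog × Cfg} :
    W.Mem t (gateW k c s) ↔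
      (c.q s = [] ∧ t = ([], c)) ∨ ∃ p l y, c.q s = p :: l ∧ t = ([], c.setQ s (y :: l)) := by
  rcases hs : c.q s with _ | ⟨p, l⟩
  · simp [gateW, hs]
  · have e : gateW k c s = (List.map (fun y : Bool × Bool => (k p.1 y.1 * star (k p.2 y.2),
        (([] : List Prog), c.setQ s (y :: l)))) bitPairs : W (List Prog × Cfg)) := by
      simp [gateW, hs]
      rfl
    rw [e]
    constructor
    · rintro ⟨w, hw⟩
      obtain ⟨y, -, hy⟩ := List.mem_map.1 (show (w, t) ∈ List.map _ _ from hw)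
      exact Or.inr ⟨p, l, y, rfl, (congrArg Prod.snd hy).symm⟩
    · rintro (⟨h, -⟩ | ⟨p', l', y, h, rfl⟩)
      · cases h
      · obtain ⟨rfl, rfl⟩ := List.cons.inj h
        refine ⟨k p.1 y.1 * star (k p.2 y.2), ?_⟩
        show _ ∈ List.map _ _
        refine List.mem_map.2 ⟨y, ?_, rfl⟩
        rcases y with ⟨_ | _, _ | _⟩ <;> simp [bitPairs]

theorem mem_wexec_meas {c : Cfg} {s r : ℕ} {t : List Prog × Cfg} :
    W.Mem t (wexec c (.meas s r)) ↔
      (c.q s = [] ∧ t = ([], c)) ∨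
        ∃ p l b, c.q s = p :: l ∧ t = ([], (c.setB r (b :: c.bits r)).setQ s l) := by
  rcases hs : c.q s with _ | ⟨p, l⟩
  · simp [wexec, hs]
  · have e : wexec c (.meas s r) = (List.map (fun b : Bool =>
        ((if p.1 = b ∧ p.2 = b then (1 : ℂ) else 0),
          (([] : List Prog), (c.setB r (b :: c.bits r)).setQ s l))) [false, true] :
            W (List Prog × Cfg)) := by
      simp [wexec, hs]
      rfl
    rw [e]
    constructor
    · rintro ⟨w, hw⟩
      obtain ⟨y, -, hy⟩ := List.mem_map.1 (show (w, t) ∈ List.map _ _ from hw)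
      exact Or.inr ⟨p, l, y, rfl, (congrArg Prod.snd hy).symm⟩
    · rintro (⟨h, -⟩ | ⟨p', l', y, h, rfl⟩)
      · cases h
      · obtain ⟨rfl, rfl⟩ := List.cons.inj h
        refine ⟨if p.1 = y ∧ p.2 = y then 1 else 0, ?_⟩
        show _ ∈ List.map _ _
        refine List.mem_map.2 ⟨y, ?_, rfl⟩
        rcases y with _ | _ <;> simp

theorem Sim.setQ {c : Config} {d : Cfg} (h : Sim c d) {l : List ℕ} {l' : QL} {s : ℕ}
    (hl : l.length = l'.length) {s' : ℕ} :
    (Function.update c.qubits s l s').length = ((d.setQ s l').q s').length := by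
  rw [Cfg.setQ_q, Function.update_apply]
  split_ifs with hs
  · exact hl
  · exact h.2 s'

/-- Tests read only classical bits and the lengths of quantum stacks, so control flow ignores
amplitudes. The correspondence is not one-to-one, as a gate has one successor here and four on
dyads; hence the two inclusions. One transfers halting and output lengths to the machine, the other
transfers them back. -/
theorem sim_exec {c : Config} {d : Cfg} (h : Sim c d) (P : Prog) :
    (∀ c' ∈ exec c P, ∃ t, W.Mem t (wexec d P) ∧ c'.todo = t.1 ++ c.todo ∧ Sim c' t.2) ∧
    ∀ t, W.Mem t (wexec d P) → ∃ c' ∈ exec c P, c'.todo = t.1 ++ c.todo ∧ Sim c' t.2 := by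
  have gate : ∀ (k : Bool → Bool → ℂ) (s : ℕ) (f : ℕ → MemOp),
      (∀ c' ∈ (match c.qubits s with
        | [] => [c]
        | i :: _ => [{ c with state := f i }] : List Config),
        ∃ t, W.Mem t (gateW k d s) ∧ c'.todo = t.1 ++ c.todo ∧ Sim c' t.2) ∧
      ∀ t, W.Mem t (gateW k d s) → ∃ c' ∈ (match c.qubits s with
        | [] => [c]
        | i :: _ => [{ c with state := f i }] : List Config),
        c'.todo = t.1 ++ c.todo ∧ Sim c' t.2 := by
    intro k s f
    have hl := h.2 s
    rcases hs : c.qubits s with _ | ⟨i, l⟩ <;> rcases hd : d.q s with _ | ⟨p, m⟩ <;>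
      simp only [hs, hd, List.length_nil, List.length_cons] at hl
    · simp [mem_gateW, hd, h]
    · omega
    · omega
    · simp only [mem_gateW, hd, List.mem_singleton]
      refine ⟨?_, ?_⟩
      · rintro _ rfl
        refine ⟨([], d.setQ s (p :: m)), Or.inr ⟨p, m, p, rfl, rfl⟩, rfl, h.1, fun s' => ?_⟩
        simp only [Cfg.setQ_q]
        split_ifs with e
        · subst e; simp [hs]; omega
        · exact h.2 s'
      · rintro _ (⟨e, -⟩ | ⟨p', l', y, e, rfl⟩)
        · cases e
        · obtain ⟨rfl, rfl⟩ := List.cons.inj e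
          refine ⟨_, rfl, rfl, h.1, fun s' => ?_⟩
          simp only [Cfg.setQ_q]
          split_ifs with e
          · subst e; simp [hs]; omega
          · exact h.2 s'
  cases P with
  | skip => simp [exec, wexec, h]
  | push r b =>
    simp [exec, wexec]
    exact ⟨by simp [h.1, Cfg.setB], h.2⟩
  | pop r =>
    simp [exec, wexec]
    exact ⟨by simp [h.1, Cfg.setB], h.2⟩
  | alloc s =>
    simp [exec, wexec]
    exact ⟨h.1, fun s' => h.setQ (by simp [h.2])⟩
  | discard s =>
    have hl := h.2 s
    rcases hd : d.q s with _ | ⟨p, m⟩ <;> simp only [hd, List.length_nil, List.length_cons] at hl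
    · have hs : c.qubits s = [] := List.length_eq_zero_iff.1 hl
      simp [exec, wexec, hd, hs]
      refine ⟨h.1, fun s' => ?_⟩
      simp only [Function.update_apply]
      split_ifs with e
      · subst e; simp [hd]
      · exact h.2 s'
    · simp [exec, wexec, hd]
      exact ⟨h.1, fun s' => h.setQ (by simp [hl])⟩
  | move s s' =>
    have hl := h.2 s
    rcases hs : c.qubits s with _ | ⟨i, l⟩ <;> rcases hd : d.q s with _ | ⟨p, m⟩ <;>
      simp only [hs, hd, List.length_nil, List.length_cons] at hl
    · simp [exec, wexec, hs, hd, h]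
    · omega
    · omega
    · simp [exec, wexec, hs, hd]
      refine ⟨h.1, fun s'' => ?_⟩
      simp only [Function.update_apply, Cfg.setQ_q]
      have h2 := h.2 s''
      have h3 := h.2 s'
      split_ifs <;> (try simp only [List.length_cons]) <;> omega
  | had s => exact gate hadC s _
  | tgate s => exact gate tC s _
  | cnot s s' =>
    have hl := h.2 s
    have hl' := h.2 s'
    rcases hs : c.qubits s with _ | ⟨i, l⟩ <;> rcases hd : d.q s with _ | ⟨p, m⟩ <;>
      simp only [hs, hd, List.length_nil, List.length_cons] at hl
    · simp [exec, wexec, hs, hd, h]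
    · omega
    · omega
    · rcases hs' : c.qubits s' with _ | ⟨i', l'⟩ <;> rcases hd' : d.q s' with _ | ⟨p', m'⟩ <;>
        simp only [hs', hd', List.length_nil, List.length_cons] at hl'
      · simp [exec, wexec, hs, hd, hs', hd', h]
      · omega
      · omega
      · have hS : ∀ x, Sim c (d.setQ s' (x :: m')) := by
          intro x
          refine ⟨h.1, fun s'' => ?_⟩
          simp only [Cfg.setQ_q]
          split_ifs with e
          · subst e; simp [hs']; omega
          · exact h.2 _
        have hS' : ∀ (x : Bool × Bool) (ρ : MemOp), Sim { c with state := ρ } (d.setQ s' (x :: m')) :=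
          fun x ρ => hS x
        by_cases e1 : i = i' <;> by_cases e2 : s = s' <;>
          simp [exec, wexec, hs, hd, hs', hd', e1, e2, h, hS, hS']
  | meas s r =>
    have hl := h.2 s
    simp only [mem_wexec_meas]
    rcases hs : c.qubits s with _ | ⟨i, l⟩ <;> rcases hd : d.q s with _ | ⟨p, m⟩ <;>
      simp only [hs, hd, List.length_nil, List.length_cons] at hl
    · simp [exec, hs, h]
    · omega
    · omega
    · have hl : l.length = m.length := by omega
      constructor
      · intro c' hc'
        simp only [exec, hs, List.map_cons, List.map_nil, List.mem_cons, List.not_mem_nil,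
          or_false] at hc'
        rcases hc' with rfl | rfl
        · exact ⟨_, Or.inr ⟨p, m, false, rfl, rfl⟩, rfl, by simp [h.1, Cfg.setB],
            fun s' => h.setQ hl⟩
        · exact ⟨_, Or.inr ⟨p, m, true, rfl, rfl⟩, rfl, by simp [h.1, Cfg.setB],
            fun s' => h.setQ hl⟩
      · rintro t (⟨e, -⟩ | ⟨p', l', y, e, rfl⟩)
        · cases e
        · obtain ⟨rfl, rfl⟩ := List.cons.inj e
          refine ⟨{ c with
              bits := Function.update c.bits r (y :: c.bits r)
              qubits := Function.update c.qubits s l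
              state := conjBy (projVec i y) c.state }, ?_, rfl, by simp [h.1, Cfg.setB],
            fun s' => h.setQ hl⟩
          cases y <;> simp [exec, hs]
  | seq P Q =>
    simp [exec, wexec]
    exact h
  | ite r P Q =>
    have hb : c.bits r = d.bits r := congrFun h.1 r
    rcases hr : d.bits r with _ | ⟨_ | _, l⟩ <;> simp [exec, wexec, hb, hr] <;> exact h
  | whileBits r P =>
    have hb : c.bits r = d.bits r := congrFun h.1 r
    rcases hr : d.bits r with _ | ⟨_, l⟩ <;> simp [exec, wexec, hb, hr] <;> exact h
  | whileQubits s P =>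
    have hl := h.2 s
    rcases hs : c.qubits s with _ | ⟨i, l⟩ <;> rcases hd : d.q s with _ | ⟨p, m⟩ <;>
      simp only [hs, hd, List.length_nil, List.length_cons] at hl
    · simp [exec, wexec, hs, hd, h]
    · omega
    · omega
    · simp [exec, wexec, hs, hd]
      exact h

theorem sim_run (n : ℕ) : ∀ {c : Config} {d : Cfg}, Sim c d →
    (∀ c' ∈ run n c, ∃ t, W.Mem t (wrun n c.todo d) ∧ c'.todo = t.1 ∧ Sim c' t.2) ∧
    ∀ t, W.Mem t (wrun n c.todo d) → ∃ c' ∈ run n c, c'.todo = t.1 ∧ Sim c' t.2 := by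
  induction n with
  | zero => 
    intro c d h
    simp [run, wrun, h]
  | succ n ih =>
    intro c d h
    have hstep : (∀ c' ∈ step c, ∃ t, W.Mem t (wstep c.todo d) ∧ c'.todo = t.1 ∧ Sim c' t.2) ∧
        ∀ t, W.Mem t (wstep c.todo d) → ∃ c' ∈ step c, c'.todo = t.1 ∧ Sim c' t.2 := by
      rcases hK : c.todo with _ | ⟨P, K⟩
      · simp [step, wstep, hK, h]
      · have := sim_exec (c := { c with todo := K }) (d := d) h P
        constructor
        · intro c' hc'
          simp only [step, hK] at hc'
          obtain ⟨t, h1, h2, h3⟩ := this.1 c' hc'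
          exact ⟨(t.1 ++ K, t.2), by simp only [wstep, W.mem_map]; exact ⟨t, h1, rfl⟩, h2, h3⟩
        · intro t ht
          simp only [wstep, W.mem_map] at ht
          obtain ⟨t, h1, rfl⟩ := ht
          obtain ⟨c', h2, h3, h4⟩ := this.2 t h1
          exact ⟨c', by simpa only [step, hK] using h2, h3, h4⟩
    constructor
    · intro c' hc'
      simp only [run, List.mem_flatMap] at hc'
      obtain ⟨c1, h1, h2⟩ := hc'
      obtain ⟨t, h3, h4, h5⟩ := hstep.1 c1 h1
      obtain ⟨t', h6, h7, h8⟩ := (ih h5).1 c' h2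
      rw [h4] at h6
      exact ⟨t', by simp only [wrun, W.mem_bind]; exact ⟨t, h3, h6⟩, h7, h8⟩
    · intro t' ht'
      simp only [wrun, W.mem_bind] at ht'
      obtain ⟨t, h1, h2⟩ := ht'
      obtain ⟨c1, h3, h4, h5⟩ := hstep.2 t h1
      rw [← h4] at h2
      obtain ⟨c', h6, h7, h8⟩ := (ih h5).2 t' h2
      exact ⟨c', by simp only [run, List.mem_flatMap]; exact ⟨c1, h3, h6⟩, h7, h8⟩

/-! ### The values of paths -/

/-- The matrix `ρ` is a finite sum of dyads `|ψ⟩⟨ψ|`. -/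
def Gram {α : Type*} (ρ : Matrix α α ℂ) : Prop :=
  ∃ (n : ℕ) (ψ : Fin n → α → ℂ), ∀ S S', ρ S S' = ∑ a, ψ a S * star (ψ a S')

theorem Gram.of_fintype {α ι : Type*} [Fintype ι] {ρ : Matrix α α ℂ} (ψ : ι → α → ℂ)
    (h : ∀ S S', ρ S S' = ∑ a, ψ a S * star (ψ a S')) : Gram ρ := by
  refine ⟨Fintype.card ι, fun a => ψ ((Fintype.equivFin ι).symm a), fun S S' => ?_⟩
  rw [h, ← (Fintype.equivFin ι).symm.sum_comp]

theorem Gram.zero {α : Type*} : Gram (0 : Matrix α α ℂ) :=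
  ⟨0, fun _ _ => 0, by simp⟩

theorem Gram.add {α : Type*} {ρ σ : Matrix α α ℂ} (h : Gram ρ) (h' : Gram σ) : Gram (ρ + σ) := by
  obtain ⟨n, ψ, h⟩ := h
  obtain ⟨m, φ, h'⟩ := h'
  refine Gram.of_fintype (ι := Fin n ⊕ Fin m) (fun a => Sum.elim ψ φ a) fun S S' => ?_
  simp [h, h']

theorem Gram.sum {α : Type*} {ι : Type*} (s : Finset ι) {ρ : ι → Matrix α α ℂ}
    (h : ∀ i ∈ s, Gram (ρ i)) : Gram (∑ i ∈ s, ρ i) := by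
  classical
  induction s using Finset.induction_on with
  | empty => simpa using Gram.zero
  | insert i s hi ih =>
    rw [Finset.sum_insert hi]
    exact (h i (by simp)).add (ih fun j hj => h j (by simp [hj]))

theorem Gram.list_sum {α : Type*} (L : List (Matrix α α ℂ)) (h : ∀ ρ ∈ L, Gram ρ) :
    Gram L.sum := by
  induction L with
  | nil => simpa using Gram.zero
  | cons ρ L ih =>
    rw [List.sum_cons]
    exact (h ρ (by simp)).add (ih fun j hj => h j (by simp [hj]))

/-- Restriction of a matrix along a map of index sets. -/
theorem Gram.comp {α β : Type*} {ρ : Matrix α α ℂ} (h : Gram ρ) (f : β → α) :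
    Gram (fun u v => ρ (f u) (f v)) := by
  obtain ⟨n, ψ, h⟩ := h
  exact ⟨n, fun a u => ψ a (f u), fun u v => h _ _⟩

theorem Gram.cut {α : Type*} {ρ : Matrix α α ℂ} (h : Gram ρ) (p : α → Prop) [DecidablePred p] :
    Gram (fun u v => if p u ∧ p v then ρ u v else 0) := by
  obtain ⟨n, ψ, h⟩ := h
  refine ⟨n, fun a u => if p u then ψ a u else 0, fun u v => ?_⟩
  by_cases hu : p u <;> by_cases hv : p v <;> simp [hu, hv, h]

theorem Gram.diag_im {α : Type*} {ρ : Matrix α α ℂ} (h : Gram ρ) (S : α) :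
    ρ S S = ((ρ S S).re : ℂ) := by
  obtain ⟨n, ψ, h⟩ := h
  rw [h]
  simp [Complex.mul_conj]

theorem Gram.diag_nonneg {α : Type*} {ρ : Matrix α α ℂ} (h : Gram ρ) (S : α) :
    0 ≤ (ρ S S).re := by
  obtain ⟨n, ψ, h⟩ := h
  rw [h]
  simp only [Complex.re_sum]
  refine Finset.sum_nonneg fun a _ => ?_
  have : ψ a S * star (ψ a S) = (Complex.normSq (ψ a S) : ℂ) := by
    simp [Complex.mul_conj]
  rw [this, Complex.ofReal_re]
  exact Complex.normSq_nonneg _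

/-- `conjBy` applies `K` to the columns and then to the conjugated rows, which amounts to applying
`K` to each vector of the Gram decomposition. Only linearity matters, so measurements are included
along with unitary gates. -/
theorem Gram.conjBy {ρ : MemOp} (h : Gram ρ) (K : (Finset ℕ → ℂ) →ₗ[ℂ] (Finset ℕ → ℂ)) :
    Gram (conjBy K ρ) := by
  obtain ⟨n, ψ, h⟩ := h
  refine ⟨n, fun a => K (ψ a), fun S S' => ?_⟩
  have h1 : ∀ R', (fun R => ρ R R') = ∑ a, star (ψ a R') • ψ a := by
    intro R'
    ext R
    rw [h]
    simp [mul_comm]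
  have h2 : (fun R' => star (K (fun R => ρ R R') S)) = ∑ a, star (K (ψ a) S) • ψ a := by
    ext R'
    rw [h1]
    simp [mul_comm]
  unfold QCrypto.conjBy
  rw [h2]
  simp

theorem Gram.had {ρ : MemOp} (h : Gram ρ) (i : ℕ) : Gram (QCrypto.conjBy (hadVec i) ρ) :=
  h.conjBy
    { toFun := hadVec i
      map_add' := fun x y => by ext S; simp only [hadVec, Pi.add_apply]; ring
      map_smul' := fun x y => by
        ext S; simp only [hadVec, Pi.smul_apply, smul_eq_mul, RingHom.id_apply]; ring }

theorem Gram.tgate {ρ : MemOp} (h : Gram ρ) (i : ℕ) : Gram (QCrypto.conjBy (tVec i) ρ) :=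
  h.conjBy
    { toFun := tVec i
      map_add' := fun x y => by ext S; simp only [tVec, Pi.add_apply]; split_ifs <;> ring
      map_smul' := fun x y => by
        ext S; simp only [tVec, Pi.smul_apply, smul_eq_mul, RingHom.id_apply]; split_ifs <;> ring }

theorem Gram.cnot {ρ : MemOp} (h : Gram ρ) (i j : ℕ) : Gram (QCrypto.conjBy (cnotVec i j) ρ) :=
  h.conjBy
    { toFun := cnotVec i j
      map_add' := fun x y => by ext S; simp only [cnotVec, Pi.add_apply]; split_ifs <;> ring
      map_smul' := fun x y => by
        ext S; simp only [cnotVec, Pi.smul_apply, smul_eq_mul, RingHom.id_apply]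
        split_ifs <;> ring }

theorem Gram.proj {ρ : MemOp} (h : Gram ρ) (i : ℕ) (b : Bool) :
    Gram (QCrypto.conjBy (projVec i b) ρ) :=
  h.conjBy
    { toFun := projVec i b
      map_add' := fun x y => by ext S; simp only [projVec, Pi.add_apply]; split_ifs <;> ring
      map_smul' := fun x y => by
        ext S; simp only [projVec, Pi.smul_apply, smul_eq_mul, RingHom.id_apply]
        split_ifs <;> ring }

theorem gram_exec {c : Config} (h : Gram c.state) (P : Prog) :
    ∀ c' ∈ exec c P, Gram c'.state := by
  intro c' hc'
  cases P <;> simp only [exec] at hc'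
  all_goals
    repeat' split at hc'
  all_goals
    simp only [List.map_cons, List.map_nil, List.mem_cons, List.not_mem_nil,
      or_false] at hc'
  all_goals first
    | (subst hc'; first | exact h | exact h.had _ | exact h.tgate _ | exact h.cnot _ _)
    | (rcases hc' with rfl | rfl <;> exact h.proj _ _)

theorem gram_run (n : ℕ) {c : Config} (h : Gram c.state) : ∀ c' ∈ run n c, Gram c'.state := by
  induction n generalizing c with
  | zero => simpa [run] using h
  | succ n ih =>
    intro c' hc'
    simp only [run, List.mem_flatMap] at hc'
    obtain ⟨c1, h1, h2⟩ := hc'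
    refine ih ?_ c' h2
    rcases hK : c.todo with _ | ⟨P, K⟩
    · simp [step, hK] at h1
      rwa [h1]
    · simp only [step, hK] at h1
      exact gram_exec (c := { c with todo := K }) h P c1 h1

/-! ### The dyad machine computes the states of the machine -/

/-- The stacks of a configuration hold different qubits, which are in use, and all the qubits that
are not in use are in the state `|0⟩`. -/
structure Config.Wired (c : Config) : Prop where
  nodup : ∀ s, (c.qubits s).Nodup
  lt : ∀ s, ∀ i ∈ c.qubits s, i < c.next
  disj : ∀ s s' i, i ∈ c.qubits s → i ∈ c.qubits s' → s = s'
  supp : ∀ S S', c.state S S' ≠ 0 → S ⊆ Finset.range c.next ∧ S' ⊆ Finset.range c.next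

/-- The dyad of the stacks that belongs to a dyad of the memory. -/
def Config.dyad (c : Config) (S S' : Finset ℕ) : Cfg where
  bits := c.bits
  q s := (c.qubits s).map fun j => (decide (j ∈ S), decide (j ∈ S'))

/-- The sets `S` and `S'` agree on the qubits that are in no stack. -/
def Config.Agree (c : Config) (S S' : Finset ℕ) : Prop :=
  ∀ j < c.next, (∀ s, j ∉ c.qubits s) → (j ∈ S ↔ j ∈ S')

open Classical in
/-- The indicator function of `Config.Agree`. -/
def Config.ag (c : Config) (S S' : Finset ℕ) : ℂ := if c.Agree S S' then 1 else 0

theorem Config.ag_congr {c c' : Config} {S S' R R' : Finset ℕ} (h : c.Agree S S' ↔ c'.Agree R R') :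
    c.ag S S' = c'.ag R R' := by
  unfold Config.ag
  by_cases h1 : c.Agree S S'
  · rw [if_pos h1, if_pos (h.1 h1)]
  · rw [if_neg h1, if_neg fun h2 => h1 (h.2 h2)]

/-- The linear extension of the function `F` of dyads, applied to the state of the stacks. -/
def Config.val (c : Config) (F : Cfg → ℂ) : ℂ :=
  ∑ S ∈ (Finset.range c.next).powerset, ∑ S' ∈ (Finset.range c.next).powerset,
    c.ag S S' * (c.state S S' * F (c.dyad S S'))

theorem Config.val_congr {c c' : Config} {F G : Cfg → ℂ} (hn : c.next = c'.next)
    (h : ∀ S S', S ⊆ Finset.range c.next → S' ⊆ Finset.range c.next →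
      c.ag S S' * (c.state S S' * F (c.dyad S S'))
        = c'.ag S S' * (c'.state S S' * G (c'.dyad S S'))) :
    c.val F = c'.val G := by
  unfold Config.val
  rw [← hn]
  exact Finset.sum_congr rfl fun S hS => Finset.sum_congr rfl fun S' hS' =>
    h S S' (Finset.mem_powerset.1 hS) (Finset.mem_powerset.1 hS')

/-- Set the bit of qubit `i` to `x`. -/
def setBit (i : ℕ) (x : Bool) (S : Finset ℕ) : Finset ℕ := if x then insert i S else S.erase i

theorem mem_setBit {i j : ℕ} {x : Bool} {S : Finset ℕ} :
    j ∈ setBit i x S ↔ if j = i then x = true else j ∈ S := by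
  cases x <;> by_cases h : j = i <;> simp [setBit, h]

@[simp] theorem setBit_setBit {i : ℕ} {x y : Bool} {S : Finset ℕ} :
    setBit i x (setBit i y S) = setBit i x S := by
  ext j
  simp only [mem_setBit]
  split_ifs <;> rfl

theorem sum_powerset_setBit {n i : ℕ} (hi : i < n) (f : Finset ℕ → ℂ) :
    ∑ S ∈ (Finset.range n).powerset, f S
      = ∑ S ∈ ((Finset.range n).erase i).powerset, ∑ x : Bool, f (setBit i x S) := by
  have h : Finset.range n = insert i ((Finset.range n).erase i) := by
    rw [Finset.insert_erase (Finset.mem_range.2 hi)]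
  conv_lhs => rw [h]
  rw [Finset.sum_powerset_insert (by simp), ← Finset.sum_add_distrib]
  refine Finset.sum_congr rfl fun S hS => ?_
  have : i ∉ S := fun hi => by
    have := Finset.mem_powerset.1 hS hi
    simp at this
  simp [setBit, Finset.erase_eq_of_notMem this, add_comm]

/-- Each qubit sits at one place of one stack, so changing its bit changes a single entry of the
dyad. -/
theorem Config.Wired.dyad_setBit {c : Config} (hw : c.Wired) {s i : ℕ} {l : List ℕ}
    (hs : c.qubits s = i :: l) (x x' : Bool) (S S' : Finset ℕ) :
    c.dyad (setBit i x S) (setBit i x' S') =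
      (c.dyad S S').setQ s ((x, x') :: l.map fun j => (decide (j ∈ S), decide (j ∈ S'))) := by
  ext1
  · rfl
  · funext s'
    rw [Cfg.setQ_q]
    have hn := hw.nodup s
    rw [hs, List.nodup_cons] at hn
    split_ifs with e
    · subst e
      simp only [Config.dyad, hs, List.map_cons, mem_setBit, if_true, List.cons.injEq]
      refine ⟨by simp, List.map_congr_left fun j hj => ?_⟩
      have : j ≠ i := fun e => hn.1 (e ▸ hj)
      simp [this]
    · simp only [Config.dyad]
      refine List.map_congr_left fun j hj => ?_
      have : j ≠ i := fun h => e (hw.disj s' s j hj (by rw [hs, h]; simp))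
      simp [this, mem_setBit]

theorem ex_gateW_cons {k : Bool → Bool → ℂ} {c : Cfg} {s : ℕ} {p : Bool × Bool} {l : QL}
    (h : c.q s = p :: l) (F : List Prog × Cfg → ℂ) :
    (gateW k c s).ex F
      = ∑ y : Bool, ∑ y' : Bool, k p.1 y * star (k p.2 y') * F ([], c.setQ s ((y, y') :: l)) := by
  have e : gateW k c s = (List.map (fun y : Bool × Bool => (k p.1 y.1 * star (k p.2 y.2),
      (([] : List Prog), c.setQ s (y :: l)))) bitPairs : W (List Prog × Cfg)) := by
    simp [gateW, h]
    rfl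
  rw [e]
  simp only [W.ex, bitPairs]
  simp
  ring

/-- For fixed values of the other qubits, both sides are the same sum over the two old and the two
new bits of qubit `i`: `hρ` is indexed by the new bits, `gateW` branches from the old ones. The
qubit lies in a stack, so `ag` does not depend on it. -/
theorem Config.Wired.val_gate {c : Config} (hw : c.Wired) {s i : ℕ} {l : List ℕ}
    (hs : c.qubits s = i :: l) (k : Bool → Bool → ℂ) (ρ : MemOp)
    (hρ : ∀ S S', ρ S S' = ∑ x : Bool, ∑ x' : Bool, k x (decide (i ∈ S)) *
      star (k x' (decide (i ∈ S'))) * c.state (setBit i x S) (setBit i x' S')) (F : Cfg → ℂ) :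
    Config.val { c with state := ρ } F
      = c.val fun d => (gateW k d s).ex fun t => F t.2 := by
  have hi : i < c.next := hw.lt s i (by rw [hs]; simp)
  have hag : ∀ x x' S S', c.ag (setBit i x S) (setBit i x' S') = c.ag S S' := by
    intro x x' S S'
    refine Config.ag_congr ?_
    refine forall_congr' fun j => forall_congr' fun _ => forall_congr' fun hj => ?_
    have : j ≠ i := by
      rintro rfl
      exact hj s (by rw [hs]; simp)
    simp [mem_setBit, this]
  show ∑ S ∈ (Finset.range c.next).powerset, ∑ S' ∈ (Finset.range c.next).powerset,
    c.ag S S' * (ρ S S' * F (c.dyad S S')) = _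
  unfold Config.val
  simp only [sum_powerset_setBit hi]
  refine Finset.sum_congr rfl fun S _ => ?_
  rw [Finset.sum_comm]
  conv_rhs => rw [Finset.sum_comm]
  refine Finset.sum_congr rfl fun S' _ => ?_
  simp only [hag, hρ]
  have hq : ∀ x x', (c.dyad (setBit i x S) (setBit i x' S')).q s
      = (x, x') :: l.map fun j => (decide (j ∈ S), decide (j ∈ S')) := by
    intro x x'
    rw [hw.dyad_setBit hs, Cfg.setQ_q, if_pos rfl]
  have e : ∀ x x' y y', (c.dyad (setBit i x S) (setBit i x' S')).setQ s
      ((y, y') :: l.map fun j => (decide (j ∈ S), decide (j ∈ S')))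
      = c.dyad (setBit i y S) (setBit i y' S') := by
    intro x x' y y'
    rw [hw.dyad_setBit hs, hw.dyad_setBit hs]
    ext1
    · rfl
    · funext s'
      simp only [Cfg.setQ_q]
      split_ifs <;> rfl
  simp only [ex_gateW_cons (hq _ _), e, setBit_setBit, mem_setBit, if_true]
  simp only [Fintype.sum_bool, Bool.decide_eq_true]
  ring

theorem conjBy_hadVec (i : ℕ) (ρ : MemOp) (S S' : Finset ℕ) :
    conjBy (hadVec i) ρ S S' = ∑ x : Bool, ∑ x' : Bool, hadC x (decide (i ∈ S)) *
      star (hadC x' (decide (i ∈ S'))) * ρ (setBit i x S) (setBit i x' S') := by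
  have hs : (starRingEnd ℂ) (Real.sqrt 2 : ℂ) = (Real.sqrt 2 : ℂ) := Complex.conj_ofReal _
  by_cases h : i ∈ S <;> by_cases h' : i ∈ S' <;>
    simp [conjBy, hadVec, hadC, setBit, h, h', hs] <;> ring

theorem conjBy_tVec (i : ℕ) (ρ : MemOp) (S S' : Finset ℕ) :
    conjBy (tVec i) ρ S S' = ∑ x : Bool, ∑ x' : Bool, tC x (decide (i ∈ S)) *
      star (tC x' (decide (i ∈ S'))) * ρ (setBit i x S) (setBit i x' S') := by
  by_cases h : i ∈ S <;> by_cases h' : i ∈ S' <;>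
    simp [conjBy, tVec, tC, setBit, h, h'] <;> ring

theorem conjBy_projVec (i : ℕ) (b : Bool) (ρ : MemOp) (S S' : Finset ℕ) :
    conjBy (projVec i b) ρ S S' =
      if decide (i ∈ S) = b ∧ decide (i ∈ S') = b then ρ S S' else 0 := by
  by_cases h : decide (i ∈ S) = b <;> by_cases h' : decide (i ∈ S') = b <;>
    simp [conjBy, projVec, h, h']

/-- The permutation of basis states by a controlled not. -/
def flipIf (i j : ℕ) (S : Finset ℕ) : Finset ℕ := if i ∈ S then symmDiff S {j} else S

theorem conjBy_cnotVec (i j : ℕ) (ρ : MemOp) (S S' : Finset ℕ) :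
    conjBy (cnotVec i j) ρ S S' = ρ (flipIf i j S) (flipIf i j S') := by
  by_cases h : i ∈ S <;> by_cases h' : i ∈ S' <;>
    simp [conjBy, cnotVec, flipIf, h, h']

theorem mem_flipIf {i j k : ℕ} {S : Finset ℕ} :
    k ∈ flipIf i j S ↔ if k = j ∧ i ∈ S then k ∉ S else k ∈ S := by
  unfold flipIf
  by_cases h : i ∈ S <;> by_cases h' : k = j <;> simp [h, h', Finset.mem_symmDiff]

theorem flipIf_flipIf {i j : ℕ} (hij : i ≠ j) (S : Finset ℕ) :
    flipIf i j (flipIf i j S) = S := by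
  ext k
  simp only [mem_flipIf, hij, false_and, if_false]
  by_cases h : k = j ∧ i ∈ S <;> simp [h]

theorem sum_powerset_flipIf {n i j : ℕ} (hij : i ≠ j) (hj : j < n) (f : Finset ℕ → ℂ) :
    ∑ S ∈ (Finset.range n).powerset, f (flipIf i j S)
      = ∑ S ∈ (Finset.range n).powerset, f S := by
  have hmem : ∀ S ∈ (Finset.range n).powerset, flipIf i j S ∈ (Finset.range n).powerset := by
    intro S hS
    rw [Finset.mem_powerset] at hS ⊢
    intro k hk
    rw [mem_flipIf] at hk
    by_cases h : k = j
    · rw [h]; exact Finset.mem_range.2 hj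
    · simp only [h, false_and, if_false] at hk
      exact hS hk
  exact Finset.sum_nbij' (flipIf i j) (flipIf i j) hmem hmem
    (fun S _ => flipIf_flipIf hij S) (fun S _ => flipIf_flipIf hij S) fun S _ => rfl

/-- A controlled not permutes the basis by an involution, which serves as a change of the summation
variable on either side of the dyad. -/
theorem Config.Wired.val_cnot {c : Config} (hw : c.Wired) {s s' i j : ℕ} {l l' : List ℕ}
    (hs : c.qubits s = i :: l) (hs' : c.qubits s' = j :: l') (hij : i ≠ j)
    (F : List Prog × Cfg → ℂ) :
    Config.val { c with state := conjBy (cnotVec i j) c.state } (fun d => F ([], d))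
      = c.val fun d => (wexec d (.cnot s s')).ex F := by
  have hj : j < c.next := hw.lt s' j (by rw [hs']; simp)
  have hss : s ≠ s' := by
    rintro rfl
    rw [hs] at hs'
    exact hij (List.cons.inj hs').1
  have hag : ∀ S S', Config.ag c S S' = c.ag (flipIf i j S) (flipIf i j S') := by
    intro S S'
    refine Config.ag_congr ?_
    refine forall_congr' fun k => forall_congr' fun _ => forall_congr' fun hk => ?_
    have : k ≠ j := by
      rintro rfl
      exact hk s' (by rw [hs']; simp)
    simp [mem_flipIf, this]
  have he : ∀ S S', (wexec (c.dyad S S') (.cnot s s')).ex F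
      = F ([], c.dyad (flipIf i j S) (flipIf i j S')) := by
    intro S S'
    have : c.dyad (flipIf i j S) (flipIf i j S')
        = (c.dyad S S').setQ s' ((xor (decide (j ∈ S)) (decide (i ∈ S)),
          xor (decide (j ∈ S')) (decide (i ∈ S'))) ::
            l'.map fun j => (decide (j ∈ S), decide (j ∈ S'))) := by
      ext1
      · rfl
      · funext s''
        rw [Cfg.setQ_q]
        have hn := hw.nodup s'
        rw [hs', List.nodup_cons] at hn
        split_ifs with e
        · subst e
          simp only [Config.dyad, hs', List.map_cons, mem_flipIf, List.cons.injEq]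
          refine ⟨?_, List.map_congr_left fun k hk => ?_⟩
          · by_cases h1 : i ∈ S <;> by_cases h2 : i ∈ S' <;> simp [h1, h2]
          · have : k ≠ j := fun e => hn.1 (e ▸ hk)
            simp [this]
        · simp only [Config.dyad]
          refine List.map_congr_left fun k hk => ?_
          have : k ≠ j := fun h => e (hw.disj s'' s' k hk (by rw [hs', h]; simp))
          simp [this, mem_flipIf]
    rw [this]
    simp [wexec, Config.dyad, hs, hs', hss]
  show ∑ S ∈ (Finset.range c.next).powerset, ∑ S' ∈ (Finset.range c.next).powerset,
    c.ag S S' * (conjBy (cnotVec i j) c.state S S' * F ([], c.dyad S S')) = _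
  unfold Config.val
  simp only [he, conjBy_cnotVec]
  rw [← sum_powerset_flipIf hij hj]
  refine Finset.sum_congr rfl fun S _ => ?_
  rw [← sum_powerset_flipIf hij hj]
  refine Finset.sum_congr rfl fun S' _ => ?_
  rw [← hag, flipIf_flipIf hij, flipIf_flipIf hij]

/-- The sums range over one more qubit, but the terms in which it is `1` vanish, because unused
qubits are in the state `|0⟩`. -/
theorem Config.Wired.val_alloc {c : Config} (hw : c.Wired) (s : ℕ) (F : Cfg → ℂ) :
    Config.val { c with
          qubits := Function.update c.qubits s (c.next :: c.qubits s)
          next := c.next + 1 } F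
      = c.val fun d => F (d.setQ s ((false, false) :: d.q s)) := by
  set c' : Config := { c with
          qubits := Function.update c.qubits s (c.next :: c.qubits s)
          next := c.next + 1 } with hc'
  have hsub : (Finset.range c.next).powerset ⊆ (Finset.range (c.next + 1)).powerset :=
    Finset.powerset_mono.2 (Finset.range_mono (Nat.le_succ _))
  unfold Config.val
  show ∑ S ∈ (Finset.range (c.next + 1)).powerset, ∑ S' ∈ (Finset.range (c.next + 1)).powerset,
    c'.ag S S' * (c.state S S' * F (c'.dyad S S')) = _
  rw [← Finset.sum_subset hsub]
  · refine Finset.sum_congr rfl fun S hS => ?_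
    rw [← Finset.sum_subset hsub]
    · refine Finset.sum_congr rfl fun S' hS' => ?_
      have h1 : c.next ∉ S := fun h => by
        have := Finset.mem_powerset.1 hS h
        simp at this
      have h2 : c.next ∉ S' := fun h => by
        have := Finset.mem_powerset.1 hS' h
        simp at this
      have ha : c'.ag S S' = c.ag S S' := by
        refine Config.ag_congr ?_
        constructor
        · intro h j hj hn
          refine h j (Nat.lt_succ_of_lt hj) fun t => ?_
          simp only [hc', Function.update_apply]
          split_ifs with e
          · simp [hj.ne, hn]
          · exact hn t
        · intro h j hj hn
          have : j ≠ c.next := by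
            rintro rfl
            have := hn s
            simp [hc'] at this
          refine h j (by have : j < c.next + 1 := hj; omega) fun t ht => hn t ?_
          simp only [hc', Function.update_apply]
          split_ifs with e
          · subst e; simp [ht]
          · exact ht
      have hd : c'.dyad S S' = (c.dyad S S').setQ s ((false, false) :: (c.dyad S S').q s) := by
        ext1
        · rfl
        · funext t
          rw [Cfg.setQ_q]
          simp only [Config.dyad, hc', Function.update_apply]
          split_ifs <;> simp [h1, h2]
      simp only [ha, hd]
    · intro S' _ hS'
      have : c.state S S' = 0 := by
        by_contra h
        exact hS' (Finset.mem_powerset.2 (hw.supp _ _ h).2)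
      simp [this]
  · intro S _ hS
    refine Finset.sum_eq_zero fun S' _ => ?_
    have : c.state S S' = 0 := by
      by_contra h
      exact hS (Finset.mem_powerset.2 (hw.supp _ _ h).1)
    simp [this]

theorem Config.val_add (c : Config) (F G : Cfg → ℂ) :
    c.val (fun d => F d + G d) = c.val F + c.val G := by
  unfold Config.val
  simp only [← Finset.sum_add_distrib]
  refine Finset.sum_congr rfl fun S _ => Finset.sum_congr rfl fun S' _ => ?_
  ring

theorem Config.val_congr' {c : Config} {F G : Cfg → ℂ}
    (h : ∀ S S', F (c.dyad S S') = G (c.dyad S S')) : c.val F = c.val G :=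
  Config.val_congr rfl fun S S' _ _ => by rw [h]

/-- A qubit that leaves the stacks must agree on both sides of the dyad from then on. The additional
factor is the partial trace over this qubit. -/
theorem Config.ag_tail {c : Config} {s i : ℕ} {l : List ℕ} (hw : c.Wired)
    (hs : c.qubits s = i :: l) {c' : Config} (hn : c'.next = c.next)
    (hq : c'.qubits = Function.update c.qubits s l) (S S' : Finset ℕ) :
    c'.ag S S' = c.ag S S' * (if decide (i ∈ S) = decide (i ∈ S') then 1 else 0) := by
  have hnd := hw.nodup s
  rw [hs, List.nodup_cons] at hnd
  have hi : i < c.next := hw.lt s i (by rw [hs]; simp)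
  have key : c'.Agree S S' ↔ c.Agree S S' ∧ (decide (i ∈ S) = decide (i ∈ S')) := by
    constructor
    · intro h
      refine ⟨fun j hj hj' => h j (hn ▸ hj) fun t => ?_, ?_⟩
      · rw [hq, Function.update_apply]
        split_ifs with e
        · have := hj' s
          rw [hs] at this
          exact fun h => this (List.mem_cons_of_mem _ h)
        · exact hj' t
      · have := h i (hn ▸ hi) fun t => ?_
        · simpa using this
        · rw [hq, Function.update_apply]
          split_ifs with e
          · exact hnd.1
          · exact fun h => e (hw.disj t s i h (by rw [hs]; simp))
    · rintro ⟨h, h'⟩ j hj hj'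
      by_cases e : j = i
      · subst e
        simpa using h'
      · refine h j (hn ▸ hj) fun t ht => hj' t ?_
        rw [hq, Function.update_apply]
        split_ifs with et
        · subst et
          rw [hs] at ht
          exact (List.mem_cons.1 ht).resolve_left e
        · exact ht
  unfold Config.ag
  by_cases h1 : c.Agree S S' <;> by_cases h2 : decide (i ∈ S) = decide (i ∈ S') <;>
    simp only [key, h1, h2] <;> simp

theorem Config.ag_move {c c' : Config} {s s' i : ℕ} {l : List ℕ} (hs : c.qubits s = i :: l)
    (hn : c'.next = c.next)
    (hq : c'.qubits = Function.update (Function.update c.qubits s l) s'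
      (i :: Function.update c.qubits s l s')) (S S' : Finset ℕ) :
    c'.ag S S' = c.ag S S' := by
  refine Config.ag_congr ?_
  have : ∀ j, (∀ t, j ∉ c'.qubits t) ↔ ∀ t, j ∉ c.qubits t := by
    intro j
    rw [hq]
    constructor
    · intro h t ht
      by_cases e : t = s
      · subst e
        rw [hs, List.mem_cons] at ht
        rcases ht with rfl | ht
        · have := h s'
          simp at this
        · have := h t
          rw [Function.update_apply] at this
          split_ifs at this with e2
          · subst e2
            simp [ht] at this
          · simp [ht] at this
      · have := h t
        simp only [Function.update_apply, e, if_false] at this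
        split_ifs at this with e2 e3
        · exact e (e2.trans e3)
        · subst e2
          exact this (by simp [ht])
        · exact this ht
    · intro h t
      have hs' := h s
      rw [hs, List.mem_cons, not_or] at hs'
      simp only [Function.update_apply]
      split_ifs with e1 e2
      · simp [hs'.1, hs'.2]
      · simp [hs'.1, h s']
      · exact hs'.2
      · exact h t
  unfold Config.Agree
  rw [hn]
  simp only [this]

/-- One step in the Heisenberg picture: instead of evolving the state, `H` is averaged over the
successors of a dyad. `H` receives the remaining programs as well, because the rest of the run
depends on them. -/
theorem Config.val_exec {c : Config} (hw : c.Wired) (P : Prog) (H : List Prog → Cfg → ℂ) :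
    ((exec c P).map fun c' => c'.val (H c'.todo)).sum
      = c.val fun d => (wexec d P).ex fun t => H (t.1 ++ c.todo) t.2 := by
  cases P with
  | skip => simp [exec, wexec]
  | push r b =>
    simp only [exec, List.map_cons, List.map_nil, List.sum_cons, List.sum_nil, add_zero]
    refine Config.val_congr rfl fun S S' _ _ => ?_
    simp only [wexec, W.ex_pure, List.nil_append]
    rfl
  | pop r =>
    simp only [exec, List.map_cons, List.map_nil, List.sum_cons, List.sum_nil, add_zero]
    refine Config.val_congr rfl fun S S' _ _ => ?_
    simp only [wexec, W.ex_pure, List.nil_append]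
    rfl
  | alloc s =>
    simp only [exec, List.map_cons, List.map_nil, List.sum_cons, List.sum_nil, add_zero]
    rw [hw.val_alloc]
    simp only [wexec, W.ex_pure, List.nil_append]
  | discard s =>
    simp only [exec, List.map_cons, List.map_nil, List.sum_cons, List.sum_nil, add_zero]
    rcases hs : c.qubits s with _ | ⟨i, l⟩
    · have : Function.update c.qubits s ([] : List ℕ).tail = c.qubits := by
        rw [List.tail_nil, ← hs, Function.update_eq_self]
      rw [this]
      refine Config.val_congr' fun S S' => ?_
      simp [wexec, Config.dyad, hs]
    · refine Config.val_congr rfl fun S S' _ _ => ?_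
      rw [List.tail_cons,
        Config.ag_tail (c' := { c with qubits := Function.update c.qubits s l }) hw hs rfl rfl]
      have : wexec (c.dyad S S') (.discard s) = W.single
          (if decide (i ∈ S) = decide (i ∈ S') then 1 else 0) ([], (c.dyad S S').setQ s
            (l.map fun j => (decide (j ∈ S), decide (j ∈ S')))) := by
        simp [wexec, Config.dyad, hs]
      rw [this]
      have e : Config.dyad { c with qubits := Function.update c.qubits s l } S S'
          = (c.dyad S S').setQ s (l.map fun j => (decide (j ∈ S), decide (j ∈ S'))) := by
        ext1
        · rfl
        · funext t
          rw [Cfg.setQ_q]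
          simp only [Config.dyad, Function.update_apply]
          split_ifs <;> rfl
      simp only [W.ex_single, List.nil_append, e]
      ring
  | move s s' =>
    rcases hs : c.qubits s with _ | ⟨i, l⟩
    · simp only [exec, hs, List.map_cons, List.map_nil, List.sum_cons, List.sum_nil, add_zero]
      refine Config.val_congr' fun S S' => ?_
      simp [wexec, Config.dyad, hs]
    · simp only [exec, hs, List.map_cons, List.map_nil, List.sum_cons, List.sum_nil, add_zero]
      refine Config.val_congr rfl fun S S' _ _ => ?_
      let c' : Config := { c with
        qubits := Function.update (Function.update c.qubits s l) s'
          (i :: Function.update c.qubits s l s') }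
      have hag : c'.ag S S' = c.ag S S' :=
        Config.ag_move (c := c) (c' := c') hs rfl rfl S S'
      show c'.ag S S' * (c.state S S' * H c.todo (c'.dyad S S')) = _
      rw [hag]
      congr 2
      simp only [wexec, Config.dyad, hs, List.map_cons, W.ex_pure, List.nil_append, c']
      congr 1
      ext1
      · rfl
      · funext t
        simp only [Cfg.setQ_q, Function.update_apply]
        split_ifs <;> simp_all
  | had s =>
    rcases hs : c.qubits s with _ | ⟨i, l⟩
    · simp only [exec, hs, List.map_cons, List.map_nil, List.sum_cons, List.sum_nil, add_zero]
      refine Config.val_congr' fun S S' => ?_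
      simp [wexec, gateW, Config.dyad, hs]
    · simp only [exec, hs, List.map_cons, List.map_nil, List.sum_cons, List.sum_nil, add_zero]
      rw [hw.val_gate hs hadC _ fun S S' => conjBy_hadVec i c.state S S']
      refine Config.val_congr' fun S S' => ?_
      have hq : (c.dyad S S').q s = (decide (i ∈ S), decide (i ∈ S')) ::
          l.map fun j => (decide (j ∈ S), decide (j ∈ S')) := by simp [Config.dyad, hs]
      simp only [wexec, ex_gateW_cons hq, List.nil_append]
  | tgate s =>
    rcases hs : c.qubits s with _ | ⟨i, l⟩
    · simp only [exec, hs, List.map_cons, List.map_nil, List.sum_cons, List.sum_nil, add_zero]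
      refine Config.val_congr' fun S S' => ?_
      simp [wexec, gateW, Config.dyad, hs]
    · simp only [exec, hs, List.map_cons, List.map_nil, List.sum_cons, List.sum_nil, add_zero]
      rw [hw.val_gate hs tC _ fun S S' => conjBy_tVec i c.state S S']
      refine Config.val_congr' fun S S' => ?_
      have hq : (c.dyad S S').q s = (decide (i ∈ S), decide (i ∈ S')) ::
          l.map fun j => (decide (j ∈ S), decide (j ∈ S')) := by simp [Config.dyad, hs]
      simp only [wexec, ex_gateW_cons hq, List.nil_append]
  | cnot s s' =>
    rcases hs : c.qubits s with _ | ⟨i, l⟩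
    · simp only [exec, hs, List.map_cons, List.map_nil, List.sum_cons, List.sum_nil, add_zero]
      refine Config.val_congr' fun S S' => ?_
      simp [wexec, Config.dyad, hs]
    · rcases hs' : c.qubits s' with _ | ⟨j, l'⟩
      · simp only [exec, hs, hs', List.map_cons, List.map_nil, List.sum_cons, List.sum_nil,
          add_zero]
        refine Config.val_congr' fun S S' => ?_
        simp [wexec, Config.dyad, hs, hs']
      · by_cases hij : i = j
        -- The machine compares qubits, the dyad machine compares stacks; since the stacks are
        -- disjoint, the two tests agree.
        · have : s = s' := hw.disj s s' i (by rw [hs]; simp) (by rw [hs', hij]; simp)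
          subst this
          simp only [exec, hs, List.map_cons, List.map_nil, List.sum_cons, List.sum_nil, add_zero,
            if_true]
          refine Config.val_congr' fun S S' => ?_
          simp [wexec, Config.dyad, hs]
        · simp only [exec, hs, hs', List.map_cons, List.map_nil, List.sum_cons, List.sum_nil,
            add_zero, if_neg hij]
          exact hw.val_cnot hs hs' hij fun t => H (t.1 ++ c.todo) t.2
  | meas s r =>
    rcases hs : c.qubits s with _ | ⟨i, l⟩
    · simp only [exec, hs, List.map_cons, List.map_nil, List.sum_cons, List.sum_nil, add_zero]
      refine Config.val_congr' fun S S' => ?_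
      simp [wexec, Config.dyad, hs]
    · have e : ∀ S S', (wexec (c.dyad S S') (.meas s r)).ex (fun t => H (t.1 ++ c.todo) t.2)
          = (if decide (i ∈ S) = false ∧ decide (i ∈ S') = false then 1 else 0) *
              H c.todo (((c.dyad S S').setB r (false :: c.bits r)).setQ s
                (l.map fun j => (decide (j ∈ S), decide (j ∈ S'))))
            + (if decide (i ∈ S) = true ∧ decide (i ∈ S') = true then 1 else 0) *
              H c.todo (((c.dyad S S').setB r (true :: c.bits r)).setQ s
                (l.map fun j => (decide (j ∈ S), decide (j ∈ S')))) := by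
        intro S S'
        have : wexec (c.dyad S S') (.meas s r) = (List.map (fun b : Bool =>
            ((if decide (i ∈ S) = b ∧ decide (i ∈ S') = b then (1 : ℂ) else 0),
            (([] : List Prog), ((c.dyad S S').setB r (b :: c.bits r)).setQ s
              (l.map fun j => (decide (j ∈ S), decide (j ∈ S')))))) [false, true] :
              W (List Prog × Cfg)) := by
          simp [wexec, Config.dyad, hs]
          rfl
        rw [this]
        simp only [W.ex]
        simp
      have hv : ∀ b : Bool, Config.val { c with
              bits := Function.update c.bits r (b :: c.bits r)
              qubits := Function.update c.qubits s l
              state := conjBy (projVec i b) c.state } (H c.todo)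
          = c.val fun d => (if (d.q s).head? = some (b, b) then 1 else 0) *
              H c.todo ((d.setB r (b :: c.bits r)).setQ s (d.q s).tail) := by
        intro b
        refine Config.val_congr rfl fun S S' _ _ => ?_
        rw [Config.ag_tail (c' := { c with
              bits := Function.update c.bits r (b :: c.bits r)
              qubits := Function.update c.qubits s l
              state := conjBy (projVec i b) c.state }) hw hs rfl rfl]
        have e : Config.dyad { c with
              bits := Function.update c.bits r (b :: c.bits r)
              qubits := Function.update c.qubits s l
              state := conjBy (projVec i b) c.state } S S'
            = ((c.dyad S S').setB r (b :: c.bits r)).setQ s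
              (l.map fun j => (decide (j ∈ S), decide (j ∈ S'))) := by
          ext1
          · rfl
          · funext t
            rw [Cfg.setQ_q]
            simp only [Config.dyad, Function.update_apply]
            split_ifs <;> rfl
        have e2 : (c.dyad S S').q s = (decide (i ∈ S), decide (i ∈ S')) ::
          l.map fun j => (decide (j ∈ S), decide (j ∈ S')) := by simp [Config.dyad, hs]
        rw [e, e2]
        simp only [conjBy_projVec, List.tail_cons, List.head?_cons, Option.some.injEq,
          Prod.mk.injEq]
        by_cases h1 : decide (i ∈ S) = b <;> by_cases h2 : decide (i ∈ S') = b <;>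
          simp [h1, h2]
      simp only [exec, hs, List.map_cons, List.map_nil, List.sum_cons, List.sum_nil, add_zero]
      rw [hv, hv, ← Config.val_add]
      refine Config.val_congr' fun S S' => ?_
      have e2 : (c.dyad S S').q s = (decide (i ∈ S), decide (i ∈ S')) ::
          l.map fun j => (decide (j ∈ S), decide (j ∈ S')) := by simp [Config.dyad, hs]
      rw [e, e2]
      simp only [List.tail_cons, List.head?_cons, Option.some.injEq, Prod.mk.injEq]
  | seq P Q => 
    simp only [exec, List.map_cons, List.map_nil, List.sum_cons, List.sum_nil, add_zero]
    refine Config.val_congr rfl fun S S' _ _ => ?_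
    simp only [wexec, W.ex_pure]
    rfl
  | ite r P Q =>
    rcases hr : c.bits r with _ | ⟨_ | _, l⟩ <;>
      simp only [exec, hr, List.map_cons, List.map_nil, List.sum_cons, List.sum_nil, add_zero] <;>
      refine Config.val_congr rfl fun S S' _ _ => ?_ <;>
      simp only [wexec, Config.dyad, hr, W.ex_pure] <;> rfl
  | whileBits r P =>
    rcases hr : c.bits r with _ | ⟨_, l⟩ <;>
      simp only [exec, hr, List.map_cons, List.map_nil, List.sum_cons, List.sum_nil, add_zero] <;>
      refine Config.val_congr rfl fun S S' _ _ => ?_ <;>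
      simp only [wexec, Config.dyad, hr, W.ex_pure] <;> rfl
  | whileQubits s P =>
    rcases hr : c.qubits s with _ | ⟨_, l⟩ <;>
      simp only [exec, hr, List.map_cons, List.map_nil, List.sum_cons, List.sum_nil, add_zero] <;>
      refine Config.val_congr rfl fun S S' _ _ => ?_ <;>
      simp only [wexec, Config.dyad, hr, List.map_cons, List.map_nil, W.ex_pure] <;> rfl

theorem Config.Wired.tail {c : Config} (hw : c.Wired) {s : ℕ} {l : List ℕ}
    (hl : l.Sublist (c.qubits s)) :
    (∀ t, (Function.update c.qubits s l t).Nodup) ∧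
    (∀ t, ∀ i ∈ Function.update c.qubits s l t, i < c.next) ∧
    ∀ t t' i, i ∈ Function.update c.qubits s l t → i ∈ Function.update c.qubits s l t' → t = t' := by
  have hsub : ∀ t, ∀ i ∈ Function.update c.qubits s l t, i ∈ c.qubits t := by
    intro t i hi
    rw [Function.update_apply] at hi
    split_ifs at hi with e
    · rw [e]; exact hl.subset hi
    · exact hi
  refine ⟨fun t => ?_, fun t i hi => hw.lt t i (hsub t i hi),
    fun t t' i h h' => hw.disj t t' i (hsub t i h) (hsub t' i h')⟩
  rw [Function.update_apply]
  split_ifs with e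
  · exact (hw.nodup s).sublist hl
  · exact hw.nodup t

theorem Config.Wired.gate {c : Config} (hw : c.Wired) {ρ : MemOp}
    (h : ∀ S S', ρ S S' ≠ 0 → S ⊆ Finset.range c.next ∧ S' ⊆ Finset.range c.next) :
    Config.Wired { c with state := ρ } := ⟨hw.nodup, hw.lt, hw.disj, h⟩

theorem Config.Wired.gate1 {c : Config} (hw : c.Wired) {i : ℕ} (hi : i < c.next)
    (k : Bool → Bool → ℂ) (ρ : MemOp)
    (hρ : ∀ S S', ρ S S' = ∑ x : Bool, ∑ x' : Bool, k x (decide (i ∈ S)) *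
      star (k x' (decide (i ∈ S'))) * c.state (setBit i x S) (setBit i x' S')) :
    Config.Wired { c with state := ρ } := by
  refine hw.gate fun S S' h => ?_
  have hsub : ∀ x S, setBit i x S ⊆ Finset.range c.next → S ⊆ Finset.range c.next := by
    intro x S h j hj
    by_cases e : j = i
    · rw [e]; exact Finset.mem_range.2 hi
    · exact h (by simp [mem_setBit, e, hj])
  rw [hρ] at h
  obtain ⟨x, -, hx⟩ := Finset.exists_ne_zero_of_sum_ne_zero h
  obtain ⟨x', -, hx'⟩ := Finset.exists_ne_zero_of_sum_ne_zero hx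
  have := hw.supp _ _ (right_ne_zero_of_mul hx')
  exact ⟨hsub _ _ this.1, hsub _ _ this.2⟩

theorem Config.Wired.exec {c : Config} (hw : c.Wired) (P : Prog) :
    ∀ c' ∈ exec c P, c'.Wired := by
  have same : ∀ K b, Config.Wired { c with todo := K, bits := b } := fun K b =>
    ⟨hw.nodup, hw.lt, hw.disj, hw.supp⟩
  have gate : ∀ (k : Bool → Bool → ℂ) (f : ℕ → MemOp) (s : ℕ)
      (_ : ∀ i S S', f i S S' = ∑ x : Bool, ∑ x' : Bool, k x (decide (i ∈ S)) *
        star (k x' (decide (i ∈ S'))) * c.state (setBit i x S) (setBit i x' S')),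
      ∀ c' ∈ (match c.qubits s with
        | [] => [c]
        | i :: _ => [{ c with state := f i }] : List Config), c'.Wired := by
    intro k f s hf c' hc'
    rcases hs : c.qubits s with _ | ⟨i, l⟩
    · simp only [hs, List.mem_singleton] at hc'
      rwa [hc']
    · simp only [hs, List.mem_singleton] at hc'
      rw [hc']
      exact hw.gate1 (hw.lt s i (by rw [hs]; simp)) k _ (hf i)
  intro c' hc'
  cases P with
  | skip => simp only [QCrypto.exec, List.mem_singleton] at hc'; rwa [hc']
  | push r b => simp only [QCrypto.exec, List.mem_singleton] at hc'; rw [hc']; exact same _ _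
  | pop r => simp only [QCrypto.exec, List.mem_singleton] at hc'; rw [hc']; exact same _ _
  | seq P Q => simp only [QCrypto.exec, List.mem_singleton] at hc'; rw [hc']; exact same _ _
  | ite r P Q =>
    rcases hr : c.bits r with _ | ⟨_ | _, l⟩ <;>
      simp only [QCrypto.exec, hr, List.mem_singleton] at hc' <;> rw [hc'] <;>
      exact ⟨hw.nodup, hw.lt, hw.disj, hw.supp⟩
  | whileBits r P =>
    rcases hr : c.bits r with _ | ⟨_, l⟩ <;>
      simp only [QCrypto.exec, hr, List.mem_singleton] at hc' <;> rw [hc'] <;>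
      exact ⟨hw.nodup, hw.lt, hw.disj, hw.supp⟩
  | whileQubits r P =>
    rcases hr : c.qubits r with _ | ⟨_, l⟩ <;>
      simp only [QCrypto.exec, hr, List.mem_singleton] at hc' <;> rw [hc'] <;>
      exact ⟨hw.nodup, hw.lt, hw.disj, hw.supp⟩
  | had s => exact gate hadC _ s (fun i => conjBy_hadVec i c.state) c' hc'
  | tgate s => exact gate tC _ s (fun i => conjBy_tVec i c.state) c' hc'
  | discard s =>
    simp only [QCrypto.exec, List.mem_singleton] at hc'
    rw [hc']
    have := hw.tail (List.tail_sublist (c.qubits s))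
    exact ⟨this.1, this.2.1, this.2.2, hw.supp⟩
  | alloc s =>
    simp only [QCrypto.exec, List.mem_singleton] at hc'
    rw [hc']
    have hnew : ∀ t, c.next ∉ c.qubits t := fun t h => (hw.lt t _ h).false
    refine ⟨fun t => ?_, fun t i hi => ?_, fun t t' i hi hi' => ?_, fun S S' h => ?_⟩
    · simp only [Function.update_apply]
      split_ifs with e
      · exact List.nodup_cons.2 ⟨hnew s, hw.nodup s⟩
      · exact hw.nodup t
    · simp only [Function.update_apply] at hi
      show i < c.next + 1
      split_ifs at hi with e
      · rcases List.mem_cons.1 hi with rfl | hi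
        · omega
        · have := hw.lt s i hi
          omega
      · have := hw.lt t i hi
        omega
    · simp only [Function.update_apply] at hi hi'
      split_ifs at hi hi' with e e' e'
      · rw [e, e']
      · rcases List.mem_cons.1 hi with rfl | hi
        · exact absurd hi' (hnew _)
        · rw [e]; exact hw.disj _ _ i hi hi'
      · rcases List.mem_cons.1 hi' with rfl | hi'
        · exact absurd hi (hnew _)
        · rw [e']; exact hw.disj _ _ i hi hi'
      · exact hw.disj _ _ i hi hi'
    · have hr : Finset.range c.next ⊆ Finset.range (c.next + 1) := Finset.range_mono (Nat.le_succ _)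
      exact ⟨(hw.supp S S' h).1.trans hr, (hw.supp S S' h).2.trans hr⟩
  | move s s' =>
    rcases hs : c.qubits s with _ | ⟨i, l⟩
    · simp only [QCrypto.exec, hs, List.mem_singleton] at hc'
      rwa [hc']
    · simp only [QCrypto.exec, hs, List.mem_singleton] at hc'
      rw [hc']
      have hnd := hw.nodup s
      rw [hs, List.nodup_cons] at hnd
      have htl := hw.tail (s := s) (l := l) (by rw [hs]; exact List.sublist_cons_self _ _)
      have hi : ∀ t, i ∉ Function.update c.qubits s l t := by
        intro t
        rw [Function.update_apply]
        split_ifs with e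
        · exact hnd.1
        · exact fun h => e (hw.disj t s i h (by rw [hs]; simp))
      refine ⟨fun t => ?_, fun t j hj => ?_, fun t t' j hj hj' => ?_, hw.supp⟩
      · show (Function.update (Function.update c.qubits s l) s' _ t).Nodup
        rw [Function.update_apply]
        split_ifs with e
        · exact List.nodup_cons.2 ⟨hi s', htl.1 s'⟩
        · exact htl.1 t
      · change j ∈ Function.update (Function.update c.qubits s l) s' _ t at hj
        show j < c.next
        rw [Function.update_apply] at hj
        split_ifs at hj with e
        · rcases List.mem_cons.1 hj with rfl | hj
          · exact hw.lt s j (by rw [hs]; simp)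
          · exact htl.2.1 _ j hj
        · exact htl.2.1 _ j hj
      · change j ∈ Function.update (Function.update c.qubits s l) s' _ t at hj
        change j ∈ Function.update (Function.update c.qubits s l) s' _ t' at hj'
        rw [Function.update_apply] at hj hj'
        split_ifs at hj hj' with e e' e'
        · rw [e, e']
        · rcases List.mem_cons.1 hj with rfl | hj
          · exact absurd hj' (hi _)
          · rw [e]; exact htl.2.2 _ _ j hj hj'
        · rcases List.mem_cons.1 hj' with rfl | hj'
          · exact absurd hj (hi _)
          · rw [e']; exact htl.2.2 _ _ j hj hj'
        · exact htl.2.2 _ _ j hj hj'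
  | cnot s s' =>
    rcases hs : c.qubits s with _ | ⟨i, l⟩
    · simp only [QCrypto.exec, hs, List.mem_singleton] at hc'
      rwa [hc']
    · rcases hs' : c.qubits s' with _ | ⟨j, l'⟩
      · simp only [QCrypto.exec, hs, hs', List.mem_singleton] at hc'
        rwa [hc']
      · by_cases hij : i = j
        · simp only [QCrypto.exec, hs, hs', hij, if_true, List.mem_singleton] at hc'
          rwa [hc']
        · simp only [QCrypto.exec, hs, hs', if_neg hij, List.mem_singleton] at hc'
          rw [hc']
          have hj : j < c.next := hw.lt s' j (by rw [hs']; simp)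
          refine hw.gate fun S S' h => ?_
          rw [conjBy_cnotVec] at h
          have hsub : ∀ S, flipIf i j S ⊆ Finset.range c.next → S ⊆ Finset.range c.next := by
            intro S h k hk
            by_cases e : k = j
            · rw [e]; exact Finset.mem_range.2 hj
            · exact h (by simp [mem_flipIf, e, hk])
          exact ⟨hsub _ (hw.supp _ _ h).1, hsub _ (hw.supp _ _ h).2⟩
  | meas s r =>
    rcases hs : c.qubits s with _ | ⟨i, l⟩
    · simp only [QCrypto.exec, hs, List.mem_singleton] at hc'
      rwa [hc']
    · have htl := hw.tail (s := s) (l := l) (by rw [hs]; exact List.sublist_cons_self _ _)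
      have : ∀ b : Bool, Config.Wired { c with
              bits := Function.update c.bits r (b :: c.bits r)
              qubits := Function.update c.qubits s l
              state := conjBy (projVec i b) c.state } := by
        intro b
        refine ⟨htl.1, htl.2.1, htl.2.2, fun S S' h => hw.supp S S' fun h0 => h ?_⟩
        show conjBy (projVec i b) c.state S S' = 0
        rw [conjBy_projVec, h0, ite_self]
      simp only [QCrypto.exec, hs, List.map_cons, List.map_nil, List.mem_cons, List.not_mem_nil,
        or_false] at hc'
      rcases hc' with rfl | rfl <;> exact this _

theorem Config.Wired.step {c : Config} (hw : c.Wired) : ∀ c' ∈ step c, c'.Wired := by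
  rcases hK : c.todo with _ | ⟨P, K⟩
  · simpa [QCrypto.step, hK] using hw
  · simp only [QCrypto.step, hK]
    exact Config.Wired.exec (c := { c with todo := K }) ⟨hw.nodup, hw.lt, hw.disj, hw.supp⟩ P

theorem Config.Wired.run {c : Config} (hw : c.Wired) (n : ℕ) : ∀ c' ∈ run n c, c'.Wired := by
  induction n generalizing c with
  | zero => simpa [QCrypto.run] using hw
  | succ n ih =>
    intro c' hc'
    simp only [QCrypto.run, List.mem_flatMap] at hc'
    obtain ⟨c1, h1, h2⟩ := hc'
    exact ih (hw.step c1 h1) c' h2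

/-- The transfer principle. The inductive step is `Config.val_exec`, where `H` is the average over
the remaining steps. -/
theorem Config.val_run {c : Config} (hw : c.Wired) (n : ℕ) (F : Cfg → ℂ) :
    ((run n c).map fun c' => c'.val F).sum
      = c.val fun d => (wrun n c.todo d).ex fun t => F t.2 := by
  induction n generalizing c with
  | zero => simp [run, wrun]
  | succ n ih =>
    have hsum : ((QCrypto.run (n + 1) c).map fun c' => c'.val F).sum
        = ((QCrypto.step c).map fun c' => ((QCrypto.run n c').map fun c'' => c''.val F).sum).sum := by
      simp only [QCrypto.run]
      induction QCrypto.step c with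
      | nil => rfl
      | cons a L ih => simp [ih]
    have hc : ((QCrypto.step c).map fun c' => ((QCrypto.run n c').map fun c'' => c''.val F).sum)
        = (QCrypto.step c).map fun c' => c'.val fun d => (wrun n c'.todo d).ex fun t => F t.2 :=
      List.map_congr_left fun c' hc' => ih (hw.step c' hc')
    rw [hsum, hc]
    simp only [wrun, W.ex_bind]
    rcases hK : c.todo with _ | ⟨P, K⟩
    · simp [QCrypto.step, wstep, hK]
    · simp only [QCrypto.step, hK, wstep, W.ex_map]
      exact Config.val_exec (c := { c with todo := K }) ⟨hw.nodup, hw.lt, hw.disj, hw.supp⟩ P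
        fun K d => (wrun n K d).ex fun t => F t.2

/-! ### Algorithms as maps of dyads -/

/-- The initial memory of the dyad machine. -/
def dinit (n : ℕ) (x : List Bool) (d : QL) : Cfg where
  bits r := if r = 0 then List.replicate n true else if r = 1 then x else []
  q s := if s = 0 then d else []

/-- The list of pairs that stands for the dyad `|u⟩⟨v|`. -/
def dy {m : ℕ} (u v : Fin m → Bool) : QL := List.ofFn fun i => (u i, v i)

@[simp] theorem length_dy {m : ℕ} (u v : Fin m → Bool) : (dy u v).length = m := by simp [dy]

theorem dy_injective {m : ℕ} {u v u' v' : Fin m → Bool} (h : dy u v = dy u' v') :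
    u = u' ∧ v = v' := by
  have := List.ofFn_injective h
  constructor
  · funext i; exact congrArg Prod.fst (congrFun this i)
  · funext i; exact congrArg Prod.snd (congrFun this i)

theorem exists_dy {m : ℕ} {d : QL} (h : d.length = m) : ∃ u v : Fin m → Bool, d = dy u v := by
  subst h
  refine ⟨fun i => d[i].1, fun i => d[i].2, ?_⟩
  simp [dy]

/-- The linear extension of a function of dyads, applied to `ρ`. -/
def smp {m : ℕ} (ρ : QState m) (G : QL → ℂ) : ℂ := ∑ u, ∑ v, ρ u v * G (dy u v)

open Classical in
/-- The indicator function of the lists of pairs that stand for dyads `|u⟩⟨u|`: the trace. -/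
def dg (d : QL) : ℂ := if ∀ p ∈ d, p.1 = p.2 then 1 else 0

open Classical in
/-- The partial trace of all the quantum stacks except stack `0`. -/
def jk (c : Cfg) : ℂ := if ∀ s, s ≠ 0 → ∀ p ∈ c.q s, p.1 = p.2 then 1 else 0

open Classical in
/-- The trace of all the quantum stacks. -/
def dgc (c : Cfg) : ℂ := if ∀ s, ∀ p ∈ c.q s, p.1 = p.2 then 1 else 0

theorem jk_mul_dg (c : Cfg) : jk c * dg (c.q 0) = dgc c := by
  unfold jk dg dgc
  by_cases h : ∀ s, ∀ p ∈ c.q s, p.1 = p.2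
  · rw [if_pos fun s _ => h s, if_pos (h 0), if_pos h, one_mul]
  · rw [if_neg h]
    by_cases h0 : ∀ p ∈ c.q 0, p.1 = p.2
    · rw [if_neg, zero_mul]
      intro h1
      refine h fun s => ?_
      by_cases hs : s = 0
      · rw [hs]; exact h0
      · exact h1 s hs
    · rw [if_neg h0, mul_zero]

@[simp] theorem dg_nil : dg [] = 1 := by simp [dg]

theorem dg_cons (p : Bool × Bool) (d : QL) : dg (p :: d) = (if p.1 = p.2 then 1 else 0) * dg d := by
  unfold dg
  by_cases h : p.1 = p.2 <;> simp [h]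

theorem dg_append (d e : QL) : dg (d ++ e) = dg d * dg e := by
  induction d with
  | nil => simp
  | cons p d ih => rw [List.cons_append, dg_cons, dg_cons, ih, mul_assoc]

theorem wired_initial (P : Prog) (n : ℕ) (x : List Bool) (N : ℕ) (ρ : QState N) :
    (initial P n x N ρ).Wired := by
  refine ⟨fun s => ?_, fun s i hi => ?_, fun s s' i hi hi' => ?_, fun S S' h => ?_⟩
  · by_cases h : s = 0 <;> simp [initial, h, List.nodup_range]
  · by_cases h : s = 0 <;> simp [initial, h] at hi ⊢
    exact hi
  · by_cases h : s = 0 <;> by_cases h' : s' = 0 <;> simp [initial, h, h'] at hi hi' ⊢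
  · by_contra hn
    exact h (if_neg hn)

theorem val_initial (P : Prog) (n : ℕ) (x : List Bool) (N : ℕ) (ρ : QState N) (F : Cfg → ℂ) :
    (initial P n x N ρ).val F = smp ρ fun d => F (dinit n x d) := by
  have key : ∀ f : Finset ℕ → ℂ, ∑ S ∈ (Finset.range N).powerset, f S
      = ∑ u : Fin N → Bool, f ((Finset.univ.filter fun i => u i = true).map Fin.valEmbedding) := by
    intro f
    refine Finset.sum_bij' (fun S _ => fun i : Fin N => decide ((i : ℕ) ∈ S))
      (fun u _ => (Finset.univ.filter fun i => u i = true).map Fin.valEmbedding)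
      (fun _ _ => Finset.mem_univ _) ?_ ?_ ?_ ?_
    · intro u _
      rw [Finset.mem_powerset]
      intro j hj
      simp only [Finset.mem_map, Fin.valEmbedding_apply] at hj
      obtain ⟨i, -, rfl⟩ := hj
      exact Finset.mem_range.2 i.2
    · intro S hS
      ext j
      simp only [decide_eq_true_eq, Finset.mem_map, Finset.mem_filter, Finset.mem_univ, true_and,
        Fin.valEmbedding_apply]
      constructor
      · rintro ⟨i, hi, rfl⟩; exact hi
      · intro hj
        exact ⟨⟨j, Finset.mem_range.1 (Finset.mem_powerset.1 hS hj)⟩, hj, rfl⟩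
    · intro u _
      funext i
      simp [Fin.ext_iff.symm]
    · intro S hS
      congr 1
      ext j
      simp only [decide_eq_true_eq, Finset.mem_map, Finset.mem_filter, Finset.mem_univ, true_and,
        Fin.valEmbedding_apply]
      constructor
      · intro hj
        exact ⟨⟨j, Finset.mem_range.1 (Finset.mem_powerset.1 hS hj)⟩, hj, rfl⟩
      · rintro ⟨i, hi, rfl⟩; exact hi
  unfold Config.val smp
  show ∑ S ∈ (Finset.range N).powerset, ∑ S' ∈ (Finset.range N).powerset, _ = _
  rw [key]
  refine Finset.sum_congr rfl fun u _ => ?_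
  rw [key]
  refine Finset.sum_congr rfl fun v _ => ?_
  have hsub : ∀ u : Fin N → Bool,
      (Finset.univ.filter fun i => u i = true).map Fin.valEmbedding ⊆ Finset.range N := by
    intro u j hj
    simp only [Finset.mem_map, Fin.valEmbedding_apply] at hj
    obtain ⟨i, -, rfl⟩ := hj
    exact Finset.mem_range.2 i.2
  have hmem : ∀ (u : Fin N → Bool) (i : Fin N),
      (decide ((i : ℕ) ∈ (Finset.univ.filter fun i => u i = true).map Fin.valEmbedding)) = u i := by
    intro u i
    simp [Fin.ext_iff.symm]
  have h1 : Config.ag (initial P n x N ρ)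
      ((Finset.univ.filter fun i => u i = true).map Fin.valEmbedding)
      ((Finset.univ.filter fun i => v i = true).map Fin.valEmbedding) = 1 := by
    unfold Config.ag
    rw [if_pos]
    intro j hj hn
    refine absurd ?_ (hn 0)
    simpa [initial] using hj
  have h2 : (initial P n x N ρ).state
      ((Finset.univ.filter fun i => u i = true).map Fin.valEmbedding)
      ((Finset.univ.filter fun i => v i = true).map Fin.valEmbedding) = ρ u v := by
    simp only [initial, embed]
    rw [if_pos ⟨hsub u, hsub v⟩]
    simp only [hmem]
  have h3 : Config.dyad (initial P n x N ρ)
      ((Finset.univ.filter fun i => u i = true).map Fin.valEmbedding)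
      ((Finset.univ.filter fun i => v i = true).map Fin.valEmbedding) = dinit n x (dy u v) := by
    ext1
    · rfl
    · funext s
      by_cases hs : s = 0
      · subst hs
        simp only [Config.dyad, initial, dinit, if_true, dy]
        rw [List.ofFn_eq_map, ← List.map_coe_finRange_eq_range, List.map_map]
        refine List.map_congr_left fun i _ => ?_
        simp only [Function.comp_apply, hmem]
      · simp [Config.dyad, initial, dinit, hs]
  rw [h1, h2, h3, one_mul]

namespace QPTAlg

variable (A : QPTAlg)

/-- The final memories of the dyad machine. -/
def wfin (n : ℕ) (x : List Bool) (d : QL) : W (List Prog × Cfg) :=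
  wrun (A.time.eval (n + x.length + d.length)) [A.prog] (dinit n x d)

/-- The classical output and the dyad of the quantum output. -/
def den (n : ℕ) (x : List Bool) (d : QL) : W (List Bool × QL) :=
  (A.wfin n x d).bind fun t => W.single (jk t.2) (t.2.bits 1, t.2.q 0)

theorem sim_initial (P : Prog) (n : ℕ) (x : List Bool) (N : ℕ) (ρ : QState N) (d : QL)
    (hd : d.length = N) : Sim (initial P n x N ρ) (dinit n x d) := by
  refine ⟨rfl, fun s => ?_⟩
  by_cases h : s = 0 <;> simp [initial, dinit, h, hd]

theorem wfin_halted {n : ℕ} {x : List Bool} {d : QL} {t : List Prog × Cfg}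
    (ht : W.Mem t (A.wfin n x d)) : t.1 = [] := by
  obtain ⟨c', h1, h2, -⟩ := (sim_run _ (sim_initial A.prog n x _ 0 d rfl)).2 t ht
  rw [← h2]
  exact A.halts n x d.length 0 c' h1

theorem final_of_mem_den {n N : ℕ} {x : List Bool} {d : QL} {a : List Bool × QL}
    (ρ : QState N) (hd : d.length = N) (ha : W.Mem a (A.den n x d)) :
    ∃ c ∈ A.final n x N ρ, c.out = a.1 ∧ (c.qubits 0).length = a.2.length := by
  subst hd
  simp only [den, W.mem_bind, W.mem_single] at ha
  obtain ⟨t, ht, rfl⟩ := ha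
  obtain ⟨c', h1, h2, h3⟩ := (sim_run _ (sim_initial A.prog n x _ ρ d rfl)).2 t ht
  exact ⟨c', h1, by rw [Config.out, h3.1], h3.2 0⟩

theorem den_of_mem_final {n N : ℕ} {x : List Bool} {d : QL}
    {ρ : QState N} (hd : d.length = N) {c : Config} (hc : c ∈ A.final n x N ρ) :
    ∃ a, W.Mem a (A.den n x d) ∧ c.out = a.1 ∧ (c.qubits 0).length = a.2.length := by
  subst hd
  obtain ⟨t, h1, h2, h3⟩ := (sim_run _ (sim_initial A.prog n x _ ρ d rfl)).1 c hc
  refine ⟨_, W.mem_bind.2 ⟨t, h1, W.mem_single.2 rfl⟩, ?_, h3.2 0⟩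
  rw [Config.out, h3.1]

theorem val_final (n : ℕ) (x : List Bool) (N : ℕ) (ρ : QState N) (F : Cfg → ℂ) :
    ((A.final n x N ρ).map fun c => c.val F).sum
      = smp ρ fun d => (A.wfin n x d).ex fun t => F t.2 := by
  unfold final
  rw [Config.val_run (wired_initial _ _ _ _ _), val_initial]
  simp only [smp, wfin, length_dy]
  rfl

end QPTAlg

/-- Only the diagonal survives: `ag` forces agreement on the qubits outside the stacks, and `jk`
together with `dg` forces it on those inside. -/
theorem val_trace (c : Config) (f : List Bool → ℂ) :
    c.val (fun d => jk d * (f (d.bits 1) * dg (d.q 0)))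
      = (∑ S ∈ (Finset.range c.next).powerset, c.state S S) * f c.out := by
  have h : ∀ S ∈ (Finset.range c.next).powerset, ∀ S' ∈ (Finset.range c.next).powerset,
      c.ag S S' * (c.state S S' * (jk (c.dyad S S') * (f ((c.dyad S S').bits 1) *
        dg ((c.dyad S S').q 0)))) = if S = S' then c.state S S' * f c.out else 0 := by
    intro S hS S' hS'
    have e : jk (c.dyad S S') * (f ((c.dyad S S').bits 1) * dg ((c.dyad S S').q 0))
        = dgc (c.dyad S S') * f c.out := by
      rw [← jk_mul_dg]
      show _ * (f c.out * _) = _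
      ring
    rw [e]
    by_cases hSS : S = S'
    · subst hSS
      have h1 : c.ag S S = 1 := by
        unfold Config.ag
        exact if_pos fun _ _ _ => Iff.rfl
      have h2 : dgc (c.dyad S S) = 1 := by
        unfold dgc
        rw [if_pos]
        intro s p hp
        simp only [Config.dyad, List.mem_map] at hp
        obtain ⟨j, -, rfl⟩ := hp
        rfl
      rw [h1, h2, if_pos rfl]
      ring
    · rw [if_neg hSS]
      by_cases ha : c.Agree S S'
      · have : dgc (c.dyad S S') = 0 := by
          unfold dgc
          rw [if_neg]
          intro hall
          apply hSS
          ext j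
          by_cases hj : j < c.next
          · by_cases hl : ∀ s, j ∉ c.qubits s
            · exact ha j hj hl
            · push Not at hl
              obtain ⟨s, hs⟩ := hl
              have := hall s (decide (j ∈ S), decide (j ∈ S')) (List.mem_map.2 ⟨j, hs, rfl⟩)
              simpa using this
          · have h1 : j ∉ S := fun h => hj (Finset.mem_range.1 (Finset.mem_powerset.1 hS h))
            have h2 : j ∉ S' := fun h => hj (Finset.mem_range.1 (Finset.mem_powerset.1 hS' h))
            simp [h1, h2]
        rw [this]
        ring
      · have : c.ag S S' = 0 := by
          unfold Config.ag
          exact if_neg ha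
        rw [this, zero_mul]
  unfold Config.val
  rw [Finset.sum_mul]
  refine Finset.sum_congr rfl fun S hS => ?_
  rw [Finset.sum_congr rfl fun S' hS' => h S hS S' hS', Finset.sum_ite_eq]
  simp only [hS, if_true]

/-- On the stack `0` the dyad is prescribed; on all the other qubits `ag` and `jk` force agreement.
Summing over the common value `E` of the latter is the partial trace. -/
theorem val_out {c : Config} (hw : c.Wired) {m : ℕ} (u v : Fin m → Bool) :
    c.val (fun d => jk d * if d.q 0 = dy u v then 1 else 0) = c.outQubits m u v := by
  by_cases hm : (c.qubits 0).length = m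
  swap
  · unfold Config.val Config.outQubits
    rw [if_neg hm]
    refine Finset.sum_eq_zero fun S _ => Finset.sum_eq_zero fun S' _ => ?_
    have : (c.dyad S S').q 0 ≠ dy u v := by
      intro h
      have := congrArg List.length h
      simp only [Config.dyad, List.length_map, length_dy] at this
      exact hm this
    simp only [if_neg this, mul_zero]
  obtain ⟨g, hg⟩ : ∃ g : Fin m → ℕ, c.qubits 0 = List.ofFn g := by
    subst hm
    exact ⟨fun i => (c.qubits 0)[i], by simp⟩
  have hginj : Function.Injective g := by
    have := hw.nodup 0
    rw [hg] at this
    exact List.nodup_ofFn.1 this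
  have hmem : ∀ j, j ∈ c.qubits 0 ↔ ∃ i, g i = j := by
    intro j
    rw [hg, List.mem_ofFn]
  have hbs : ∀ (w : Fin m → Bool) j, j ∈ basisSet (c.qubits 0) w ↔ ∃ i, w i = true ∧ g i = j := by
    intro w j
    simp [basisSet, hg]
  have hcond : ∀ S S', (c.dyad S S').q 0 = dy u v ↔
      (∀ i, (g i ∈ S ↔ u i = true)) ∧ ∀ i, (g i ∈ S' ↔ v i = true) := by
    intro S S'
    have : (c.dyad S S').q 0 = List.ofFn fun i => (decide (g i ∈ S), decide (g i ∈ S')) := by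
      simp only [Config.dyad, hg, List.map_ofFn]
      rfl
    rw [this, dy]
    constructor
    · intro h
      have := List.ofFn_injective h
      constructor
      · intro i
        have := congrArg Prod.fst (congrFun this i)
        simp only at this
        rw [← this, decide_eq_true_eq]
      · intro i
        have := congrArg Prod.snd (congrFun this i)
        simp only at this
        rw [← this, decide_eq_true_eq]
    · rintro ⟨h1, h2⟩
      congr 1
      funext i
      refine Prod.ext ?_ ?_
      · by_cases h : g i ∈ S
        · simp [h, (h1 i).1 h]
        · have := Bool.eq_false_iff.2 fun e => h ((h1 i).2 e)
          simp [h, this]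
      · by_cases h : g i ∈ S'
        · simp [h, (h2 i).1 h]
        · have := Bool.eq_false_iff.2 fun e => h ((h2 i).2 e)
          simp [h, this]
  -- off stack `0`, the two sets agree
  have hoff : ∀ S S', S ⊆ Finset.range c.next → S' ⊆ Finset.range c.next →
      c.ag S S' * jk (c.dyad S S')
        = if S \ (c.qubits 0).toFinset = S' \ (c.qubits 0).toFinset then 1 else 0 := by
    intro S S' hS hS'
    have : (c.Agree S S' ∧ ∀ s, s ≠ 0 → ∀ p ∈ (c.dyad S S').q s, p.1 = p.2) ↔
        S \ (c.qubits 0).toFinset = S' \ (c.qubits 0).toFinset := by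
      constructor
      · rintro ⟨h1, h2⟩
        ext j
        simp only [Finset.mem_sdiff, List.mem_toFinset]
        by_cases h0 : j ∈ c.qubits 0
        · simp [h0]
        · simp only [h0, not_false_eq_true, and_true]
          by_cases hj : j < c.next
          · by_cases hl : ∀ s, j ∉ c.qubits s
            · exact h1 j hj hl
            · push Not at hl
              obtain ⟨s, hs⟩ := hl
              have hs0 : s ≠ 0 := fun e => h0 (e ▸ hs)
              have := h2 s hs0 (decide (j ∈ S), decide (j ∈ S')) (List.mem_map.2 ⟨j, hs, rfl⟩)
              simpa using this
          · have h1 : j ∉ S := fun h => hj (Finset.mem_range.1 (hS h))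
            have h2 : j ∉ S' := fun h => hj (Finset.mem_range.1 (hS' h))
            simp [h1, h2]
      · intro h
        have h' : ∀ j, j ∉ c.qubits 0 → (j ∈ S ↔ j ∈ S') := by
          intro j hj
          have := Finset.ext_iff.1 h j
          simpa [hj] using this
        refine ⟨fun j _ hj => h' j (hj 0), fun s hs p hp => ?_⟩
        simp only [Config.dyad, List.mem_map] at hp
        obtain ⟨j, hj, rfl⟩ := hp
        simp only [h' j fun h0 => hs (hw.disj s 0 j hj h0)]
    unfold Config.ag jk
    by_cases h1 : c.Agree S S' <;>
      by_cases h2 : ∀ s, s ≠ 0 → ∀ p ∈ (c.dyad S S').q s, p.1 = p.2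
    · rw [if_pos h1, if_pos h2, if_pos (this.1 ⟨h1, h2⟩), one_mul]
    · rw [if_neg h2, mul_zero, if_neg fun h => h2 (this.2 h).2]
    · rw [if_neg h1, zero_mul, if_neg fun h => h1 (this.2 h).1]
    · rw [if_neg h1, zero_mul, if_neg fun h => h1 (this.2 h).1]
  unfold Config.val Config.outQubits
  rw [if_pos hm, ← Finset.sum_product']
  symm
  -- The pairs `(S, S')` with a nonzero indicator are exactly those that arise from some `E`.
  refine Finset.sum_of_injOn (fun E => (basisSet (c.qubits 0) u ∪ E, basisSet (c.qubits 0) v ∪ E))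
    ?_ ?_ ?_ ?_
  · intro E hE E' hE' h
    have h1 := Finset.ext_iff.1 (congrArg Prod.fst h)
    simp only [Finset.coe_powerset, Set.mem_preimage, Set.mem_powerset_iff, Finset.coe_subset]
      at hE hE'
    have hd : ∀ E ⊆ Finset.range c.next \ (c.qubits 0).toFinset, ∀ j ∈ E,
        j ∉ basisSet (c.qubits 0) u := by
      intro E hE j hj hb
      have := hE hj
      simp only [Finset.mem_sdiff, List.mem_toFinset] at this
      obtain ⟨i, -, hi⟩ := (hbs u j).1 hb
      exact this.2 ((hmem j).2 ⟨i, hi⟩)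
    ext j
    have := h1 j
    simp only [Finset.mem_union] at this
    constructor
    · intro hj
      exact (this.1 (Or.inr hj)).resolve_left (hd E hE j hj)
    · intro hj
      exact (this.2 (Or.inr hj)).resolve_left (hd E' hE' j hj)
  · intro E hE
    simp only [Finset.coe_powerset, Set.mem_preimage, Set.mem_powerset_iff, Finset.coe_subset]
      at hE
    have hb : ∀ w : Fin m → Bool, basisSet (c.qubits 0) w ⊆ Finset.range c.next := by
      intro w j hj
      obtain ⟨i, -, hi⟩ := (hbs w j).1 hj
      exact Finset.mem_range.2 (hw.lt 0 j ((hmem j).2 ⟨i, hi⟩))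
    have hE' : E ⊆ Finset.range c.next := hE.trans Finset.sdiff_subset
    simp only [Finset.coe_product, Set.mem_prod, Finset.mem_coe, Finset.mem_powerset]
    exact ⟨Finset.union_subset (hb u) hE', Finset.union_subset (hb v) hE'⟩
  · rintro ⟨S, S'⟩ hSS hn
    simp only [Finset.mem_product, Finset.mem_powerset] at hSS
    show c.ag S S' * (c.state S S' * (jk (c.dyad S S') * _)) = 0
    by_cases hc : (c.dyad S S').q 0 = dy u v
    · by_cases ho : S \ (c.qubits 0).toFinset = S' \ (c.qubits 0).toFinset
      · exfalso
        apply hn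
        rw [hcond] at hc
        have hrec : ∀ (w : Fin m → Bool) (T : Finset ℕ), (∀ i, g i ∈ T ↔ w i = true) →
            basisSet (c.qubits 0) w ∪ T \ (c.qubits 0).toFinset = T := by
          intro w T hT
          ext j
          simp only [Finset.mem_union, hbs, Finset.mem_sdiff, List.mem_toFinset, hmem]
          constructor
          · rintro (⟨i, hi, rfl⟩ | h)
            · exact (hT i).2 hi
            · exact h.1
          · intro hj
            by_cases h : ∃ i, g i = j
            · obtain ⟨i, rfl⟩ := h
              exact Or.inl ⟨i, (hT i).1 hj, rfl⟩
            · exact Or.inr ⟨hj, h⟩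
        refine ⟨S \ (c.qubits 0).toFinset, ?_, ?_⟩
        · simp only [Finset.coe_powerset, Set.mem_preimage, Set.mem_powerset_iff,
            Finset.coe_subset]
          exact Finset.sdiff_subset_sdiff hSS.1 (Finset.Subset.refl _)
        · simp only [Prod.mk.injEq]
          refine ⟨hrec u S hc.1, ?_⟩
          rw [ho]
          exact hrec v S' hc.2
      · have := hoff S S' hSS.1 hSS.2
        rw [if_neg ho] at this
        linear_combination (c.state S S' * (if (c.dyad S S').q 0 = dy u v then 1 else 0)) * this
    · rw [if_neg hc, mul_zero, mul_zero, mul_zero]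
  · intro E hE
    rw [Finset.mem_powerset] at hE
    set S := basisSet (c.qubits 0) u ∪ E with hS
    set S' := basisSet (c.qubits 0) v ∪ E with hS'
    have hb : ∀ w : Fin m → Bool, basisSet (c.qubits 0) w ⊆ Finset.range c.next := by
      intro w j hj
      obtain ⟨i, -, hi⟩ := (hbs w j).1 hj
      exact Finset.mem_range.2 (hw.lt 0 j ((hmem j).2 ⟨i, hi⟩))
    have hE' : E ⊆ Finset.range c.next := hE.trans Finset.sdiff_subset
    have hEn : ∀ j ∈ E, j ∉ c.qubits 0 := by
      intro j hj
      have := hE hj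
      simp only [Finset.mem_sdiff, List.mem_toFinset] at this
      exact this.2
    have hEo : ∀ w : Fin m → Bool, (basisSet (c.qubits 0) w ∪ E) \ (c.qubits 0).toFinset = E := by
      intro w
      ext j
      simp only [Finset.mem_sdiff, Finset.mem_union, hbs, List.mem_toFinset]
      constructor
      · rintro ⟨⟨i, -, hi⟩ | h, h2⟩
        · exact absurd ((hmem j).2 ⟨i, hi⟩) h2
        · exact h
      · intro h
        exact ⟨Or.inr h, hEn j h⟩
    have hEg : ∀ (w : Fin m → Bool) i, g i ∈ basisSet (c.qubits 0) w ∪ E ↔ w i = true := by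
      intro w i
      simp only [Finset.mem_union, hbs]
      constructor
      · rintro (⟨k, hk, hi⟩ | h)
        · rwa [← hginj hi]
        · exact absurd ((hmem _).2 ⟨i, rfl⟩) (hEn _ h)
      · intro h
        exact Or.inl ⟨i, h, rfl⟩
    have h1 := hoff S S' (Finset.union_subset (hb u) hE') (Finset.union_subset (hb v) hE')
    rw [hS, hS', hEo, hEo, if_pos rfl, ← hS, ← hS'] at h1
    have h2 : (c.dyad S S').q 0 = dy u v := (hcond S S').2 ⟨hEg u, hEg v⟩
    show c.state S S' = c.ag S S' * (c.state S S' * (jk (c.dyad S S') * _))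
    rw [if_pos h2]
    linear_combination (-c.state S S') * h1

/-! ### Traces and positivity -/

theorem dgc_setQ_cons {c : Cfg} {s : ℕ} {p p' : Bool × Bool} {l : QL} (h : c.q s = p :: l) :
    dgc (c.setQ s (p' :: l)) = (if p'.1 = p'.2 then 1 else 0) * dgc (c.setQ s l) ∧
    dgc c = (if p.1 = p.2 then 1 else 0) * dgc (c.setQ s l) := by
  have key : ∀ (c' : Cfg) (p' : Bool × Bool), c'.q = Function.update c.q s (p' :: l) →
      dgc c' = (if p'.1 = p'.2 then 1 else 0) * dgc (c.setQ s l) := by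
    intro c' p' hc'
    have e : (∀ t, ∀ r ∈ c'.q t, r.1 = r.2) ↔
        p'.1 = p'.2 ∧ ∀ t, ∀ r ∈ (c.setQ s l).q t, r.1 = r.2 := by
      rw [hc']
      constructor
      · intro h
        refine ⟨h s p' (by simp), fun t r hr => ?_⟩
        rw [Cfg.setQ_q] at hr
        split_ifs at hr with e
        · exact h s r (by simp [hr])
        · exact h t r (by simpa [Function.update_apply, e] using hr)
      · rintro ⟨h1, h2⟩ t r hr
        rw [Function.update_apply] at hr
        split_ifs at hr with e
        · rcases List.mem_cons.1 hr with rfl | hr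
          · exact h1
          · exact h2 s r (by simpa [Cfg.setQ_q] using hr)
        · exact h2 t r (by simpa [Cfg.setQ_q, e] using hr)
    unfold dgc
    by_cases h1 : p'.1 = p'.2 <;> by_cases h2 : ∀ t, ∀ r ∈ (c.setQ s l).q t, r.1 = r.2
    · rw [if_pos (e.2 ⟨h1, h2⟩), if_pos h1, if_pos h2, one_mul]
    · rw [if_neg fun h => h2 (e.1 h).2, if_neg h2, mul_zero]
    · rw [if_neg fun h => h1 (e.1 h).1, if_neg h1, zero_mul]
    · rw [if_neg fun h => h1 (e.1 h).1, if_neg h1, zero_mul]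
  exact ⟨key _ p' rfl, key c p (by rw [← h, Function.update_eq_self])⟩

theorem dgc_congr {c c' : Cfg} (h : ∀ s, c.q s = c'.q s) : dgc c = dgc c' := by
  unfold dgc
  rw [funext h]

/-- The hypothesis says that the rows of the gate are orthonormal; conjugation by it preserves the
trace of the top qubit. -/
theorem dgc_gate (k : Bool → Bool → ℂ)
    (hk : ∀ x x', ∑ y : Bool, k x y * star (k x' y) = if x = x' then 1 else 0) (c : Cfg) (s : ℕ) :
    (gateW k c s).ex (fun t => dgc t.2) = dgc c := by
  rcases hs : c.q s with _ | ⟨p, l⟩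
  · simp [gateW, hs]
  · rw [ex_gateW_cons hs, (dgc_setQ_cons hs (p' := p)).2, ← hk]
    simp only [(dgc_setQ_cons hs).1, Fintype.sum_bool]
    simp only [Bool.true_eq_false, Bool.false_eq_true, if_true, if_false]
    ring

theorem sum_hadC (x x' : Bool) :
    ∑ y : Bool, hadC x y * star (hadC x' y) = if x = x' then 1 else 0 := by
  have hs : (starRingEnd ℂ) (Real.sqrt 2 : ℂ) = (Real.sqrt 2 : ℂ) := Complex.conj_ofReal _
  have h2 : (Real.sqrt 2 : ℂ) * (Real.sqrt 2 : ℂ) = 2 := by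
    rw [← Complex.ofReal_mul, Real.mul_self_sqrt (by norm_num)]
    norm_num
  have h0 : (Real.sqrt 2 : ℂ) ≠ 0 := by
    intro h
    rw [h] at h2
    norm_num at h2
  have h3 : (Real.sqrt 2 : ℂ)⁻¹ * (Real.sqrt 2 : ℂ)⁻¹ = 1 / 2 := by
    rw [← mul_inv, h2]
    norm_num
  cases x <;> cases x' <;> simp [hadC, hs, div_eq_mul_inv, h3] <;> norm_num

theorem sum_tC (x x' : Bool) :
    ∑ y : Bool, tC x y * star (tC x' y) = if x = x' then 1 else 0 := by
  have : Complex.exp (Complex.I * Real.pi / 4) *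
      (starRingEnd ℂ) (Complex.exp (Complex.I * Real.pi / 4)) = 1 := by
    rw [← Complex.exp_conj, ← Complex.exp_add]
    have : Complex.I * Real.pi / 4 + (starRingEnd ℂ) (Complex.I * Real.pi / 4) = 0 := by
      rw [map_div₀, map_mul, Complex.conj_I, Complex.conj_ofReal, map_ofNat (starRingEnd ℂ) 4]
      ring
    rw [this, Complex.exp_zero]
  cases x <;> cases x' <;> simp [tC, this]

theorem dgc_wexec (c : Cfg) (P : Prog) : (wexec c P).ex (fun t => dgc t.2) = dgc c := by
  cases P with
  | skip => simp [wexec]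
  | push r b => simp only [wexec, W.ex_pure]; exact dgc_congr fun _ => rfl
  | pop r => simp only [wexec, W.ex_pure]; exact dgc_congr fun _ => rfl
  | alloc s =>
    simp only [wexec, W.ex_pure]
    have h := (dgc_setQ_cons (c := c.setQ s ((false, false) :: c.q s)) (s := s)
      (p := (false, false)) (p' := (false, false)) (l := c.q s) (by simp [Cfg.setQ_q])).2
    rw [h, if_pos rfl, one_mul]
    refine dgc_congr fun t => ?_
    simp only [Cfg.setQ_q]
    split_ifs with e
    · rw [e]
    · rfl
  | discard s =>
    rcases hs : c.q s with _ | ⟨p, l⟩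
    · simp [wexec, hs]
    · simp only [wexec, hs, W.ex_single]
      rw [(dgc_setQ_cons hs (p' := p)).2]
  | move s s' =>
    rcases hs : c.q s with _ | ⟨p, l⟩
    · simp [wexec, hs]
    · simp only [wexec, hs, W.ex_pure]
      rw [(dgc_setQ_cons hs (p' := p)).2]
      have h := (dgc_setQ_cons (c := (c.setQ s l).setQ s' (p :: (c.setQ s l).q s')) (s := s')
        (p := p) (p' := p) (l := (c.setQ s l).q s') (by simp [Cfg.setQ_q])).2
      rw [h]
      congr 1
      refine dgc_congr fun t => ?_
      simp only [Cfg.setQ_q]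
      by_cases e1 : t = s' <;> by_cases e2 : t = s <;> simp_all
  | had s => exact dgc_gate hadC sum_hadC c s
  | tgate s => exact dgc_gate tC sum_tC c s
  | cnot s s' =>
    rcases hs : c.q s with _ | ⟨p, l⟩
    · simp [wexec, hs]
    · rcases hs' : c.q s' with _ | ⟨r, l'⟩
      · simp [wexec, hs, hs']
      · by_cases e : s = s'
        · subst e
          simp [wexec, hs]
        · simp only [wexec, hs, hs', if_neg e, W.ex_pure]
          have h1 := (dgc_setQ_cons hs' (p' := (xor r.1 p.1, xor r.2 p.2)))
          rw [h1.1, h1.2]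
          have hs2 : (c.setQ s' l').q s = p :: l := by rw [Cfg.setQ_q, if_neg e, hs]
          rw [(dgc_setQ_cons hs2 (p' := p)).2]
          obtain ⟨p1, p2⟩ := p
          obtain ⟨r1, r2⟩ := r
          cases p1 <;> cases p2 <;> simp
  | meas s r =>
    rcases hs : c.q s with _ | ⟨p, l⟩
    · simp [wexec, hs]
    · have : wexec c (.meas s r) = (List.map (fun b : Bool =>
          ((if p.1 = b ∧ p.2 = b then (1 : ℂ) else 0),
            (([] : List Prog), (c.setB r (b :: c.bits r)).setQ s l))) [false, true] :
              W (List Prog × Cfg)) := by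
        simp [wexec, hs]
        rfl
      rw [this, (dgc_setQ_cons hs (p' := p)).2]
      have e : ∀ b, dgc ((c.setB r (b :: c.bits r)).setQ s l) = dgc (c.setQ s l) :=
        fun b => dgc_congr fun _ => rfl
      simp only [W.ex]
      simp [e]
      obtain ⟨p1, p2⟩ := p
      cases p1 <;> cases p2 <;> simp
  | seq P Q => simp [wexec]
  | ite r P Q => rcases hr : c.bits r with _ | ⟨_ | _, l⟩ <;> simp [wexec, hr]
  | whileBits r P => rcases hr : c.bits r with _ | ⟨_, l⟩ <;> simp [wexec, hr]
  | whileQubits s P => rcases hr : c.q s with _ | ⟨_, l⟩ <;> simp [wexec, hr]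

theorem dgc_wrun (n : ℕ) (K : List Prog) (c : Cfg) : (wrun n K c).ex (fun t => dgc t.2) = dgc c := by
  induction n generalizing K c with
  | zero => simp [wrun]
  | succ n ih =>
    simp only [wrun, W.ex_bind, ih]
    cases K with
    | nil => simp [wstep]
    | cons P K => simp [wstep, dgc_wexec]

theorem dgc_dinit (n : ℕ) (x : List Bool) (d : QL) : dgc (dinit n x d) = dg d := by
  rw [← jk_mul_dg]
  have : jk (dinit n x d) = 1 := by
    unfold jk
    rw [if_pos]
    intro s hs p hp
    simp [dinit, hs] at hp
  rw [this, one_mul]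
  rfl

/-- Trace preservation, already at the level of a single dyad. All statements that total
probabilities are `1` come from here. -/
theorem QPTAlg.den_trace (A : QPTAlg) (n : ℕ) (x : List Bool) (d : QL) :
    (A.den n x d).ex (fun a => dg a.2) = dg d := by
  simp only [QPTAlg.den, W.ex_bind, W.ex_single, jk_mul_dg, QPTAlg.wfin, dgc_wrun, dgc_dinit]

theorem Gram.embed {N : ℕ} {ρ : QState N} (h : Gram ρ) : Gram (embed N ρ) :=
  (h.comp fun (S : Finset ℕ) (i : Fin N) => decide ((i : ℕ) ∈ S)).cut fun S => S ⊆ Finset.range N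

theorem Gram.weight {c : Config} (h : Gram c.state) :
    ∑ S ∈ (Finset.range c.next).powerset, c.state S S = (c.weight : ℂ) := by
  unfold Config.weight
  rw [Complex.re_sum, Complex.ofReal_sum]
  exact Finset.sum_congr rfl fun S _ => h.diag_im S

theorem Gram.weight_nonneg {c : Config} (h : Gram c.state) : 0 ≤ c.weight := by
  unfold Config.weight
  rw [Complex.re_sum]
  exact Finset.sum_nonneg fun S _ => h.diag_nonneg S

theorem Gram.final {A : QPTAlg} {n : ℕ} {x : List Bool} {N : ℕ} {ρ : QState N} (h : Gram ρ) :
    ∀ c ∈ A.final n x N ρ, Gram c.state :=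
  gram_run _ (c := initial A.prog n x N ρ) h.embed

theorem Gram.outState {A : QPTAlg} {n : ℕ} {x : List Bool} {N : ℕ} {ρ : QState N} (h : Gram ρ)
    (m : ℕ) : Gram (A.outState n x N ρ m) := by
  unfold QPTAlg.outState
  refine Gram.list_sum _ fun σ hσ => ?_
  obtain ⟨c, hc, rfl⟩ := List.mem_map.1 hσ
  by_cases hm : (c.qubits 0).length = m
  · have : c.outQubits m = ∑ E ∈ (Finset.range c.next \ (c.qubits 0).toFinset).powerset,
        (fun u v => c.state (basisSet (c.qubits 0) u ∪ E) (basisSet (c.qubits 0) v ∪ E) :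
          QState m) := by
      ext u v
      rw [Config.outQubits, if_pos hm]
      exact (Matrix.sum_apply (α := ℂ) u v _ fun E => (fun u v =>
        c.state (basisSet (c.qubits 0) u ∪ E) (basisSet (c.qubits 0) v ∪ E) : QState m)).symm
    rw [this]
    exact Gram.sum _ fun E _ => (h.final c hc).comp fun u => basisSet (c.qubits 0) u ∪ E
  · have : c.outQubits m = 0 := by
      ext u v
      rw [Config.outQubits, if_neg hm]
      rfl
    rw [this]
    exact Gram.zero

theorem Gram.noQubits : Gram noQubits := ⟨1, fun _ _ => 1, by simp [QCrypto.noQubits]⟩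

/-- Expanding the product of the Gram sums gives one product vector for every choice of a summand in
each factor. -/
theorem Gram.tensorPow {m : ℕ} {ρ : QState m} (h : Gram ρ) (t : ℕ) : Gram (tensorPow t ρ) := by
  obtain ⟨n, ψ, h⟩ := h
  refine Gram.of_fintype (ι := Fin t → Fin n)
    (fun a u => ∏ j, ψ (a j) fun i => u (finProdFinEquiv (j, i))) fun u v => ?_
  simp only [QCrypto.tensorPow, h, star_prod, ← Finset.prod_mul_distrib]
  rw [Finset.prod_univ_sum, Fintype.piFinset_univ]

namespace QPTAlg

variable (A : QPTAlg)

/-- The weight of a path is defined as the real part of a trace. Positivity makes the trace real, so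
that nothing is lost and the complex calculus applies. -/
theorem expect_eq {n : ℕ} {x : List Bool} {N : ℕ} {ρ : QState N} (h : Gram ρ)
    (f : List Bool → ℝ) :
    (A.expect n x N ρ f : ℂ)
      = smp ρ fun d => (A.den n x d).ex fun a => (f a.1 : ℂ) * dg a.2 := by
  have e := A.val_final n x N ρ fun d => jk d * ((f (d.bits 1) : ℂ) * dg (d.q 0))
  simp only [den, W.ex_bind, W.ex_single]
  rw [← e]
  unfold expect
  have hsum : ∀ L : List ℝ, ((L.sum : ℝ) : ℂ) = (L.map fun r : ℝ => (r : ℂ)).sum := by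
    intro L
    induction L with
    | nil => simp
    | cons r L ih => simp [ih]
  rw [hsum, List.map_map]
  congr 1
  refine List.map_congr_left fun c hc => ?_
  rw [val_trace c fun y => (f y : ℂ), (h.final c hc).weight]
  simp

theorem expect_nonneg {n : ℕ} {x : List Bool} {N : ℕ} {ρ : QState N} (h : Gram ρ)
    {f : List Bool → ℝ} (hf : ∀ y, 0 ≤ f y) : 0 ≤ A.expect n x N ρ f := by
  unfold expect
  refine List.sum_nonneg fun a ha => ?_
  obtain ⟨c, hc, rfl⟩ := List.mem_map.1 ha
  exact mul_nonneg (h.final c hc).weight_nonneg (hf _)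

/-- Feeding the output state into a further linear functional composes the two dyad maps. The length
hypothesis matters, because `outQubits` is zero when the number of output qubits is wrong. -/
theorem smp_outState {n : ℕ} {x : List Bool} {N : ℕ} {ρ : QState N} {m : ℕ}
    (h : ∀ c ∈ A.final n x N ρ, (c.qubits 0).length = m) (G : QL → ℂ) :
    smp (A.outState n x N ρ m) G = smp ρ fun d => (A.den n x d).ex fun a => G a.2 := by
  have h1 : ∀ u v : Fin m → Bool, A.outState n x N ρ m u v
      = smp ρ fun d => (A.den n x d).ex fun a => if a.2 = dy u v then 1 else 0 := by
    intro u v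
    have e := A.val_final n x N ρ fun d => jk d * if d.q 0 = dy u v then 1 else 0
    simp only [den, W.ex_bind, W.ex_single]
    rw [← e]
    unfold outState
    have : ∀ L : List (QState m), L.sum u v = (L.map fun σ => σ u v).sum := by
      intro L
      induction L with
      | nil => rfl
      | cons σ L ih => rw [List.sum_cons, List.map_cons, List.sum_cons, ← ih]; rfl
    rw [this, List.map_map]
    congr 1
    refine List.map_congr_left fun c hc => ?_
    exact (val_out (Config.Wired.run (wired_initial _ _ _ _ _) _ c hc) u v).symm
  have hG : ∀ a : QL, a.length = m →
      ∑ u : Fin m → Bool, ∑ v : Fin m → Bool, (if a = dy u v then (1 : ℂ) else 0) * G (dy u v)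
        = G a := by
    intro a ha
    obtain ⟨u, v, rfl⟩ := exists_dy ha
    rw [Finset.sum_eq_single u, Finset.sum_eq_single v]
    · simp
    · intro v' _ hv
      rw [if_neg fun h => hv (dy_injective h).2.symm, zero_mul]
    · simp
    · intro u' _ hu
      refine Finset.sum_eq_zero fun v' _ => ?_
      rw [if_neg fun h => hu (dy_injective h).1.symm, zero_mul]
    · simp
  have h2 : ∀ d : QL, d.length = N → (A.den n x d).ex (fun a => G a.2) =
      ∑ u : Fin m → Bool, ∑ v : Fin m → Bool,
        ((A.den n x d).ex fun a => if a.2 = dy u v then 1 else 0) * G (dy u v) := by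
    intro d hd
    simp only [← W.ex_mul_right, ← W.ex_sum]
    refine W.ex_congr fun a ha => (hG a.2 ?_).symm
    obtain ⟨c, hc, -, h3⟩ := A.final_of_mem_den ρ hd ha
    rw [← h3, h c hc]
  have h3 : smp ρ (fun d => (A.den n x d).ex fun a => G a.2)
      = ∑ u : Fin m → Bool, ∑ v : Fin m → Bool, smp ρ (fun d =>
        ((A.den n x d).ex fun a => if a.2 = dy u v then 1 else 0)) * G (dy u v) := by
    unfold smp
    simp only [h2 _ (length_dy _ _), Finset.mul_sum, Finset.sum_mul]
    have hc : ∀ f : (Fin N → Bool) → (Fin N → Bool) → (Fin m → Bool) → (Fin m → Bool) → ℂ,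
        ∑ a, ∑ b, ∑ u, ∑ v, f a b u v = ∑ u, ∑ v, ∑ a, ∑ b, f a b u v := by
      intro f
      rw [Finset.sum_congr rfl fun a _ => Finset.sum_comm, Finset.sum_comm]
      refine Finset.sum_congr rfl fun u _ => ?_
      rw [Finset.sum_congr rfl fun a _ => Finset.sum_comm, Finset.sum_comm]
    rw [hc]
    refine Finset.sum_congr rfl fun u _ => Finset.sum_congr rfl fun v _ =>
      Finset.sum_congr rfl fun a _ => Finset.sum_congr rfl fun b _ => ?_
    ring
  rw [h3]
  unfold smp
  simp only [h1]
  rfl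

end QPTAlg

theorem smp_noQubits (G : QL → ℂ) : smp noQubits G = G [] := by
  simp [smp, noQubits, dy]

/-! ### Programs as subroutines -/

/-- Renumber the stacks of a program. -/
def Prog.shift (a b : ℕ) : Prog → Prog
  | .skip => .skip
  | .push r x => .push (r + a) x
  | .pop r => .pop (r + a)
  | .alloc s => .alloc (s + b)
  | .discard s => .discard (s + b)
  | .move s s' => .move (s + b) (s' + b)
  | .had s => .had (s + b)
  | .tgate s => .tgate (s + b)
  | .cnot s s' => .cnot (s + b) (s' + b)
  | .meas s r => .meas (s + b) (r + a)
  | .seq P Q => .seq (P.shift a b) (Q.shift a b)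
  | .ite r P Q => .ite (r + a) (P.shift a b) (Q.shift a b)
  | .whileBits r P => .whileBits (r + a) (P.shift a b)
  | .whileQubits s P => .whileQubits (s + b) (P.shift a b)

/-- The memory whose first stacks are those of `c`, followed by those of `e`. -/
def Cfg.merge (a b : ℕ) (c e : Cfg) : Cfg where
  bits r := if r < a then c.bits r else e.bits (r - a)
  q s := if s < b then c.q s else e.q (s - b)

section Shift

variable {a b : ℕ} {c e : Cfg}

theorem merge_bits (r : ℕ) : (Cfg.merge a b c e).bits (r + a) = e.bits r := by
  simp [Cfg.merge]

theorem merge_q (s : ℕ) : (Cfg.merge a b c e).q (s + b) = e.q s := by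
  simp [Cfg.merge]

theorem merge_setB (r : ℕ) (l : List Bool) :
    (Cfg.merge a b c e).setB (r + a) l = Cfg.merge a b c (e.setB r l) := by
  ext1
  · funext t
    simp only [Cfg.merge, Cfg.setB_bits]
    by_cases h : t < a
    · rw [if_neg (by omega), if_pos h, if_pos h]
    · by_cases h' : t = r + a
      · subst h'
        simp
      · rw [if_neg h', if_neg h, if_neg h, if_neg (by omega)]
  · rfl

theorem merge_setQ (s : ℕ) (l : QL) :
    (Cfg.merge a b c e).setQ (s + b) l = Cfg.merge a b c (e.setQ s l) := by
  ext1
  · rfl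
  · funext t
    simp only [Cfg.merge, Cfg.setQ_q]
    by_cases h : t < b
    · rw [if_neg (by omega), if_pos h, if_pos h]
    · by_cases h' : t = s + b
      · subst h'
        simp
      · rw [if_neg h', if_neg h, if_neg h, if_neg (by omega)]

/-- A renumbered program never touches the first `a` classical and `b` quantum stacks, so the data
of a caller kept there remain as they are. -/
theorem wexec_merge (P : Prog) :
    wexec (Cfg.merge a b c e) (P.shift a b)
      = (wexec e P).map fun t => (t.1.map (Prog.shift a b), Cfg.merge a b c t.2) := by
  have gate : ∀ k s, gateW k (Cfg.merge a b c e) (s + b)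
      = (gateW k e s).map fun t => (t.1.map (Prog.shift a b), Cfg.merge a b c t.2) := by
    intro k s
    simp only [gateW, merge_q]
    cases e.q s with
    | nil => rfl
    | cons p l =>
      simp only [merge_setQ]
      rfl
  cases P with
  | had s => exact gate hadC s
  | tgate s => exact gate tC s
  | push r x => simp only [Prog.shift, wexec, merge_bits, merge_setB]; rfl
  | pop r => simp only [Prog.shift, wexec, merge_bits, merge_setB]; rfl
  | alloc s => simp only [Prog.shift, wexec, merge_q, merge_setQ]; rfl
  | discard s =>
    simp only [Prog.shift, wexec, merge_q]
    cases e.q s with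
    | nil => rfl
    | cons p l => simp only [merge_setQ]; rfl
  | move s s' =>
    simp only [Prog.shift, wexec, merge_q]
    cases e.q s with
    | nil => rfl
    | cons p l => simp only [merge_setQ, merge_q]; rfl
  | cnot s s' =>
    simp only [Prog.shift, wexec, merge_q]
    cases e.q s with
    | nil => rfl
    | cons p l =>
      cases e.q s' with
      | nil => rfl
      | cons r l' =>
        simp only [merge_setQ, Nat.add_right_cancel_iff]
        split_ifs <;> rfl
  | meas s r =>
    simp only [Prog.shift, wexec, merge_q]
    cases e.q s with
    | nil => rfl
    | cons p l => simp only [merge_bits, merge_setB, merge_setQ]; rfl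
  | skip => rfl
  | seq P Q => rfl
  | ite r P Q =>
    simp only [Prog.shift, wexec, merge_bits]
    rcases e.bits r with _ | ⟨_ | _, l⟩ <;> rfl
  | whileBits r P =>
    simp only [Prog.shift, wexec, merge_bits]
    rcases e.bits r with _ | ⟨_, l⟩ <;> rfl
  | whileQubits s P =>
    simp only [Prog.shift, wexec, merge_q]
    rcases e.q s with _ | ⟨_, l⟩ <;> rfl

theorem wrun_merge (n : ℕ) (K : List Prog) :
    wrun n (K.map (Prog.shift a b)) (Cfg.merge a b c e)
      = (wrun n K e).map fun t => (t.1.map (Prog.shift a b), Cfg.merge a b c t.2) := by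
  induction n generalizing K e with
  | zero => rfl
  | succ n ih =>
    have hstep : wstep (K.map (Prog.shift a b)) (Cfg.merge a b c e)
        = (wstep K e).map fun t => (t.1.map (Prog.shift a b), Cfg.merge a b c t.2) := by
      cases K with
      | nil => rfl
      | cons P K =>
        simp only [List.map_cons, wstep, wexec_merge, W.map_map, List.map_append]
    simp only [wrun, hstep, W.bind_map, W.map_bind, ih]

end Shift

/-- All the stacks of a program have numbers less than `B`. -/
def Prog.Below (B : ℕ) : Prog → Prop
  | .skip => True
  | .push r _ => r < B
  | .pop r => r < B
  | .alloc s => s < B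
  | .discard s => s < B
  | .move s s' => s < B ∧ s' < B
  | .had s => s < B
  | .tgate s => s < B
  | .cnot s s' => s < B ∧ s' < B
  | .meas s r => s < B ∧ r < B
  | .seq P Q => P.Below B ∧ Q.Below B
  | .ite r P Q => r < B ∧ P.Below B ∧ Q.Below B
  | .whileBits r P => r < B ∧ P.Below B
  | .whileQubits s P => s < B ∧ P.Below B

theorem Prog.Below.mono {P : Prog} {B B' : ℕ} (h : P.Below B) (hB : B ≤ B') : P.Below B' := by
  induction P with
  | skip => trivial
  | seq P Q ihP ihQ => exact ⟨ihP h.1, ihQ h.2⟩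
  | ite r P Q ihP ihQ => exact ⟨h.1.trans_le hB, ihP h.2.1, ihQ h.2.2⟩
  | whileBits r P ih => exact ⟨h.1.trans_le hB, ih h.2⟩
  | whileQubits s P ih => exact ⟨h.1.trans_le hB, ih h.2⟩
  | move s s' => exact ⟨h.1.trans_le hB, h.2.trans_le hB⟩
  | cnot s s' => exact ⟨h.1.trans_le hB, h.2.trans_le hB⟩
  | meas s s' => exact ⟨h.1.trans_le hB, h.2.trans_le hB⟩
  | _ => exact lt_of_lt_of_le h hB

/-- The bound is at least `2` because the stacks `0` and `1` carry the input, whether or not the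
program mentions them. -/
theorem Prog.exists_below (P : Prog) : ∃ B, 2 ≤ B ∧ P.Below B := by
  have h2 : ∀ s s' : ℕ, 2 ≤ s + s' + 2 ∧ s < s + s' + 2 ∧ s' < s + s' + 2 := fun s s' => by omega
  induction P with
  | skip => exact ⟨2, le_rfl, trivial⟩
  | seq P Q ihP ihQ =>
    obtain ⟨B, hB, h⟩ := ihP
    obtain ⟨B', hB', h'⟩ := ihQ
    exact ⟨B + B', by omega, h.mono (by omega), h'.mono (by omega)⟩
  | ite r P Q ihP ihQ =>
    obtain ⟨B, hB, h⟩ := ihP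
    obtain ⟨B', hB', h'⟩ := ihQ
    exact ⟨B + B' + r, by omega, by omega, h.mono (by omega), h'.mono (by omega)⟩
  | whileBits r P ih =>
    obtain ⟨B, hB, h⟩ := ih
    exact ⟨B + r, by omega, by omega, h.mono (by omega)⟩
  | whileQubits r P ih =>
    obtain ⟨B, hB, h⟩ := ih
    exact ⟨B + r, by omega, by omega, h.mono (by omega)⟩
  | move s s' => exact ⟨_, h2 s s'⟩
  | cnot s s' => exact ⟨_, h2 s s'⟩
  | meas s s' => exact ⟨_, h2 s s'⟩
  | push r _ => exact ⟨_, (h2 r r).1, (h2 r r).2.1⟩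
  | pop r => exact ⟨_, (h2 r r).1, (h2 r r).2.1⟩
  | alloc r => exact ⟨_, (h2 r r).1, (h2 r r).2.1⟩
  | discard r => exact ⟨_, (h2 r r).1, (h2 r r).2.1⟩
  | had r => exact ⟨_, (h2 r r).1, (h2 r r).2.1⟩
  | tgate r => exact ⟨_, (h2 r r).1, (h2 r r).2.1⟩

/-- The stacks with numbers from `B` on are empty, and all stacks have length at most `L`. -/
def Cfg.Bounded (B L : ℕ) (e : Cfg) : Prop :=
  (∀ r, (e.bits r).length ≤ if r < B then L else 0) ∧ ∀ r, (e.q r).length ≤ if r < B then L else 0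

theorem Cfg.Bounded.mono {B L L' : ℕ} {e : Cfg} (h : e.Bounded B L) (hL : L ≤ L') :
    e.Bounded B L' := by
  refine ⟨fun r => (h.1 r).trans ?_, fun r => (h.2 r).trans ?_⟩ <;> split_ifs <;> omega

theorem Cfg.Bounded.setB {B L : ℕ} {e : Cfg} (h : e.Bounded B L) {r : ℕ} (hr : r < B)
    {l : List Bool} (hl : l.length ≤ L) : (e.setB r l).Bounded B L := by
  refine ⟨fun t => ?_, h.2⟩
  rw [Cfg.setB_bits]
  split_ifs with h1 h2 h2
  · exact hl
  · omega
  · have := h.1 t; rwa [if_pos h2] at this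
  · have := h.1 t; rwa [if_neg h2] at this

theorem Cfg.Bounded.setQ {B L : ℕ} {e : Cfg} (h : e.Bounded B L) {r : ℕ} (hr : r < B)
    {l : QL} (hl : l.length ≤ L) : (e.setQ r l).Bounded B L := by
  refine ⟨h.1, fun t => ?_⟩
  rw [Cfg.setQ_q]
  split_ifs with h1 h2 h2
  · exact hl
  · omega
  · have := h.2 t; rwa [if_pos h2] at this
  · have := h.2 t; rwa [if_neg h2] at this

theorem Cfg.Bounded.bits_le {B L : ℕ} {e : Cfg} (h : e.Bounded B L) (r : ℕ) :
    (e.bits r).length ≤ L := by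
  have := h.1 r
  split_ifs at this <;> omega

theorem Cfg.Bounded.q_le {B L : ℕ} {e : Cfg} (h : e.Bounded B L) (r : ℕ) :
    (e.q r).length ≤ L := by
  have := h.2 r
  split_ifs at this <;> omega

/-- An instruction lengthens a stack by at most one, so stack lengths are controlled by the running
time. This bounds the cost of cleaning up after a call, and the length of outputs. -/
theorem bounded_wexec {B L : ℕ} {e : Cfg} (h : e.Bounded B L) {P : Prog} (hP : P.Below B)
    {t : List Prog × Cfg} (ht : W.Mem t (wexec e P)) :
    (∀ Q ∈ t.1, Q.Below B) ∧ t.2.Bounded B (L + 1) := by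
  have h1 := h.mono (Nat.le_succ L)
  have gate : ∀ {k s}, s < B → W.Mem t (gateW k e s) →
      (∀ Q ∈ t.1, Q.Below B) ∧ t.2.Bounded B (L + 1) := by
    intro k s hs ht
    rcases mem_gateW.1 ht with ⟨-, rfl⟩ | ⟨p, l, y, hl, rfl⟩
    · exact ⟨by simp, h1⟩
    · refine ⟨by simp, h1.setQ hs ?_⟩
      have := h.q_le s
      rw [hl] at this
      simp only [List.length_cons] at this ⊢
      omega
  cases P with
  | skip =>
    simp only [wexec, W.mem_pure] at ht
    subst ht
    exact ⟨by simp, h1⟩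
  | push r b =>
    simp only [wexec, W.mem_pure] at ht
    subst ht
    refine ⟨by simp, h1.setB hP ?_⟩
    have := h.bits_le r
    simp only [List.length_cons]
    omega
  | pop r =>
    simp only [wexec, W.mem_pure] at ht
    subst ht
    refine ⟨by simp, h1.setB hP ?_⟩
    have := h.bits_le r
    simp only [List.length_tail]
    omega
  | alloc s =>
    simp only [wexec, W.mem_pure] at ht
    subst ht
    refine ⟨by simp, h1.setQ hP ?_⟩
    have := h.q_le s
    simp only [List.length_cons]
    omega
  | discard s =>
    rcases hs : e.q s with _ | ⟨p, l⟩
    · simp only [wexec, hs, W.mem_pure] at ht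
      subst ht
      exact ⟨by simp, h1⟩
    · simp only [wexec, hs, W.mem_single] at ht
      subst ht
      refine ⟨by simp, h1.setQ hP ?_⟩
      have := h.q_le s
      rw [hs, List.length_cons] at this
      omega
  | move s s' =>
    rcases hs : e.q s with _ | ⟨p, l⟩
    · simp only [wexec, hs, W.mem_pure] at ht
      subst ht
      exact ⟨by simp, h1⟩
    · simp only [wexec, hs, W.mem_pure] at ht
      subst ht
      have := h.q_le s
      rw [hs, List.length_cons] at this
      have h2 := h.setQ hP.1 (l := l) (by omega)
      refine ⟨by simp, (h2.mono (Nat.le_succ L)).setQ hP.2 ?_⟩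
      have := h2.q_le s'
      simp only [List.length_cons]
      omega
  | had s => exact gate hP ht
  | tgate s => exact gate hP ht
  | cnot s s' =>
    rcases hs : e.q s with _ | ⟨p, l⟩
    · simp only [wexec, hs, W.mem_pure] at ht
      subst ht
      exact ⟨by simp, h1⟩
    · rcases hs' : e.q s' with _ | ⟨r, l'⟩
      · simp only [wexec, hs, hs', W.mem_pure] at ht
        subst ht
        exact ⟨by simp, h1⟩
      · simp only [wexec, hs, hs'] at ht
        split_ifs at ht
        · rw [W.mem_pure] at ht
          subst ht
          exact ⟨by simp, h1⟩
        · rw [W.mem_pure] at ht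
          subst ht
          refine ⟨by simp, h1.setQ hP.2 ?_⟩
          have := h.q_le s'
          rw [hs', List.length_cons] at this
          simp only [List.length_cons]
          omega
  | meas s r =>
    rcases mem_wexec_meas.1 ht with ⟨-, rfl⟩ | ⟨p, l, y, hl, rfl⟩
    · exact ⟨by simp, h1⟩
    · refine ⟨by simp, (h1.setB hP.2 ?_).setQ hP.1 ?_⟩
      · have := h.bits_le r
        simp only [List.length_cons]
        omega
      · have := h.q_le s
        rw [hl, List.length_cons] at this
        omega
  | seq P Q =>
    simp only [wexec, W.mem_pure] at ht
    subst ht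
    refine ⟨?_, h1⟩
    simp only [List.mem_cons, List.not_mem_nil, or_false, forall_eq_or_imp, forall_eq]
    exact hP
  | ite r P Q =>
    rcases hr : e.bits r with _ | ⟨_ | _, l⟩ <;> simp only [wexec, hr, W.mem_pure] at ht <;>
      subst ht <;> simp only [List.mem_singleton, forall_eq]
    · exact ⟨hP.2.2, h1⟩
    · exact ⟨hP.2.2, h1⟩
    · exact ⟨hP.2.1, h1⟩
  | whileBits r P =>
    rcases hr : e.bits r with _ | ⟨_, l⟩ <;> simp only [wexec, hr, W.mem_pure] at ht <;>
      subst ht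
    · exact ⟨by simp, h1⟩
    · refine ⟨?_, h1⟩
      simp only [List.mem_cons, List.not_mem_nil, or_false, forall_eq_or_imp, forall_eq]
      exact ⟨hP.2, hP⟩
  | whileQubits s P =>
    rcases hr : e.q s with _ | ⟨_, l⟩ <;> simp only [wexec, hr, W.mem_pure] at ht <;>
      subst ht
    · exact ⟨by simp, h1⟩
    · refine ⟨?_, h1⟩
      simp only [List.mem_cons, List.not_mem_nil, or_false, forall_eq_or_imp, forall_eq]
      exact ⟨hP.2, hP⟩

theorem bounded_wrun {B : ℕ} (n : ℕ) {L : ℕ} {e : Cfg} (h : e.Bounded B L) {K : List Prog}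
    (hK : ∀ Q ∈ K, Q.Below B) {t : List Prog × Cfg} (ht : W.Mem t (wrun n K e)) :
    t.2.Bounded B (L + n) := by
  induction n generalizing L e K with
  | zero =>
    simp only [wrun, W.mem_pure] at ht
    subst ht
    exact h
  | succ n ih =>
    simp only [wrun, W.mem_bind] at ht
    obtain ⟨t1, h1, h2⟩ := ht
    have h3 : (∀ Q ∈ t1.1, Q.Below B) ∧ t1.2.Bounded B (L + 1) := by
      cases K with
      | nil =>
        simp only [wstep, W.mem_pure] at h1
        subst h1
        exact ⟨by simp, h.mono (Nat.le_succ L)⟩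
      | cons P K =>
        simp only [wstep, W.mem_map] at h1
        obtain ⟨t2, h4, rfl⟩ := h1
        have := bounded_wexec h (hK P (by simp)) h4
        refine ⟨fun Q hQ => ?_, this.2⟩
        rcases List.mem_append.1 hQ with hQ | hQ
        · exact this.1 Q hQ
        · exact hK Q (by simp [hQ])
    exact (ih h3.2 h3.1 h2).mono (by omega)

theorem bounded_dinit {B : ℕ} (hB : 2 ≤ B) (n : ℕ) (x : List Bool) (d : QL) :
    (dinit n x d).Bounded B (n + x.length + d.length) := by
  constructor
  · intro r
    by_cases h0 : r = 0
    · subst h0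
      rw [if_pos (by omega)]
      simp only [dinit, if_true, List.length_replicate]
      omega
    · by_cases h1 : r = 1
      · subst h1
        rw [if_pos (by omega)]
        simp only [dinit, if_true, one_ne_zero, if_false]
        omega
      · simp [dinit, h0, h1]
  · intro r
    by_cases h0 : r = 0
    · subst h0
      rw [if_pos (by omega)]
      simp only [dinit, if_true]
      omega
    · simp [dinit, h0]

/-! ### Clearing stacks -/

/-- Empty a classical stack. -/
def clrB (r : ℕ) : Prog := .whileBits r (.pop r)

/-- Discard a quantum stack. -/
def clrQ (s : ℕ) : Prog := .whileQubits s (.discard s)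

theorem setB_setB (c : Cfg) (r : ℕ) (l l' : List Bool) : (c.setB r l).setB r l' = c.setB r l' := by
  simp [Cfg.setB]

theorem setQ_setQ (c : Cfg) (r : ℕ) (l l' : QL) : (c.setQ r l).setQ r l' = c.setQ r l' := by
  simp [Cfg.setQ]

theorem setB_self {c : Cfg} {r : ℕ} {l : List Bool} (h : c.bits r = l) : c.setB r l = c := by
  subst h
  simp [Cfg.setB]

theorem setQ_self {c : Cfg} {r : ℕ} {l : QL} (h : c.q r = l) : c.setQ r l = c := by
  subst h
  simp [Cfg.setQ]

theorem clrB_det (c : Cfg) (r : ℕ) : Det (clrB r) c (2 * (c.bits r).length + 1) (c.setB r []) := by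
  generalize hl : c.bits r = l
  induction l generalizing c with
  | nil =>
    rw [setB_self hl]
    exact Spec.whileBits_nil hl
  | cons b l ih =>
    have h := ih (c.setB r l) (by simp [Cfg.setB])
    rw [setB_setB] at h
    refine (Spec.whileBits_cons_det (by simp [hl]) (Det.pop c r) (L := W.pure (c.setB r []))
      ?_).mono (m := 2 * (b :: l).length + 1) ?_ (n := 1 + (2 * l.length + 1) + 1)
    · rw [hl]
      exact h
    · simp only [List.length_cons]
      omega

/-- Each `discard` weights the dyad by the trace of one qubit; the product of these factors is `dg`.
-/
theorem clrQ_spec (c : Cfg) (s : ℕ) :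
    Spec [clrQ s] c (2 * (c.q s).length + 1) (W.single (dg (c.q s)) (c.setQ s [])) := by
  generalize hl : c.q s = l
  induction l generalizing c with
  | nil =>
    rw [setQ_self hl, dg_nil]
    exact Spec.whileQubits_nil hl
  | cons p l ih =>
    have h := ih (c.setQ s l) (by simp [Cfg.setQ])
    rw [setQ_setQ] at h
    have hd : Spec [Prog.discard s] c 1 (W.single (if p.1 = p.2 then 1 else 0) (c.setQ s l)) := by
      refine (Spec.first (L := W.single (if p.1 = p.2 then 1 else 0) ([], c.setQ s l)) (n := 0)
        (f := fun t => W.pure t.2) ?_ fun t ht => ?_).conv (fun a ha => ?_) fun F => ?_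
      · simp [wexec, hl]
      · rw [W.mem_single] at ht
        subst ht
        exact Spec.nil _ _
      · simpa using ha
      · simp
    refine ((Spec.whileQubits_cons (f := fun _ => W.single (dg l) (c.setQ s [])) (by simp [hl]) hd
      (m := 2 * l.length + 1) fun c' hc' => ?_).mono ?_).conv (fun a ha => ?_) fun F => ?_
    · rw [W.mem_single] at hc'
      subst hc'
      exact h
    · simp only [List.length_cons]
      omega
    · simpa using ha
    · simp [dg_cons]

/-- Empty the classical stacks `rs` and discard the quantum stacks `ss`. -/
def clr (rs ss : List ℕ) : Prog :=
  rs.foldr (fun r P => .seq (clrB r) P) (ss.foldr (fun s P => .seq (clrQ s) P) .skip)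

theorem clr_spec (rs ss : List ℕ) (hss : ss.Nodup) (c : Cfg) (L : ℕ)
    (hL : ∀ r ∈ rs, (c.bits r).length ≤ L) (hL' : ∀ r ∈ ss, (c.q r).length ≤ L) :
    Spec [clr rs ss] c ((2 * L + 2) * (rs.length + ss.length) + 1)
      (W.single (ss.map fun s => dg (c.q s)).prod
        ⟨fun r => if r ∈ rs then [] else c.bits r, fun s => if s ∈ ss then [] else c.q s⟩) := by
  induction rs generalizing c with
  | nil =>
    induction ss generalizing c with
    | nil =>
      refine (Det.skip c).conv (fun a ha => ?_) fun F => ?_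
      · simpa using ha
      · simp
    | cons s ss ih =>
      rw [List.nodup_cons] at hss
      have h := ih hss.2 (c.setQ s []) (by simp) (by
        intro r hr
        rw [Cfg.setQ_q]
        split_ifs
        · simp
        · exact hL' r (List.mem_cons_of_mem _ hr))
      have h2 : Spec [clr [] (s :: ss)] c _ _ := Spec.seq (clrQ_spec c s)
        (f := fun _ => _) fun c' hc' => by
          rw [W.mem_single] at hc'
          subst hc'
          exact h
      have e : (⟨fun t => if t ∈ ([] : List ℕ) then [] else c.bits t,
          fun t => if t ∈ s :: ss then [] else c.q t⟩ : Cfg)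
          = ⟨fun t => if t ∈ ([] : List ℕ) then [] else (c.setQ s []).bits t,
            fun t => if t ∈ ss then [] else (c.setQ s []).q t⟩ := by
        ext1
        · rfl
        · funext t
          simp only [Cfg.setQ_q, List.mem_cons]
          by_cases e1 : t ∈ ss <;> by_cases e2 : t = s <;> simp [e1, e2]
      rw [e]
      refine (h2.mono ?_).conv ?_ ?_
      · have := hL' s (by simp)
        simp only [List.length_cons, List.length_nil, zero_add]
        ring_nf
        omega
      · intro a ha
        simpa using ha
      · intro F
        simp only [W.ex_bind, W.ex_single, List.map_cons, List.prod_cons]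
        have : (ss.map fun t => dg ((c.setQ s []).q t)) = ss.map fun t => dg (c.q t) := by
          refine List.map_congr_left fun t ht => ?_
          rw [Cfg.setQ_q, if_neg fun e => hss.1 (by rwa [← e])]
        rw [this, mul_assoc]
  | cons r rs ih =>
    have h := ih (c.setB r []) (by
        intro t ht
        rw [Cfg.setB_bits]
        split_ifs
        · simp
        · exact hL t (List.mem_cons_of_mem _ ht)) (by simpa using hL')
    have e : (⟨fun t => if t ∈ r :: rs then [] else c.bits t,
        fun s => if s ∈ ss then [] else c.q s⟩ : Cfg)
        = ⟨fun t => if t ∈ rs then [] else (c.setB r []).bits t,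
          fun s => if s ∈ ss then [] else (c.setB r []).q s⟩ := by
      ext1
      · funext t
        simp only [Cfg.setB_bits, List.mem_cons]
        by_cases e1 : t ∈ rs <;> by_cases e2 : t = r <;> simp [e1, e2]
      · rfl
    rw [e]
    refine (Det.spec_seq (clrB_det c r) h : Spec [clr (r :: rs) ss] c _ _).mono ?_
    have := hL r (by simp)
    simp only [List.length_cons]
    ring_nf
    omega

/-! ### Calling an algorithm -/

/-- The stacks of the block of the called algorithms are empty. -/
def Cfg.Clean (c : Cfg) : Prop := (∀ r, 18 ≤ r → c.bits r = []) ∧ ∀ s, 3 ≤ s → c.q s = []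

/-- A bound for the stacks of an algorithm. -/
def QPTAlg.top (A : QPTAlg) : ℕ := A.prog.exists_below.choose

/-- Run an algorithm on the block of stacks from `18` and `3` on. -/
def QPTAlg.call (A : QPTAlg) : Prog :=
  .seq (A.prog.shift 18 3) (clr (18 :: List.range' 20 A.top) (List.range' 4 A.top))

theorem merge_dinit {c : Cfg} (hc : c.Clean) (n : ℕ) (x : List Bool) (d : QL) :
    Cfg.merge 18 3 c (dinit n x d)
      = ((c.setB 18 (List.replicate n true)).setB 19 x).setQ 3 d := by
  ext1
  · funext r
    simp only [Cfg.merge, dinit, Cfg.setQ_bits, Cfg.setB_bits]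
    by_cases h : r < 18
    · rw [if_pos h, if_neg (by omega), if_neg (by omega)]
    · rw [if_neg h, hc.1 r (by omega)]
      split_ifs <;> first | omega | rfl
  · funext s
    simp only [Cfg.merge, dinit, Cfg.setQ_q, Cfg.setB_q]
    by_cases h : s < 3
    · rw [if_pos h, if_neg (by omega)]
    · rw [if_neg h, hc.2 s (by omega)]
      split_ifs <;> first | omega | rfl

theorem prod_dg (c : Cfg) (ss : List ℕ) :
    (ss.map fun s => dg (c.q s)).prod = if ∀ s ∈ ss, ∀ p ∈ c.q s, p.1 = p.2 then 1 else 0 := by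
  induction ss with
  | nil => simp
  | cons s ss ih =>
    rw [List.map_cons, List.prod_cons, ih, dg]
    simp only [List.mem_cons, forall_eq_or_imp]
    rw [boole_mul, ite_and]

/-- The caller owns the classical stacks below `18` and the quantum stacks below `3`. The called
algorithm finds its parameter in `18`, its input in `19` and its qubits in `3`, and it leaves its
output in `19` and `3`. Emptying the rest of the block traces out the remaining qubits, which
produces the factor `jk` in `den` and makes the block ready for the next call. -/
theorem QPTAlg.call_spec (A : QPTAlg) : ∃ T : Polynomial ℕ, ∀ (n : ℕ) (x : List Bool) (d : QL)
    (c : Cfg), c.Clean →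
    Spec [A.call] (((c.setB 18 (List.replicate n true)).setB 19 x).setQ 3 d)
      (T.eval (n + x.length + d.length))
      ((A.den n x d).map fun a => (c.setB 19 a.1).setQ 3 a.2) := by
  obtain ⟨hB, hP⟩ := A.prog.exists_below.choose_spec
  have hBd : ∀ n x d t, W.Mem t (A.wfin n x d) → t.2.Bounded A.top
      (n + x.length + d.length + A.time.eval (n + x.length + d.length)) :=
    fun n x d t ht => bounded_wrun _ (bounded_dinit hB n x d) (by simpa using hP) ht
  -- The running time, and the clearing of `A.top + 1` classical and `A.top` quantum stacks, each no
  -- longer than the input size plus the running time.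
  refine ⟨A.time + ((2 * (Polynomial.X + A.time) + 2) * ((2 * A.top + 1 : ℕ) : Polynomial ℕ) + 1) + 1,
    fun n x d c hc => ?_⟩
  rw [← merge_dinit hc]
  set s := n + x.length + d.length with hs
  have h1 : Spec [A.prog.shift 18 3] (Cfg.merge 18 3 c (dinit n x d)) (A.time.eval s)
      ((A.wfin n x d).map fun t => Cfg.merge 18 3 c t.2) := by
    have e := wrun_merge (a := 18) (b := 3) (c := c) (e := dinit n x d) (A.time.eval s) [A.prog]
    rw [List.map_singleton] at e
    constructor
    · intro t ht
      rw [e, W.mem_map] at ht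
      obtain ⟨t', h1, rfl⟩ := ht
      refine ⟨?_, W.mem_map.2 ⟨t', h1, rfl⟩⟩
      simp [A.wfin_halted h1]
    · intro F
      rw [e, W.ex_map, W.ex_map]
      rfl
  have h2 : ∀ t, W.Mem t (A.wfin n x d) →
      Spec [clr (18 :: List.range' 20 A.top) (List.range' 4 A.top)] (Cfg.merge 18 3 c t.2)
        ((2 * (s + A.time.eval s) + 2) * (2 * A.top + 1) + 1)
        (W.single (jk t.2) ((c.setB 19 (t.2.bits 1)).setQ 3 (t.2.q 0))) := by
    intro t ht
    have hb := hBd n x d t ht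
    have h3 := clr_spec (18 :: List.range' 20 A.top) (List.range' 4 A.top)
      (List.nodup_range') (Cfg.merge 18 3 c t.2) (s + A.time.eval s) (fun r hr => by
        have hr' : 18 ≤ r := by
          simp only [List.mem_cons, List.mem_range'_1] at hr
          omega
        simp only [Cfg.merge]
        rw [if_neg (by omega)]
        exact hb.bits_le _) (fun r hr => by
        have hr' : 3 ≤ r := by
          simp only [List.mem_range'_1] at hr
          omega
        simp only [Cfg.merge]
        rw [if_neg (by omega)]
        exact hb.q_le _)
    have hq0 : ∀ s, A.top ≤ s → t.2.q s = [] := fun s hs' => by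
      have := hb.2 s
      rw [if_neg (by omega)] at this
      exact List.eq_nil_of_length_eq_zero (by omega)
    have hb0 : ∀ s, A.top ≤ s → t.2.bits s = [] := fun s hs' => by
      have := hb.1 s
      rw [if_neg (by omega)] at this
      exact List.eq_nil_of_length_eq_zero (by omega)
    have e1 : (List.map (fun s => dg ((Cfg.merge 18 3 c t.2).q s)) (List.range' 4 A.top)).prod
        = jk t.2 := by
      rw [prod_dg, jk]
      suffices hiff : (∀ s ∈ List.range' 4 A.top, ∀ p ∈ (Cfg.merge 18 3 c t.2).q s, p.1 = p.2) ↔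
          ∀ s, s ≠ 0 → ∀ p ∈ t.2.q s, p.1 = p.2 by
        split_ifs <;> tauto
      refine ⟨fun h s hs' p hp => ?_, fun h s hs' p hp => ?_⟩
      · have hlt : s < A.top := by
          by_contra h'
          rw [hq0 s (by omega)] at hp
          simp at hp
        refine h (s + 3) (by simp only [List.mem_range'_1]; omega) p ?_
        rwa [merge_q]
      · simp only [List.mem_range'_1] at hs'
        obtain ⟨s, rfl⟩ : ∃ s', s = s' + 3 := ⟨s - 3, by omega⟩
        rw [merge_q] at hp
        exact h s (by omega) p hp
    have e2 : (⟨fun r => if r ∈ 18 :: List.range' 20 A.top then [] else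
        (Cfg.merge 18 3 c t.2).bits r, fun s => if s ∈ List.range' 4 A.top then [] else
        (Cfg.merge 18 3 c t.2).q s⟩ : Cfg) = (c.setB 19 (t.2.bits 1)).setQ 3 (t.2.q 0) := by
      ext1
      · funext r
        simp only [Cfg.setQ_bits, Cfg.setB_bits, Cfg.merge, List.mem_cons, List.mem_range'_1]
        by_cases r1 : r = 19
        · subst r1
          simp
        · by_cases r2 : r < 18
          · rw [if_neg (by omega), if_pos r2, if_neg r1]
          · rw [if_neg r1, if_neg r2, hc.1 r (by omega)]
            split_ifs with h4
            · rfl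
            · exact hb0 _ (by omega)
      · funext r
        simp only [Cfg.setQ_q, Cfg.setB_q, Cfg.merge, List.mem_range'_1]
        by_cases r1 : r = 3
        · subst r1
          simp
        · by_cases r2 : r < 3
          · rw [if_neg (by omega), if_pos r2, if_neg r1]
          · rw [if_neg r1, if_neg r2, hc.2 r (by omega)]
            split_ifs with h4
            · rfl
            · exact hq0 _ (by omega)
    rw [e1, e2] at h3
    refine h3.mono (le_of_eq ?_)
    simp only [List.length_cons, List.length_range']
    ring
  -- The continuation has to be a function of the merged memory, so the stacks of the called
  -- algorithm are read back through the shift.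
  have h3 := h1.append (K := [clr (18 :: List.range' 20 A.top) (List.range' 4 A.top)])
    (m := (2 * (s + A.time.eval s) + 2) * (2 * A.top + 1) + 1)
    (f := fun c' => W.single (jk (Cfg.mk (fun r => c'.bits (r + 18)) fun s => c'.q (s + 3)))
      ((c.setB 19 (c'.bits 19)).setQ 3 (c'.q 3))) (fun c' hc' => by
      rw [W.mem_map] at hc'
      obtain ⟨t, ht, rfl⟩ := hc'
      have := h2 t ht
      simp only [merge_bits, merge_q]
      rw [show (19 : ℕ) = 1 + 18 from rfl, merge_bits]
      rw [show (3 : ℕ) = 0 + 3 from rfl, merge_q]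
      exact this)
  refine ((Spec.first_pure (P := A.call) (J := [A.prog.shift 18 3,
    clr (18 :: List.range' 20 A.top) (List.range' 4 A.top)]) (c := Cfg.merge 18 3 c (dinit n x d))
    (K := []) rfl h3).mono (le_of_eq ?_)).conv ?_ ?_
  · simp
  · intro a ha
    simp only [W.mem_bind, W.mem_map, W.mem_single, den] at ha ⊢
    obtain ⟨_, ⟨t, ht, rfl⟩, rfl⟩ := ha
    refine ⟨_, ⟨t, ht, rfl⟩, ?_⟩
    rw [show (19 : ℕ) = 1 + 18 from rfl, merge_bits, show (3 : ℕ) = 0 + 3 from rfl, merge_q]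
  · intro F
    simp only [W.ex_bind, W.ex_map, W.ex_single, den, merge_bits, merge_q]
    rw [show (19 : ℕ) = 1 + 18 from rfl, show (3 : ℕ) = 0 + 3 from rfl]
    simp only [merge_bits, merge_q]

/-! ### Monad laws, iteration and loops. -/

namespace W

variable {α β γ : Type*}

theorem pure_bind (a : α) (f : α → W β) : (pure a).bind f = f a := by
  show List.flatMap _ [((1 : ℂ), a)] = f a
  simp only [List.flatMap_cons, List.flatMap_nil, List.append_nil, one_mul]
  exact List.map_id _

theorem bind_pure (L : W α) (f : α → β) : (L.bind fun a => pure (f a)) = L.map f := by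
  show List.flatMap (fun p : ℂ × α => [(p.1 * 1, f p.2)]) L = _
  simp only [mul_one]
  exact List.map_eq_flatMap.symm

theorem bind_assoc (L : W α) (f : α → W β) (g : β → W γ) :
    (L.bind f).bind g = L.bind fun a => (f a).bind g := by
  have key : ∀ (w : ℂ) (M : W β), bind (List.map (fun t : ℂ × β => (w * t.1, t.2)) M : W β) g
      = List.map (fun t : ℂ × γ => (w * t.1, t.2)) (M.bind g) := by
    intro w M
    refine (List.flatMap_map _ _ _).trans (Eq.trans ?_ List.map_flatMap.symm)
    refine congrArg (fun h => List.flatMap h M) (funext fun p => ?_)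
    refine Eq.trans ?_ List.map_map.symm
    refine List.map_congr_left fun t _ => ?_
    simp [mul_assoc]
  refine (List.flatMap_assoc).trans ?_
  refine congrArg (fun h => List.flatMap h L) (funext fun p => ?_)
  exact key p.1 (f p.2)

theorem map_eq_bind (L : W α) (f : α → β) : L.map f = L.bind fun a => pure (f a) :=
  (bind_pure L f).symm

theorem bind_congr {L : W α} {f g : α → W β} (h : ∀ a, Mem a L → f a = g a) :
    L.bind f = L.bind g := by
  refine List.flatMap_congr ?_
  rintro ⟨w, a⟩ hp
  simp only
  rw [h a ⟨w, hp⟩]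

theorem map_congr {L : W α} {f g : α → β} (h : ∀ a, Mem a L → f a = g a) :
    L.map f = L.map g := by
  simp only [map_eq_bind]
  exact bind_congr fun a ha => by rw [h a ha]

/-- The iteration of a random step. -/
def iter (f : α → W α) : ℕ → α → W α
  | 0, a => pure a
  | n + 1, a => (f a).bind (iter f n)

theorem iter_ok {f : α → W α} {Ok : α → Prop} (h : ∀ a, Ok a → ∀ b, Mem b (f a) → Ok b) (n : ℕ) :
    ∀ a, Ok a → ∀ b, Mem b (iter f n a) → Ok b := by
  induction n with
  | zero =>
    intro a ha b hb
    rw [iter, mem_pure] at hb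
    exact hb ▸ ha
  | succ n ih =>
    intro a ha b hb
    rw [iter, mem_bind] at hb
    obtain ⟨c, hc, hb⟩ := hb
    exact ih c (h a ha c hc) b hb

end W

namespace Spec

/-- The final combination may depend on `a` and not only on the memory `g a`. As `g` need not be
injective, the run of `Q` itself is taken as the continuation, and it is compared with `M a`
afterwards. -/
theorem seq_map {α : Type*} {P Q : Prog} {c : Cfg} {n m : ℕ} {L : W α} {g : α → Cfg}
    {M : α → W Cfg} (h1 : Spec [P] c n (L.map g))
    (h2 : ∀ a, W.Mem a L → Spec [Q] (g a) m (M a)) : Spec [P.seq Q] c (n + m + 1) (L.bind M) := by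
  refine (Spec.seq (f := fun c' => (wrun m [Q] c').map Prod.snd) h1 fun c' hc' => ?_).conv
    (fun b hb => ?_) fun F => ?_
  · rw [W.mem_map] at hc'
    obtain ⟨a, ha, rfl⟩ := hc'
    exact ⟨fun t ht => ⟨((h2 a ha).1 t ht).1, W.mem_map.2 ⟨t, ht, rfl⟩⟩, fun F => by rw [W.ex_map]⟩
  · simp only [W.mem_bind, W.mem_map] at hb ⊢
    obtain ⟨_, ⟨a, ha, rfl⟩, t, ht, rfl⟩ := hb
    exact ⟨a, ha, ((h2 a ha).1 t ht).2⟩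
  · simp only [W.ex_bind, W.ex_map]
    exact W.ex_congr fun a ha => (h2 a ha).2 F

end Spec

theorem Det.of_eq {P : Prog} {c c' c'' : Cfg} {n m : ℕ} (h : Det P c n c') (hn : n ≤ m)
    (e : c' = c'') : Det P c m c'' := e ▸ h.mono hn

/-- Repeat a program, where a classical stack holds the number of repetitions in unary. -/
def loop (u : ℕ) (P : Prog) : Prog := .whileBits u (.seq (.pop u) P)

/-- The random step acts on abstract states `S`, which `g` realizes as memories. The counter is
decremented before the body runs, so `Ok k` is an invariant with `k` rounds left. Each round costs
three more steps: the test, the sequencing and the `pop`. -/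
theorem loop_spec {S : Type*} {u : ℕ} {P : Prog} {g : S → Cfg} {step : S → W S} {Ok : ℕ → S → Prop}
    {T : ℕ} (hstep : ∀ k s, Ok (k + 1) s → Spec [P] ((g s).setB u (List.replicate k true)) T
      ((step s).map fun s' => (g s').setB u (List.replicate k true)))
    (hOk : ∀ k s, Ok (k + 1) s → ∀ s', W.Mem s' (step s) → Ok k s') (k : ℕ) :
    ∀ s, Ok k s → Spec [loop u P] ((g s).setB u (List.replicate k true)) (k * (T + 3) + 1)
      ((W.iter step k s).map fun s' => (g s').setB u []) := by
  induction k with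
  | zero =>
    intro s hs
    exact (Spec.whileBits_nil (by simp [Cfg.setB_bits])).mono (by omega)
  | succ k ih =>
    intro s hs
    have e : Det (.pop u) ((g s).setB u (List.replicate (k + 1) true)) 1
        ((g s).setB u (List.replicate k true)) := by
      have := Det.pop ((g s).setB u (List.replicate (k + 1) true)) u
      rw [setB_setB] at this
      simpa [Cfg.setB_bits, List.replicate_succ] using this
    have h1 := e.spec_seq (hstep k s hs)
    have h2 : Spec [loop u P] _ _ _ := Spec.whileBits_cons
      (f := fun c' => (wrun (k * (T + 3) + 1) [loop u P] c').map Prod.snd)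
      (by simp [Cfg.setB_bits, List.replicate_succ]) h1 (m := k * (T + 3) + 1) fun c' hc' => by
        rw [W.mem_map] at hc'
        obtain ⟨a, ha, rfl⟩ := hc'
        exact ⟨fun t ht => ⟨((ih a (hOk k s hs a ha)).1 t ht).1, W.mem_map.2 ⟨t, ht, rfl⟩⟩,
          fun F => by rw [W.ex_map]; rfl⟩
    refine (h2.mono (by ring_nf; omega)).conv (fun b hb => ?_) fun F => ?_
    · simp only [W.iter, W.map_bind, W.mem_bind, W.mem_map (f := Prod.snd),
        W.mem_map (f := fun s' => (g s').setB u (List.replicate k true))] at hb ⊢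
      obtain ⟨_, ⟨a, ha, rfl⟩, t, ht, rfl⟩ := hb
      exact ⟨a, ha, ((ih a (hOk k s hs a ha)).1 t ht).2⟩
    · simp only [W.iter, W.map_bind, W.ex_bind, W.ex_map (f := Prod.snd),
        W.ex_map (f := fun s' => (g s').setB u (List.replicate k true))]
      exact W.ex_congr fun a ha => (ih a (hOk k s hs a ha)).2 F

/-- The deterministic case of `loop_spec`. -/
theorem loop_det {u : ℕ} {P : Prog} {g : ℕ → Cfg} {T k : ℕ}
    (hstep : ∀ i j, i < k → Det P ((g i).setB u (List.replicate j true)) T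
      ((g (i + 1)).setB u (List.replicate j true))) :
    Det (loop u P) ((g 0).setB u (List.replicate k true)) (k * (T + 3) + 1) ((g k).setB u []) := by
  have key : ∀ j i, i + j = k → Det (loop u P) ((g i).setB u (List.replicate j true))
      (j * (T + 3) + 1) ((g k).setB u []) := by
    intro j
    induction j with
    | zero =>
      rintro i rfl
      exact (Spec.whileBits_nil (by simp [Cfg.setB_bits])).mono (by omega)
    | succ j ih =>
      intro i hi
      have e : Det (.pop u) ((g i).setB u (List.replicate (j + 1) true)) 1
          ((g i).setB u (List.replicate j true)) := by
        have := Det.pop ((g i).setB u (List.replicate (j + 1) true)) u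
        rw [setB_setB] at this
        simpa [Cfg.setB_bits, List.replicate_succ] using this
      exact (Spec.whileBits_cons_det (by simp [Cfg.setB_bits, List.replicate_succ])
        (e.seq (hstep i j (by omega))) (ih (i + 1) (by omega))).mono (by ring_nf; omega)
  exact key k 0 (by omega)

/-! ### Moving and copying data -/

/-- Move a bit, or push `0` if there is none. -/
def mvBit (r r' : ℕ) : Prog :=
  .ite r (.seq (.push r' true) (.pop r)) (.seq (.push r' false) (.pop r))

theorem mvBit_det (c : Cfg) {r r' : ℕ} (h : r ≠ r') : Det (mvBit r r') c 4
    ((c.setB r (c.bits r).tail).setB r' ((c.bits r).headD false :: c.bits r')) := by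
  have e : ∀ b, Det (.seq (.push r' b) (.pop r)) c 3
      ((c.setB r (c.bits r).tail).setB r' (b :: c.bits r')) := by
    intro b
    have := (Det.push c r' b).seq (Det.pop _ r)
    refine this.of_eq le_rfl ?_
    ext1
    · funext t
      simp only [Cfg.setB_bits]
      split_ifs <;> simp_all
    · rfl
  cases hb : (c.bits r).headD false with
  | true => exact Spec.ite_true hb (e true)
  | false => exact Spec.ite_false hb (e false)

/-- Move a stack of bits; this reverses it. -/
def mvB (r r' : ℕ) : Prog := .whileBits r (mvBit r r')

theorem mvB_det (c : Cfg) {r r' : ℕ} (h : r ≠ r') : Det (mvB r r') c (5 * (c.bits r).length + 1)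
    ((c.setB r []).setB r' ((c.bits r).reverse ++ c.bits r')) := by
  generalize hl : c.bits r = l
  induction l generalizing c with
  | nil =>
    have : (c.setB r []).setB r' (([] : List Bool).reverse ++ c.bits r') = c := by
      rw [setB_self hl]
      exact setB_self rfl
    rw [this]
    exact Spec.whileBits_nil hl
  | cons b l ih =>
    have h1 := mvBit_det c h
    rw [hl] at h1
    have h2 := ih (c := (c.setB r l).setB r' (b :: c.bits r')) (by simp [Cfg.setB_bits, h])
    have h' : Det (mvB r r') c _ _ := Spec.whileBits_cons_det (by simp [hl]) h1 h2
    refine h'.of_eq (by simp only [List.length_cons]; omega) ?_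
    ext1
    · funext t
      simp only [Cfg.setB_bits]
      split_ifs <;> simp_all
    · rfl

/-- Copy a stack of bits, using an empty stack `t`. -/
def cpB (r r' t : ℕ) : Prog :=
  .seq (mvB r t) (.whileBits t (.ite t (.seq (.push r true) (.seq (.push r' true) (.pop t)))
    (.seq (.push r false) (.seq (.push r' false) (.pop t)))))

theorem cpB_det (c : Cfg) {r r' t : ℕ} (h1 : r ≠ r') (h2 : r ≠ t) (h3 : r' ≠ t)
    (ht : c.bits t = []) : Det (cpB r r' t) c (12 * (c.bits r).length + 3)
    (c.setB r' (c.bits r ++ c.bits r')) := by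
  have e1 : ∀ c : Cfg, Det (.ite t (.seq (.push r true) (.seq (.push r' true) (.pop t)))
    (.seq (.push r false) (.seq (.push r' false) (.pop t)))) c 6
      (((c.setB t (c.bits t).tail).setB r ((c.bits t).headD false :: c.bits r)).setB r'
        ((c.bits t).headD false :: c.bits r')) := by
    intro c
    have e : ∀ b, Det (.seq (.push r b) (.seq (.push r' b) (.pop t))) c 5
        (((c.setB t (c.bits t).tail).setB r (b :: c.bits r)).setB r' (b :: c.bits r')) := by
      intro b
      have h' : Det _ _ 5 _ := (Det.push c r b).seq ((Det.push _ r' b).seq (Det.pop _ t))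
      refine h'.of_eq le_rfl ?_
      ext1
      · funext t
        simp only [Cfg.setB_bits]
        split_ifs <;> simp_all
      · rfl
    cases hb : (c.bits t).headD false with
    | true => exact Spec.ite_true hb (e true)
    | false => exact Spec.ite_false hb (e false)
  have e2 : ∀ (l : List Bool) (c : Cfg), c.bits t = l → Det (.whileBits t (.ite t
      (.seq (.push r true) (.seq (.push r' true) (.pop t)))
      (.seq (.push r false) (.seq (.push r' false) (.pop t))))) c (7 * l.length + 1)
      (((c.setB t []).setB r (l.reverse ++ c.bits r)).setB r' (l.reverse ++ c.bits r')) := by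
    intro l
    induction l with
    | nil =>
      intro c hl
      have : ((c.setB t []).setB r (([] : List Bool).reverse ++ c.bits r)).setB r'
          (([] : List Bool).reverse ++ c.bits r') = c := by
        rw [setB_self hl, List.reverse_nil, List.nil_append, setB_self rfl]
        exact setB_self rfl
      rw [this]
      exact Spec.whileBits_nil hl
    | cons b l ih =>
      intro c hl
      have h4 := e1 c
      rw [hl] at h4
      have h5 := ih (((c.setB t l).setB r (b :: c.bits r)).setB r' (b :: c.bits r'))
        (by simp [Cfg.setB_bits, h2.symm, h3.symm])
      have h' := (Spec.whileBits_cons_det (by simp [hl]) h4 h5).mono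
        (m := 7 * (b :: l).length + 1) (by simp only [List.length_cons]; omega)
      refine Det.of_eq h' le_rfl ?_
      ext1
      · funext t
        simp only [Cfg.setB_bits]
        split_ifs <;> simp_all
      · rfl
  have h' := ((mvB_det c h2).seq (e2 _ _ rfl)).mono (m := 12 * (c.bits r).length + 3) (by
    simp only [Cfg.setB_bits, if_true, ht, List.append_nil, List.length_reverse]
    omega)
  refine h'.of_eq le_rfl ?_
  ext1
  · funext t
    simp only [Cfg.setB_bits]
    split_ifs <;> simp_all
  · rfl

/-- The first `k` bits of `x`, padded with `0`, in reverse order, followed by `acc`. -/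
def tr : ℕ → List Bool → List Bool → List Bool
  | 0, _, acc => acc
  | k + 1, x, acc => tr k x.tail (x.headD false :: acc)

theorem length_tr (k : ℕ) (x acc : List Bool) : (tr k x acc).length = k + acc.length := by
  induction k generalizing x acc with
  | zero => simp [tr]
  | succ k ih =>
    rw [tr, ih, List.length_cons]
    omega

/-- Moving bits between stacks reverses them. Keys are therefore stored in reverse order, and taking
a key restores it. -/
theorem tr_reverse (k x acc : List Bool) : tr k.length (k.reverse ++ x) acc = k ++ acc := by
  have : ∀ (l : List Bool) acc, tr l.length (l ++ x) acc = l.reverse ++ acc := by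
    intro l
    induction l with
    | nil => intro acc; rfl
    | cons b l ih => intro acc; simp [tr, ih]
  simpa using this k.reverse acc

/-- Move as many bits as the counter `u` says. -/
def tkB (u r r' : ℕ) : Prog := loop u (mvBit r r')

theorem tkB_det (c : Cfg) {u r r' k : ℕ} (h1 : u ≠ r) (h2 : u ≠ r') (h3 : r ≠ r')
    (hu : c.bits u = List.replicate k true) : Det (tkB u r r') c (7 * k + 1)
    (((c.setB u []).setB r ((c.bits r).drop k)).setB r' (tr k (c.bits r) (c.bits r'))) := by
  induction k generalizing c with
  | zero =>
    have : ((c.setB u []).setB r ((c.bits r).drop 0)).setB r' (tr 0 (c.bits r) (c.bits r')) = c := by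
      rw [setB_self (r := u) (l := []) (by simpa using hu), List.drop_zero, setB_self (r := r) rfl]
      exact setB_self rfl
    rw [this]
    exact Spec.whileBits_nil hu
  | succ k ih =>
    have h4 := (Det.pop c u).seq (mvBit_det _ h3)
    have h5 := ih (c := ((c.setB u (c.bits u).tail).setB r (c.bits r).tail).setB r'
      ((c.bits r).headD false :: c.bits r'))
      (by simp [Cfg.setB_bits, h1, h2, hu, List.replicate_succ])
    have e : ((((c.setB u (c.bits u).tail).setB r ((c.setB u (c.bits u).tail).bits r).tail).setB r'
      (((c.setB u (c.bits u).tail).bits r).headD false :: (c.setB u (c.bits u).tail).bits r')))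
      = ((c.setB u (c.bits u).tail).setB r (c.bits r).tail).setB r'
      ((c.bits r).headD false :: c.bits r') := by
      simp [Cfg.setB_bits, h1.symm, h2.symm]
    rw [e] at h4
    have h' := (Spec.whileBits_cons_det (by simp [hu, List.replicate_succ]) h4 h5).mono
      (m := 7 * (k + 1) + 1) (by omega)
    refine Det.of_eq h' le_rfl ?_
    ext1
    · funext t
      simp only [Cfg.setB_bits]
      split_ifs <;> simp_all [tr]
    · rfl

theorem Det.move_cons {c : Cfg} {s s' : ℕ} {p : Bool × Bool} {l : QL} (h : c.q s = p :: l)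
    (hs : s ≠ s') : Det (.move s s') c 1 ((c.setQ s l).setQ s' (p :: c.q s')) := by
  refine Spec.first_pure (J := []) ?_ (Spec.nil _ _)
  simp [wexec, h, Cfg.setQ_q, hs.symm]

theorem Det.move_nil {c : Cfg} {s s' : ℕ} (h : c.q s = []) : Det (.move s s') c 1 c := by
  refine Spec.first_pure (J := []) ?_ (Spec.nil _ _)
  simp [wexec, h]

/-- Move a stack of qubits; this reverses it. -/
def mvQ (s s' : ℕ) : Prog := .whileQubits s (.move s s')

theorem mvQ_det (c : Cfg) {s s' : ℕ} (h : s ≠ s') : Det (mvQ s s') c (2 * (c.q s).length + 1)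
    ((c.setQ s []).setQ s' ((c.q s).reverse ++ c.q s')) := by
  generalize hl : c.q s = l
  induction l generalizing c with
  | nil =>
    have : (c.setQ s []).setQ s' (([] : QL).reverse ++ c.q s') = c := by
      rw [setQ_self hl]
      exact setQ_self rfl
    rw [this]
    exact Spec.whileQubits_nil hl
  | cons p l ih =>
    have h1 := Det.move_cons hl h
    have h2 := ih (c := (c.setQ s l).setQ s' (p :: c.q s')) (by simp [Cfg.setQ_q, h])
    have h' := ((Spec.whileQubits_cons (s := s) (f := fun _ => _) (by simp [hl]) h1 fun c' hc' => by
      rw [W.mem_pure] at hc'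
      rw [hc']
      exact h2).mono (m := 2 * (p :: l).length + 1) (by simp only [List.length_cons]; omega))
    rw [W.pure_bind] at h'
    refine Det.of_eq h' le_rfl ?_
    ext1
    · rfl
    · funext t
      simp only [Cfg.setQ_q]
      split_ifs <;> simp_all

/-- Move as many qubits as the counter `u` says, as far as there are any. -/
def tkQ (u s s' : ℕ) : Prog := loop u (.move s s')

theorem tkQ_det (c : Cfg) {u s s' k : ℕ} (h : s ≠ s')
    (hu : c.bits u = List.replicate k true) : Det (tkQ u s s') c (4 * k + 1)
    (((c.setB u []).setQ s ((c.q s).drop k)).setQ s' (((c.q s).take k).reverse ++ c.q s')) := by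
  induction k generalizing c with
  | zero =>
    have : ((c.setB u []).setQ s ((c.q s).drop 0)).setQ s' (((c.q s).take 0).reverse ++ c.q s')
        = c := by
      rw [setB_self (r := u) (l := []) (by simpa using hu), List.drop_zero, setQ_self rfl]
      exact setQ_self rfl
    rw [this]
    exact Spec.whileBits_nil hu
  | succ k ih =>
    have h0 := Det.pop c u
    have hu' : (c.setB u (c.bits u).tail).bits u = List.replicate k true := by
      simp [Cfg.setB_bits, hu, List.replicate_succ]
    rcases hl : c.q s with _ | ⟨p, l⟩
    · have h5 := ih _ hu'
      have h' := (Spec.whileBits_cons_det (by simp [hu, List.replicate_succ])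
        (h0.seq (Det.move_nil (s' := s') (by simpa using hl))) h5).mono (m := 4 * (k + 1) + 1)
        (by omega)
      refine Det.of_eq h' le_rfl ?_
      ext1
      · funext t
        simp only [Cfg.setQ_bits, Cfg.setB_bits]
        split_ifs <;> simp_all
      · funext t
        simp only [Cfg.setQ_q, Cfg.setB_q]
        split_ifs <;> simp_all
    · have h5 := ih (c := ((c.setB u (c.bits u).tail).setQ s l).setQ s' (p :: c.q s'))
        (by simpa using hu')
      have h' := (Spec.whileBits_cons_det (by simp [hu, List.replicate_succ])
        (h0.seq (Det.move_cons (by simpa using hl) h)) h5).mono (m := 4 * (k + 1) + 1) (by omega)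
      refine Det.of_eq h' le_rfl ?_
      ext1
      · funext t
        simp only [Cfg.setQ_bits, Cfg.setB_bits]
        split_ifs <;> simp_all
      · funext t
        simp only [Cfg.setQ_q, Cfg.setB_q]
        split_ifs <;> simp_all

theorem monotone_eval_nat (p : Polynomial ℕ) : Monotone fun n => p.eval n := by
  intro a b h
  induction p using Polynomial.induction_on' with
  | add p q hp hq => simpa using Nat.add_le_add hp hq
  | monomial n a =>
    simp only [Polynomial.eval_monomial]
    gcongr

theorem QPTAlg.length_den (A : QPTAlg) {n : ℕ} {x : List Bool} {d : QL} {a : List Bool × QL}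
    (ha : W.Mem a (A.den n x d)) :
    a.1.length ≤ n + x.length + d.length + A.time.eval (n + x.length + d.length) ∧
      a.2.length ≤ n + x.length + d.length + A.time.eval (n + x.length + d.length) := by
  obtain ⟨hB, hP⟩ := A.prog.exists_below.choose_spec
  simp only [QPTAlg.den, W.mem_bind, W.mem_single] at ha
  obtain ⟨t, ht, rfl⟩ := ha
  have := bounded_wrun _ (bounded_dinit hB n x d) (by simpa using hP) ht
  exact ⟨this.bits_le _, this.q_le _⟩

/-- The memory in which the security parameter is `n` and the auxiliary stacks are empty. -/
structure Cfg.Std (n : ℕ) (c : Cfg) : Prop where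
  clean : c.Clean
  param : c.bits 0 = List.replicate n true
  b4 : c.bits 4 = []
  b5 : c.bits 5 = []
  b16 : c.bits 16 = []
  b17 : c.bits 17 = []
  q2 : c.q 2 = []

/-- The classical stacks that are free for use. -/
def Free (r : ℕ) : Prop := r < 18 ∧ r ≠ 0 ∧ r ≠ 4 ∧ r ≠ 5 ∧ r ≠ 16 ∧ r ≠ 17

instance (r : ℕ) : Decidable (Free r) := by unfold Free; infer_instance

theorem Cfg.Clean.setB {c : Cfg} (h : c.Clean) {r : ℕ} (hr : r < 18) (l : List Bool) :
    (c.setB r l).Clean :=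
  ⟨fun t ht => by rw [Cfg.setB_bits, if_neg (by omega), h.1 t ht], h.2⟩

theorem Cfg.Clean.setQ {c : Cfg} (h : c.Clean) {r : ℕ} (hr : r < 3) (l : QL) :
    (c.setQ r l).Clean :=
  ⟨h.1, fun t ht => by rw [Cfg.setQ_q, if_neg (by omega), h.2 t ht]⟩

theorem Cfg.Std.setB {n : ℕ} {c : Cfg} (h : c.Std n) {r : ℕ} (hr : Free r) (l : List Bool) :
    (c.setB r l).Std n := by
  obtain ⟨h1, h2, h3, h4, h5, h6⟩ := hr
  refine ⟨h.clean.setB h1 l, ?_, ?_, ?_, ?_, ?_, h.q2⟩ <;> rw [Cfg.setB_bits, if_neg (by omega)]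
  exacts [h.param, h.b4, h.b5, h.b16, h.b17]

theorem Cfg.Std.setQ {n : ℕ} {c : Cfg} (h : c.Std n) {r : ℕ} (hr : r < 2) (l : QL) :
    (c.setQ r l).Std n :=
  ⟨h.clean.setQ (by omega) l, h.param, h.b4, h.b5, h.b16, h.b17,
    by rw [Cfg.setQ_q, if_neg (by omega), h.q2]⟩

/-- Write the value of a polynomial in unary. -/
theorem exists_setPoly (p : Polynomial ℕ) (r : ℕ) (hr : Free r) :
    ∃ (P : Prog) (T : Polynomial ℕ), ∀ n c, Cfg.Std n c →
      Det P c (T.eval n) (c.setB r (List.replicate (p.eval n) true ++ c.bits r)) := by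
  obtain ⟨h1, h2, h3, h4, h5, h6⟩ := hr
  induction p using Polynomial.induction_on' with
  | add p q hp hq =>
    obtain ⟨P, T, hP⟩ := hp
    obtain ⟨Q, T', hQ⟩ := hq
    refine ⟨P.seq Q, T + T' + 1, fun n c hc => ?_⟩
    refine ((hP n c hc).seq (hQ n _ (hc.setB ⟨h1, h2, h3, h4, h5, h6⟩ _))).of_eq (by simp) ?_
    rw [setB_setB, Cfg.setB_bits, if_pos rfl, ← List.append_assoc, List.replicate_append_replicate,
      Polynomial.eval_add, add_comm]
  | monomial k a =>
    have key : ∀ k, ∃ (P : Prog) (T : Polynomial ℕ), ∀ n c, Cfg.Std n c →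
        Det P c (T.eval n) (c.setB 16 (List.replicate (a * n ^ k) true)) := by
      intro k
      induction k with
      | zero =>
        have : ∀ a, ∃ P : Prog, ∀ n c, Cfg.Std n c →
            Det P c (2 * a + 1) (c.setB 16 (List.replicate a true)) := by
          intro a
          induction a with
          | zero =>
            refine ⟨.skip, fun n c hc => (Det.skip c).of_eq (by simp) ?_⟩
            exact (setB_self hc.b16).symm
          | succ a ih =>
            obtain ⟨P, hP⟩ := ih
            refine ⟨.seq P (.push 16 true), fun n c hc => ?_⟩
            refine ((hP n c hc).seq (Det.push _ _ _)).of_eq (by omega) ?_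
            rw [setB_setB, Cfg.setB_bits, if_pos rfl, List.replicate_succ]
        obtain ⟨P, hP⟩ := this a
        refine ⟨P, ((2 * a + 1 : ℕ) : Polynomial ℕ), fun n c hc => ?_⟩
        simpa using hP n c hc
      | succ k ih =>
        obtain ⟨P, T, hP⟩ := ih
        -- Multiplication by `n` in unary: the old value becomes a loop counter in the stack `17`,
        -- and each round appends a copy of the security parameter to the stack `16`.
        refine ⟨.seq P (.seq (mvB 16 17) (loop 17 (cpB 0 16 4))),
          T + (5 * (Polynomial.C a * Polynomial.X ^ k) + 1 +
            (Polynomial.C a * Polynomial.X ^ k * (12 * Polynomial.X + 3 + 3) + 1) + 1) + 1,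
          fun n c hc => ?_⟩
        have e1 := hP n c hc
        have e2 := mvB_det (c.setB 16 (List.replicate (a * n ^ k) true)) (r := 16) (r' := 17)
          (by decide)
        have e3 := loop_det (u := 17) (P := cpB 0 16 4) (T := 12 * n + 3) (k := a * n ^ k)
          (g := fun i => c.setB 16 (List.replicate (i * n) true)) fun i j hi => by
            refine (cpB_det _ (by decide) (by decide) (by decide) ?_).of_eq ?_ ?_
            · simp [Cfg.setB_bits, hc.b4]
            · simp [Cfg.setB_bits, hc.param]
            · ext1
              · funext t
                simp only [Cfg.setB_bits]
                split_ifs <;> simp_all [hc.param, add_mul, add_comm]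
              · rfl
        have e4 : ((c.setB 16 (List.replicate (a * n ^ k) true)).setB 16 []).setB 17
            (((c.setB 16 (List.replicate (a * n ^ k) true)).bits 16).reverse ++
              (c.setB 16 (List.replicate (a * n ^ k) true)).bits 17)
            = (c.setB 16 (List.replicate (0 * n) true)).setB 17
              (List.replicate (a * n ^ k) true) := by
          simp [Cfg.setB_bits, hc.b17, setB_setB]
        rw [e4] at e2
        refine (e1.seq (e2.seq e3)).of_eq ?_ ?_
        · simp [Cfg.setB_bits]
        · rw [setB_self (r := 17), pow_succ, mul_assoc]
          simp [Cfg.setB_bits, hc.b17]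
    obtain ⟨P, T, hP⟩ := key k
    refine ⟨.seq P (mvB 16 r), T + (5 * (Polynomial.C a * Polynomial.X ^ k) + 1) + 1,
      fun n c hc => ?_⟩
    refine ((hP n c hc).seq (mvB_det _ (by omega))).of_eq ?_ ?_
    · simp [Cfg.setB_bits]
    · rw [setB_setB, setB_self (r := 16) hc.b16]
      simp [Cfg.setB_bits, h5]

/-! ### Calls -/

theorem QPTAlg.exists_run (A : QPTAlg) : ∃ (P : Prog) (T : Polynomial ℕ),
    ∀ (n : ℕ) (x : List Bool) (d : QL) (c : Cfg), c.Std n →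
      Spec [P] ((c.setB 19 x).setQ 3 d) (T.eval (n + x.length + d.length))
        ((A.den n x d).map fun a => (c.setB 19 a.1).setQ 3 a.2) := by
  obtain ⟨T, hT⟩ := A.call_spec
  refine ⟨.seq (cpB 0 18 4) A.call, (12 * Polynomial.X + 3) + T + 1, fun n x d c hc => ?_⟩
  have h1 := cpB_det ((c.setB 19 x).setQ 3 d) (r := 0) (r' := 18) (t := 4) (by decide) (by decide)
    (by decide) (by simp [Cfg.setB_bits, hc.b4])
  refine ((h1.of_eq le_rfl ?_).spec_seq (hT n x d c hc.clean)).mono ?_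
  · ext1
    · funext t
      simp only [Cfg.setB_bits, Cfg.setQ_bits]
      have := hc.clean.1 18 le_rfl
      split_ifs <;> simp_all [hc.param]
    · rfl
  · simp only [Cfg.setB_bits, Cfg.setQ_bits, hc.param]
    simp
    omega

/-- The classical output. -/
def QPTAlg.cls (A : QPTAlg) (n : ℕ) (x : List Bool) (d : QL) : W (List Bool) :=
  (A.den n x d).bind fun a => W.single (dg a.2) a.1

theorem QPTAlg.mem_cls {A : QPTAlg} {n : ℕ} {x : List Bool} {d : QL} {y : List Bool} :
    W.Mem y (A.cls n x d) ↔ ∃ e, W.Mem (y, e) (A.den n x d) := by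
  simp only [QPTAlg.cls, W.mem_bind, W.mem_single]
  constructor
  · rintro ⟨a, h, rfl⟩
    exact ⟨_, h⟩
  · rintro ⟨e, h⟩
    exact ⟨_, h, rfl⟩

theorem QPTAlg.cls_ex (A : QPTAlg) (n : ℕ) (x : List Bool) (d : QL) (F : List Bool → ℂ) :
    (A.cls n x d).ex F = (A.den n x d).ex fun a => F a.1 * dg a.2 := by
  simp [QPTAlg.cls, mul_comm]

/-- Run an algorithm for its classical output. -/
theorem QPTAlg.exists_cls (A : QPTAlg) : ∃ (P : Prog) (T : Polynomial ℕ),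
    ∀ (n : ℕ) (x : List Bool) (d : QL) (c : Cfg), c.Std n →
      Spec [P] ((c.setB 19 x).setQ 3 d) (T.eval (n + x.length + d.length))
        ((A.cls n x d).map fun y => c.setB 19 y) := by
  obtain ⟨P, T, hP⟩ := A.exists_run
  refine ⟨.seq P (clrQ 3), T + (2 * (Polynomial.X + A.time) + 1) + 1, fun n x d c hc => ?_⟩
  have h := Spec.seq_map (hP n x d c hc) (Q := clrQ 3)
    (m := 2 * (n + x.length + d.length + A.time.eval (n + x.length + d.length)) + 1)
    (M := fun a => W.single (dg a.2) (c.setB 19 a.1)) fun a ha => by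
      have h1 := clrQ_spec ((c.setB 19 a.1).setQ 3 a.2) 3
      rw [setQ_setQ, setQ_self (c := c.setB 19 a.1) (hc.clean.2 3 le_rfl), Cfg.setQ_q,
        if_pos rfl] at h1
      exact h1.mono (by have := (A.length_den ha).2; omega)
  rw [QPTAlg.cls, W.map_bind]
  simp only [W.map_single]
  exact h.mono (by simp)

/-! ### Key generation, state generation and verification as subroutines. -/

namespace StateGenerator

variable (G : StateGenerator)

/-- The random key. -/
def kg (n : ℕ) : W (List Bool) := G.keyGen.cls n [] []

/-- The random dyad of the state of a key. -/
def sg (n : ℕ) (k : List Bool) : W QL := (G.stateGen.den n k []).map Prod.snd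

theorem length_kg {n : ℕ} {y : List Bool} (h : W.Mem y (G.kg n)) : y.length = G.keyLen n := by
  obtain ⟨e, he⟩ := QPTAlg.mem_cls.1 h
  obtain ⟨c, hc, h1, -⟩ := QPTAlg.final_of_mem_den _ noQubits rfl he
  exact (congrArg List.length h1).symm.trans (G.keyGen_length n c hc)

theorem length_sg {n : ℕ} {k : List Bool} (hk : k.length = G.keyLen n) {d : QL}
    (h : W.Mem d (G.sg n k)) : d.length = G.stateLen n := by
  obtain ⟨a, ha, rfl⟩ := W.mem_map.1 h
  obtain ⟨c, hc, -, h1⟩ := QPTAlg.final_of_mem_den _ noQubits rfl ha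
  exact h1.symm.trans (G.stateGen_length n k hk c hc)

theorem kg_one (n : ℕ) : (G.kg n).ex (fun _ => 1) = 1 := by
  rw [kg, QPTAlg.cls_ex]
  simpa using G.keyGen.den_trace n [] []

theorem sg_dg (n : ℕ) (k : List Bool) : (G.sg n k).ex dg = 1 := by
  rw [sg, W.ex_map]
  simpa using G.stateGen.den_trace n k []

/-- The two lengths are arbitrary functions in the definition. They are polynomially bounded because
they are lengths of actual outputs of polynomial-time algorithms, which exist as the total weight is
`1`. -/
theorem exists_bound : ∃ B : Polynomial ℕ, ∀ n, G.keyLen n ≤ B.eval n ∧ G.stateLen n ≤ B.eval n := by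
  have h1 : ∀ n, G.keyLen n ≤ (Polynomial.X + G.keyGen.time).eval n := by
    intro n
    have : ∃ y, W.Mem y (G.kg n) := by
      by_contra! h
      have := G.kg_one n
      rw [W.ex_congr (G := fun _ => 0) fun a ha => absurd ha (h a), W.ex_zero] at this
      exact zero_ne_one this
    obtain ⟨y, hy⟩ := this
    obtain ⟨e, he⟩ := QPTAlg.mem_cls.1 hy
    rw [← G.length_kg hy]
    simpa using (G.keyGen.length_den he).1
  refine ⟨Polynomial.X + G.keyGen.time + (Polynomial.X + G.stateGen.time).comp
    (Polynomial.X + (Polynomial.X + G.keyGen.time)), fun n => ⟨?_, ?_⟩⟩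
  · have := h1 n
    rw [Polynomial.eval_add]
    omega
  -- Any string of the right length may serve as a key here.
  · have : ∃ y, W.Mem y (G.sg n (List.replicate (G.keyLen n) true)) := by
      by_contra! h
      have := G.sg_dg n (List.replicate (G.keyLen n) true)
      rw [W.ex_congr (G := fun _ => 0) fun a ha => absurd ha (h a), W.ex_zero] at this
      exact zero_ne_one this
    obtain ⟨y, hy⟩ := this
    rw [← G.length_sg (by simp) hy]
    obtain ⟨a, ha, rfl⟩ := W.mem_map.1 hy
    have h2 := (G.stateGen.length_den ha).2
    have h3 := monotone_eval_nat (Polynomial.X + G.stateGen.time)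
      (show n + G.keyLen n ≤ n + (Polynomial.X + G.keyGen.time).eval n by have := h1 n; omega)
    simp at h2 h3 ⊢
    omega

/-- Push a random key, reversed. -/
theorem exists_pushKey (r : ℕ) (hr : Free r) : ∃ (P : Prog) (T : Polynomial ℕ),
    ∀ n c, Cfg.Std n c → Spec [P] c (T.eval n)
      ((G.kg n).map fun y => c.setB r (y.reverse ++ c.bits r)) := by
  obtain ⟨P, T, hP⟩ := G.keyGen.exists_cls
  obtain ⟨B, hB⟩ := G.exists_bound
  have hr18 := hr.1
  refine ⟨.seq P (mvB 19 r), T + (5 * B + 1) + 1, fun n c hc => ?_⟩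
  have h1 := hP n [] [] c hc
  rw [setB_self (c := c) (hc.clean.1 19 (by omega)), setQ_self (c := c) (hc.clean.2 3 le_rfl)] at h1
  have h := Spec.seq_map h1 (Q := mvB 19 r) (m := 5 * B.eval n + 1)
    (M := fun y => W.pure (c.setB r (y.reverse ++ c.bits r))) fun y hy => by
      refine (mvB_det _ (by omega)).of_eq ?_ ?_
      · have := G.length_kg hy
        have := (hB n).1
        simp only [Cfg.setB_bits, if_true]
        omega
      · rw [setB_setB, setB_self (c := c) (hc.clean.1 19 (by omega)), Cfg.setB_bits, if_pos rfl,
          Cfg.setB_bits, if_neg (by omega)]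
  rw [W.bind_pure] at h
  exact h.mono (by simp)

theorem exists_state : ∃ (P : Prog) (T : Polynomial ℕ),
    ∀ n k c, k.length = G.keyLen n → Cfg.Std n c → Spec [P] (c.setB 19 k) (T.eval n)
      ((G.sg n k).map fun d => c.setQ 3 d) := by
  obtain ⟨P, T, hP⟩ := G.stateGen.exists_run
  obtain ⟨B, hB⟩ := G.exists_bound
  refine ⟨.seq P (clrB 19), T.comp (Polynomial.X + B)
    + (2 * (Polynomial.X + G.stateGen.time).comp (Polynomial.X + B) + 1) + 1,
    fun n k c hk hc => ?_⟩
  have h1 := hP n k [] c hc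
  rw [setQ_self (c := c.setB 19 k) (hc.clean.2 3 le_rfl)] at h1
  have hle : n + k.length + ([] : QL).length ≤ n + B.eval n := by
    have := (hB n).1
    simp
    omega
  have h := Spec.seq_map h1 (Q := clrB 19)
    (m := 2 * (Polynomial.X + G.stateGen.time).eval (n + B.eval n) + 1)
    (M := fun a => W.pure (c.setQ 3 a.2)) fun a ha => by
      refine (clrB_det _ 19).of_eq ?_ ?_
      · have h2 := (G.stateGen.length_den ha).1
        have h3 := monotone_eval_nat (Polynomial.X + G.stateGen.time) hle
        simp only [Polynomial.eval_add, Polynomial.eval_X] at h3 ⊢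
        simp only [Cfg.setQ_bits, Cfg.setB_bits, if_true]
        omega
      · ext1
        · funext t
          have := hc.clean.1 19 (by omega)
          simp only [Cfg.setB_bits, Cfg.setQ_bits]
          split_ifs <;> simp_all
        · rfl
  rw [sg, W.map_map]
  rw [W.bind_pure] at h
  refine h.mono ?_
  have := monotone_eval_nat T hle
  simp only [Polynomial.eval_add, Polynomial.eval_comp, Polynomial.eval_X, Polynomial.eval_mul,
    Polynomial.eval_ofNat, Polynomial.eval_one] at this ⊢
  omega

/-- Push the state of a key, reversed. -/
theorem exists_pushState (s : ℕ) (hs : s < 2) : ∃ (P : Prog) (T : Polynomial ℕ),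
    ∀ n k c, k.length = G.keyLen n → Cfg.Std n c → Spec [P] (c.setB 19 k) (T.eval n)
      ((G.sg n k).map fun d => c.setQ s (d.reverse ++ c.q s)) := by
  obtain ⟨P, T, hP⟩ := G.exists_state
  obtain ⟨B, hB⟩ := G.exists_bound
  refine ⟨.seq P (mvQ 3 s), T + (2 * B + 1) + 1, fun n k c hk hc => ?_⟩
  have h := Spec.seq_map (hP n k c hk hc) (Q := mvQ 3 s) (m := 2 * B.eval n + 1)
    (M := fun d => W.pure (c.setQ s (d.reverse ++ c.q s))) fun d hd => by
      refine (mvQ_det _ (by omega)).of_eq ?_ ?_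
      · have := G.length_sg hk hd
        have := (hB n).2
        simp only [Cfg.setQ_q, if_true]
        omega
      · rw [setQ_setQ, setQ_self (c := c) (hc.clean.2 3 le_rfl), Cfg.setQ_q, if_pos rfl,
          Cfg.setQ_q, if_neg (by omega)]
  rw [W.bind_pure] at h
  exact h.mono (by simp)

/-- Verify, and run a program if the verification fails. -/
theorem exists_verify (P : Prog) (g : Cfg → Cfg) (hP : ∀ c, Det P c 1 (g c)) :
    ∃ (Q : Prog) (T : Polynomial ℕ),
    ∀ n k d c, k.length = G.keyLen n → d.length ≤ G.stateLen n → Cfg.Std n c →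
      Spec [Q] ((c.setB 19 k).setQ 3 d) (T.eval n)
      ((G.ver.cls n k d).map fun y => if y.head? = some true then c else g c) := by
  obtain ⟨Q, T, hQ⟩ := G.ver.exists_cls
  obtain ⟨B, hB⟩ := G.exists_bound
  refine ⟨.seq Q (.ite 19 (clrB 19) (.seq (clrB 19) P)), T.comp (Polynomial.X + 2 * B)
    + (2 * (Polynomial.X + G.ver.time).comp (Polynomial.X + 2 * B) + 1 + 1 + 1 + 1) + 1,
    fun n k d c hk hd hc => ?_⟩
  have hle : n + k.length + d.length ≤ n + 2 * B.eval n := by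
    have := hB n
    omega
  have h := Spec.seq_map (hQ n k d c hc) (Q := .ite 19 (clrB 19) (.seq (clrB 19) P))
    (m := 2 * (Polynomial.X + G.ver.time).eval (n + 2 * B.eval n) + 1 + 1 + 1 + 1)
    (M := fun y => W.pure (if y.head? = some true then c else g c)) fun y hy => by
      obtain ⟨e, he⟩ := QPTAlg.mem_cls.1 hy
      have h2 := (G.ver.length_den he).1
      have h3 := monotone_eval_nat (Polynomial.X + G.ver.time) hle
      simp only [Polynomial.eval_add, Polynomial.eval_X] at h3 ⊢
      have h4 := (clrB_det (c.setB 19 y) 19)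
      rw [setB_setB, setB_self (c := c) (hc.clean.1 19 (by omega)), Cfg.setB_bits, if_pos rfl] at h4
      rcases y with _ | ⟨_ | _, y⟩
      · rw [if_neg (by simp)]
        exact (Spec.ite_false (by simp [Cfg.setB_bits]) (h4.seq (hP c))).mono
          (by simp only [List.length_nil] at *; omega)
      · rw [if_neg (by simp)]
        exact (Spec.ite_false (by simp [Cfg.setB_bits]) (h4.seq (hP c))).mono
          (by simp only at *; omega)
      · rw [if_pos (by simp)]
        exact (Spec.ite_true (by simp [Cfg.setB_bits]) h4).mono
          (by simp only at *; omega)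
  rw [W.bind_pure] at h
  refine h.mono ?_
  have := monotone_eval_nat T hle
  simp only [Polynomial.eval_add, Polynomial.eval_comp, Polynomial.eval_X, Polynomial.eval_mul,
    Polynomial.eval_ofNat, Polynomial.eval_one] at this ⊢
  omega

end StateGenerator

/-- Empty the stack `r`, pushing as many ones on `r'`. -/
def count (r r' : ℕ) : Prog := .whileBits r (.seq (.pop r) (.push r' true))

theorem count_det (c : Cfg) {r r' : ℕ} (h : r ≠ r') :
    Det (count r r') c (4 * (c.bits r).length + 1)
      ((c.setB r []).setB r' (List.replicate (c.bits r).length true ++ c.bits r')) := by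
  generalize hl : c.bits r = l
  induction l generalizing c with
  | nil =>
    have : (c.setB r []).setB r' (List.replicate ([] : List Bool).length true ++ c.bits r') = c := by
      rw [setB_self hl]
      exact setB_self rfl
    rw [this]
    exact Spec.whileBits_nil hl
  | cons b l ih =>
    have h2 := ih (c := (c.setB r l).setB r' (true :: c.bits r')) (by simp [Cfg.setB_bits, h])
    have h1 := (Det.pop c r).seq (Det.push _ r' true)
    rw [hl] at h1
    have e : (c.setB r (b :: l).tail).setB r' (true :: (c.setB r (b :: l).tail).bits r')
      = (c.setB r l).setB r' (true :: c.bits r') := by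
      simp [Cfg.setB_bits, h.symm]
    rw [e] at h1
    have h' : Det (count r r') c _ _ := Spec.whileBits_cons_det (by simp [hl]) h1 h2
    refine h'.of_eq (by simp only [List.length_cons]; omega) ?_
    ext1
    · funext t
      simp only [Cfg.setB_bits]
      split_ifs <;> simp_all [List.replicate_succ']
    · rfl

/-- Discard the quantum stack `s`, pushing as many ones on `r`. -/
def countQ (s r : ℕ) : Prog := .whileQubits s (.seq (.discard s) (.push r true))

theorem countQ_spec (c : Cfg) (s r : ℕ) :
    Spec [countQ s r] c (4 * (c.q s).length + 1)
      (W.single (dg (c.q s)) ((c.setQ s []).setB r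
        (List.replicate (c.q s).length true ++ c.bits r))) := by
  generalize hl : c.q s = l
  induction l generalizing c with
  | nil =>
    have : (c.setQ s []).setB r (List.replicate ([] : QL).length true ++ c.bits r) = c := by
      rw [setQ_self hl]
      exact setB_self rfl
    rw [this, dg_nil]
    exact Spec.whileQubits_nil hl
  | cons p l ih =>
    have hd : Spec [Prog.discard s] c 1 (W.single (if p.1 = p.2 then 1 else 0) (c.setQ s l)) := by
      refine (Spec.first (L := W.single (if p.1 = p.2 then 1 else 0) ([], c.setQ s l)) (n := 0)
        (f := fun t => W.pure t.2) ?_ fun t ht => ?_).conv (fun a ha => ?_) fun F => ?_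
      · simp [wexec, hl]
      · rw [W.mem_single] at ht
        subst ht
        exact Spec.nil _ _
      · simpa using ha
      · simp
    have hd2 : Spec [(Prog.discard s).seq (.push r true)] c 3 ((W.single (if p.1 = p.2 then 1 else 0)
        (c.setQ s l)).bind fun c' => W.pure (c'.setB r (true :: c'.bits r))) :=
      Spec.seq hd fun c' _ => Det.push c' r true
    rw [W.bind_pure, W.map_single, Cfg.setQ_bits] at hd2
    have h := ih ((c.setQ s l).setB r (true :: c.bits r)) (by simp [Cfg.setQ_q])
    have e : (((c.setQ s l).setB r (true :: c.bits r)).setQ s []).setB r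
        (List.replicate l.length true ++ ((c.setQ s l).setB r (true :: c.bits r)).bits r)
        = (c.setQ s []).setB r (List.replicate (l.length + 1) true ++ c.bits r) := by
      ext1
      · funext t
        simp only [Cfg.setB_bits, Cfg.setQ_bits]
        split_ifs <;> simp_all [List.replicate_succ']
      · funext t
        simp only [Cfg.setB_q, Cfg.setQ_q]
        split_ifs <;> simp_all
    rw [e] at h
    refine ((Spec.whileQubits_cons (f := fun _ => W.single (dg l)
      ((c.setQ s []).setB r (List.replicate (l.length + 1) true ++ c.bits r))) (by simp [hl]) hd2
      (m := 4 * l.length + 1) fun c' hc' => ?_).mono ?_).conv (fun a ha => ?_) fun F => ?_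
    · rw [W.mem_single] at hc'
      subst hc'
      exact h
    · simp only [List.length_cons]
      omega
    · simpa using ha
    · simp [dg_cons]

/-- The memory in which the lengths of keys and states are available in unary. -/
structure StateGenerator.Par (G : StateGenerator) (n : ℕ) (c : Cfg) : Prop where
  std : c.Std n
  b2 : c.bits 2 = List.replicate (G.keyLen n) true
  b3 : c.bits 3 = List.replicate (G.stateLen n) true

namespace StateGenerator

variable {G : StateGenerator}

theorem Par.setB {n : ℕ} {c : Cfg} (h : G.Par n c) {r : ℕ} (hr : Free r) (h2 : r ≠ 2) (h3 : r ≠ 3)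
    (l : List Bool) : G.Par n (c.setB r l) :=
  ⟨h.std.setB hr l, by rw [Cfg.setB_bits, if_neg h2.symm, h.b2],
    by rw [Cfg.setB_bits, if_neg h3.symm, h.b3]⟩

theorem Par.setQ {n : ℕ} {c : Cfg} (h : G.Par n c) {s : ℕ} (hs : s < 2) (l : QL) :
    G.Par n (c.setQ s l) := ⟨h.std.setQ hs l, h.b2, h.b3⟩

variable (G)

/-- Write the lengths of keys and states. -/
theorem exists_prep : ∃ (P : Prog) (T : Polynomial ℕ), ∀ n c, Cfg.Std n c → c.bits 2 = [] →
    c.bits 3 = [] → c.bits 6 = [] →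
    Det P c (T.eval n) ((c.setB 2 (List.replicate (G.keyLen n) true)).setB 3
      (List.replicate (G.stateLen n) true)) := by
  obtain ⟨B, hB⟩ := G.exists_bound
  obtain ⟨P, T, hP⟩ := G.exists_pushKey 6 (by decide)
  obtain ⟨Q, T', hQ⟩ := G.exists_state
  -- The key length is found by drawing a key and counting its bits. The drawn key is forgotten, and
  -- since its total weight is `1`, the outcome is deterministic.
  have h1 : ∀ n c, Cfg.Std n c → c.bits 2 = [] → c.bits 6 = [] →
      Det (P.seq (count 6 2)) c (T.eval n + (4 * B.eval n + 1) + 1)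
        (c.setB 2 (List.replicate (G.keyLen n) true)) := by
    intro n c hc h2 h6
    refine (Spec.seq_map (hP n c hc) (Q := count 6 2) (m := 4 * B.eval n + 1)
      (M := fun _ => W.pure (c.setB 2 (List.replicate (G.keyLen n) true))) fun y hy => ?_).conv
      (fun a ha => ?_) fun F => ?_
    · have hl := G.length_kg hy
      have := (hB n).1
      refine (count_det _ (by decide)).of_eq ?_ ?_
      · simp only [Cfg.setB_bits, if_true, h6, List.append_nil, List.length_reverse]
        omega
      · rw [setB_setB, setB_self (c := c) h6, Cfg.setB_bits, if_pos rfl, Cfg.setB_bits, h6, h2]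
        simp [hl]
    · simp only [W.mem_bind] at ha
      obtain ⟨_, -, h⟩ := ha
      exact h
    · simp only [W.ex_bind, W.ex_pure]
      have := W.ex_mul_right (G.kg n) (F (c.setB 2 (List.replicate (G.keyLen n) true))) fun _ => 1
      rw [G.kg_one] at this
      simpa using this
  -- The number of qubits is found by preparing the state of the key `1…1` and counting while
  -- discarding; the trace of this state is `1`.
  have h2 : ∀ n c, Cfg.Std n c → c.bits 2 = List.replicate (G.keyLen n) true → c.bits 3 = [] →
      Det (.seq (cpB 2 19 4) (.seq Q (countQ 3 3))) c ((12 * B.eval n + 3) +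
        (T'.eval n + (4 * B.eval n + 1) + 1) + 1)
        (c.setB 3 (List.replicate (G.stateLen n) true)) := by
    intro n c hc h2 h3
    have e := cpB_det c (r := 2) (r' := 19) (t := 4) (by decide) (by decide) (by decide) hc.b4
    rw [h2, hc.clean.1 19 (by omega), List.append_nil] at e
    have := hB n
    refine (e.spec_seq (Spec.seq_map (hQ n (List.replicate (G.keyLen n) true) c (by simp) hc)
      (Q := countQ 3 3) (m := 4 * B.eval n + 1)
      (M := fun d => W.single (dg d) (c.setB 3 (List.replicate (G.stateLen n) true)))
      fun y hy => ?_)).mono ?_ |>.conv (fun a ha => ?_) fun F => ?_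
    · have hl := G.length_sg (by simp) hy
      have h4 := countQ_spec (c.setQ 3 y) 3 3
      rw [setQ_setQ, setQ_self (c := c) (hc.clean.2 3 le_rfl), Cfg.setQ_q, if_pos rfl,
        Cfg.setQ_bits, h3, List.append_nil, hl] at h4
      exact h4.mono (by omega)
    · simp only [List.length_replicate]
      omega
    · simp only [W.mem_bind, W.mem_single] at ha
      obtain ⟨_, -, h⟩ := ha
      exact W.mem_pure.2 h
    · simp only [W.ex_bind, W.ex_pure, W.ex_single]
      rw [W.ex_mul_right, G.sg_dg, one_mul]
  refine ⟨.seq (P.seq (count 6 2)) (.seq (cpB 2 19 4) (.seq Q (countQ 3 3))),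
    (T + (4 * B + 1) + 1) + ((12 * B + 3) + (T' + (4 * B + 1) + 1) + 1) + 1,
    fun n c hc e2 e3 e6 => ?_⟩
  refine ((h1 n c hc e2 e6).seq (h2 n _ (hc.setB (by decide) _) ?_ ?_)).of_eq (by simp) rfl
  · simp [Cfg.setB_bits]
  · simp [Cfg.setB_bits, e3]

/-- Take the qubits of a state from the stack `0`. -/
theorem exists_takeQ : ∃ (P : Prog) (T : Polynomial ℕ), ∀ n c, G.Par n c → ∀ k,
    Det P (c.setB 19 k) (T.eval n) (((c.setQ 0 ((c.q 0).drop (G.stateLen n))).setB 19 k).setQ 3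
      ((c.q 0).take (G.stateLen n))) := by
  obtain ⟨B, hB⟩ := G.exists_bound
  -- The detour through the quantum stack `2` undoes the reversal. The counter is copied first,
  -- because the loop consumes it.
  refine ⟨.seq (cpB 3 5 4) (.seq (tkQ 5 0 2) (mvQ 2 3)),
    (12 * B + 3) + ((4 * B + 1) + (2 * B + 1) + 1) + 1, fun n c hc k => ?_⟩
  have h1 := cpB_det (c.setB 19 k) (r := 3) (r' := 5) (t := 4) (by decide) (by decide) (by decide)
    (by simp [Cfg.setB_bits, hc.std.b4])
  have h2 := tkQ_det ((c.setB 19 k).setB 5 ((c.setB 19 k).bits 3 ++ (c.setB 19 k).bits 5)) (u := 5)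
    (s := 0) (s' := 2) (k := G.stateLen n) (by decide)
    (by simp [Cfg.setB_bits, hc.b3, hc.std.b5])
  have hb := (hB n).2
  refine (h1.seq (h2.seq (mvQ_det _ (s := 2) (s' := 3) (by decide)))).of_eq ?_ ?_
  · simp [Cfg.setB_bits, Cfg.setQ_q, hc.b3, hc.std.q2]
    have : min (G.stateLen n) (c.q 0).length ≤ B.eval n := (min_le_left _ _).trans hb
    omega
  · ext1
    · funext t
      have := hc.std.b5
      simp only [Cfg.setB_bits, Cfg.setQ_bits]
      split_ifs <;> simp_all
    · funext t
      have := hc.std.q2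
      have := hc.std.clean.2 3 le_rfl
      simp only [Cfg.setQ_q, Cfg.setB_q]
      split_ifs <;> simp_all

/-- Take a key from the stack `r`. -/
theorem exists_takeKey (r : ℕ) (hr : Free r) : ∃ (P : Prog) (T : Polynomial ℕ),
    ∀ n c, G.Par n c → Det P c (T.eval n) ((c.setB r ((c.bits r).drop (G.keyLen n))).setB 19
      (tr (G.keyLen n) (c.bits r) [])) := by
  obtain ⟨B, hB⟩ := G.exists_bound
  obtain ⟨g1, g2, g3, g4, g5, g6⟩ := hr
  refine ⟨.seq (cpB 2 5 4) (tkB 5 r 19), (12 * B + 3) + (7 * B + 1) + 1, fun n c hc => ?_⟩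
  have h1 := cpB_det c (r := 2) (r' := 5) (t := 4) (by decide) (by decide) (by decide) hc.std.b4
  have h2 := tkB_det (c.setB 5 (c.bits 2 ++ c.bits 5)) (u := 5) (r := r) (r' := 19)
    (k := G.keyLen n) (by omega) (by decide) (by omega) (by simp [Cfg.setB_bits, hc.b2, hc.std.b5])
  have hb := (hB n).1
  refine (h1.seq h2).of_eq ?_ ?_
  · simp [hc.b2]
    omega
  · ext1
    · funext t
      have := hc.std.b5
      have := hc.std.clean.1 19 (by omega)
      simp only [Cfg.setB_bits]
      split_ifs <;> simp_all
    · rfl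

end StateGenerator

/-! ### Algorithms from programs -/

/-- The way back from verified dyad programs to algorithms of the model. The specification is
required for all inputs, since an algorithm has to halt on all of them. -/
theorem QPTAlg.exists_of_spec {P : Prog} {T : Polynomial ℕ}
    {L : ℕ → List Bool → QL → W Cfg}
    (h : ∀ n x d, Spec [P] (dinit n x d) (T.eval (n + x.length + d.length)) (L n x d)) :
    ∃ A : QPTAlg, ∀ n x d,
      (∀ F, (A.den n x d).ex F = (L n x d).ex fun c => jk c * F (c.bits 1, c.q 0)) ∧
      ∀ a, W.Mem a (A.den n x d) → ∃ c, W.Mem c (L n x d) ∧ a = (c.bits 1, c.q 0) := by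
  refine ⟨⟨P, T, fun n x N ρ c hc => ?_⟩, fun n x d => ⟨fun F => ?_, fun a ha => ?_⟩⟩
  -- Any dyad on `N` qubits would do, as halting does not depend on the state.
  · have hs := QPTAlg.sim_initial P n x N ρ (List.replicate N (false, false)) (by simp)
    obtain ⟨t, h1, h2, -⟩ := (sim_run _ hs).1 c hc
    rw [h2]
    have := (h n x (List.replicate N (false, false))).1 t
    simp only [List.length_replicate] at this
    exact (this h1).1
  · simp only [QPTAlg.den, QPTAlg.wfin, W.ex_bind, W.ex_single]
    exact (h n x d).2 fun c => jk c * F (c.bits 1, c.q 0)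
  · simp only [QPTAlg.den, QPTAlg.wfin, W.mem_bind, W.mem_single] at ha
    obtain ⟨t, ht, rfl⟩ := ha
    exact ⟨t.2, ((h n x d).1 t ht).2, rfl⟩

theorem std_dinit (n : ℕ) (x : List Bool) (d : QL) : Cfg.Std n (dinit n x d) := by
  refine ⟨⟨fun r hr => ?_, fun s hs => ?_⟩, rfl, rfl, rfl, rfl, rfl, rfl⟩
  · simp only [dinit]
    rw [if_neg (by omega), if_neg (by omega)]
  · simp only [dinit]
    rw [if_neg (by omega)]

theorem jk_eq_one {c : Cfg} (h : ∀ s, s ≠ 0 → c.q s = []) : jk c = 1 := by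
  unfold jk
  rw [if_pos]
  intro s hs p hp
  rw [h s hs] at hp
  simp at hp

/-- The encoding of a list of keys. -/
def enc (ks : List (List Bool)) : List Bool := (ks.map List.reverse).flatten

/-! ### Lists of keys, their states, and their verification. -/

namespace StateGenerator

variable (G : StateGenerator)

/-- A list of random keys. -/
def kgs (n a : ℕ) : W (List (List Bool)) := W.iter (fun ks => (G.kg n).map fun k => k :: ks) a []

theorem mem_kgs {n a : ℕ} {ks : List (List Bool)} (h : W.Mem ks (G.kgs n a)) :
    ks.length = a ∧ ∀ k ∈ ks, k.length = G.keyLen n := by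
  have key : ∀ a l, (∀ k ∈ l, k.length = G.keyLen n) → ∀ ks,
      W.Mem ks (W.iter (fun ks => (G.kg n).map fun k => k :: ks) a l) →
      ks.length = a + l.length ∧ ∀ k ∈ ks, k.length = G.keyLen n := by
    intro a
    induction a with
    | zero =>
      intro l hl ks hks
      rw [W.iter, W.mem_pure] at hks
      subst hks
      exact ⟨by simp, hl⟩
    | succ a ih =>
      intro l hl ks hks
      simp only [W.iter, W.mem_bind, W.mem_map] at hks
      obtain ⟨_, ⟨k, hk, rfl⟩, hks⟩ := hks
      have := ih (k :: l) (by
        simp only [List.mem_cons, forall_eq_or_imp]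
        exact ⟨G.length_kg hk, hl⟩) ks hks
      refine ⟨?_, this.2⟩
      rw [this.1, List.length_cons]
      ring
  exact key a [] (by simp) ks h

theorem length_enc {κ : ℕ} {ks : List (List Bool)} (h : ∀ k ∈ ks, k.length = κ) :
    (enc ks).length = ks.length * κ := by
  induction ks with
  | nil => simp [enc]
  | cons k ks ih =>
    simp only [List.mem_cons, forall_eq_or_imp] at h
    have := ih h.2
    simp only [enc, List.map_cons, List.flatten_cons, List.length_append, List.length_reverse,
      List.length_cons] at this ⊢
    rw [this, h.1]
    ring

/-- Push random keys on the stack `r`. -/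
theorem exists_pushKeys (r u : ℕ) (hr : Free r) (hu : Free u) (hur : u ≠ r) :
    ∃ (P : Prog) (T : Polynomial ℕ), ∀ n a c, Cfg.Std n c → c.bits r = [] →
      Spec [P] (c.setB u (List.replicate a true)) (a * T.eval n + 1)
        ((G.kgs n a).map fun ks => (c.setB r (enc ks)).setB u []) := by
  obtain ⟨P, T, hP⟩ := G.exists_pushKey r hr
  refine ⟨loop u P, T + 3, fun n a c hc h0 => ?_⟩
  have h := loop_spec (u := u) (P := P) (T := T.eval n) (g := fun ks => c.setB r (enc ks))
    (step := fun ks => (G.kg n).map fun k => k :: ks) (Ok := fun _ _ => True) (fun k ks _ => by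
      have := hP n ((c.setB r (enc ks)).setB u (List.replicate k true))
        ((hc.setB hr _).setB hu _)
      rw [W.map_map]
      convert this using 3 with y
      ext1
      · funext t
        simp only [Cfg.setB_bits]
        split_ifs <;> simp_all [enc]
      · rfl) (fun _ _ _ _ _ => trivial) a [] trivial
  rw [show c.setB r (enc []) = c from setB_self h0] at h
  simpa [kgs] using h

/-- One step of the generation of states: take a key from the first list, and put its state on
top of the second one. -/
def stStep (n : ℕ) (s : List Bool × QL) : W (List Bool × QL) :=
  (G.sg n (tr (G.keyLen n) s.1 [])).map fun d => (s.1.drop (G.keyLen n), d.reverse ++ s.2)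

/-- The states of several keys. -/
def sgs (n : ℕ) : List (List Bool) → W QL
  | [] => W.pure []
  | k :: ks => (G.sg n k).bind fun d => (sgs n ks).map fun e => d ++ e

/-- Each key in `enc ks` is reversed and taking it reverses it again, so the right keys are used, in
order. The accumulated dyad is reversed because stacks grow at the top. -/
theorem iter_stStep (n : ℕ) (ks : List (List Bool)) (hks : ∀ k ∈ ks, k.length = G.keyLen n)
    (x : List Bool) (acc : QL) : W.iter (G.stStep n) ks.length (enc ks ++ x, acc)
      = (G.sgs n ks).map fun d => (x, d.reverse ++ acc) := by
  induction ks generalizing acc with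
  | nil => rfl
  | cons k ks ih =>
    simp only [List.mem_cons, forall_eq_or_imp] at hks
    have e1 : tr (G.keyLen n) (enc (k :: ks) ++ x) [] = k := by
      have := tr_reverse k (enc ks ++ x) []
      rw [hks.1] at this
      simpa [enc] using this
    have e2 : (enc (k :: ks) ++ x).drop (G.keyLen n) = enc ks ++ x := by
      simp only [enc, List.map_cons, List.flatten_cons, List.append_assoc]
      rw [← hks.1, ← List.length_reverse, List.drop_left]
    rw [List.length_cons, W.iter, stStep]
    simp only
    rw [e1, e2, W.bind_map, sgs, W.map_bind]
    simp only [ih hks.2, W.map_map, List.reverse_append, List.append_assoc]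

/-- No assumption on the string of keys is needed: a string that is too short is padded with zeros,
and state generation has the prescribed output length on every string of key length. -/
theorem iter_stStep_length (n a : ℕ) (s s' : List Bool × QL)
    (h : W.Mem s' (W.iter (G.stStep n) a s)) : s'.2.length = a * G.stateLen n + s.2.length := by
  induction a generalizing s with
  | zero =>
    rw [W.iter, W.mem_pure] at h
    simp [h]
  | succ a ih =>
    simp only [W.iter, stStep, W.mem_bind, W.mem_map] at h
    obtain ⟨_, ⟨d, hd, rfl⟩, h⟩ := h
    rw [ih _ h]
    simp only [List.length_append, List.length_reverse]
    rw [G.length_sg (by simp [length_tr]) hd]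
    ring

/-- Push the states of the keys in the stack `r` on the quantum stack `1`. -/
theorem exists_pushStates (r u : ℕ) (hr : Free r) (hu : Free u) (hur : u ≠ r) (hr2 : r ≠ 2)
    (hr3 : r ≠ 3) (hu2 : u ≠ 2) (hu3 : u ≠ 3) :
    ∃ (P : Prog) (T : Polynomial ℕ), ∀ n a c, G.Par n c →
      Spec [P] (c.setB u (List.replicate a true)) (a * T.eval n + 1)
        ((W.iter (G.stStep n) a (c.bits r, c.q 1)).map fun s =>
          ((c.setB r s.1).setQ 1 s.2).setB u []) := by
  obtain ⟨P, T, hP⟩ := G.exists_takeKey r hr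
  obtain ⟨Q, T', hQ⟩ := G.exists_pushState 1 (by omega)
  refine ⟨loop u (P.seq Q), T + T' + 1 + 3, fun n a c hc => ?_⟩
  have h := loop_spec (u := u) (P := P.seq Q) (T := T.eval n + T'.eval n + 1)
    (g := fun s : List Bool × QL => (c.setB r s.1).setQ 1 s.2)
    (step := G.stStep n) (Ok := fun _ _ => True) (fun k s _ => by
      have hc' := (((hc.setB hr hr2 hr3 s.1).setQ (s := 1) (by omega) s.2).setB hu hu2 hu3
        (List.replicate k true))
      have h1 := hP n _ hc'
      have h2 := hQ n (tr (G.keyLen n) s.1 [])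
        ((((c.setB r s.1).setQ 1 s.2).setB u (List.replicate k true)).setB r
          (s.1.drop (G.keyLen n))) (by simp [length_tr]) (hc'.setB hr hr2 hr3 _).std
      simp only [Cfg.setB_bits, Cfg.setQ_bits, if_neg hur.symm, if_pos] at h1
      have h3 := h1.spec_seq h2
      rw [stStep, W.map_map]
      convert h3 using 3 with y
      ext1
      · funext t
        simp only [Cfg.setB_bits, Cfg.setQ_bits]
        split_ifs <;> simp_all
      · funext t
        simp only [Cfg.setB_q, Cfg.setQ_q]
        split_ifs <;> simp_all) (fun _ _ _ _ _ => trivial) a (c.bits r, c.q 1) trivial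
  rw [show (c.setB r (c.bits r)).setQ 1 (c.q 1) = c by
    rw [setB_self rfl]; exact setQ_self rfl] at h
  simpa using h

/-- One step of the verification of several states. -/
def verStep (n : ℕ) (s : List Bool × QL × List Bool) : W (List Bool × QL × List Bool) :=
  (G.ver.cls n (tr (G.keyLen n) s.1 []) (s.2.1.take (G.stateLen n))).map fun y =>
    (s.1.drop (G.keyLen n), s.2.1.drop (G.stateLen n),
      if y.head? = some true then s.2.2 else true :: s.2.2)

theorem exists_verify_all :
    ∃ (P : Prog) (T : Polynomial ℕ), ∀ n a c, G.Par n c →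
      Spec [P] (c.setB 6 (List.replicate a true)) (a * T.eval n + 1)
        ((W.iter (G.verStep n) a (c.bits 1, c.q 0, c.bits 15)).map fun s =>
          (((c.setB 1 s.1).setQ 0 s.2.1).setB 15 s.2.2).setB 6 []) := by
  obtain ⟨P, T, hP⟩ := G.exists_takeKey 1 (by decide)
  obtain ⟨Q, T', hQ⟩ := G.exists_takeQ
  obtain ⟨R, T'', hR⟩ := G.exists_verify (.push 15 true) (fun c => c.setB 15 (true :: c.bits 15))
    fun c => Det.push c _ _
  refine ⟨loop 6 (P.seq (Q.seq R)), T + (T' + T'' + 1) + 1 + 3, fun n a c hc => ?_⟩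
  have h := loop_spec (u := 6) (P := P.seq (Q.seq R))
    (T := T.eval n + (T'.eval n + T''.eval n + 1) + 1)
    (g := fun s : List Bool × QL × List Bool => ((c.setB 1 s.1).setQ 0 s.2.1).setB 15 s.2.2)
    (step := G.verStep n) (Ok := fun _ _ => True) (fun k s _ => by
      have hc' := ((((hc.setB (r := 1) (by decide) (by decide) (by decide) s.1).setQ (s := 0)
        (by omega) s.2.1).setB (r := 15) (by decide) (by decide) (by decide) s.2.2).setB (r := 6)
        (by decide) (by decide) (by decide) (List.replicate k true))
      have h1 := hP n _ hc'
      have hc2 := hc'.setB (r := 1) (by decide) (by decide) (by decide) (s.1.drop (G.keyLen n))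
      have h2 := hQ n _ hc2 (tr (G.keyLen n) s.1 [])
      have hc3 := hc2.setQ (s := 0) (by omega) (s.2.1.drop (G.stateLen n))
      have h3 := hR n (tr (G.keyLen n) s.1 []) (s.2.1.take (G.stateLen n)) _
        (by simp [length_tr]) (by simp) hc3.std
      simp [Cfg.setB_bits, Cfg.setQ_q] at h1 h2
      have h4 := h1.spec_seq (h2.spec_seq h3)
      rw [verStep, W.map_map]
      convert h4 using 3 with y
      split_ifs
      all_goals
        ext1
        · funext t
          simp only [Cfg.setB_bits, Cfg.setQ_bits]
          split_ifs <;> simp_all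
        · funext t
          simp only [Cfg.setB_q, Cfg.setQ_q]
          split_ifs <;> simp_all) (fun _ _ _ _ _ => trivial) a (c.bits 1, c.q 0, c.bits 15) trivial
  rw [show ((c.setB 1 (c.bits 1)).setQ 0 (c.q 0)).setB 15 (c.bits 15) = c by
    rw [setB_self (r := 1) rfl, setQ_self rfl]; exact setB_self rfl] at h
  simpa using h

end StateGenerator

/-- Inputs that an algorithm is not supposed to receive are removed at the start, so that its
running time can be bounded on all inputs. -/
theorem clr_input (n : ℕ) (x : List Bool) (d : QL) :
    Spec [.seq (clrQ 0) (clrB 1)] (dinit n x d) (2 * d.length + 2 * x.length + 3)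
      (W.single (dg d) (dinit n [] [])) := by
  have h := Spec.seq_map (α := Cfg) (L := W.single (dg d) ((dinit n x d).setQ 0 [])) (g := id)
    (Q := clrB 1) (m := 2 * x.length + 1) (M := fun _ => W.pure (dinit n [] []))
    (by rw [W.map_single]; exact clrQ_spec (dinit n x d) 0) fun a ha => by
      rw [W.mem_single] at ha
      subst ha
      refine (clrB_det _ 1).of_eq (by simp [dinit]) ?_
      ext1
      · funext t
        simp only [dinit, id, Cfg.setB_bits, Cfg.setQ_bits]
        split_ifs <;> simp_all
      · funext t
        simp only [dinit, id, Cfg.setB_q, Cfg.setQ_q]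
        split_ifs <;> simp_all
  rw [W.bind_pure, W.map_single] at h
  exact h.mono (by simp [dinit]; omega)

/-! ### The algorithms of the repeated generator. -/

namespace StateGenerator

variable (G : StateGenerator)

theorem exists_keyGens (N : Polynomial ℕ) : ∃ A : QPTAlg, ∀ n,
    (∀ F, (A.den n [] []).ex F = (G.kgs n (N.eval n)).ex fun ks => F (enc ks, [])) ∧
    ∀ a, W.Mem a (A.den n [] []) → ∃ ks, W.Mem ks (G.kgs n (N.eval n)) ∧ a = (enc ks, []) := by
  obtain ⟨P, T, hP⟩ := exists_setPoly N 6 (by decide)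
  obtain ⟨Q, T', hQ⟩ := G.exists_pushKeys 1 6 (by decide) (by decide) (by decide)
  have key : ∀ n x d, Spec [.seq (.seq (clrQ 0) (clrB 1)) (.seq P Q)] (dinit n x d)
      ((4 * Polynomial.X + 3 + (T + (N * T' + 1) + 1) + 1).eval (n + x.length + d.length))
      ((W.single (dg d) ()).bind fun _ => (G.kgs n (N.eval n)).map fun ks =>
        ((dinit n [] []).setB 1 (enc ks)).setB 6 []) := by
    intro n x d
    have h1 := hP n _ (std_dinit n [] [])
    rw [show (dinit n [] []).bits 6 = [] from rfl, List.append_nil] at h1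
    have h2 := h1.spec_seq (hQ n (N.eval n) _ (std_dinit n [] []) rfl)
    have h3 := Spec.seq_map (α := Unit) (L := W.single (dg d) ()) (g := fun _ => dinit n [] [])
      (clr_input n x d) (fun _ _ => h2)
    refine h3.mono ?_
    have := monotone_eval_nat (T + (N * T' + 1) + 1)
      (show n ≤ n + x.length + d.length by omega)
    simp at this ⊢
    omega
  obtain ⟨A, hA⟩ := QPTAlg.exists_of_spec key
  refine ⟨A, fun n => ⟨fun F => ?_, fun a ha => ?_⟩⟩
  · rw [(hA n [] []).1]
    simp only [W.ex_bind, W.ex_map, W.ex_single, dg_nil, one_mul]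
    refine W.ex_congr fun ks _ => ?_
    rw [jk_eq_one]
    · simp [Cfg.setB_bits, dinit]
    · intro s _
      simp [dinit]
  · obtain ⟨c, hc, rfl⟩ := (hA n [] []).2 a ha
    simp only [W.mem_bind, W.mem_map] at hc
    obtain ⟨_, _, ks, hks, rfl⟩ := hc
    exact ⟨ks, hks, by simp [Cfg.setB_bits, dinit]⟩

theorem prep_dinit {G : StateGenerator} {P : Prog} {T : Polynomial ℕ}
    (hP : ∀ n c, Cfg.Std n c → c.bits 2 = [] → c.bits 3 = [] → c.bits 6 = [] →
      Det P c (T.eval n) ((c.setB 2 (List.replicate (G.keyLen n) true)).setB 3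
        (List.replicate (G.stateLen n) true))) (n : ℕ) (x : List Bool) (d : QL) :
    ∃ c, Det P (dinit n x d) (T.eval n) c ∧ G.Par n c ∧ c.bits 1 = x ∧
      (∀ r, 6 ≤ r → c.bits r = []) ∧ c.q 0 = d ∧ ∀ s, s ≠ 0 → c.q s = [] := by
  refine ⟨_, hP n _ (std_dinit n x d) rfl rfl rfl, ⟨?_, ?_, ?_⟩, ?_, ?_, rfl, ?_⟩
  · exact ((std_dinit n x d).setB (by decide) _).setB (by decide) _
  · simp [Cfg.setB_bits]
  · simp [Cfg.setB_bits]
  · simp [Cfg.setB_bits, dinit]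
  · intro r hr
    simp only [Cfg.setB_bits, dinit]
    rw [if_neg (by omega), if_neg (by omega), if_neg (by omega), if_neg (by omega)]
  · intro s hs
    simp [dinit, hs]

theorem exists_stateGens (N : Polynomial ℕ) : ∃ A : QPTAlg, ∀ n x,
    (∀ F : QL → ℂ, (A.den n x []).ex (fun a => F a.2)
      = (W.iter (G.stStep n) (N.eval n) (x, [])).ex fun s => F s.2.reverse) ∧
    ∀ a, W.Mem a (A.den n x []) → a.2.length = N.eval n * G.stateLen n := by
  obtain ⟨P0, T0, hP0⟩ := G.exists_prep
  obtain ⟨P, T, hP⟩ := exists_setPoly N 6 (by decide)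
  obtain ⟨Q, T', hQ⟩ := G.exists_pushStates 1 6 (by decide) (by decide) (by decide) (by decide)
    (by decide) (by decide) (by decide)
  obtain ⟨B, hB⟩ := G.exists_bound
  have key : ∀ n x d, ∃ L : W Cfg, Spec [.seq (clrQ 0) (.seq P0 (.seq P (.seq Q (mvQ 1 0)))) ]
      (dinit n x d)
      ((2 * Polynomial.X + 1 + (T0 + (T + (N * T' + 1 + (2 * (N * B) + 1) + 1) + 1) + 1) + 1).eval
        (n + x.length + d.length)) L ∧
      (∀ F : QL → ℂ, (L.ex fun c => jk c * F (c.q 0)) = dg d *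
        (W.iter (G.stStep n) (N.eval n) (x, [])).ex fun s => F s.2.reverse) ∧
      ∀ c, W.Mem c L → (c.q 0).length = N.eval n * G.stateLen n := by
    intro n x d
    obtain ⟨c, h0, hpar, c1, c6, cq0, cq⟩ := prep_dinit hP0 n x []
    have h1 := hP n _ hpar.std
    rw [c6 6 le_rfl, List.append_nil] at h1
    have h2 := hQ n (N.eval n) c hpar
    rw [c1, cq 1 (by omega)] at h2
    have hlen := fun s' hs' => G.iter_stStep_length n (N.eval n) (x, []) s' hs'
    have h3 := Spec.seq_map h2 (Q := mvQ 1 0) (m := 2 * (N * B).eval n + 1)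
      (M := fun s => W.pure (((c.setB 1 s.1).setQ 0 s.2.reverse).setB 6 [])) fun s hs => by
        refine (mvQ_det _ (by omega)).of_eq ?_ ?_
        · have e := hlen s hs
          have : N.eval n * G.stateLen n ≤ N.eval n * B.eval n := Nat.mul_le_mul_left _ (hB n).2
          simp only [Cfg.setB_q, Cfg.setQ_q, if_true, Polynomial.eval_mul] at e ⊢
          rw [e]
          simp only [List.length_nil]
          omega
        · ext1
          · funext t
            simp only [Cfg.setB_bits, Cfg.setQ_bits]
          · funext t
            have := cq 1 (by omega)
            simp only [Cfg.setB_q, Cfg.setQ_q]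
            split_ifs <;> simp_all
    rw [W.bind_pure] at h3
    have h4 := Spec.seq_map (α := Unit) (L := W.single (dg d) ()) (g := fun _ => dinit n x [])
      (Q := .seq P0 (.seq P (.seq Q (mvQ 1 0)))) (n := 2 * d.length + 1) (P := clrQ 0)
      (c := dinit n x d) (by
        have := clrQ_spec (dinit n x d) 0
        refine this.conv (fun a ha => ?_) fun F => ?_
        · rw [W.mem_single] at ha
          rw [W.map_single, W.mem_single, ha]
          ext1
          · rfl
          · funext t
            simp only [dinit, Cfg.setQ_q]
            split_ifs <;> rfl
        · have e : (dinit n x d).setQ 0 [] = dinit n x [] := by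
            ext1
            · rfl
            · funext t
              simp only [dinit, Cfg.setQ_q]
              split_ifs <;> rfl
          rw [W.map_single, W.ex_single, W.ex_single, e]
          rfl) (fun _ _ => h0.spec_seq (h1.spec_seq h3))
    refine ⟨_, h4.mono ?_, fun F => ?_, fun c' hc' => ?_⟩
    · have := monotone_eval_nat (T0 + (T + (N * T' + 1 + (2 * (N * B) + 1) + 1) + 1) + 1)
        (show n ≤ n + x.length + d.length by omega)
      simp at this ⊢
      omega
    · simp only [W.ex_bind, W.ex_map, W.ex_single]
      congr 1
      refine W.ex_congr fun s _ => ?_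
      rw [jk_eq_one]
      · simp [Cfg.setQ_q]
      · intro t ht
        simp [Cfg.setQ_q, ht, cq t ht]
    · simp only [W.mem_bind, W.mem_map] at hc'
      obtain ⟨_, _, s, hs, rfl⟩ := hc'
      have := hlen s hs
      simpa [Cfg.setQ_q] using this
  choose L hL using key
  obtain ⟨A, hA⟩ := QPTAlg.exists_of_spec fun n x d => (hL n x d).1
  refine ⟨A, fun n x => ⟨fun F => ?_, fun a ha => ?_⟩⟩
  · rw [(hA n x []).1, (hL n x []).2.1]
    simp
  · obtain ⟨c, hc, rfl⟩ := (hA n x []).2 a ha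
    exact (hL n x []).2.2 c hc

/-- The failure stack holds ones only, so reading its top bit, which counts as `0` if missing,
decides whether it is empty. The bound on the key string pays for clearing it. -/
theorem verStep_ok (n a : ℕ) (s s' : List Bool × QL × List Bool) (hs : ∀ b ∈ s.2.2, b = true)
    (h : W.Mem s' (W.iter (G.verStep n) a s)) :
    s'.1.length ≤ s.1.length ∧ ∀ b ∈ s'.2.2, b = true := by
  refine W.iter_ok (Ok := fun s' : List Bool × QL × List Bool =>
    s'.1.length ≤ s.1.length ∧ ∀ b ∈ s'.2.2, b = true) (fun t ht t' ht' => ?_) a s ⟨le_rfl, hs⟩ s' h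
  simp only [verStep, W.mem_map] at ht'
  obtain ⟨y, -, rfl⟩ := ht'
  refine ⟨?_, ?_⟩
  · simp only [List.length_drop]
    omega
  · simp only
    split_ifs
    · exact ht.2
    · simp only [List.mem_cons, forall_eq_or_imp, true_and]
      exact ht.2

theorem exists_vers (N : Polynomial ℕ) : ∃ A : QPTAlg, ∀ n x d,
    ((A.den n x d).ex fun a => (if a.1.head? = some true then 1 else 0) * dg a.2)
      = (W.iter (G.verStep n) (N.eval n) (x, d, [])).ex fun s =>
        if s.2.2 = [] then dg s.2.1 else 0 := by
  obtain ⟨P0, T0, hP0⟩ := G.exists_prep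
  obtain ⟨P, T, hP⟩ := exists_setPoly N 6 (by decide)
  obtain ⟨Q, T', hQ⟩ := G.exists_verify_all
  have key : ∀ n x d, ∃ L : W Cfg, Spec [.seq P0 (.seq P (.seq Q (.ite 15 (clrB 1) (.push 1 true))))]
      (dinit n x d)
      ((T0 + (T + (N * T' + 1 + (2 * Polynomial.X + 2) + 1) + 1) + 1).eval
        (n + x.length + d.length)) L ∧
      (L.ex fun c => jk c * ((if (c.bits 1).head? = some true then 1 else 0) * dg (c.q 0))) =
        (W.iter (G.verStep n) (N.eval n) (x, d, [])).ex fun s =>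
          if s.2.2 = [] then dg s.2.1 else 0 := by
    intro n x d
    obtain ⟨c, h0, hpar, c1, c6, cq0, cq⟩ := prep_dinit hP0 n x d
    have h1 := hP n _ hpar.std
    rw [c6 6 le_rfl, List.append_nil] at h1
    have h2 := hQ n (N.eval n) c hpar
    rw [c1, cq0, c6 15 (by omega)] at h2
    have hok := fun s' hs' => G.verStep_ok n (N.eval n) (x, d, []) s' (by simp) hs'
    -- Without a failure, a `1` is put on top of the output. Otherwise the output is emptied, which
    -- counts as rejection; the remaining key string alone might begin with `1`.
    have h3 := Spec.seq_map h2 (Q := .ite 15 (clrB 1) (.push 1 true)) (m := 2 * x.length + 2)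
      (M := fun s => W.pure ((((c.setB 1 (if s.2.2 = [] then true :: s.1 else [])).setQ 0 s.2.1).setB
        15 s.2.2).setB 6 [])) fun s hs => by
        obtain ⟨o1, o2⟩ := hok s hs
        rcases h : s.2.2 with _ | ⟨b, l⟩
        · refine (Spec.ite_false (by simp [Cfg.setB_bits])
            (Det.of_eq (Det.push _ 1 true) (m := 2 * x.length + 1) (by omega) ?_))
          ext1
          · funext t
            simp only [Cfg.setB_bits, Cfg.setQ_bits]
            split_ifs <;> simp_all
          · rfl
        · have hb : b = true := o2 b (by simp [h])
          subst hb
          refine (Spec.ite_true (by simp [Cfg.setB_bits])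
            (Det.of_eq (clrB_det _ 1) (m := 2 * x.length + 1) ?_ ?_))
          · simp [Cfg.setB_bits]
            exact o1
          · ext1
            · funext t
              simp only [Cfg.setB_bits, Cfg.setQ_bits]
              split_ifs <;> simp_all
            · rfl
    rw [W.bind_pure] at h3
    refine ⟨_, (h0.spec_seq (h1.spec_seq h3)).mono ?_, ?_⟩
    · have := monotone_eval_nat (T0 + T + N * T') (show n ≤ n + x.length + d.length by omega)
      simp at this ⊢
      omega
    · simp only [W.ex_map]
      refine W.ex_congr fun s _ => ?_
      rw [jk_eq_one]
      · by_cases h : s.2.2 = [] <;> simp [Cfg.setQ_q, Cfg.setB_bits, h]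
      · intro t ht
        simp [Cfg.setQ_q, ht, cq t ht]
  choose L hL using key
  obtain ⟨A, hA⟩ := QPTAlg.exists_of_spec fun n x d => (hL n x d).1
  refine ⟨A, fun n x d => ?_⟩
  rw [(hA n x d).1 fun a => (if a.1.head? = some true then 1 else 0) * dg a.2, (hL n x d).2]

/-- The repetition of a state generator. -/
theorem exists_repeat (N : Polynomial ℕ) : ∃ G' : StateGenerator,
    (∀ n, G'.keyLen n = N.eval n * G.keyLen n) ∧
    (∀ n, G'.stateLen n = N.eval n * G.stateLen n) ∧
    (∀ n F, (G'.kg n).ex F = (G.kgs n (N.eval n)).ex fun ks => F (enc ks)) ∧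
    (∀ n ks, ks.length = N.eval n → (∀ k ∈ ks, k.length = G.keyLen n) → ∀ F,
      (G'.sg n (enc ks)).ex F = (G.sgs n ks).ex F) ∧
    ∀ n x d, ((G'.ver.den n x d).ex fun a => (if a.1.head? = some true then 1 else 0) * dg a.2)
      = (W.iter (G.verStep n) (N.eval n) (x, d, [])).ex fun s =>
        if s.2.2 = [] then dg s.2.1 else 0 := by
  obtain ⟨K, hK⟩ := G.exists_keyGens N
  obtain ⟨S, hS⟩ := G.exists_stateGens N
  obtain ⟨V, hV⟩ := G.exists_vers N
  refine ⟨⟨fun n => N.eval n * G.keyLen n, fun n => N.eval n * G.stateLen n, K, S, V, ?_, ?_⟩,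
    fun _ => rfl, fun _ => rfl, fun n F => ?_, fun n ks h1 h2 F => ?_, hV⟩
  · intro n c hc
    obtain ⟨a, ha, h1, -⟩ := QPTAlg.den_of_mem_final K (d := []) rfl hc
    obtain ⟨ks, hks, rfl⟩ := (hK n).2 a ha
    rw [h1, length_enc (G.mem_kgs hks).2, (G.mem_kgs hks).1]
  · intro n k _ c hc
    obtain ⟨a, ha, -, h1⟩ := QPTAlg.den_of_mem_final S (d := []) rfl hc
    rw [h1, (hS n k).2 a ha]
  · rw [kg, QPTAlg.cls_ex]
    simp only
    rw [(hK n).1]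
    simp
  · rw [sg, W.ex_map]
    simp only
    rw [(hS n (enc ks)).1]
    have := G.iter_stStep n ks h2 [] []
    rw [h1, List.append_nil] at this
    rw [this, W.ex_map]
    simp

end StateGenerator

/-! ### The adversary against one instance: copies of a product state, candidates and tests. -/

namespace StateGenerator

variable (G : StateGenerator)

theorem exists_keysAt (r u : ℕ) (hr : Free r) (h6 : 6 ≠ r) (hu4 : u ≠ 4) (hu6 : u ≠ 6) :
    ∃ (P : Prog) (T : Polynomial ℕ), ∀ n a c, Cfg.Std n c → c.bits r = [] → c.bits 6 = [] →
      c.bits u = List.replicate a true →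
      Spec [P] c (a * T.eval n + 5) ((G.kgs n a).map fun ks => c.setB r (enc ks)) := by
  obtain ⟨P, T, hP⟩ := G.exists_pushKeys r 6 hr (by decide) h6
  refine ⟨.seq (cpB u 6 4) P, T + 12, fun n a c hc e1 e2 e3 => ?_⟩
  have h1 := cpB_det c (r := u) (r' := 6) (t := 4) hu6 hu4 (by decide) hc.b4
  rw [e2, e3, List.append_nil] at h1
  refine (h1.spec_seq (hP n a c hc e1)).mono ?_ |>.conv (fun b hb => ?_) fun F => ?_
  · simp
    ring_nf
    omega
  · rw [W.map_congr fun ks _ => setB_self (c := c.setB r (enc ks)) (r := 6) (l := [])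
      (by rw [Cfg.setB_bits, if_neg h6, e2])] at hb
    exact hb
  · rw [W.map_congr fun ks _ => setB_self (c := c.setB r (enc ks)) (r := 6) (l := [])
      (by rw [Cfg.setB_bits, if_neg h6, e2])]

/-- Pushing states consumes the list of keys and the counter. Copies in `t` and `6` are used up
instead, so the same keys are available for the next copy of the product state. -/
theorem exists_statesAt (r t u : ℕ) (ht : Free t) (h1 : 6 ≠ t) (h2 : t ≠ 2) (h3 : t ≠ 3)
    (hr4 : r ≠ 4) (hrt : r ≠ t) (hu4 : u ≠ 4) (hu6 : u ≠ 6) (hut : u ≠ t) :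
    ∃ (P : Prog) (T : Polynomial ℕ), ∀ n ks c, G.Par n c → (∀ k ∈ ks, k.length = G.keyLen n) →
      c.bits r = enc ks → c.bits t = [] → c.bits 6 = [] →
      c.bits u = List.replicate ks.length true →
      Spec [P] c (ks.length * T.eval n + 9)
        ((G.sgs n ks).map fun d => c.setQ 1 (d.reverse ++ c.q 1)) := by
  obtain ⟨P, T, hP⟩ := G.exists_pushStates t 6 ht (by decide) h1 h2 h3 (by decide) (by decide)
  obtain ⟨B, hB⟩ := G.exists_bound
  refine ⟨.seq (cpB r t 4) (.seq (cpB u 6 4) P), 12 * B + 12 + T, fun n ks c hc hks er et e6 eu => ?_⟩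
  have e1 := cpB_det c (r := r) (r' := t) (t := 4) hrt hr4 ht.2.2.1 hc.std.b4
  rw [er, et, List.append_nil] at e1
  have e2 := cpB_det (c.setB t (enc ks)) (r := u) (r' := 6) (t := 4) hu6 hu4 (by decide)
    (by rw [Cfg.setB_bits, if_neg ht.2.2.1.symm, hc.std.b4])
  rw [Cfg.setB_bits, if_neg hut, Cfg.setB_bits, if_neg h1, e6, eu, List.append_nil] at e2
  have e3 := hP n ks.length (c.setB t (enc ks)) (hc.setB ht h2 h3 _)
  have e4 := G.iter_stStep n ks hks [] (c.q 1)
  rw [List.append_nil] at e4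
  rw [Cfg.setB_bits, if_pos rfl, Cfg.setB_q, e4, W.map_map] at e3
  have hmap : ((G.sgs n ks).map fun d => ((((c.setB t (enc ks)).setB t []).setQ 1
      (d.reverse ++ c.q 1)).setB 6 [])) = (G.sgs n ks).map fun d => c.setQ 1 (d.reverse ++ c.q 1) := by
    refine W.map_congr fun d _ => ?_
    rw [setB_setB, setB_self et, setB_self]
    exact e6
  rw [hmap] at e3
  refine (e1.spec_seq (e2.spec_seq e3)).mono ?_
  have := Nat.mul_le_mul_left ks.length (hB n).1
  rw [length_enc hks, List.length_replicate]
  simp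
  ring_nf at this ⊢
  omega

/-- One step of the production of copies of the product state with one part taken from the
input. -/
def cpStep (n : ℕ) (pre post : List (List Bool)) (s : QL × QL) : W (QL × QL) :=
  (G.sgs n pre).bind fun e => (G.sgs n post).map fun f =>
    (s.1.drop (G.stateLen n), (e ++ s.1.take (G.stateLen n) ++ f).reverse ++ s.2)

theorem length_sgs {n : ℕ} {ks : List (List Bool)} (hks : ∀ k ∈ ks, k.length = G.keyLen n) {d : QL}
    (hd : W.Mem d (G.sgs n ks)) : d.length = ks.length * G.stateLen n := by
  induction ks generalizing d with
  | nil =>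
    rw [sgs, W.mem_pure] at hd
    simp [hd]
  | cons k ks ih =>
    simp only [List.mem_cons, forall_eq_or_imp] at hks
    simp only [sgs, W.mem_bind, W.mem_map] at hd
    obtain ⟨d', h1, e, h2, rfl⟩ := hd
    rw [List.length_append, G.length_sg hks.1 h1, ih hks.2 h2, List.length_cons]
    ring

/-- The stacks `12` and `13` hold the keys before and after the unknown one, `10` and `11` their
numbers, `14` and `15` are scratch space, and `7` counts the copies. The keys stay fixed while their
states are prepared anew each time, so the result is a number of copies of one product state. -/
theorem exists_copies :
    ∃ (P : Prog) (T : Polynomial ℕ), ∀ n pre post t c, G.Par n c →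
      (∀ k ∈ pre, k.length = G.keyLen n) → (∀ k ∈ post, k.length = G.keyLen n) →
      c.bits 12 = enc pre → c.bits 13 = enc post → c.bits 14 = [] → c.bits 15 = [] →
      c.bits 6 = [] → c.bits 7 = [] → c.bits 10 = List.replicate pre.length true →
      c.bits 11 = List.replicate post.length true →
      Spec [P] (c.setB 7 (List.replicate t true)) (t * ((pre.length + post.length + 1) * T.eval n) + 1)
        ((W.iter (G.cpStep n pre post) t (c.q 0, c.q 1)).map fun s => (c.setQ 0 s.1).setQ 1 s.2) := by
  obtain ⟨P, T1, hP⟩ := G.exists_statesAt 12 14 10 (by decide) (by decide) (by decide) (by decide)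
    (by decide) (by decide) (by decide) (by decide) (by decide)
  obtain ⟨Q, T2, hQ⟩ := G.exists_statesAt 13 15 11 (by decide) (by decide) (by decide) (by decide)
    (by decide) (by decide) (by decide) (by decide) (by decide)
  obtain ⟨R, T3, hR⟩ := G.exists_takeQ
  obtain ⟨B, hB⟩ := G.exists_bound
  refine ⟨loop 7 (.seq P (.seq R (.seq (mvQ 3 1) Q))), T1 + T2 + T3 + 2 * B + 25,
    fun n pre post t c hc hpre hpost e12 e13 e14 e15 e6 e7 e10 e11 => ?_⟩
  have h := loop_spec (u := 7) (P := .seq P (.seq R (.seq (mvQ 3 1) Q)))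
    (T := (pre.length * T1.eval n + 9) + (T3.eval n + ((2 * B.eval n + 1) +
      (post.length * T2.eval n + 9) + 1) + 1) + 1)
    (g := fun s : QL × QL => (c.setQ 0 s.1).setQ 1 s.2)
    (step := G.cpStep n pre post) (Ok := fun _ _ => True) (fun k s _ => by
      set c1 := ((c.setQ 0 s.1).setQ 1 s.2).setB 7 (List.replicate k true) with hc1
      have hp1 : G.Par n c1 := ((hc.setQ (s := 0) (by omega) s.1).setQ (s := 1)
        (by omega) s.2).setB (r := 7) (by decide) (by decide) (by decide) _
      have h1 := hP n pre c1 hp1 hpre (by simpa [hc1, Cfg.setB_bits] using e12)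
        (by simpa [hc1, Cfg.setB_bits] using e14) (by simpa [hc1, Cfg.setB_bits] using e6)
        (by simpa [hc1, Cfg.setB_bits] using e10)
      refine (Spec.seq_map (M := fun e => (G.sgs n post).map fun f =>
        ((c.setQ 0 (s.1.drop (G.stateLen n))).setQ 1
          ((e ++ s.1.take (G.stateLen n) ++ f).reverse ++ s.2)).setB 7 (List.replicate k true)) h1
        fun e he => ?_).conv (fun b hb => ?_) fun F => ?_
      · set c2 := c1.setQ 1 (e.reverse ++ c1.q 1) with hc2
        have hp2 : G.Par n c2 := hp1.setQ (by omega) _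
        have h2 := hR n c2 hp2 []
        rw [setB_self (c := c2) (hp2.std.clean.1 19 (by omega)),
          setB_self (c := c2.setQ 0 _) (r := 19) (l := []) (hp2.std.clean.1 19 (by omega))] at h2
        have e1 : c2.q 0 = s.1 := by simp [hc2, hc1, Cfg.setQ_q]
        rw [e1] at h2
        have h3 := mvQ_det ((c2.setQ 0 (s.1.drop (G.stateLen n))).setQ 3
          (s.1.take (G.stateLen n))) (s := 3) (s' := 1) (by decide)
        set c3 := (c.setQ 0 (s.1.drop (G.stateLen n))).setQ 1
          ((e ++ s.1.take (G.stateLen n)).reverse ++ s.2) |>.setB 7 (List.replicate k true) with hc3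
        have hp3 : G.Par n c3 := ((hc.setQ (s := 0) (by omega) _).setQ (s := 1)
          (by omega) _).setB (r := 7) (by decide) (by decide) (by decide) _
        have h3' := h3.of_eq (m := 2 * B.eval n + 1) (c'' := c3) (by
          have := (hB n).2
          have : min (G.stateLen n) s.1.length ≤ B.eval n := (min_le_left _ _).trans this
          simp [Cfg.setQ_q]
          omega) (by
          have := hc.std.clean.2 3 le_rfl
          ext1
          · rfl
          · funext t
            simp only [hc3, hc2, hc1, Cfg.setB_q, Cfg.setQ_q]
            split_ifs <;> simp_all)
        have h4 := hQ n post c3 hp3 hpost (by simpa [hc3, Cfg.setB_bits] using e13)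
          (by simpa [hc3, Cfg.setB_bits] using e15) (by simpa [hc3, Cfg.setB_bits] using e6)
          (by simpa [hc3, Cfg.setB_bits] using e11)
        have h5 := h2.spec_seq (h3'.spec_seq h4)
        convert h5 using 3 with f
        ext1
        · rfl
        · funext t
          simp only [hc3, Cfg.setB_q, Cfg.setQ_q]
          split_ifs <;> simp_all
      · simpa only [cpStep, W.map_bind, W.map_map] using hb
      · simp only [cpStep, W.map_bind, W.map_map])
    (fun _ _ _ _ _ => trivial) t (c.q 0, c.q 1) trivial
  rw [show (c.setQ 0 (c.q 0)).setQ 1 (c.q 1) = c by rw [setQ_self rfl]; exact setQ_self rfl] at h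
  have hmap : ∀ s : QL × QL, ((c.setQ 0 s.1).setQ 1 s.2).setB 7 [] = (c.setQ 0 s.1).setQ 1 s.2 :=
    fun s => setB_self e7
  simp only [hmap] at h
  refine h.mono ?_
  gcongr
  simp
  ring_nf
  omega

theorem length_iter_cpStep (n : ℕ) {pre post : List (List Bool)}
    (hpre : ∀ k ∈ pre, k.length = G.keyLen n) (hpost : ∀ k ∈ post, k.length = G.keyLen n)
    (t : ℕ) (s s' : QL × QL) (h : W.Mem s' (W.iter (G.cpStep n pre post) t s)) :
    s'.2.length ≤ t * ((pre.length + post.length + 1) * G.stateLen n) + s.2.length := by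
  induction t generalizing s with
  | zero =>
    rw [W.iter, W.mem_pure] at h
    simp [h]
  | succ a ih =>
    simp only [W.iter, cpStep, W.mem_bind, W.mem_map] at h
    obtain ⟨_, ⟨e, he, f, hf, rfl⟩, h⟩ := h
    have h1 := ih _ h
    have h2 := G.length_sgs hpre he
    have h3 := G.length_sgs hpost hf
    simp only [List.length_append, List.length_reverse, List.length_take] at h1
    have : min (G.stateLen n) s.1.length ≤ G.stateLen n := min_le_left _ _
    rw [h2, h3] at h1
    ring_nf at h1 ⊢
    omega

/-- The key number `a` in the string `y`. -/
def cand (n a : ℕ) (y : List Bool) : List Bool :=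
  tr (G.keyLen n) (y.drop (a * G.keyLen n)) []

theorem exists_candidate :
    ∃ (P : Prog) (T : Polynomial ℕ), ∀ n a y c, G.Par n c → c.bits 14 = [] → c.bits 15 = [] →
      c.bits 6 = [] → c.bits 10 = List.replicate a true →
      Det P (c.setB 19 y) ((a + y.length + 1) * T.eval n) (c.setB 14 (G.cand n a y)) := by
  obtain ⟨P, T, hP⟩ := G.exists_takeKey 14 (by decide)
  obtain ⟨B, hB⟩ := G.exists_bound
  -- Two moves bring the string to the stack `14` in its original order. Then `a` keys are taken and
  -- thrown away, and the next one is kept.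
  refine ⟨.seq (mvB 19 15) (.seq (mvB 15 14) (.seq (cpB 10 6 4) (.seq (loop 6 (P.seq (clrB 19)))
    (.seq P (.seq (clrB 14) (.seq (cpB 19 14 4) (clrB 19))))))), 2 * T + 28 * B + 50,
    fun n a y c hc e14 e15 e6 e10 => ?_⟩
  have h19 := hc.std.clean.1 19 (by omega)
  have hb := (hB n).1
  have h1 : Det (mvB 19 15) (c.setB 19 y) (5 * y.length + 1) (c.setB 15 y.reverse) := by
    refine (mvB_det _ (by decide)).of_eq (by simp [Cfg.setB_bits]) ?_
    rw [setB_setB, setB_self h19]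
    simp [Cfg.setB_bits, e15]
  have h2 : Det (mvB 15 14) (c.setB 15 y.reverse) (5 * y.length + 1) (c.setB 14 y) := by
    refine (mvB_det _ (by decide)).of_eq (by simp [Cfg.setB_bits]) ?_
    rw [setB_setB, setB_self e15]
    simp [Cfg.setB_bits, e14]
  have h3 : Det (cpB 10 6 4) (c.setB 14 y) (12 * a + 3)
      ((c.setB 14 (y.drop (0 * G.keyLen n))).setB 6 (List.replicate a true)) := by
    refine (cpB_det _ (by decide) (by decide) (by decide) ?_).of_eq ?_ ?_
    · simp [Cfg.setB_bits, hc.std.b4]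
    · simp [Cfg.setB_bits, e10]
    · simp [Cfg.setB_bits, e10, e6]
  have h14 : ∀ i, G.Par n (c.setB 14 (y.drop (i * G.keyLen n))) := fun i =>
    hc.setB (by decide) (by decide) (by decide) _
  have h4 := loop_det (u := 6) (P := P.seq (clrB 19)) (T := T.eval n + (2 * B.eval n + 1) + 1)
    (k := a) (g := fun i => c.setB 14 (y.drop (i * G.keyLen n))) fun i j hi => by
      have h := hP n _ ((h14 i).setB (r := 6) (by decide) (by decide) (by decide)
        (List.replicate j true))
      refine (h.seq (clrB_det _ 19)).of_eq ?_ ?_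
      · simp [Cfg.setB_bits, length_tr]
        exact hb
      · ext1
        · funext t
          simp only [Cfg.setB_bits]
          split_ifs <;> simp_all [add_mul]
        · rfl
  have h5 := hP n _ (h14 a)
  rw [setB_self (c := c.setB 14 (y.drop (a * G.keyLen n))) (r := 6) (l := [])
    (by simp [Cfg.setB_bits, e6])] at h4
  rw [setB_setB, Cfg.setB_bits, if_pos rfl] at h5
  have h6 : Det (clrB 14) ((c.setB 14 ((y.drop (a * G.keyLen n)).drop (G.keyLen n))).setB 19
      (G.cand n a y)) (2 * y.length + 1) (c.setB 19 (G.cand n a y)) := by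
    refine (clrB_det _ 14).of_eq ?_ ?_
    · simp [Cfg.setB_bits]
    · ext1
      · funext t
        simp only [Cfg.setB_bits]
        split_ifs <;> simp_all
      · rfl
  have hl : (G.cand n a y).length = G.keyLen n := by simp [cand, length_tr]
  have h7 : Det (cpB 19 14 4) (c.setB 19 (G.cand n a y)) (12 * B.eval n + 3)
      ((c.setB 19 (G.cand n a y)).setB 14 (G.cand n a y)) := by
    refine (cpB_det _ (by decide) (by decide) (by decide) ?_).of_eq ?_ ?_
    · simp [Cfg.setB_bits, hc.std.b4]
    · simp [Cfg.setB_bits, hl]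
      exact hb
    · simp [Cfg.setB_bits, e14]
  have h8 : Det (clrB 19) ((c.setB 19 (G.cand n a y)).setB 14 (G.cand n a y)) (2 * B.eval n + 1)
      (c.setB 14 (G.cand n a y)) := by
    refine (clrB_det _ 19).of_eq ?_ ?_
    · simp [Cfg.setB_bits, hl]
      exact hb
    · ext1
      · funext t
        simp only [Cfg.setB_bits]
        split_ifs <;> simp_all
      · rfl
  refine (h1.seq (h2.seq (h3.seq (h4.seq (h5.seq (h6.seq (h7.seq h8))))))).mono ?_
  simp
  ring_nf
  have hT : 0 ≤ y.length * T.eval n := Nat.zero_le _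
  have hT2 : 0 ≤ y.length * B.eval n := Nat.zero_le _
  have hT3 : 0 ≤ a * B.eval n := Nat.zero_le _
  have hT4 : 0 ≤ a * T.eval n := Nat.zero_le _
  omega

/-- One test of the key `k`; the second component counts the failures that are still allowed. -/
def testStep (n : ℕ) (k : List Bool) (s : QL × ℕ) : W (QL × ℕ) :=
  (G.ver.cls n k (s.1.take (G.stateLen n))).map fun y =>
    (s.1.drop (G.stateLen n), if y.head? = some true then s.2 else s.2 - 1)

/-- The remaining failure budget is kept in unary in the stack `15`. Removing a bit from an empty
stack does nothing, which agrees with truncated subtraction: an exhausted budget stays exhausted. -/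
theorem exists_tests (F T : Polynomial ℕ) :
    ∃ (P : Prog) (T' : Polynomial ℕ), ∀ n k c, G.Par n c → k.length = G.keyLen n →
      c.bits 15 = [] → c.bits 6 = [] →
      Spec [P] (c.setB 14 k) (T'.eval n)
        ((W.iter (G.testStep n k) (T.eval n) (c.q 0, F.eval n)).map fun s =>
          ((c.setB 14 k).setQ 0 s.1).setB 15 (List.replicate s.2 true)) := by
  obtain ⟨P1, T1, h1⟩ := exists_setPoly F 15 (by decide)
  obtain ⟨P2, T2, h2⟩ := exists_setPoly T 6 (by decide)
  obtain ⟨Q, T3, hQ⟩ := G.exists_takeQ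
  obtain ⟨R, T4, hR⟩ := G.exists_verify (.pop 15) (fun c => c.setB 15 (c.bits 15).tail)
    fun c => Det.pop c _
  obtain ⟨B, hB⟩ := G.exists_bound
  refine ⟨.seq P1 (.seq P2 (loop 6 (.seq (cpB 14 19 4) (.seq Q R)))),
    T1 + (T2 + (T * ((12 * B + 3) + (T3 + T4 + 1) + 1 + 3) + 1) + 1) + 1,
    fun n k c hc hk e15 e6 => ?_⟩
  have hc14 := hc.setB (r := 14) (by decide) (by decide) (by decide) k
  have g1 := h1 n _ hc14.std
  have g2 := h2 n _ (hc14.setB (r := 15) (by decide) (by decide) (by decide)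
    (List.replicate (F.eval n) true)).std
  rw [Cfg.setB_bits, if_neg (by decide), e15, List.append_nil] at g1
  rw [Cfg.setB_bits, if_neg (by decide), Cfg.setB_bits, if_neg (by decide), e6,
    List.append_nil] at g2
  have h := loop_spec (u := 6) (P := .seq (cpB 14 19 4) (.seq Q R))
    (T := (12 * B.eval n + 3) + (T3.eval n + T4.eval n + 1) + 1)
    (g := fun s : QL × ℕ => ((c.setB 14 k).setQ 0 s.1).setB 15 (List.replicate s.2 true))
    (step := G.testStep n k) (Ok := fun _ _ => True) (fun j s _ => by
      set c1 := (((c.setB 14 k).setQ 0 s.1).setB 15 (List.replicate s.2 true)).setB 6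
        (List.replicate j true) with hc1
      have hp1 : G.Par n c1 := ((hc14.setQ (s := 0) (by omega) _).setB (r := 15) (by decide)
        (by decide) (by decide) _).setB (r := 6) (by decide) (by decide) (by decide) _
      have e1 : Det (cpB 14 19 4) c1 (12 * B.eval n + 3) (c1.setB 19 k) := by
        have e14 : c1.bits 14 = k := by simp [hc1, Cfg.setB_bits]
        refine (cpB_det _ (by decide) (by decide) (by decide) hp1.std.b4).of_eq ?_ ?_
        · rw [e14, hk]
          have := (hB n).1
          omega
        · rw [e14, hp1.std.clean.1 19 (by omega), List.append_nil]
      have e2 := hQ n c1 hp1 k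
      have hp2 := hp1.setQ (s := 0) (by omega) ((c1.q 0).drop (G.stateLen n))
      have e3 := hR n k ((c1.q 0).take (G.stateLen n)) _ hk (by simp) hp2.std
      have hq : c1.q 0 = s.1 := by simp [hc1, Cfg.setQ_q]
      rw [hq] at e2 e3
      have e4 := e1.spec_seq (e2.spec_seq e3)
      rw [testStep, W.map_map]
      convert e4 using 3 with y
      split_ifs
      all_goals
        ext1
        · funext t
          simp only [hc1, Cfg.setB_bits, Cfg.setQ_bits]
          try (split_ifs <;> simp_all)
        · funext t
          simp only [hc1, Cfg.setB_q, Cfg.setQ_q]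
          split_ifs <;> simp_all) (fun _ _ _ _ _ => trivial) (T.eval n) (c.q 0, F.eval n) trivial
  have e0 : (c.setB 14 k).setQ 0 (c.q 0) = c.setB 14 k := setQ_self rfl
  simp only [e0] at h
  have h3 := g1.spec_seq (g2.spec_seq h)
  rw [W.map_congr fun s _ => setB_self (c := ((c.setB 14 k).setQ 0 s.1).setB 15
    (List.replicate s.2 true)) (r := 6) (l := []) (by simp [Cfg.setB_bits, e6])] at h3
  exact h3.mono (by simp)

end StateGenerator

/-! ### Attempts at all positions, and the whole adversary. -/

namespace StateGenerator

variable (G : StateGenerator)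

theorem testStep_le (n : ℕ) (k : List Bool) (T : ℕ) (s s' : QL × ℕ)
    (h : W.Mem s' (W.iter (G.testStep n k) T s)) : s'.2 ≤ s.2 := by
  refine W.iter_ok (Ok := fun s' : QL × ℕ => s'.2 ≤ s.2) (fun t ht t' ht' => ?_) T s le_rfl s' h
  simp only [testStep, W.mem_map] at ht'
  obtain ⟨y, -, rfl⟩ := ht'
  simp only
  split_ifs <;> omega

/-- Test the key number `a` in the output of the adversary, and take it over if it passes. -/
theorem exists_judge (F T : Polynomial ℕ) :
    ∃ (P : Prog) (T' : Polynomial ℕ), ∀ n a y c, G.Par n c → c.bits 14 = [] → c.bits 15 = [] →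
      c.bits 6 = [] → c.bits 10 = List.replicate a true → (c.bits 1).length ≤ G.keyLen n →
      Spec [P] (c.setB 19 y) ((a + y.length + 1) * T'.eval n)
        ((W.iter (G.testStep n (G.cand n a y)) (T.eval n) (c.q 0, F.eval n)).map fun v =>
          (c.setB 1 (if v.2 = 0 then c.bits 1 else G.cand n a y)).setQ 0 v.1) := by
  obtain ⟨P, T1, hP⟩ := G.exists_candidate
  obtain ⟨Q, T2, hQ⟩ := G.exists_tests F T
  obtain ⟨B, hB⟩ := G.exists_bound
  refine ⟨.seq P (.seq Q (.seq (.ite 15 (.seq (clrB 1) (.seq (cpB 14 1 4) (clrB 15))) .skip)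
    (clrB 14))), T1 + T2 + 16 * B + 2 * F + 20, fun n a y c hc e14 e15 e6 e10 e1 => ?_⟩
  have h1 := hP n a y c hc e14 e15 e6 e10
  have hk : (G.cand n a y).length = G.keyLen n := by simp [cand, length_tr]
  generalize G.cand n a y = k at h1 hk
  have h2 := hQ n k c hc hk e15 e6
  have hb := (hB n).1
  have h3 := Spec.seq_map h2
    (Q := .seq (.ite 15 (.seq (clrB 1) (.seq (cpB 14 1 4) (clrB 15))) .skip) (clrB 14))
    (M := fun v => W.pure ((c.setB 1 (if v.2 = 0 then c.bits 1 else k)).setQ 0 v.1))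
    (m := (2 * B.eval n + 1 + (12 * B.eval n + 3 + (2 * F.eval n + 1) + 1) + 1 + 1) +
      (2 * B.eval n + 1) + 1) fun v hv => by
      have hle := G.testStep_le n k _ _ _ hv
      simp only at hle
      refine (Det.seq (c' := ((c.setB 14 k).setB 1 (if v.2 = 0 then c.bits 1 else k)).setQ 0 v.1)
        ?_ ((clrB_det _ 14).mono ?_)).of_eq le_rfl ?_
      · rcases Nat.eq_zero_or_pos v.2 with h0 | h0
        · refine Spec.ite_false (by simp [Cfg.setB_bits, h0])
            ((Det.skip _).of_eq (by omega) ?_)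
          ext1
          · funext t
            simp only [Cfg.setB_bits, Cfg.setQ_bits]
            split_ifs <;> simp_all
          · rfl
        · refine Spec.ite_true ?_ (((clrB_det _ 1).seq ((cpB_det _ (by decide) (by decide)
            (by decide) ?_).seq (clrB_det _ 15))).of_eq ?_ ?_)
          · obtain ⟨j, hj⟩ : ∃ j, v.2 = j + 1 := ⟨v.2 - 1, by omega⟩
            simp [Cfg.setB_bits, hj, List.replicate_succ]
          · simp [Cfg.setB_bits, hc.std.b4]
          · simp [Cfg.setB_bits, hk]
            omega
          · ext1
            · funext t
              simp only [Cfg.setB_bits, Cfg.setQ_bits]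
              have : v.2 ≠ 0 := by omega
              split_ifs <;> simp_all
            · rfl
      · simp [Cfg.setB_bits, hk]
        exact hb
      · ext1
        · funext t
          simp only [Cfg.setB_bits, Cfg.setQ_bits]
          split_ifs <;> simp_all
        · rfl
  rw [W.bind_pure] at h3
  refine (h1.spec_seq h3).mono ?_
  simp
  ring_nf
  have g1 : 0 ≤ a * T2.eval n + a * B.eval n + a * F.eval n := Nat.zero_le _
  have g2 : 0 ≤ y.length * T2.eval n + y.length * B.eval n + y.length * F.eval n := Nat.zero_le _
  omega

/-- The output of the adversary, and the remaining copies, where `a` of the keys before and `b` of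
the keys after the unknown one are chosen at random. -/
def samp (A : QPTAlg) (n t a b : ℕ) (d : QL) : W (QL × List Bool) :=
  (G.kgs n a).bind fun pre => (G.kgs n b).bind fun post =>
    (W.iter (G.cpStep n pre post) t (d, [])).bind fun u =>
      (A.cls n [] u.2.reverse).map fun y => (u.1, y)

/-- The random keys are erased at the end, so the memory is ready for the next attempt. The bound on
the length of the output is what makes the subsequent search for the candidate polynomial. -/
theorem exists_samp (A : QPTAlg) (N t : Polynomial ℕ) :
    ∃ (P : Prog) (T' : Polynomial ℕ), ∀ n a b c, a + b + 1 ≤ N.eval n → G.Par n c →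
      (∀ r, r = 6 ∨ r = 7 ∨ r = 12 ∨ r = 13 ∨ r = 14 ∨ r = 15 → c.bits r = []) →
      c.bits 10 = List.replicate a true → c.bits 11 = List.replicate b true → c.q 1 = [] →
      Spec [P] c (T'.eval n)
        ((G.samp A n (t.eval n) a b (c.q 0)).map fun v => (c.setQ 0 v.1).setB 19 v.2) ∧
      ∀ v, W.Mem v (G.samp A n (t.eval n) a b (c.q 0)) → v.2.length ≤ T'.eval n := by
  obtain ⟨P1, T1, h1⟩ := G.exists_keysAt 12 10 (by decide) (by decide) (by decide) (by decide)
  obtain ⟨P2, T2, h2⟩ := G.exists_keysAt 13 11 (by decide) (by decide) (by decide) (by decide)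
  obtain ⟨P3, T3, h3⟩ := exists_setPoly t 7 (by decide)
  obtain ⟨P4, T4, h4⟩ := G.exists_copies
  obtain ⟨P5, T5, h5⟩ := A.exists_cls
  obtain ⟨B, hB⟩ := G.exists_bound
  refine ⟨.seq P1 (.seq P2 (.seq P3 (.seq P4 (.seq (mvQ 1 3) (.seq P5 (.seq (clrB 12)
    (clrB 13))))))), (N * T1 + 5) + ((N * T2 + 5) + (T3 + ((t * (N * T4) + 1) +
    ((2 * (t * (N * B)) + 1) + (T5.comp (Polynomial.X + t * (N * B)) + (2 * (N * B) + 1 +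
    (2 * (N * B) + 1) + 1) + 1) + 1) + 1) + 1) + 1) + 1 +
    (Polynomial.X + A.time).comp (Polynomial.X + t * (N * B)),
    fun n a b c hab hc he e10 e11 eq1 => ?_⟩
  have hb := hB n
  have ha : a ≤ N.eval n := by omega
  have hb' : b ≤ N.eval n := by omega
  have hu : ∀ pre post, W.Mem pre (G.kgs n a) → W.Mem post (G.kgs n b) → ∀ d u,
      W.Mem u (W.iter (G.cpStep n pre post) (t.eval n) (d, [])) →
      u.2.length ≤ t.eval n * (N.eval n * B.eval n) := by
    intro pre post hpre hpost d u hu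
    obtain ⟨p1, p2⟩ := G.mem_kgs hpre
    obtain ⟨q1, q2⟩ := G.mem_kgs hpost
    have := G.length_iter_cpStep n p2 q2 _ _ _ hu
    rw [p1, q1] at this
    simp only [List.length_nil, add_zero] at this
    exact this.trans (Nat.mul_le_mul_left _ (Nat.mul_le_mul hab hb.2))
  refine ⟨?_, fun v hv => ?_⟩
  · have k1 := h1 n a c hc.std (he 12 (by simp)) (he 6 (by simp)) e10
    have main := Spec.seq_map k1 (Q := .seq P2 (.seq P3 (.seq P4 (.seq (mvQ 1 3) (.seq P5
      (.seq (clrB 12) (clrB 13))))))) (m := (N.eval n * T2.eval n + 5) + (T3.eval n +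
        ((t.eval n * (N.eval n * T4.eval n) + 1) + ((2 * (t.eval n * (N.eval n * B.eval n)) + 1) +
        (T5.eval (n + t.eval n * (N.eval n * B.eval n)) + (2 * (N.eval n * B.eval n) + 1 +
        (2 * (N.eval n * B.eval n) + 1) + 1) + 1) + 1) + 1) + 1) + 1)
      (M := fun pre => (G.kgs n b).bind fun post =>
        (W.iter (G.cpStep n pre post) (t.eval n) (c.q 0, [])).bind fun u =>
          (A.cls n [] u.2.reverse).map fun y => (c.setQ 0 u.1).setB 19 y) fun pre hpre => by
        obtain ⟨p1, p2⟩ := G.mem_kgs hpre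
        have hc1 := hc.setB (r := 12) (by decide) (by decide) (by decide) (enc pre)
        have k2 := h2 n b _ hc1.std (by simp [Cfg.setB_bits, he 13]) (by simp [Cfg.setB_bits, he 6])
          (by simp [Cfg.setB_bits, e11])
        refine (Spec.seq_map k2 (m := T3.eval n +
          ((t.eval n * (N.eval n * T4.eval n) + 1) + ((2 * (t.eval n * (N.eval n * B.eval n)) + 1) +
          (T5.eval (n + t.eval n * (N.eval n * B.eval n)) + (2 * (N.eval n * B.eval n) + 1 +
          (2 * (N.eval n * B.eval n) + 1) + 1) + 1) + 1) + 1) + 1)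
          fun post hpost => ?_).mono (by gcongr)
        obtain ⟨q1, q2⟩ := G.mem_kgs hpost
        set c2 := (c.setB 12 (enc pre)).setB 13 (enc post) with hc2
        have hp2 : G.Par n c2 := hc1.setB (r := 13) (by decide) (by decide) (by decide) (enc post)
        have k3 := h3 n c2 hp2.std
        rw [show c2.bits 7 = [] by simp [hc2, Cfg.setB_bits, he 7], List.append_nil] at k3
        have k4 := h4 n pre post (t.eval n) c2 hp2 p2 q2 (by simp [hc2, Cfg.setB_bits])
          (by simp [hc2, Cfg.setB_bits]) (by simp [hc2, Cfg.setB_bits, he 14])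
          (by simp [hc2, Cfg.setB_bits, he 15]) (by simp [hc2, Cfg.setB_bits, he 6])
          (by simp [hc2, Cfg.setB_bits, he 7]) (by simp [hc2, Cfg.setB_bits, e10, p1])
          (by simp [hc2, Cfg.setB_bits, e11, q1])
        rw [show c2.q 0 = c.q 0 from rfl, show c2.q 1 = [] from eq1, p1, q1] at k4
        refine k3.spec_seq ((Spec.seq_map k4 (m := (2 * (t.eval n * (N.eval n * B.eval n)) + 1) +
          (T5.eval (n + t.eval n * (N.eval n * B.eval n)) + (2 * (N.eval n * B.eval n) + 1 +
          (2 * (N.eval n * B.eval n) + 1) + 1) + 1) + 1) fun u hu' => ?_).mono (by gcongr))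
        have hul := hu pre post hpre hpost _ u hu'
        have k5 : Det (mvQ 1 3) ((c2.setQ 0 u.1).setQ 1 u.2) (2 * (t.eval n * (N.eval n * B.eval n)) + 1)
            (((c2.setQ 0 u.1).setB 19 []).setQ 3 u.2.reverse) := by
          refine (mvQ_det _ (by decide)).of_eq ?_ ?_
          · simpa [Cfg.setQ_q] using hul
          · ext1
            · funext r
              have := hp2.std.clean.1 19 (by omega)
              simp only [Cfg.setB_bits, Cfg.setQ_bits]
              split_ifs <;> simp_all
            · funext r
              have := hp2.std.clean.2 3 (by omega)
              have : c2.q 1 = [] := eq1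
              simp only [Cfg.setB_q, Cfg.setQ_q]
              split_ifs <;> simp_all
        have k6 := h5 n [] u.2.reverse (c2.setQ 0 u.1) (hp2.setQ (s := 0) (by omega) _).std
        refine k5.spec_seq ((Spec.seq_map k6 (m := 2 * (N.eval n * B.eval n) + 1 +
          (2 * (N.eval n * B.eval n) + 1) + 1) (M := fun y => W.pure ((c.setQ 0 u.1).setB 19 y))
          fun y hy => ?_).mono ?_ |>.conv ?_ ?_)
        · refine ((clrB_det _ 12).seq (clrB_det _ 13)).of_eq ?_ ?_
          · have l1 := length_enc p2
            have l2 := length_enc q2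
            have l3 := Nat.mul_le_mul ha hb.1
            have l4 := Nat.mul_le_mul hb' hb.1
            rw [p1] at l1
            rw [q1] at l2
            simp [hc2, Cfg.setB_bits, l1, l2]
            omega
          · have e12 := he 12 (by simp)
            have e13 := he 13 (by simp)
            ext1
            · funext r
              simp only [hc2, Cfg.setB_bits, Cfg.setQ_bits]
              split_ifs <;> simp_all
            · rfl
        · have := monotone_eval_nat T5 (show n + ([] : List Bool).length + u.2.reverse.length ≤
            n + t.eval n * (N.eval n * B.eval n) by simpa using hul)
          simp only at this
          omega
        · intro z hz
          rwa [W.bind_pure] at hz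
        · intro F
          rw [W.bind_pure]
    refine (main.mono ?_).conv (fun z hz => ?_) fun F => ?_
    · have := Nat.mul_le_mul_right (T1.eval n) ha
      simp
      omega
    · simpa only [samp, W.map_bind, W.map_map] using hz
    · simp only [samp, W.map_bind, W.map_map]
  · simp only [samp, W.mem_bind, W.mem_map] at hv
    obtain ⟨pre, hpre, post, hpost, u, hu', y, hy, rfl⟩ := hv
    obtain ⟨e, he'⟩ := QPTAlg.mem_cls.1 hy
    have l1 := (A.length_den he').1
    have hul := hu pre post hpre hpost _ u hu'
    have l2 := monotone_eval_nat (Polynomial.X + A.time)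
      (show n + ([] : List Bool).length + u.2.reverse.length ≤
        n + t.eval n * (N.eval n * B.eval n) by simpa using hul)
    simp at l1 l2 ⊢
    omega

/-- One attempt to find a key. -/
def attempt (A : QPTAlg) (n t F T a b : ℕ) (s : List Bool × QL) : W (List Bool × QL) :=
  (G.samp A n t a b s.2).bind fun u => (W.iter (G.testStep n (G.cand n a u.2)) T (u.1, F)).map
    fun v => (if v.2 = 0 then s.1 else G.cand n a u.2, v.1)

/-- An invariant that bounds the cost of replacing the current candidate. -/
theorem length_attempt {A : QPTAlg} {n t F T a b : ℕ} {s s' : List Bool × QL}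
    (hs : s.1.length ≤ G.keyLen n) (h : W.Mem s' (G.attempt A n t F T a b s)) :
    s'.1.length ≤ G.keyLen n := by
  simp only [attempt, W.mem_bind, W.mem_map] at h
  obtain ⟨u, -, v, -, rfl⟩ := h
  simp only
  split_ifs
  · exact hs
  · simp [cand, length_tr]

/-- Several attempts with the same position of the unknown key. -/
theorem exists_attempts (A : QPTAlg) (N t F T R : Polynomial ℕ) :
    ∃ (P : Prog) (T' : Polynomial ℕ), ∀ n a b c, a + b + 1 ≤ N.eval n → G.Par n c →
      (∀ r, r = 6 ∨ r = 7 ∨ r = 8 ∨ r = 12 ∨ r = 13 ∨ r = 14 ∨ r = 15 → c.bits r = []) →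
      c.bits 10 = List.replicate a true → c.bits 11 = List.replicate b true → c.q 1 = [] →
      (c.bits 1).length ≤ G.keyLen n →
      Spec [P] c (T'.eval n)
        ((W.iter (G.attempt A n (t.eval n) (F.eval n) (T.eval n) a b) (R.eval n)
          (c.bits 1, c.q 0)).map fun v => (c.setB 1 v.1).setQ 0 v.2) := by
  obtain ⟨P, T1, h1⟩ := G.exists_samp A N t
  obtain ⟨Q, T2, h2⟩ := G.exists_judge F T
  obtain ⟨P0, T0, h0⟩ := exists_setPoly R 8 (by decide)
  refine ⟨.seq P0 (loop 8 (.seq P Q)), T0 + (R * (T1 + (N + T1 + 1) * T2 + 1 + 3) + 1) + 1,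
    fun n a b c hab hc he e10 e11 eq1 hl => ?_⟩
  have k0 := h0 n c hc.std
  rw [he 8 (by simp), List.append_nil] at k0
  have k1 := loop_spec (u := 8) (P := .seq P Q)
    (T := T1.eval n + ((N.eval n + T1.eval n + 1) * T2.eval n) + 1)
    (g := fun s : List Bool × QL => (c.setB 1 s.1).setQ 0 s.2)
    (step := G.attempt A n (t.eval n) (F.eval n) (T.eval n) a b)
    (Ok := fun _ s => s.1.length ≤ G.keyLen n) (fun k s hs => by
      set c1 := ((c.setB 1 s.1).setQ 0 s.2).setB 8 (List.replicate k true) with hc1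
      have hp1 : G.Par n c1 := ((hc.setB (r := 1) (by decide) (by decide) (by decide) _).setQ
        (s := 0) (by omega) _).setB (r := 8) (by decide) (by decide) (by decide) _
      obtain ⟨m1, m2⟩ := h1 n a b c1 hab hp1 (fun r hr => by
        have h8 : r ≠ 8 := by omega
        have h1 : r ≠ 1 := by omega
        simp [hc1, Cfg.setB_bits, h8, h1]
        exact he r (by omega)) (by simp [hc1, Cfg.setB_bits, e10])
        (by simp [hc1, Cfg.setB_bits, e11]) (by simp [hc1, Cfg.setQ_q, eq1])
      rw [show c1.q 0 = s.2 from rfl] at m1 m2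
      have m3 := Spec.seq_map m1 (Q := Q) (m := (N.eval n + T1.eval n + 1) * T2.eval n)
        (M := fun u => (W.iter (G.testStep n (G.cand n a u.2)) (T.eval n) (u.1, F.eval n)).map
          fun v => ((c.setB 1 (if v.2 = 0 then s.1 else G.cand n a u.2)).setQ 0 v.1).setB 8
            (List.replicate k true)) fun u hu => by
          have hp2 := hp1.setQ (s := 0) (by omega) u.1
          have m4 := h2 n a u.2 _ hp2 (by simp [hc1, Cfg.setB_bits, he 14])
            (by simp [hc1, Cfg.setB_bits, he 15]) (by simp [hc1, Cfg.setB_bits, he 6])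
            (by simp [hc1, Cfg.setB_bits, e10]) (by simpa [hc1, Cfg.setB_bits] using hs)
          have e1 : (c1.setQ 0 u.1).bits 1 = s.1 := by simp [hc1, Cfg.setB_bits]
          have e2 : (c1.setQ 0 u.1).q 0 = u.1 := by simp [Cfg.setQ_q]
          rw [e1, e2] at m4
          have hle : (a + u.2.length + 1) * T2.eval n ≤ (N.eval n + T1.eval n + 1) * T2.eval n := by
            have := m2 u hu
            gcongr
            omega
          convert m4.mono hle using 3 with v
          ext1
          · funext r
            simp only [hc1, Cfg.setB_bits, Cfg.setQ_bits]
            split_ifs <;> simp_all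
          · funext r
            simp only [hc1, Cfg.setB_q, Cfg.setQ_q]
            split_ifs <;> simp_all
      refine m3.conv (fun z hz => ?_) fun F => ?_
      · simpa only [attempt, W.map_bind, W.map_map] using hz
      · simp only [attempt, W.map_bind, W.map_map])
    (fun k s hs s' hs' => G.length_attempt hs hs') (R.eval n) (c.bits 1, c.q 0) hl
  rw [show (c.setB 1 (c.bits 1)).setQ 0 (c.q 0) = c by
    rw [setB_self rfl]; exact setQ_self rfl] at k1
  rw [W.map_congr fun s _ => setB_self (c := (c.setB 1 s.1).setQ 0 s.2) (r := 8) (l := [])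
    (by simp [Cfg.setB_bits, he 8])] at k1
  exact (k0.spec_seq k1).mono (by simp)

/-- The attempts with all positions of the unknown key from `s.1` on. -/
def posStep (A : QPTAlg) (n N t F T R : ℕ) (s : ℕ × List Bool × QL) : W (ℕ × List Bool × QL) :=
  (W.iter (G.attempt A n t F T s.1 (N - 1 - s.1)) R s.2).map fun v => (s.1 + 1, v)

/-- The stacks `10` and `11` hold the numbers of the keys before and after the unknown one.
Advancing the position adds one to the former and removes one from the latter. -/
theorem advance_det (c : Cfg) (l m x y k : List Bool) (d d' : QL) :
    Det (.seq (.push 10 true) (.pop 11)) (((((((c.setB 10 l).setB 11 m).setB 1 x).setQ 0 d).setB 9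
      k).setB 1 y).setQ 0 d') 3 (((((c.setB 10 (true :: l)).setB 11 m.tail).setB 1 y).setQ 0
      d').setB 9 k) := by
  refine ((Det.push _ _ _).seq (Det.pop _ _)).of_eq le_rfl ?_
  ext1
  · funext r
    simp only [Cfg.setB_bits, Cfg.setQ_bits]
    split_ifs <;> first | omega | rfl
  · funext r
    simp only [Cfg.setB_q, Cfg.setQ_q]
    split_ifs <;> rfl

/-- The memory of the adversary in the state `s`. -/
def posCfg (c : Cfg) (N : ℕ) (s : ℕ × List Bool × QL) : Cfg :=
  (((c.setB 10 (List.replicate s.1 true)).setB 11 (List.replicate (N - 1 - s.1) true)).setB 1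
    s.2.1).setQ 0 s.2.2

theorem exists_positions (A : QPTAlg) (N t F T R : Polynomial ℕ) :
    ∃ (P : Prog) (T' : Polynomial ℕ), ∀ n d c, G.Par n c →
      (∀ r, 6 ≤ r → c.bits r = []) → c.q 1 = [] →
      Spec [P] ((posCfg c (N.eval n) (0, [], d)).setB 9 (List.replicate (N.eval n) true))
        (T'.eval n) ((W.iter (G.posStep A n (N.eval n) (t.eval n) (F.eval n) (T.eval n) (R.eval n))
        (N.eval n) (0, [], d)).map fun s => (posCfg c (N.eval n) s).setB 9 []) := by
  obtain ⟨P3, T3, h3⟩ := G.exists_attempts A N t F T R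
  refine ⟨loop 9 (.seq P3 (.seq (.push 10 true) (.pop 11))), N * (T3 + 3 + 1 + 3) + 1,
    fun n d c hpar c6 cq => ?_⟩
  -- The invariant `s.1 + k = N` guarantees that, while rounds remain, the position is less than
  -- `N`, so the keys before, at and after it number `N`.
  refine (loop_spec (u := 9) (P := .seq P3 (.seq (.push 10 true) (.pop 11)))
      (T := T3.eval n + 3 + 1) (g := posCfg c (N.eval n))
      (step := G.posStep A n (N.eval n) (t.eval n) (F.eval n) (T.eval n) (R.eval n))
      (Ok := fun k s => s.1 + k = N.eval n ∧ s.2.1.length ≤ G.keyLen n) (fun k s hs => ?_)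
      (fun k s hs s' hs' => ?_) (N.eval n) (0, [], d) ⟨by simp, by simp⟩).mono (by simp)
  · obtain ⟨hs1, hs2⟩ := hs
    set c2 := (posCfg c (N.eval n) s).setB 9 (List.replicate k true) with hc2
    have hp2 : G.Par n c2 := ((((hpar.setB (r := 10) (by decide) (by decide) (by decide)
      _).setB (r := 11) (by decide) (by decide) (by decide) _).setB (r := 1) (by decide)
      (by decide) (by decide) _).setQ (s := 0) (by omega) _).setB (r := 9) (by decide)
      (by decide) (by decide) _
    have m1 := h3 n s.1 (N.eval n - 1 - s.1) c2 (by omega) hp2 (fun r hr => by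
      have e1 : r ≠ 1 := by omega
      have e9 : r ≠ 9 := by omega
      have e10 : r ≠ 10 := by omega
      have e11 : r ≠ 11 := by omega
      simp only [hc2, posCfg, Cfg.setB_bits, Cfg.setQ_bits, if_neg e1, if_neg e9, if_neg e10,
        if_neg e11]
      exact c6 r (by omega)) (by simp [hc2, posCfg, Cfg.setB_bits])
      (by simp [hc2, posCfg, Cfg.setB_bits])
      (by simp [hc2, posCfg, Cfg.setQ_q, cq]) (by simpa [hc2, posCfg, Cfg.setB_bits] using hs2)
    rw [show c2.bits 1 = s.2.1 by simp [hc2, posCfg, Cfg.setB_bits],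
      show c2.q 0 = s.2.2 from rfl] at m1
    have m2 := Spec.seq_map m1 (Q := .seq (.push 10 true) (.pop 11)) (m := 3)
      (M := fun v => W.pure ((posCfg c (N.eval n) (s.1 + 1, v)).setB 9 (List.replicate k true)))
      fun v hv => by
        refine (advance_det c _ _ _ _ _ _ _).of_eq le_rfl ?_
        have e : List.replicate (N.eval n - 1 - (s.1 + 1)) true
            = (List.replicate (N.eval n - 1 - s.1) true).tail := by
          rw [List.tail_replicate]
          congr 1
        rw [posCfg, e, List.replicate_succ]
    rw [W.bind_pure] at m2
    rw [posStep, W.map_map]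
    exact m2
  · simp only [posStep, W.mem_map] at hs'
    obtain ⟨v, hv, rfl⟩ := hs'
    refine ⟨by simp only; omega, ?_⟩
    exact W.iter_ok (Ok := fun v : List Bool × QL => v.1.length ≤ G.keyLen n)
      (fun _ h _ h' => G.length_attempt h h') _ _ hs.2 v hv

/-- The adversary against the given generator built from an adversary against its repetition. -/
theorem exists_adversary (A : QPTAlg) (N t F T R : Polynomial ℕ) :
    ∃ B : QPTAlg, ∀ n d, ∀ f : List Bool → ℂ, ((B.den n [] d).ex fun a => f a.1 * dg a.2)
      = (W.iter (G.posStep A n (N.eval n) (t.eval n) (F.eval n) (T.eval n) (R.eval n)) (N.eval n)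
        (0, [], d)).ex fun s => f s.2.1 * dg s.2.2 := by
  obtain ⟨P0, T0, hP0⟩ := G.exists_prep
  obtain ⟨P1, T1, h1⟩ := exists_setPoly N 9 (by decide)
  obtain ⟨P2, T2, h2⟩ := exists_setPoly N 11 (by decide)
  obtain ⟨P3, T3, h3⟩ := G.exists_positions A N t F T R
  have key : ∀ n x d, ∃ L : W Cfg, Spec [.seq (clrB 1) (.seq P0 (.seq P1 (.seq P2 (.seq (.pop 11)
      P3))))] (dinit n x d)
      ((2 * Polynomial.X + 1 + (T0 + (T1 + (T2 + (1 + T3 + 1) + 1) + 1) + 1) +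
        1).eval (n + x.length + d.length)) L ∧
      ∀ f : List Bool → ℂ, (L.ex fun c => jk c * (f (c.bits 1) * dg (c.q 0))) =
        (W.iter (G.posStep A n (N.eval n) (t.eval n) (F.eval n) (T.eval n) (R.eval n)) (N.eval n)
        (0, [], d)).ex fun s => f s.2.1 * dg s.2.2 := by
    intro n x d
    obtain ⟨c, h0, hpar, c1, c6, cq0, cq⟩ := prep_dinit hP0 n [] d
    have k0 : Det (clrB 1) (dinit n x d) (2 * x.length + 1) (dinit n [] d) := by
      refine (clrB_det _ 1).of_eq (by simp [dinit]) ?_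
      ext1
      · funext t
        simp only [dinit, Cfg.setB_bits]
        split_ifs <;> simp_all
      · rfl
    have k1 := h1 n c hpar.std
    rw [c6 9 (by omega), List.append_nil] at k1
    have k2 := h2 n _ (hpar.setB (r := 9) (by decide) (by decide) (by decide)
      (List.replicate (N.eval n) true)).std
    rw [Cfg.setB_bits, if_neg (by decide), c6 11 (by omega), List.append_nil] at k2
    -- At position `0`, there are `N - 1` keys after the unknown one.
    have k3 := Det.pop ((c.setB 9 (List.replicate (N.eval n) true)).setB 11
      (List.replicate (N.eval n) true)) 11
    have k3' := k3.of_eq (m := 1) le_rfl (c'' := (posCfg c (N.eval n) (0, [], d)).setB 9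
      (List.replicate (N.eval n) true)) (by
      have := c6 10 (by omega)
      ext1
      · funext t
        simp only [posCfg, Cfg.setB_bits, Cfg.setQ_bits]
        split_ifs <;> simp_all
      · funext t
        simp only [posCfg, Cfg.setB_q, Cfg.setQ_q]
        split_ifs <;> simp_all)
    have k4 := h3 n d c hpar c6 (cq 1 (by omega))
    refine ⟨_, (k0.spec_seq (h0.spec_seq (k1.spec_seq (k2.spec_seq (k3'.spec_seq k4))))).mono ?_,
      fun f => ?_⟩
    · have := monotone_eval_nat (T0 + (T1 + (T2 + (1 + T3 + 1) + 1) + 1) + 1)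
        (show n ≤ n + x.length + d.length by omega)
      simp at this ⊢
      omega
    · rw [W.ex_map]
      refine W.ex_congr fun s _ => ?_
      rw [jk_eq_one]
      · simp [posCfg, Cfg.setB_bits, Cfg.setQ_q]
      · intro r hr
        simp [posCfg, Cfg.setQ_q, hr, cq r hr]
  choose L hL using key
  obtain ⟨B, hB⟩ := QPTAlg.exists_of_spec fun n x d => (hL n x d).1
  refine ⟨B, fun n d f => ?_⟩
  rw [(hB n [] d).1 fun a => f a.1 * dg a.2, (hL n [] d).2]

end StateGenerator

/-! ### Finite expectations -/

/-- The functional is the expectation of a probability distribution with finite support. -/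
def IsEx {α : Type} (E : (α → ℝ) → ℝ) : Prop :=
  ∃ (ι : Type) (_ : Fintype ι) (w : ι → ℝ) (a : ι → α), (∀ i, 0 ≤ w i) ∧ ∑ i, w i = 1 ∧
    ∀ f, E f = ∑ i, w i * f (a i)

namespace IsEx

variable {α β : Type} {E : (α → ℝ) → ℝ}

theorem eval (a : α) : IsEx fun f : α → ℝ => f a :=
  ⟨Unit, inferInstance, fun _ => 1, fun _ => a, by simp, by simp, by simp⟩

theorem bind (h : IsEx E) {E' : α → (β → ℝ) → ℝ} (h' : ∀ a, IsEx (E' a)) :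
    IsEx fun f => E fun a => E' a f := by
  obtain ⟨ι, _, w, a, h1, h2, h3⟩ := h
  choose κ hκ w' b h4 h5 h6 using h'
  refine ⟨Σ i : ι, κ (a i), inferInstance, fun x => w x.1 * w' (a x.1) x.2,
    fun x => b (a x.1) x.2, fun x => mul_nonneg (h1 _) (h4 _ _), ?_, fun f => ?_⟩
  · rw [Fintype.sum_sigma]
    simp [← Finset.mul_sum, h5, h2]
  · rw [Fintype.sum_sigma]
    show E _ = _
    rw [h3]
    simp [h6, Finset.mul_sum, mul_assoc]

theorem map (h : IsEx E) (g : α → β) : IsEx fun f => E fun a => f (g a) :=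
  h.bind fun a => eval (g a)

/-- For arbitrary functionals this would fail; finite support reduces it to the exchange of finite
sums. -/
theorem comm (h : IsEx E) {E' : (β → ℝ) → ℝ} (h' : IsEx E') (f : α → β → ℝ) :
    E (fun a => E' fun b => f a b) = E' fun b => E fun a => f a b := by
  obtain ⟨ι, _, w, a, h1, h2, h3⟩ := h
  obtain ⟨ι', _, w', b, h1', h2', h3'⟩ := h'
  simp only [h3, h3', Finset.mul_sum]
  rw [Finset.sum_comm]
  refine Finset.sum_congr rfl fun i _ => Finset.sum_congr rfl fun j _ => ?_
  ring

theorem const (h : IsEx E) (x : ℝ) : E (fun _ => x) = x := by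
  obtain ⟨ι, _, w, a, h1, h2, h3⟩ := h
  rw [h3, ← Finset.sum_mul, h2, one_mul]

theorem add (h : IsEx E) (f g : α → ℝ) : E (fun a => f a + g a) = E f + E g := by
  obtain ⟨ι, _, w, a, h1, h2, h3⟩ := h
  simp [h3, mul_add, Finset.sum_add_distrib]

theorem mul_left (h : IsEx E) (x : ℝ) (f : α → ℝ) : E (fun a => x * f a) = x * E f := by
  obtain ⟨ι, _, w, a, h1, h2, h3⟩ := h
  simp only [h3, Finset.mul_sum]
  exact Finset.sum_congr rfl fun i _ => by ring

theorem sub (h : IsEx E) (f g : α → ℝ) : E (fun a => f a - g a) = E f - E g := by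
  obtain ⟨ι, _, w, a, h1, h2, h3⟩ := h
  simp [h3, mul_sub, Finset.sum_sub_distrib]

theorem sum (h : IsEx E) {ι : Type} (s : Finset ι) (f : ι → α → ℝ) :
    E (fun a => ∑ i ∈ s, f i a) = ∑ i ∈ s, E (f i) := by
  obtain ⟨κ, _, w, a, h1, h2, h3⟩ := h
  simp only [h3, Finset.mul_sum]
  exact Finset.sum_comm

theorem mono (h : IsEx E) {f g : α → ℝ} (hfg : ∀ a, f a ≤ g a) : E f ≤ E g := by
  obtain ⟨ι, _, w, a, h1, h2, h3⟩ := h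
  rw [h3, h3]
  exact Finset.sum_le_sum fun i _ => mul_le_mul_of_nonneg_left (hfg _) (h1 i)

theorem le_const (h : IsEx E) {f : α → ℝ} {x : ℝ} (hf : ∀ a, f a ≤ x) : E f ≤ x :=
  (h.mono hf).trans (h.const x).le

theorem nonneg (h : IsEx E) {f : α → ℝ} (hf : ∀ a, 0 ≤ f a) : 0 ≤ E f :=
  (h.const 0).ge.trans (h.mono hf)

end IsEx

/-! ### Independent samples -/

/-- The expectation over lists of independent samples. -/
def gen {κ : Type} (K : (κ → ℝ) → ℝ) : ℕ → (List κ → ℝ) → ℝ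
  | 0, F => F []
  | a + 1, F => K fun k => gen K a fun ks => F (k :: ks)

namespace IsEx

variable {κ : Type} {K : (κ → ℝ) → ℝ}

theorem gen (hK : IsEx K) (a : ℕ) : IsEx (gen K a) := by
  induction a with
  | zero => exact eval []
  | succ a ih => exact hK.bind fun k => ih.map fun ks => k :: ks

theorem gen_congr (a : ℕ) {F F' : List κ → ℝ} (h : ∀ ks, ks.length = a → F ks = F' ks) :
    QCrypto.gen K a F = QCrypto.gen K a F' := by
  induction a generalizing F F' with
  | zero => exact h [] rfl
  | succ a ih =>
    exact congrArg K (funext fun k => ih fun ks hks => h _ (by simp [hks]))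

/-- This isolates the key at position `a`, where the unknown key will be placed. -/
theorem gen_split (a b : ℕ) (F : List κ → ℝ) : QCrypto.gen K (a + 1 + b) F
    = QCrypto.gen K a fun pre => K fun k => QCrypto.gen K b fun post => F (pre ++ k :: post) := by
  induction a generalizing F with
  | zero =>
    rw [Nat.zero_add, Nat.add_comm]
    rfl
  | succ a ih =>
    rw [show a + 1 + 1 + b = (a + 1 + b) + 1 by ring]
    exact congrArg K (funext fun k => ih _)

/-- The product of functions of the entries of a list. -/
def _root_.QCrypto.prodAt (b : ℕ → κ → ℝ) : ℕ → List κ → ℝ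
  | _, [] => 1
  | j, k :: ks => b j k * prodAt b (j + 1) ks

/-- Independence: the expectation of a product of functions of different samples factorizes. -/
theorem gen_prodAt (hK : IsEx K) (b : ℕ → κ → ℝ) (a j : ℕ) :
    QCrypto.gen K a (prodAt b j) = ∏ i ∈ Finset.range a, K (b (j + i)) := by
  induction a generalizing j with
  | zero => simp [QCrypto.gen, prodAt]
  | succ a ih =>
    rw [Finset.prod_range_succ', mul_comm]
    simp only [QCrypto.gen, prodAt]
    simp only [(hK.gen a).mul_left, ih]
    simp_rw [mul_comm (b j _)]
    rw [hK.mul_left, mul_comm]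
    congr 1
    exact Finset.prod_congr rfl fun i _ => by rw [show j + 1 + i = j + (i + 1) by ring]

end IsEx

section ProdAt

variable {κ : Type}

theorem prodAt_nonneg {b : ℕ → κ → ℝ} (hb : ∀ j k, 0 ≤ b j k) (j : ℕ) (ks : List κ) :
    0 ≤ prodAt b j ks := by
  induction ks generalizing j with
  | nil => exact zero_le_one
  | cons k ks ih => exact mul_nonneg (hb _ _) (ih _)

theorem prodAt_le_one {b : ℕ → κ → ℝ} (hb : ∀ j k, 0 ≤ b j k) (hb1 : ∀ j k, b j k ≤ 1) (j : ℕ)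
    (ks : List κ) : prodAt b j ks ≤ 1 := by
  induction ks generalizing j with
  | nil => exact le_rfl
  | cons k ks ih => exact mul_le_one₀ (hb1 _ _) (prodAt_nonneg hb _ _) (ih _)

theorem prodAt_le {b c : ℕ → κ → ℝ} (k0 : κ) (hb : ∀ j k, 0 ≤ b j k) (j : ℕ) (ks : List κ)
    (h : ∀ i < ks.length, b (j + i) (ks.getD i k0) ≤ c (j + i) (ks.getD i k0)) :
    prodAt b j ks ≤ prodAt c j ks := by
  induction ks generalizing j with
  | nil => exact le_rfl
  | cons k ks ih =>
    have h0 : b j k ≤ c j k := by simpa using h 0 (by simp)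
    refine mul_le_mul h0 (ih _ fun i hi => ?_) (prodAt_nonneg hb _ _) ((hb j k).trans h0)
    have := h (i + 1) (by simpa using hi)
    rw [show j + 1 + i = j + (i + 1) by ring]
    simpa using this

end ProdAt

/-! ### Repeated tests -/

/-- The probability that at most `b - 1` of `T` tests with success probability `v` fail. -/
def pass (v : ℝ) : ℕ → ℕ → ℝ
  | 0, b => if b = 0 then 0 else 1
  | T + 1, b => v * pass v T b + (1 - v) * pass v T (b - 1)

section Pass

variable {v : ℝ}

theorem pass_nonneg (h0 : 0 ≤ v) (h1 : v ≤ 1) (T b : ℕ) : 0 ≤ pass v T b := by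
  induction T generalizing b with
  | zero => unfold pass; split_ifs <;> simp
  | succ T ih => exact add_nonneg (mul_nonneg h0 (ih _)) (mul_nonneg (by linarith) (ih _))

theorem pass_le_one (h0 : 0 ≤ v) (h1 : v ≤ 1) (T b : ℕ) : pass v T b ≤ 1 := by
  induction T generalizing b with
  | zero => unfold pass; split_ifs <;> simp
  | succ T ih =>
    unfold pass
    nlinarith [ih b, ih (b - 1)]

theorem pass_zero (T : ℕ) : pass v T 0 = 0 := by
  induction T with
  | zero => simp [pass]
  | succ T ih => simp [pass, ih]

/-- The exponential Markov inequality: the indicator of fewer than `b` failures is at most `2^b ·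
2^(-failures)`, and one test multiplies the expectation of `2^(-failures)` by `v + (1 - v)/2`. -/
theorem pass_upper (h0 : 0 ≤ v) (h1 : v ≤ 1) (T b : ℕ) :
    pass v T b ≤ 2 ^ b * ((1 + v) / 2) ^ T := by
  induction T generalizing b with
  | zero =>
    have : (1 : ℝ) ≤ 2 ^ b := one_le_pow₀ (by norm_num)
    unfold pass
    split_ifs <;> simp [this]
  | succ T ih =>
    cases b with
    | zero =>
      rw [pass_zero]
      positivity
    | succ b =>
      have e1 := mul_le_mul_of_nonneg_left (ih (b + 1)) h0
      have e2 := mul_le_mul_of_nonneg_left (ih b) (sub_nonneg.2 h1)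
      unfold pass
      rw [Nat.add_sub_cancel]
      refine (add_le_add e1 e2).trans (le_of_eq ?_)
      ring

/-- Markov's inequality for the remaining budget. Its expectation is at least `b - T (1 - v)`, it
never exceeds `F`, and it is positive only if the tests are passed. Keeping `F` apart from `b` makes
the induction possible. -/
theorem pass_lower (h0 : 0 ≤ v) (h1 : v ≤ 1) (F T b : ℕ) (hb : b ≤ F) :
    (b : ℝ) - T * (1 - v) ≤ F * pass v T b := by
  induction T generalizing b with
  | zero =>
    unfold pass
    split_ifs with h
    · simp [h]
    · have : (b : ℝ) ≤ F := by exact_mod_cast hb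
      simpa using this
  | succ T ih =>
    have e1 := mul_le_mul_of_nonneg_left (ih b hb) h0
    have e2 := mul_le_mul_of_nonneg_left (ih (b - 1) (by omega)) (sub_nonneg.2 h1)
    have e3 : (b : ℝ) - 1 ≤ ((b - 1 : ℕ) : ℝ) := by
      have : (b : ℝ) ≤ ((b - 1 : ℕ) : ℝ) + 1 := by exact_mod_cast (by omega : b ≤ b - 1 + 1)
      linarith
    have e4 := mul_le_mul_of_nonneg_left e3 (sub_nonneg.2 h1)
    unfold pass
    push_cast
    nlinarith

/-- By `pass_upper` the probability is at most `(4 ((1 + v)/2)^g)^X`. Here `(1 + v)/2 ≤ 1 - 4/g`, so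
its power `g` is at most `e⁻⁴ ≤ 1/8`, and `2^(-X) ≤ 1/X`. -/
theorem pass_bad {g X : ℕ} (hX : 1 ≤ X) (hg : 8 ≤ g) (h0 : 0 ≤ v) (h1 : v ≤ 1)
    (hv : v < 1 - 8 / g) : pass v (g * X) (2 * X) ≤ 1 / X := by
  have hg' : (0 : ℝ) < g := by exact_mod_cast (by omega : 0 < g)
  have e1 : ((1 + v) / 2) ≤ 1 - 4 / g := by
    have : (8 : ℝ) / g = 2 * (4 / g) := by ring
    linarith
  have e2 : ((1 + v) / 2) ^ g ≤ 1 / 8 := by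
    refine (pow_le_pow_left₀ (by linarith) e1 g).trans ?_
    refine (Real.one_sub_div_pow_le_exp_neg (by exact_mod_cast (by omega : 4 ≤ g))).trans ?_
    have h2 : (2 : ℝ) ≤ Real.exp 1 := by
      have := Real.add_one_le_exp (1 : ℝ)
      linarith
    rw [Real.exp_neg, ← one_div]
    have h3 : Real.exp 4 = Real.exp 1 ^ 4 := by rw [← Real.exp_nat_mul]; norm_num
    have h4 : (2 : ℝ) ^ 4 ≤ Real.exp 1 ^ 4 := pow_le_pow_left₀ (by norm_num) h2 4
    rw [h3]
    exact one_div_le_one_div_of_le (by norm_num) (by linarith)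
  refine (pass_upper h0 h1 _ _).trans ?_
  rw [pow_mul, pow_mul, ← mul_pow]
  have e3 : (2 : ℝ) ^ 2 * ((1 + v) / 2) ^ g ≤ 1 / 2 := by linarith
  refine (pow_le_pow_left₀ (by positivity) e3 X).trans ?_
  rw [one_div_pow]
  refine one_div_le_one_div_of_le (by exact_mod_cast hX) ?_
  exact_mod_cast X.lt_two_pow_self.le

/-- At most `X` failures are expected among the `g X` tests, which is half of the budget. -/
theorem pass_good {g X : ℕ} (hX : 1 ≤ X) (hg : 1 ≤ g) (h0 : 0 ≤ v) (h1 : v ≤ 1)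
    (hv : 1 - 1 / g ≤ v) : 1 / 2 ≤ pass v (g * X) (2 * X) := by
  have e := pass_lower h0 h1 (2 * X) (g * X) (2 * X) le_rfl
  have hg' : (0 : ℝ) < g := by exact_mod_cast (by omega : 0 < g)
  have hX' : (0 : ℝ) < X := by exact_mod_cast (by omega : 0 < X)
  have e1 : (g : ℝ) * (1 - v) ≤ 1 := by
    have : (g : ℝ) * (1 - v) ≤ g * (1 / g) := mul_le_mul_of_nonneg_left (by linarith) hg'.le
    rwa [mul_one_div_cancel hg'.ne'] at this
  push_cast at e
  have e2 : (g : ℝ) * X * (1 - v) ≤ X := by nlinarith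
  by_contra! h
  nlinarith

end Pass

/-! ### The search for a key -/

section Search

variable {κ Y C : Type} (K : (κ → ℝ) → ℝ) (L : List κ → (Y → ℝ) → ℝ) (cand : ℕ → Y → C)
  (p : C → κ → ℝ) (N R : ℕ)

/-- The distribution of the keys and of the output if the key number `i` is `k`. -/
def smpAt (i : ℕ) (k : κ) (f : List κ × Y → ℝ) : ℝ :=
  gen K i fun pre => gen K (N - 1 - i) fun post =>
    L (pre ++ k :: post) fun y => f (pre ++ k :: post, y)

/-- The expectation of `z` after one attempt, where `p` is the probability that a candidate
passes. -/
def att (i : ℕ) (k : κ) (z : C → ℝ) (c : C) : ℝ :=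
  smpAt K L N i k fun u => p (cand i u.2) k * z (cand i u.2) + (1 - p (cand i u.2) k) * z c

/-- The expectation of `z` after all the attempts for `j` positions from `i` on. -/
def pos (k : κ) : ℕ → ℕ → (C → ℝ) → C → ℝ
  | 0, _, z => z
  | j + 1, i, z => (att K L cand p N i k)^[R] (pos k j (i + 1) z)

variable {K L cand p N R}

theorem isEx_smpAt (hK : IsEx K) (hL : ∀ ks, IsEx (L ks)) (i : ℕ) (k : κ) :
    IsEx (smpAt K L N i k) :=
  (hK.gen i).bind fun pre => (hK.gen _).bind fun post => (hL _).map fun y => (pre ++ k :: post, y)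

theorem att_mono (hK : IsEx K) (hL : ∀ ks, IsEx (L ks)) (hp0 : ∀ c k, 0 ≤ p c k)
    (hp1 : ∀ c k, p c k ≤ 1) (i : ℕ) (k : κ) {z z' : C → ℝ} (h : ∀ c, z c ≤ z' c) (c : C) :
    att K L cand p N i k z c ≤ att K L cand p N i k z' c :=
  (isEx_smpAt hK hL i k).mono fun _ => add_le_add (mul_le_mul_of_nonneg_left (h _) (hp0 _ _))
    (mul_le_mul_of_nonneg_left (h _) (sub_nonneg.2 (hp1 _ _)))

theorem att_affine (hK : IsEx K) (hL : ∀ ks, IsEx (L ks)) (i : ℕ) (k : κ) (z : C → ℝ) (x y : ℝ)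
    (c : C) : att K L cand p N i k (fun c => x + y * z c) c = x + y * att K L cand p N i k z c := by
  have h := isEx_smpAt (N := N) hK hL i k
  unfold att
  rw [← h.mul_left]
  conv_rhs => rw [← h.const x]
  rw [← h.add]
  congr 1
  funext u
  ring

/-- `D` measures how bad the current candidate is. One attempt turns `D c` into at most `δ + (1 - q)
D c`: a bad newcomer gets through with expected badness at most `δ`, and the old candidate survives
with probability at most `1 - q`. Bounds of the form `x + y D` are stable under this. -/
theorem iterate_att_le (hK : IsEx K) (hL : ∀ ks, IsEx (L ks)) (hp0 : ∀ c k, 0 ≤ p c k)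
    (hp1 : ∀ c k, p c k ≤ 1) (i : ℕ) (k : κ) {D : C → ℝ} (hD : ∀ c, 0 ≤ D c) {δ : ℝ}
    (hδ : ∀ c, p c k * D c ≤ δ) {q : ℝ} (hq1 : q ≤ 1)
    (hq : q ≤ smpAt K L N i k fun u => p (cand i u.2) k) {D' : C → ℝ} {x y : ℝ} (hy : 0 ≤ y)
    (hy1 : y ≤ 1) (h : ∀ c, D' c ≤ x + y * D c) (hδ0 : 0 ≤ δ) (hq0 : 0 ≤ q) (r : ℕ) (c : C) :
    (att K L cand p N i k)^[r] D' c ≤ (x + r * δ) + y * (1 - q) ^ r * D c := by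
  have h1 : ∀ c, att K L cand p N i k D c ≤ δ + (1 - q) * D c := by
    intro c
    have hS := isEx_smpAt (N := N) hK hL i k
    have e1 : att K L cand p N i k D c ≤ smpAt K L N i k fun u =>
        (δ + D c) - D c * p (cand i u.2) k :=
      hS.mono fun u => by
        have := hδ (cand i u.2)
        nlinarith
    rw [hS.sub, hS.const, hS.mul_left] at e1
    have := mul_le_mul_of_nonneg_left hq (hD c)
    linarith
  induction r generalizing c with
  | zero => simpa using h c
  | succ r ih =>
    rw [Function.iterate_succ_apply']
    refine (att_mono hK hL hp0 hp1 i k ih c).trans ?_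
    rw [att_affine hK hL]
    have hpow : (1 - q) ^ r ≤ 1 := pow_le_one₀ (by linarith) (by linarith)
    have hpow0 : 0 ≤ (1 - q) ^ r := pow_nonneg (by linarith) _
    have e := mul_le_mul_of_nonneg_left (h1 c) (mul_nonneg hy hpow0)
    have e2 : y * (1 - q) ^ r * δ ≤ δ := mul_le_of_le_one_left hδ0 (mul_le_one₀ hy1 hpow0 hpow)
    push_cast
    rw [pow_succ]
    nlinarith

/-- A single position with success rate `q` suffices. All the other positions are treated with rate
`0`: they may replace a candidate, but they increase the badness by at most `δ` per attempt. -/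
theorem pos_le (hK : IsEx K) (hL : ∀ ks, IsEx (L ks)) (hp0 : ∀ c k, 0 ≤ p c k)
    (hp1 : ∀ c k, p c k ≤ 1) (k : κ) {D : C → ℝ} (hD : ∀ c, 0 ≤ D c) {δ : ℝ}
    (hδ : ∀ c, p c k * D c ≤ δ) (hδ0 : 0 ≤ δ) {D' : C → ℝ} {x : ℝ} (h : ∀ c, D' c ≤ x + D c) {q : ℝ}
    (hq0 : 0 ≤ q) (hq1 : q ≤ 1) (j i : ℕ)
    (hq : q = 0 ∨ ∃ l, i ≤ l ∧ l < i + j ∧ q ≤ smpAt K L N l k fun u => p (cand l u.2) k) (c : C) :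
    pos K L cand p N R k j i D' c ≤ (x + j * R * δ) + (1 - q) ^ R * D c := by
  have nn : ∀ i, 0 ≤ smpAt K L N i k fun u => p (cand i u.2) k :=
    fun i => (isEx_smpAt hK hL i k).nonneg fun u => hp0 _ _
  induction j generalizing i q c with
  | zero =>
    rcases hq with rfl | ⟨l, h1, h2, -⟩
    · simpa [pos] using h c
    · omega
  | succ j ih =>
    unfold pos
    have easy := fun q hq0 hq1 hq c => ih (q := q) hq0 hq1 (i + 1) hq c
    have nnp : 0 ≤ (1 - q) ^ R := pow_nonneg (by linarith) _
    have lep : (1 - q) ^ R ≤ 1 := pow_le_one₀ (by linarith) (by linarith)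
    -- The useful position either comes later, where the induction hypothesis takes it into account,
    -- or is the present one.
    by_cases hc : q = 0 ∨ ∃ l, i + 1 ≤ l ∧ l < i + 1 + j ∧
        q ≤ smpAt K L N l k fun u => p (cand l u.2) k
    · have e := iterate_att_le hK hL hp0 hp1 i k hD hδ zero_le_one (nn i) nnp lep
        (easy q hq0 hq1 hc) hδ0 le_rfl R c
      refine e.trans (le_of_eq ?_)
      push_cast
      simp
      ring
    · push Not at hc
      obtain ⟨l, h1, h2, h3⟩ := hq.resolve_left hc.1
      have hl : l = i := by
        by_contra hne
        exact (hc.2 l (by omega) (by omega)).not_ge h3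
      subst hl
      have e := iterate_att_le hK hL hp0 hp1 l k hD hδ hq1 h3 zero_le_one le_rfl
        (fun c => by simpa using easy 0 le_rfl zero_le_one (Or.inl rfl) c) hδ0 hq0 R c
      refine e.trans (le_of_eq ?_)
      push_cast
      ring

theorem pos_mono (hK : IsEx K) (hL : ∀ ks, IsEx (L ks)) (hp0 : ∀ c k, 0 ≤ p c k)
    (hp1 : ∀ c k, p c k ≤ 1) (k : κ) {z z' : C → ℝ} (h : ∀ c, z c ≤ z' c) (j i : ℕ) (c : C) :
    pos K L cand p N R k j i z c ≤ pos K L cand p N R k j i z' c := by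
  induction j generalizing i c with
  | zero => exact h c
  | succ j ih =>
    unfold pos
    have : ∀ r c, (att K L cand p N i k)^[r] (pos K L cand p N R k j (i + 1) z) c
        ≤ (att K L cand p N i k)^[r] (pos K L cand p N R k j (i + 1) z') c := by
      intro r
      induction r with
      | zero => exact fun c => ih (i + 1) c
      | succ r ihr =>
        intro c
        rw [Function.iterate_succ_apply', Function.iterate_succ_apply']
        exact att_mono hK hL hp0 hp1 i k ihr c
    exact this R c

/-- This turns the upper bound of `pos_le` for the failure probability `1 - v` into a lower bound
for `v`. -/
theorem pos_affine (hK : IsEx K) (hL : ∀ ks, IsEx (L ks)) (k : κ) (z : C → ℝ) (x y : ℝ) (j i : ℕ)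
    (c : C) : pos K L cand p N R k j i (fun c => x + y * z c) c
      = x + y * pos K L cand p N R k j i z c := by
  have : pos K L cand p N R k j i (fun c => x + y * z c)
      = fun c => x + y * pos K L cand p N R k j i z c := by
    induction j generalizing i with
    | zero => rfl
    | succ j ih =>
      unfold pos
      rw [ih]
      have : ∀ r, (att K L cand p N i k)^[r] (fun c => x + y * pos K L cand p N R k j (i + 1) z c)
          = fun c => x + y * (att K L cand p N i k)^[r] (pos K L cand p N R k j (i + 1) z) c := by
        intro r
        induction r with
        | zero => rfl
        | succ r ihr =>
          funext c
          rw [Function.iterate_succ_apply', Function.iterate_succ_apply', ihr, att_affine hK hL]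
      exact this R
  exact congrFun this c

end Search

/-! ### Hardness amplification -/

/-- The left side is at most `e^(-8P)`, and `e^(8P) ≥ 8P`. -/
theorem one_sub_pow_le {P u : ℕ} (hP : 1 ≤ P) (hu : 1 ≤ u) :
    (1 - 1 / (2 * u : ℝ)) ^ (16 * P * u) ≤ 1 / (8 * P) := by
  have hP' : (1 : ℝ) ≤ P := by exact_mod_cast hP
  have hu' : (1 : ℝ) ≤ u := by exact_mod_cast hu
  have e1 : (1 - 1 / (2 * u : ℝ)) ≤ Real.exp (-(1 / (2 * u))) := by
    have := Real.add_one_le_exp (-(1 / (2 * u : ℝ)))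
    linarith
  have e0 : (0 : ℝ) ≤ 1 - 1 / (2 * u) := by
    rw [sub_nonneg, div_le_one (by linarith)]
    linarith
  refine (pow_le_pow_left₀ e0 e1 _).trans ?_
  rw [← Real.exp_nat_mul]
  have e2 : ((16 * P * u : ℕ) : ℝ) * -(1 / (2 * u)) = -(8 * P) := by
    push_cast
    field_simp
    ring
  rw [e2, Real.exp_neg, ← one_div]
  exact one_div_le_one_div_of_le (by linarith) (by linarith [Real.add_one_le_exp (8 * P : ℝ)])

/-- Hypothesis `hB` is weak security against the adversary that searches all the positions. It makes
every position bad for a noticeable fraction of the keys. At such positions the given adversary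
either gives an answer below the threshold `1 - 1/g`, which costs a factor, or answers well, which
happens together with overall acceptance with probability less than `1/u`. -/
theorem amplification {κ Y C : Type} [Inhabited κ] {K : (κ → ℝ) → ℝ} {L : List κ → (Y → ℝ) → ℝ}
    (hK : IsEx K) (hL : ∀ ks, IsEx (L ks)) (cand : ℕ → Y → C) (c0 : C) {v : C → κ → ℝ}
    (hv0 : ∀ c k, 0 ≤ v c k) (hv1 : ∀ c k, v c k ≤ 1) {N P u : ℕ} (hN : 1 ≤ N) (hP : 1 ≤ P)
    (hu : 1 ≤ u)
    (hB : K (fun k => pos K L cand (fun c k => pass (v c k) (64 * P * (4 * P * (16 * P * u) * N))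
      (2 * (4 * P * (16 * P * u) * N))) N (16 * P * u) k N 0 (fun c => v c k) c0) ≤ 1 - 1 / P) :
    gen K N (fun ks => L ks fun y => prodAt (fun j k => v (cand j y) k) 0 ks)
      ≤ (1 - 1 / (2 * (64 * P) * P)) ^ N + N * (1 / u) := by
  classical
  -- `R` makes it unlikely that all the attempts at a good position fail; `X` outweighs the `N R`
  -- chances of a wrong acceptance; `g` makes the tolerance `8/g` of the tests equal to `1/(8P)`.
  set R := 16 * P * u with hR
  set X := 4 * P * R * N with hX
  set g := 64 * P with hg
  set p : C → κ → ℝ := fun c k => pass (v c k) (g * X) (2 * X) with hp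
  have hP' : (1 : ℝ) ≤ P := by exact_mod_cast hP
  have hu' : (1 : ℝ) ≤ u := by exact_mod_cast hu
  have hN' : (1 : ℝ) ≤ N := by exact_mod_cast hN
  have hR1 : 1 ≤ R := Nat.mul_pos (by omega) (by omega)
  have hX1 : 1 ≤ X := Nat.mul_pos (Nat.mul_pos (by omega) (by omega)) (by omega)
  have hR' : (1 : ℝ) ≤ R := by exact_mod_cast hR1
  have hg' : (g : ℝ) = 64 * P := by simp [hg]
  have hp0 : ∀ c k, 0 ≤ p c k := fun c k => pass_nonneg (hv0 c k) (hv1 c k) _ _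
  have hp1 : ∀ c k, p c k ≤ 1 := fun c k => pass_le_one (hv0 c k) (hv1 c k) _ _
  let V : List κ × Y → ℝ := fun s => prodAt (fun j k => v (cand j s.2) k) 0 s.1
  have hV0 : ∀ s, 0 ≤ V s := fun s => prodAt_nonneg (fun j k => hv0 _ _) _ _
  have hV1 : ∀ s, V s ≤ 1 := fun s => prodAt_le_one (fun j k => hv0 _ _) (fun j k => hv1 _ _) _ _
  -- Acceptance of the whole answer is included in `E`: it makes the final sum over positions a
  -- bound for the success, and dropping it only helps the search.
  let E : ℕ → κ → ℝ := fun i k => smpAt K L N i k fun s =>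
    if 1 - 1 / (g : ℝ) ≤ v (cand i s.2) k then V s else 0
  let bad : ℕ → κ → Prop := fun i k => E i k < 1 / u
  -- the success probability for keys that are good at some position
  have hgood : ∀ k, (∃ i < N, ¬ bad i k) →
      1 - 1 / (2 * P : ℝ) ≤ pos K L cand p N R k N 0 (fun c => v c k) c0 := by
    rintro k ⟨i, hi, hbad⟩
    have hE : 1 / (u : ℝ) ≤ E i k := not_lt.1 hbad
    -- The badness is the indicator of the candidates that the tests should reject. Up to the
    -- tolerance `8/g`, it bounds the failure probability `1 - v`.
    let D : C → ℝ := fun c => if v c k < 1 - 8 / g then 1 else 0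
    have hD : ∀ c, 0 ≤ D c := fun c => by simp only [D]; split_ifs <;> simp
    have hδ : ∀ c, p c k * D c ≤ 1 / X := by
      intro c
      simp only [D]
      split_ifs with h
      · rw [mul_one]
        exact pass_bad hX1 (by omega) (hv0 _ _) (hv1 _ _) h
      · rw [mul_zero]
        positivity
    have hD' : ∀ c, 1 + (-1) * v c k ≤ 8 / (g : ℝ) + D c := by
      intro c
      have h8 : (0 : ℝ) ≤ 8 / g := by positivity
      simp only [D]
      split_ifs with h
      · have := hv0 c k
        linarith
      · have := not_lt.1 h
        linarith
    -- The good event has probability at least `1/u`, and then the tests are passed with probability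
    -- at least `1/2`.
    have hq : 1 / (2 * u : ℝ) ≤ smpAt K L N i k fun s => p (cand i s.2) k := by
      have hS := isEx_smpAt (N := N) hK hL i k
      have : smpAt K L N i k (fun s => 1 / 2 *
          if 1 - 1 / (g : ℝ) ≤ v (cand i s.2) k then V s else 0) ≤
          smpAt K L N i k fun s => p (cand i s.2) k := hS.mono fun s => by
        split_ifs with h
        · have h2 := pass_good (X := X) hX1 (by omega) (hv0 _ _) (hv1 _ _) h
          have := hV1 s
          simp only [hp]
          linarith
        · simpa using hp0 _ _
      rw [hS.mul_left] at this
      refine le_trans ?_ this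
      have e : 1 / (2 * u : ℝ) = 1 / 2 * (1 / u) := by ring
      rw [e]
      exact mul_le_mul_of_nonneg_left hE (by norm_num)
    have hq1 : 1 / (2 * u : ℝ) ≤ 1 := by
      rw [div_le_one (by linarith)]
      linarith
    -- The failure probability is at most the sum of the tolerance `1/(8P)`, of `N R/X = 1/(4P)` for
    -- wrong acceptances, and of `1/(8P)` for the case that nothing is found.
    have e := pos_le (R := R) hK hL hp0 hp1 k hD hδ (by positivity) hD' (q := 1 / (2 * u : ℝ))
      (by positivity) hq1 N 0 (Or.inr ⟨i, by omega, by omega, hq⟩) c0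
    rw [pos_affine hK hL] at e
    have e1 := one_sub_pow_le hP hu
    have e2 : (N : ℝ) * R * (1 / X) = 1 / (4 * P) := by
      simp only [hX]
      push_cast
      field_simp
    have e3 : (8 : ℝ) / g = 1 / (8 * P) := by
      rw [hg']
      field_simp
      norm_num
    have e4 : (1 - 1 / (2 * u : ℝ)) ^ R * D c0 ≤ 1 / (8 * P) := by
      refine le_trans (mul_le_of_le_one_right (pow_nonneg (by linarith) _) ?_) e1
      simp only [D]
      split_ifs <;> simp
    rw [e2, e3] at e
    have e5 : (1 : ℝ) / (2 * P) = 1 / (8 * P) + 1 / (4 * P) + 1 / (8 * P) := by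
      field_simp
      norm_num
    linarith
  -- few keys are good
  have hfew : ∀ i < N, K (fun k => if bad i k then 0 else 1) ≤ 1 - 1 / (2 * P : ℝ) := by
    intro i hi
    have h1 : K (fun k => (1 - 1 / (2 * P : ℝ)) * if bad i k then 0 else 1) ≤ 1 - 1 / P := by
      refine le_trans (hK.mono fun k => ?_) hB
      split_ifs with h
      · rw [mul_zero]
        -- The value is nonnegative by comparison with the zero function, whose affine form lets
        -- `pos_affine` evaluate it.
        have := pos_mono (R := R) (N := N) (cand := cand) hK hL hp0 hp1 k (z := fun _ => 0 + 0 * 0)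
          (z' := fun c => v c k) (fun c => by simpa using hv0 c k) N 0 c0
        rw [pos_affine (z := fun _ => 0) hK hL] at this
        simpa using this
      · rw [mul_one]
        exact hgood k ⟨i, hi, h⟩
    rw [hK.mul_left] at h1
    -- With `x = 1/(2P)`, the inequality reads `(1 - x) Pr ≤ 1 - 2x`, and `1 - 2x < (1 - x)²`.
    have h2 : (1 : ℝ) / (2 * P) ≤ 1 / 2 := one_div_le_one_div_of_le (by norm_num) (by linarith)
    have h3 : (1 : ℝ) / P = 2 * (1 / (2 * P)) := by field_simp
    have h4 : (0 : ℝ) ≤ 1 / (2 * P) := by positivity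
    rw [h3] at h1
    by_contra! h5
    nlinarith
  let b : ℕ → κ → ℝ := fun i k => if bad i k then 1 - 1 / g else 1
  -- The exceptional event at position `i`: a good answer for a bad key.
  let ev : ℕ → κ → Y → Prop := fun i k y => bad i k ∧ 1 - 1 / (g : ℝ) ≤ v (cand i y) k
  have hg1 : (1 : ℝ) / g ≤ 1 := by
    rw [hg', div_le_one (by linarith)]
    linarith
  have hb0 : ∀ i k, 0 ≤ b i k := fun i k => by
    simp only [b]
    split_ifs <;> linarith
  -- If some exceptional event occurs, its own term in the sum is already `V`. Otherwise every
  -- factor of `V` is at most the corresponding value of `b`.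
  have hdec : ∀ ks : List κ, ks.length = N → ∀ y, V (ks, y) ≤ prodAt b 0 ks +
      ∑ i ∈ Finset.range N, if ev i (ks.getD i default) y then V (ks, y) else 0 := by
    intro ks hks y
    by_cases h : ∃ i < N, ev i (ks.getD i default) y
    · obtain ⟨i, hi, h⟩ := h
      have h1 : V (ks, y) ≤ ∑ i ∈ Finset.range N,
          if ev i (ks.getD i default) y then V (ks, y) else 0 := by
        refine le_trans (le_of_eq ?_) (Finset.single_le_sum (f := fun i =>
          if ev i (ks.getD i default) y then V (ks, y) else 0) (fun j _ => ?_)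
          (Finset.mem_range.2 hi))
        · rw [if_pos h]
        · split_ifs
          · exact hV0 _
          · exact le_rfl
      have := prodAt_nonneg hb0 0 ks
      linarith
    · push Not at h
      have h1 : V (ks, y) ≤ prodAt b 0 ks := by
        refine prodAt_le default (fun j k => hv0 _ _) 0 ks fun i hi => ?_
        rw [Nat.zero_add]
        simp only [b]
        split_ifs with hb
        · have := h i (by omega)
          simp only [ev, not_and] at this
          exact (not_le.1 (this hb)).le
        · exact hv1 _ _
      refine h1.trans (le_add_of_nonneg_right (Finset.sum_nonneg fun j _ => ?_))
      split_ifs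
      · exact hV0 _
      · exact le_rfl
  have hmain : gen K N (fun ks => L ks fun y => V (ks, y)) ≤ gen K N (fun ks => prodAt b 0 ks +
      ∑ i ∈ Finset.range N, L ks fun y => if ev i (ks.getD i default) y then V (ks, y) else 0) := by
    -- The decomposition needs lists of length `N`, and `gen K N` sees no others.
    have e : gen K N (fun ks => L ks fun y => V (ks, y))
        = gen K N (fun ks => if ks.length = N then L ks fun y => V (ks, y) else 0) :=
      IsEx.gen_congr N fun ks hks => (if_pos hks).symm
    rw [e]
    refine (hK.gen N).mono fun ks => ?_
    split_ifs with hks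
    · refine ((hL ks).mono (hdec ks hks)).trans (le_of_eq ?_)
      rw [(hL ks).add, (hL ks).const, (hL ks).sum]
    · refine add_nonneg (prodAt_nonneg hb0 _ _) (Finset.sum_nonneg fun i _ => ?_)
      refine (hL ks).nonneg fun y => ?_
      split_ifs
      · exact hV0 _
      · exact le_rfl
  refine hmain.trans ?_
  rw [(hK.gen N).add, (hK.gen N).sum]
  refine add_le_add ?_ ?_
  · rw [hK.gen_prodAt]
    -- `b i` has expectation `1 - Pr[bad]/g`, and `Pr[bad] ≥ 1/(2P)`.
    have : ∀ i ∈ Finset.range N, K (b (0 + i)) ≤ 1 - 1 / (2 * (64 * P) * P) := by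
      intro i hi
      rw [Nat.zero_add]
      have h1 : b i = fun k => (1 - 1 / (g : ℝ)) + 1 / g * if bad i k then 0 else 1 := by
        funext k
        simp only [b]
        split_ifs <;> ring
      rw [h1, hK.add, hK.const, hK.mul_left]
      have h2 := hfew i (Finset.mem_range.1 hi)
      have h3 : (0 : ℝ) ≤ 1 / g := by positivity
      have h4 := mul_le_mul_of_nonneg_left h2 h3
      have h5 : (1 : ℝ) / (2 * (64 * P) * P) = 1 / g * (1 / (2 * P)) := by
        rw [hg']
        field_simp
      rw [h5]
      linarith
    refine (Finset.prod_le_prod (fun i _ => hK.nonneg (hb0 _)) this).trans (le_of_eq ?_)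
    simp
  · have : ∀ i ∈ Finset.range N, gen K N (fun ks => L ks fun y =>
        if ev i (ks.getD i default) y then V (ks, y) else 0) ≤ 1 / u := by
      intro i hi
      have hi' := Finset.mem_range.1 hi
      have eN : N = i + 1 + (N - 1 - i) := by omega
      have e1 : gen K N (fun ks => L ks fun y =>
          if ev i (ks.getD i default) y then V (ks, y) else 0)
          = K fun k => if bad i k then E i k else 0 := by
        -- The key at position `i` is drawn first. Badness depends on it alone, so the indicator can
        -- be pulled out of the expectation over everything else, and `E i k` remains.
        conv_lhs => rw [eN]
        rw [IsEx.gen_split]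
        rw [(hK.gen i).comm hK]
        congr 1
        funext k
        simp only [E, smpAt]
        have e2 : ∀ c : Prop, ∀ [Decidable c], ∀ x : ℝ, (if c then x else 0) = (if c then 1 else 0) * x := by
          intro c _ x
          split_ifs <;> simp
        rw [e2, ← (hK.gen i).mul_left]
        refine IsEx.gen_congr i fun pre hpre => ?_
        rw [← (hK.gen (N - 1 - i)).mul_left]
        congr 1
        funext post
        rw [← (hL _).mul_left]
        congr 1
        funext y
        have e3 : (pre ++ k :: post).getD i default = k := by
          rw [List.getD_append_right _ _ _ _ (by omega), hpre]
          simp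
        rw [e3]
        simp only [ev]
        by_cases h1 : bad i k <;> by_cases h2 : 1 - 1 / (g : ℝ) ≤ v (cand i y) k <;>
          simp [h1]
      rw [e1]
      refine hK.le_const fun k => ?_
      split_ifs with h
      · exact h.le
      · positivity
    refine (Finset.sum_le_sum this).trans (le_of_eq ?_)
    simp

/-! ### Expectations of algorithms and of the dyad machine -/

/-- Positivity of the input state gives nonnegative weights, and trace preservation gives total
weight `1`. -/
theorem isEx_expect (A : QPTAlg) {n : ℕ} {x : List Bool} {N : ℕ} {ρ : QState N} (h : Gram ρ)
    (h1 : smp ρ dg = 1) : IsEx (A.expect n x N ρ) := by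
  have key : ∀ f, A.expect n x N ρ f = ∑ i : Fin (A.final n x N ρ).length,
      ((A.final n x N ρ)[i]).weight * f ((A.final n x N ρ)[i]).out := fun f => by
    unfold QPTAlg.expect
    rw [← List.sum_ofFn]
    congr 1
    exact List.ext_getElem (by simp) (by simp)
  refine ⟨Fin (A.final n x N ρ).length, inferInstance, fun i => ((A.final n x N ρ)[i]).weight,
    fun i => ((A.final n x N ρ)[i]).out, fun i => (h.final _ (List.getElem_mem _)).weight_nonneg, ?_, key⟩
  have e : (A.expect n x N ρ fun _ => 1) = 1 := by
    have := A.expect_eq h (n := n) (x := x) fun _ => 1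
    simp only [Complex.ofReal_one, one_mul, A.den_trace, h1] at this
    exact_mod_cast this
  simpa [key] using e

theorem smp_tensorPow {m : ℕ} (t : ℕ) (ρ : QState m) (F : QL → ℂ) :
    smp (tensorPow t ρ) F = ∑ u : Fin t → Fin m → Bool, ∑ v : Fin t → Fin m → Bool,
      (∏ j, ρ (u j) (v j)) * F (List.ofFn fun j => dy (u j) (v j)).flatten := by
  let e : (Fin (t * m) → Bool) ≃ (Fin t → Fin m → Bool) :=
    (finProdFinEquiv.symm.arrowCongr (Equiv.refl Bool)).trans (Equiv.curry _ _ _)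
  unfold smp
  refine Fintype.sum_equiv e _ _ fun u => Fintype.sum_equiv e _ _ fun v => ?_
  unfold tensorPow
  congr 2
  unfold dy
  rw [List.ofFn_mul]
  congr 2
  funext j
  congr 1
  funext i
  have : (⟨j * m + i, by nlinarith [j.2, i.2]⟩ : Fin (t * m)) = finProdFinEquiv (j, i) := by
    ext
    simp [finProdFinEquiv]
    ring
  rw [this]
  rfl

/-- A tensor power is sampled factor by factor, as independent dyads whose lists are concatenated.
-/
theorem smp_tensorPow_succ {m : ℕ} (t : ℕ) (ρ : QState m) (F : QL → ℂ) :
    smp (tensorPow (t + 1) ρ) F = smp ρ fun d => smp (tensorPow t ρ) fun e => F (d ++ e) := by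
  simp only [smp_tensorPow]
  rw [← (Fin.consEquiv fun _ => Fin m → Bool).sum_comp, Fintype.sum_prod_type]
  unfold smp
  refine Finset.sum_congr rfl fun u _ => ?_
  simp only [Finset.mul_sum]
  rw [Finset.sum_comm]
  simp only [← Finset.mul_sum]
  have : ∀ x : Fin t → Fin m → Bool, ∑ v : Fin (t + 1) → Fin m → Bool,
      (∏ j, ρ ((Fin.consEquiv fun _ => Fin m → Bool) (u, x) j) (v j)) * F (List.ofFn fun j =>
        dy ((Fin.consEquiv fun _ => Fin m → Bool) (u, x) j) (v j)).flatten
      = ∑ w, ∑ y : Fin t → Fin m → Bool, ρ u w * ((∏ j, ρ (x j) (y j)) *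
        F (dy u w ++ (List.ofFn fun j => dy (x j) (y j)).flatten)) := fun x => by
    rw [← (Fin.consEquiv fun _ => Fin m → Bool).sum_comp, Fintype.sum_prod_type]
    refine Finset.sum_congr rfl fun w _ => Finset.sum_congr rfl fun y _ => ?_
    simp [Fin.consEquiv, Fin.prod_univ_succ, mul_assoc]
  rw [Finset.sum_comm]
  simp only [this]
  rw [Finset.sum_comm]
  refine Finset.sum_congr rfl fun w _ => ?_
  simp only [Finset.mul_sum]

theorem W.iter_succ' {α : Type*} (f : α → W α) (n : ℕ) (a : α) :
    W.iter f (n + 1) a = (W.iter f n a).bind f := by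
  induction n generalizing a with
  | zero =>
    rw [W.iter, W.iter, W.pure_bind]
    exact (W.bind_pure _ id).trans (List.map_id _)
  | succ n ih =>
    rw [W.iter, W.iter, W.bind_assoc]
    exact W.bind_congr fun b _ => ih b

namespace StateGenerator

variable (G : StateGenerator)

/-- The expectation of a function of the key. -/
def keyEx (n : ℕ) : (List Bool → ℝ) → ℝ := G.keyGen.expect n [] 0 noQubits

theorem isEx_keyEx (n : ℕ) : IsEx (G.keyEx n) :=
  isEx_expect _ Gram.noQubits (by rw [smp_noQubits, dg_nil])

theorem keyEx_eq (n : ℕ) (f : List Bool → ℝ) :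
    (G.keyEx n f : ℂ) = (G.kg n).ex fun k => (f k : ℂ) := by
  rw [keyEx, QPTAlg.expect_eq _ Gram.noQubits, smp_noQubits, kg, QPTAlg.cls_ex]

/-- The iteration puts the last key drawn at the head, whereas `gen` draws the head first; hence the
iteration is unrolled at its end and the order of the draws is exchanged. -/
theorem kgs_ex (n a : ℕ) (F : List (List Bool) → ℝ) :
    ((G.kgs n a).ex fun ks => (F ks : ℂ)) = (gen (G.keyEx n) a F : ℝ) := by
  induction a generalizing F with
  | zero => simp [kgs, W.iter, gen]
  | succ a ih =>
    rw [kgs, W.iter_succ', W.ex_bind]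
    simp only [W.ex_map]
    rw [W.ex_comm, gen, keyEx_eq]
    congr 1
    funext k
    exact ih fun ks => F (k :: ks)

theorem gram_phi (n : ℕ) (k : List Bool) : Gram (G.phi n k) := Gram.noQubits.outState _

variable {G} {n : ℕ} {k : List Bool}

theorem smp_phi (hk : k.length = G.keyLen n) (F : QL → ℂ) :
    smp (G.phi n k) F = (G.sg n k).ex F := by
  rw [phi, QPTAlg.smp_outState _ (G.stateGen_length n k hk), smp_noQubits, sg, W.ex_map]

theorem smp_phi_pow (hk : k.length = G.keyLen n) (t : ℕ) (F : QL → ℂ) :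
    smp (tensorPow t (G.phi n k)) F = (G.sgs n (List.replicate t k)).ex F := by
  induction t generalizing F with
  | zero => simp [smp_tensorPow, sgs]
  | succ t ih =>
    rw [smp_tensorPow_succ, smp_phi hk, List.replicate_succ, sgs, W.ex_bind]
    simp only [W.ex_map, ih]

theorem sgs_append (as bs : List (List Bool)) (F : QL → ℂ) : (G.sgs n (as ++ bs)).ex F
    = (G.sgs n as).ex fun d => (G.sgs n bs).ex fun e => F (d ++ e) := by
  induction as generalizing F with
  | nil => simp [sgs]
  | cons k as ih => simp [sgs, ih]

theorem sgs_dg (ks : List (List Bool)) : (G.sgs n ks).ex dg = 1 := by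
  induction ks with
  | nil => simp [sgs, dg_nil]
  | cons k ks ih => simp [sgs, dg_append, W.ex_mul_left, ih, G.sg_dg]

/-- The acceptance probability of a key of the right length. -/
def acc (G : StateGenerator) (n : ℕ) (c k : List Bool) : ℝ :=
  if k.length = G.keyLen n then G.verProb n c k else 0

theorem verProb_eq (hk : k.length = G.keyLen n) (c : List Bool) : (G.verProb n c k : ℂ)
    = (G.sg n k).ex fun d => (G.ver.den n c d).ex fun a =>
      (if a.1.head? = some true then 1 else 0) * dg a.2 := by
  rw [verProb, QPTAlg.acceptProb, QPTAlg.expect_eq _ (G.gram_phi n k), smp_phi hk]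
  congr 1
  funext d
  congr 1
  funext a
  split_ifs <;> simp

theorem acc_eq (hk : k.length = G.keyLen n) (c : List Bool) : (G.acc n c k : ℂ)
    = (G.sg n k).ex fun d => (G.ver.cls n c d).ex fun y =>
      if y.head? = some true then 1 else 0 := by
  rw [acc, if_pos hk, verProb_eq hk]
  simp only [QPTAlg.cls_ex]

/-- For strings of the wrong length, `phi` need not have trace `1`. The value `0` of `acc` there
makes the bounds hold for all strings, as `amplification` demands. -/
theorem acc_mem (G : StateGenerator) (n : ℕ) (c k : List Bool) :
    0 ≤ G.acc n c k ∧ G.acc n c k ≤ 1 := by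
  unfold acc
  split_ifs with hk
  · have h : IsEx (G.ver.expect n c (G.stateLen n) (G.phi n k)) :=
      isEx_expect _ (G.gram_phi n k) (by rw [smp_phi hk, sg_dg])
    rw [verProb, QPTAlg.acceptProb]
    refine ⟨h.nonneg fun y => ?_, h.le_const fun y => ?_⟩ <;> split_ifs <;> norm_num
  · norm_num

/-! ### The tests, the attempts and the adversary -/

theorem cls_one (A : QPTAlg) (n : ℕ) (x : List Bool) (d : QL) :
    (A.cls n x d).ex (fun _ => 1) = dg d := by
  simpa [QPTAlg.cls_ex] using A.den_trace n x d

/-- A verification that consumes a fresh copy acts as a coin with bias `acc`, provided that the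
continuations do not involve this copy. -/
theorem acc_mix (hk : k.length = G.keyLen n) (c : List Bool) (x y : ℂ) :
    ((G.sg n k).ex fun d => (G.ver.cls n c d).ex fun a => if a.head? = some true then x else y)
      = G.acc n c k * x + (1 - G.acc n c k) * y := by
  have e : ∀ a : List Bool, (if a.head? = some true then x else y)
      = y * 1 + (if a.head? = some true then 1 else 0) * (x - y) := fun a => by
    split_ifs <;> ring
  simp only [e, W.ex_add, W.ex_mul_left, W.ex_mul_right, cls_one, sg_dg, acc_eq hk]
  ring

/-- Every test uses up its own copy, so the coins are independent and the recursion is that of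
`pass`. The other `r` copies are still in product form afterwards, ready for what follows. -/
theorem test_ex (hk : k.length = G.keyLen n) (c : List Bool) (T r b : ℕ) (X Y : QL → ℂ) :
    ((G.sgs n (List.replicate (T + r) k)).ex fun d =>
      (W.iter (G.testStep n c) T (d, b)).ex fun s => if s.2 = 0 then X s.1 else Y s.1)
      = (pass (G.acc n c k) T b : ℝ) * (G.sgs n (List.replicate r k)).ex Y
        + (1 - (pass (G.acc n c k) T b : ℝ)) * (G.sgs n (List.replicate r k)).ex X := by
  induction T generalizing b with
  | zero =>
    simp only [W.iter, W.ex_pure, pass, Nat.zero_add]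
    split_ifs <;> simp
  | succ T ih =>
    rw [show T + 1 + r = (T + r) + 1 by ring, List.replicate_succ, sgs, W.ex_bind]
    have : ∀ d, W.Mem d (G.sg n k) → (((G.sgs n (List.replicate (T + r) k)).map fun e =>
        d ++ e).ex fun d => (W.iter (G.testStep n c) (T + 1) (d, b)).ex fun s =>
          if s.2 = 0 then X s.1 else Y s.1)
        = (G.ver.cls n c d).ex fun y => if y.head? = some true then
          (G.sgs n (List.replicate (T + r) k)).ex fun d =>
            (W.iter (G.testStep n c) T (d, b)).ex fun s => if s.2 = 0 then X s.1 else Y s.1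
          else (G.sgs n (List.replicate (T + r) k)).ex fun d =>
            (W.iter (G.testStep n c) T (d, b - 1)).ex fun s =>
              if s.2 = 0 then X s.1 else Y s.1 := fun d hd => by
      have hl := G.length_sg hk hd
      simp only [W.ex_map, W.iter, W.ex_bind, testStep, List.take_left' hl, List.drop_left' hl]
      rw [W.ex_comm]
      congr 1
      funext y
      split_ifs <;> rfl
    rw [W.ex_congr this, acc_mix hk, ih, ih, pass]
    push_cast
    ring

/-- Of `t + r` copies of the unknown state, `t` are built into copies of the product state, and the
remaining `r` are untouched. -/
theorem cpStep_ex (hk : k.length = G.keyLen n) (pre post : List (List Bool)) (t r : ℕ) (acc : QL)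
    (Z : QL × QL → ℂ) : ((G.sgs n (List.replicate (t + r) k)).ex fun d =>
      (W.iter (G.cpStep n pre post) t (d, acc)).ex Z)
      = (G.sgs n (List.replicate r k)).ex fun d =>
        (G.sgs n (List.replicate t (pre ++ k :: post)).flatten).ex fun e =>
          Z (d, e.reverse ++ acc) := by
  induction t generalizing acc with
  | zero => simp [W.iter, sgs]
  | succ t ih =>
    rw [show t + 1 + r = (t + r) + 1 by ring, List.replicate_succ, sgs, W.ex_bind]
    have : ∀ d, W.Mem d (G.sg n k) → (((G.sgs n (List.replicate (t + r) k)).map fun e =>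
        d ++ e).ex fun d => (W.iter (G.cpStep n pre post) (t + 1) (d, acc)).ex Z)
        = (G.sgs n pre).ex fun e => (G.sgs n post).ex fun f =>
          (G.sgs n (List.replicate r k)).ex fun d' =>
            (G.sgs n (List.replicate t (pre ++ k :: post)).flatten).ex fun e' =>
              Z (d', e'.reverse ++ ((e ++ d ++ f).reverse ++ acc)) := fun d hd => by
      have hl := G.length_sg hk hd
      simp only [W.ex_map, W.iter, W.ex_bind, cpStep, List.take_left' hl, List.drop_left' hl]
      rw [W.ex_comm]
      congr 1
      funext e
      rw [W.ex_comm]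
      congr 1
      funext f
      exact ih _
    rw [W.ex_congr this]
    simp only [List.replicate_succ, List.flatten_cons, sgs_append, sgs, W.ex_bind, W.ex_map]
    rw [W.ex_comm, W.ex_comm (G.sgs n (List.replicate r k))]
    congr 1
    funext e
    rw [W.ex_comm (G.sgs n (List.replicate r k))]
    congr 1
    funext d
    rw [W.ex_comm (G.sgs n (List.replicate r k))]
    simp [List.append_assoc]

/-- The real functional `L` is the expectation of the output of `A` on `t` copies of the states of
`N` keys. -/
def IsRun (G : StateGenerator) (A : QPTAlg) (n N t : ℕ)
    (L : List (List Bool) → (List Bool → ℝ) → ℝ) : Prop :=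
  ∀ ks, ks.length = N → (∀ k ∈ ks, k.length = G.keyLen n) → ∀ f, (L ks f : ℂ)
    = (G.sgs n (List.replicate t ks).flatten).ex fun d => (A.cls n [] d).ex fun y => (f y : ℂ)

variable {A : QPTAlg} {N t T b R : ℕ} {L : List (List Bool) → (List Bool → ℝ) → ℝ}

/-- `Z` is the continuation of the adversary, and `hZ` says that its average over the remaining `r`
copies depends only on the current candidate. An attempt spends `t` copies on running `A` and `T` on
the tests. -/
theorem attempt_ex (hL : G.IsRun A n N t L) (hk : k.length = G.keyLen n) {i : ℕ} (hi : i < N)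
    (r : ℕ) (Z : List Bool × QL → ℂ) (z : List Bool → ℝ)
    (hZ : ∀ c, ((G.sgs n (List.replicate r k)).ex fun d => Z (c, d)) = z c) (c : List Bool) :
    ((G.sgs n (List.replicate (t + (T + r)) k)).ex fun d =>
      (G.attempt A n t b T i (N - 1 - i) (c, d)).ex Z)
      = (att (G.keyEx n) L (G.cand n) (fun c k => pass (G.acc n c k) T b) N i k z c : ℝ) := by
  simp only [attempt, samp, W.ex_bind, W.ex_map]
  rw [W.ex_comm, att, smpAt, ← kgs_ex]
  refine W.ex_congr fun pre hpre => ?_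
  rw [W.ex_comm, ← kgs_ex]
  refine W.ex_congr fun post hpost => ?_
  obtain ⟨l1, p1⟩ := G.mem_kgs hpre
  obtain ⟨l2, p2⟩ := G.mem_kgs hpost
  rw [cpStep_ex hk pre post t (T + r) [] fun u => (A.cls n [] u.2.reverse).ex fun y =>
    (W.iter (G.testStep n (G.cand n i y)) T (u.1, b)).ex fun v =>
      Z (if v.2 = 0 then c else G.cand n i y, v.1), W.ex_comm, hL _ (by simp; omega) (by
        intro k' hk'
        simp only [List.mem_append, List.mem_cons] at hk'
        rcases hk' with h | rfl | h
        exacts [p1 _ h, hk, p2 _ h])]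
  congr 1
  funext e
  simp only [List.append_nil, List.reverse_reverse]
  rw [W.ex_comm]
  congr 1
  funext y
  have := test_ex hk (G.cand n i y) T r b (fun d => Z (c, d)) fun d => Z (G.cand n i y, d)
  rw [hZ, hZ] at this
  push_cast
  rw [← this]
  congr 1
  funext d
  congr 1
  funext v
  split_ifs <;> rfl

theorem attempts_ex (hL : G.IsRun A n N t L) (hk : k.length = G.keyLen n) {i : ℕ} (hi : i < N)
    (r : ℕ) (Z : List Bool × QL → ℂ) (z : List Bool → ℝ)
    (hZ : ∀ c, ((G.sgs n (List.replicate r k)).ex fun d => Z (c, d)) = z c) (c : List Bool) :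
    ((G.sgs n (List.replicate (R * (t + T) + r) k)).ex fun d =>
      (W.iter (G.attempt A n t b T i (N - 1 - i)) R (c, d)).ex Z)
      = ((att (G.keyEx n) L (G.cand n) (fun c k => pass (G.acc n c k) T b) N i k)^[R] z c : ℝ) := by
  induction R generalizing c with
  | zero => simpa [W.iter] using hZ c
  | succ R ih =>
    rw [show (R + 1) * (t + T) + r = t + (T + (R * (t + T) + r)) by ring,
      Function.iterate_succ_apply', ← attempt_ex hL hk hi _
        (fun s => (W.iter (G.attempt A n t b T i (N - 1 - i)) R s).ex Z) _ ih c]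
    simp only [W.iter, W.ex_bind]

theorem positions_ex (hL : G.IsRun A n N t L) (hk : k.length = G.keyLen n) (f : List Bool → ℝ)
    (j i : ℕ) (hi : i + j ≤ N) (c : List Bool) :
    ((G.sgs n (List.replicate (j * (R * (t + T))) k)).ex fun d =>
      (W.iter (G.posStep A n N t b T R) j (i, c, d)).ex fun s => (f s.2.1 : ℂ) * dg s.2.2)
      = (pos (G.keyEx n) L (G.cand n) (fun c k => pass (G.acc n c k) T b) N R k j i f c : ℝ) := by
  induction j generalizing i c with
  | zero => simp [W.iter, sgs, dg_nil, pos]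
  | succ j ih =>
    rw [show (j + 1) * (R * (t + T)) = R * (t + T) + j * (R * (t + T)) by ring, pos,
      ← attempts_ex hL hk (by omega) _ (fun s => (W.iter (G.posStep A n N t b T R) j
        (i + 1, s)).ex fun s => (f s.2.1 : ℂ) * dg s.2.2) _ fun c => ih (i + 1) (by omega) c]
    simp only [W.iter, W.ex_bind, posStep, W.ex_map]

end StateGenerator

/-! ### Repetition -/

namespace StateGenerator

variable {G : StateGenerator} {n : ℕ}

theorem iter_verStep_of_ne (a : ℕ) (s : List Bool × QL × List Bool) (h : s.2.2 ≠ []) :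
    ((W.iter (G.verStep n) a s).ex fun s => if s.2.2 = [] then dg s.2.1 else 0) = 0 := by
  have key := W.iter_ok (f := G.verStep n) (Ok := fun s => s.2.2 ≠ []) (fun s hs s' h' => by
    rw [verStep, W.mem_map] at h'
    obtain ⟨y, -, rfl⟩ := h'
    simp only
    split_ifs
    exacts [hs, List.cons_ne_nil _ _]) a s h
  rw [W.ex_congr fun s hs => if_neg (key s hs), W.ex_zero]

/-- The states of different keys are independent, so the probability that no failure is recorded is
the product of the individual acceptance probabilities. -/
theorem verSteps_ex {ks : List (List Bool)} (hks : ∀ k ∈ ks, k.length = G.keyLen n)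
    (y : List Bool) (a : ℕ) : ((G.sgs n ks).ex fun d => (W.iter (G.verStep n) ks.length
      (y.drop (a * G.keyLen n), d, [])).ex fun s => if s.2.2 = [] then dg s.2.1 else 0)
      = (prodAt (fun j k => G.acc n (G.cand n j y) k) a ks : ℝ) := by
  induction ks generalizing a with
  | nil => simp [sgs, W.iter, prodAt]
  | cons k ks ih =>
    rw [List.forall_mem_cons] at hks
    rw [sgs, W.ex_bind]
    have : ∀ d, W.Mem d (G.sg n k) → (((G.sgs n ks).map fun e => d ++ e).ex fun d =>
        (W.iter (G.verStep n) (k :: ks).length (y.drop (a * G.keyLen n), d, [])).ex fun s =>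
          if s.2.2 = [] then dg s.2.1 else 0)
        = (G.ver.cls n (G.cand n a y) d).ex fun y' => if y'.head? = some true then
          ((prodAt (fun j k => G.acc n (G.cand n j y) k) (a + 1) ks : ℝ) : ℂ) else 0 :=
        fun d hd => by
      have hl := G.length_sg hks.1 hd
      simp only [W.ex_map, List.length_cons, W.iter, W.ex_bind, verStep, List.take_left' hl,
        List.drop_left' hl, List.drop_drop]
      rw [W.ex_comm]
      congr 1
      funext y'
      split_ifs
      · rw [← ih hks.2, Nat.succ_mul]
      · simp only [iter_verStep_of_ne _ (_, _, [true]) (List.cons_ne_nil _ _), W.ex_zero]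
    rw [W.ex_congr this, acc_mix hks.1, prodAt]
    push_cast
    ring

/-- In the encoding of a list of keys, the candidate at each position is the key itself. This yields
the correctness of the repetition. -/
theorem cand_enc {κ : ℕ} (hκ : G.keyLen n = κ) {ks : List (List Bool)}
    (hks : ∀ k ∈ ks, k.length = κ) (y : List Bool) (a : ℕ) (hy : y.drop (a * κ) = enc ks) :
    prodAt (fun j k => G.acc n (G.cand n j y) k) a ks = prodAt (fun _ k => G.acc n k k) a ks := by
  induction ks generalizing a with
  | nil => rfl
  | cons k ks ih =>
    rw [List.forall_mem_cons] at hks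
    have e : enc (k :: ks) = k.reverse ++ enc ks := by simp [enc]
    rw [prodAt, prodAt, ih hks.2 (a + 1) (by
      rw [Nat.succ_mul, ← List.drop_drop, hy, e, List.drop_left' (by simp [hks.1])]), cand, hκ, hy,
      e]
    nth_rw 1 [← hks.1]
    rw [tr_reverse, List.append_nil]

variable (G)

/-- The interface between programs and probability: from here on, the repetition is described by
independent keys, a family of output distributions `L`, and products of acceptance probabilities. -/
theorem exists_repetition (N : Polynomial ℕ) : ∃ G' : StateGenerator,
    (∀ n, G'.correctProb n = G.correctProb n ^ N.eval n) ∧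
    ∀ A t n, ∃ L : List (List Bool) → (List Bool → ℝ) → ℝ, (∀ ks, IsEx (L ks)) ∧
      G.IsRun A n (N.eval n) t L ∧ G'.successProb A t n = gen (G.keyEx n) (N.eval n) fun ks =>
        L ks fun y => prodAt (fun j k => G.acc n (G.cand n j y) k) 0 ks := by
  classical
  obtain ⟨G', hκ, hm, hkg, hsg, hver⟩ := G.exists_repeat N
  have len : ∀ n ks, ks.length = N.eval n → (∀ k ∈ ks, k.length = G.keyLen n) →
      (enc ks).length = G'.keyLen n := fun n ks h1 h2 => by rw [length_enc h2, h1, hκ]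
  have hv : ∀ n ks, ks.length = N.eval n → (∀ k ∈ ks, k.length = G.keyLen n) → ∀ y,
      G'.verProb n y (enc ks) = prodAt (fun j k => G.acc n (G.cand n j y) k) 0 ks := by
    intro n ks h1 h2 y
    have := verSteps_ex h2 y 0
    rw [Nat.zero_mul, List.drop_zero, h1] at this
    rw [← Complex.ofReal_inj, verProb_eq (len n ks h1 h2), hsg n ks h1 h2, ← this]
    simp only [hver]
  have hk : ∀ n f, G'.keyEx n f = gen (G.keyEx n) (N.eval n) fun ks => f (enc ks) := fun n f => by
    rw [← Complex.ofReal_inj, keyEx_eq, hkg, G.kgs_ex n (N.eval n) fun ks => f (enc ks)]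
  -- `gen` ranges over lists of arbitrary strings; passing through the weighted lists shows that
  -- only keys of the right length occur.
  have hgen : ∀ n F F', (∀ ks, ks.length = N.eval n → (∀ k ∈ ks, k.length = G.keyLen n) →
      F ks = F' ks) → gen (G.keyEx n) (N.eval n) F = gen (G.keyEx n) (N.eval n) F' := by
    intro n F F' h
    rw [← Complex.ofReal_inj, ← kgs_ex, ← kgs_ex]
    refine W.ex_congr fun ks hks => ?_
    rw [h ks (G.mem_kgs hks).1 (G.mem_kgs hks).2]
  have hpow : ∀ n ks, ks.length = N.eval n → (∀ k ∈ ks, k.length = G.keyLen n) → ∀ t F,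
      smp (tensorPow t (G'.phi n (enc ks))) F = (G.sgs n (List.replicate t ks).flatten).ex F := by
    intro n ks h1 h2 t F
    rw [smp_phi_pow (len n ks h1 h2)]
    induction t generalizing F with
    | zero => simp [sgs]
    | succ t ih =>
      simp only [List.replicate_succ, List.flatten_cons, sgs_append, sgs, W.ex_bind, W.ex_map, ih]
      exact hsg n ks h1 h2 _
  refine ⟨G', fun n => ?_, fun A t n => ?_⟩
  · show G'.keyEx n _ = (G.keyEx n _) ^ _
    have e : (G.keyEx n fun k => G.verProb n k k) = G.keyEx n fun k => G.acc n k k := by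
      rw [← Complex.ofReal_inj, keyEx_eq, keyEx_eq]
      exact W.ex_congr fun k h => by rw [acc, if_pos (G.length_kg h)]
    rw [hk, e, hgen n _ (prodAt (fun _ k => G.acc n k k) 0) fun ks h1 h2 => by
      rw [hv n ks h1 h2, cand_enc rfl h2 _ 0 (by simp)], (G.isEx_keyEx n).gen_prodAt]
    simp
  -- For lists that are not lists of `N` keys, the point mass at the empty output keeps `L ks` a
  -- probability distribution.
  · let L : List (List Bool) → (List Bool → ℝ) → ℝ := fun ks f =>
      if ks.length = N.eval n ∧ ∀ k ∈ ks, k.length = G.keyLen n then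
        A.expect n [] (t * G'.stateLen n) (tensorPow t (G'.phi n (enc ks))) f
      else f []
    refine ⟨L, fun ks => ?_, fun ks h1 h2 f => ?_, ?_⟩
    · by_cases h : ks.length = N.eval n ∧ ∀ k ∈ ks, k.length = G.keyLen n
      · simp only [L, if_pos h]
        exact isEx_expect _ ((G'.gram_phi n _).tensorPow t) (by rw [hpow n ks h.1 h.2, sgs_dg])
      · simp only [L, if_neg h]
        exact IsEx.eval []
    · simp only [L, if_pos (And.intro h1 h2)]
      rw [QPTAlg.expect_eq _ ((G'.gram_phi n _).tensorPow t), hpow n ks h1 h2]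
      simp only [QPTAlg.cls_ex]
    · show G'.keyEx n _ = _
      rw [hk]
      refine hgen n _ _ fun ks h1 h2 => ?_
      simp only [L, if_pos (And.intro h1 h2), hv n ks h1 h2]

/-- An adversary against the repetition gives an adversary against the generator. -/
theorem exists_reduction (A : QPTAlg) (N t P u : Polynomial ℕ) :
    ∃ (B : QPTAlg) (s : Polynomial ℕ), ∀ n, 1 ≤ N.eval n → 1 ≤ P.eval n → 1 ≤ u.eval n →
      ∀ L : List (List Bool) → (List Bool → ℝ) → ℝ, (∀ ks, IsEx (L ks)) →
      G.IsRun A n (N.eval n) (t.eval n) L →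
      G.successProb B (s.eval n) n ≤ 1 - 1 / (P.eval n : ℕ) →
      (gen (G.keyEx n) (N.eval n) fun ks => L ks fun y =>
        prodAt (fun j k => G.acc n (G.cand n j y) k) 0 ks)
      ≤ (1 - 1 / (2 * (64 * (P.eval n : ℕ)) * (P.eval n : ℕ))) ^ N.eval n
        + (N.eval n : ℕ) * (1 / (u.eval n : ℕ)) := by
  obtain ⟨B, hB⟩ := G.exists_adversary A N t (2 * (4 * P * (16 * P * u) * N))
    (64 * P * (4 * P * (16 * P * u) * N)) (16 * P * u)
  -- The number of copies: `N` positions, `R = 16 P u` attempts at each, and `t` copies for the run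
  -- and `64 P X` for the tests in every attempt.
  refine ⟨B, N * (16 * P * u * (t + 64 * P * (4 * P * (16 * P * u) * N))),
    fun n hN hP hu L hL hrun hs => ?_⟩
  refine amplification (G.isEx_keyEx n) hL (G.cand n) [] (fun c k => (G.acc_mem n c k).1)
    (fun c k => (G.acc_mem n c k).2) hN hP hu (le_trans (le_of_eq ?_) hs)
  show _ = G.keyEx n _
  rw [← Complex.ofReal_inj, keyEx_eq, keyEx_eq]
  refine W.ex_congr fun k hk => ?_
  have hk := G.length_kg hk
  rw [QPTAlg.expect_eq _ ((G.gram_phi n k).tensorPow _), smp_phi_pow hk]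
  simp only [fun d => hB n d fun y => (G.verProb n y k : ℂ)]
  have e : (fun c => G.verProb n c k) = fun c => G.acc n c k :=
    funext fun c => by rw [acc, if_pos hk]
  rw [← positions_ex hrun hk _ _ 0 (by simp)]
  simp only [Polynomial.eval_mul, Polynomial.eval_add, Polynomial.eval_ofNat, acc, if_pos hk]

end StateGenerator

/-! ### The equivalence -/

theorem Negligible.polynomial_mul {ε : ℕ → ℝ} (h : Negligible ε) (N : Polynomial ℕ) :
    Negligible fun n => (N.eval n : ℕ) * ε n := by
  have := Asymptotics.SuperpolynomialDecay.polynomial_mul h (N.map (Nat.castRingHom ℝ))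
  refine this.congr fun n => ?_
  rw [Polynomial.eval_natCast_map]
  rfl

theorem StateGenerator.Secure.weaklySecure {G : StateGenerator} (h : G.Secure) :
    G.WeaklySecure := by
  -- A negligible function tends to `0`, hence is eventually at most `1 - 1/2`.
  refine ⟨2, fun n => by simp, fun A t => ?_⟩
  obtain ⟨ε, h1, h2⟩ := h A t
  have h3 := h1 0
  simp only [pow_zero, one_mul] at h3
  filter_upwards [h3.eventually_le_const (show (0 : ℝ) < 1 / 2 by norm_num)] with n hn
  refine (h2 n).trans (hn.trans ?_)
  norm_num

theorem exists_owsg_of_weak {G : StateGenerator} (h : IsWeakOWSG G) :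
    ∃ G' : StateGenerator, IsOWSG G' := by
  obtain ⟨⟨ε, h1, h2⟩, p, hp, hw⟩ := h
  -- With `128 P²` factors per unit of `n`, the product term of the amplification bound is at most
  -- `e^(-n)`; the summand `1` keeps `N` positive.
  let N : Polynomial ℕ := 128 * p ^ 2 * Polynomial.X + 1
  obtain ⟨G', hc, hs⟩ := G.exists_repetition N
  have hN : ∀ n, N.eval n = 128 * p.eval n ^ 2 * n + 1 := fun n => by simp [N]
  refine ⟨G', ⟨_, h1.polynomial_mul N, fun n => ?_⟩, fun A t => ⟨_, fun a => ?_, fun n => le_rfl⟩⟩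
  -- Bernoulli's inequality: the `N`-th power loses at most `N ε`, which is still negligible.
  · have hc0 : 0 ≤ G.correctProb n := (G.isEx_keyEx n).nonneg fun k =>
      QPTAlg.expect_nonneg G.ver (G.gram_phi n k)
        (f := fun y => if y.head? = some true then 1 else 0) fun y => by split_ifs <;> norm_num
    have h3 := one_add_mul_le_pow (a := G.correctProb n - 1) (by linarith) (N.eval n)
    rw [add_sub_cancel] at h3
    rw [hc]
    refine le_trans ?_ h3
    nlinarith [h2 n, (N.eval n).cast_nonneg (α := ℝ)]
  -- The success itself serves as the negligible function. For each exponent `a` a different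
  -- reduction is used, with `u = N (n + 1)^(a + 1)`, so that the error `N/u` beats `n^a`. This is
  -- permitted because `p` in weak security does not depend on the adversary.
  · obtain ⟨B, s, hB⟩ := G.exists_reduction A N t p (N * (Polynomial.X + 1) ^ (a + 1))
    have h0 : ∀ n, 0 ≤ G'.successProb A (t.eval n) n := fun n => by
      obtain ⟨L, hL, -, e⟩ := hs A (t.eval n) n
      rw [e]
      exact ((G.isEx_keyEx n).gen _).nonneg fun ks => (hL ks).nonneg fun y =>
        prodAt_nonneg (fun j k => (G.acc_mem n _ _).1) _ _
    have hle : ∀ᶠ n : ℕ in atTop, (n : ℝ) ^ a * G'.successProb A (t.eval n) n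
        ≤ (n : ℝ) ^ a * Real.exp (-n) + 1 / ((n : ℝ) + 1) := by
      filter_upwards [hw B s] with n hn
      obtain ⟨L, hL, hrun, e⟩ := hs A (t.eval n) n
      have hP : (1 : ℝ) ≤ (p.eval n : ℕ) := by exact_mod_cast hp n
      have hN0 : 1 ≤ N.eval n := by rw [hN]; omega
      have hN1 : (1 : ℝ) ≤ (N.eval n : ℕ) := by exact_mod_cast hN0
      have key := hB n hN0 (hp n) (by
        simp only [Polynomial.eval_mul, Polynomial.eval_pow, Polynomial.eval_add,
          Polynomial.eval_X, Polynomial.eval_one]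
        exact Nat.mul_pos hN0 (by positivity)) L hL hrun hn
      rw [← e] at key
      have e1 : (1 - 1 / (2 * (64 * ((p.eval n : ℕ) : ℝ)) * (p.eval n : ℕ))) ^ N.eval n
          ≤ Real.exp (-n) := by
        have hq : 1 / (2 * (64 * ((p.eval n : ℕ) : ℝ)) * (p.eval n : ℕ)) ≤ 1 := by
          rw [div_le_one (by positivity)]
          nlinarith
        have h4 := Real.one_sub_le_exp_neg (1 / (2 * (64 * ((p.eval n : ℕ) : ℝ)) * (p.eval n : ℕ)))
        refine (pow_le_pow_left₀ (by linarith) h4 _).trans ?_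
        rw [← Real.exp_nat_mul, Real.exp_le_exp, hN]
        have hp0 : ((p.eval n : ℕ) : ℝ) ≠ 0 := by positivity
        have : ((128 * p.eval n ^ 2 * n + 1 : ℕ) : ℝ)
            * -(1 / (2 * (64 * ((p.eval n : ℕ) : ℝ)) * (p.eval n : ℕ)))
            = -n - 1 / (2 * (64 * ((p.eval n : ℕ) : ℝ)) * (p.eval n : ℕ)) := by
          push_cast
          field_simp
          ring
        rw [this]
        have : 0 ≤ 1 / (2 * (64 * ((p.eval n : ℕ) : ℝ)) * (p.eval n : ℕ)) := by positivity
        linarith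
      have e2 : ((N.eval n : ℕ) : ℝ) * (1 / ((N * (Polynomial.X + 1) ^ (a + 1)).eval n : ℕ))
          = 1 / ((n : ℝ) + 1) ^ (a + 1) := by
        simp only [Polynomial.eval_mul, Polynomial.eval_pow, Polynomial.eval_add,
          Polynomial.eval_X, Polynomial.eval_one]
        push_cast
        field_simp
      rw [e2] at key
      have hna : (n : ℝ) ^ a ≤ ((n : ℝ) + 1) ^ a := by gcongr; linarith
      calc (n : ℝ) ^ a * G'.successProb A (t.eval n) n
          ≤ (n : ℝ) ^ a * (Real.exp (-n) + 1 / ((n : ℝ) + 1) ^ (a + 1)) := by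
            gcongr
            linarith
        _ = (n : ℝ) ^ a * Real.exp (-n) + (n : ℝ) ^ a * (1 / ((n : ℝ) + 1) ^ (a + 1)) := by ring
        _ ≤ (n : ℝ) ^ a * Real.exp (-n) + ((n : ℝ) + 1) ^ a * (1 / ((n : ℝ) + 1) ^ (a + 1)) := by
            gcongr
        _ = _ := by
            congr 1
            field_simp
            ring
    refine squeeze_zero' (Eventually.of_forall fun n => mul_nonneg (by positivity) (h0 n)) hle ?_
    have l1 := (Real.tendsto_pow_mul_exp_neg_atTop_nhds_zero a).comp tendsto_natCast_atTop_atTop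
    simpa using l1.add (tendsto_one_div_add_atTop_nhds_zero_nat (𝕜 := ℝ))

end QCrypto

end

theorem mainTheorem1 :
    (∃ G : QCrypto.StateGenerator, QCrypto.IsOWSG G) ↔
      (∃ G : QCrypto.StateGenerator, QCrypto.IsWeakOWSG G) := by
  constructor
  · rintro ⟨G, h⟩
    exact ⟨G, h.1, h.2.weaklySecure⟩
  · rintro ⟨G, h⟩
    exact QCrypto.exists_owsg_of_weak h
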